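/- **Setting.** Let $M$ be a (Hausdorff, second countable, finite-dimensional) smooth manifold and $\mathcal F$ a singular foliation on $M$, i.e. a $C^\infty(M)$-submodule of $C_c^\infty(M;TM)$ that is locally finitely generated and stable under Lie brackets. Its *adiabatic foliation* $\mathcal{TF}$ on $M\times\mathbb R$ is the set of finite sums $\sum_i f_i\,(X_i\otimes 1)$ with $X_i\in\mathcal F$ and $f_i\in\lambda\, C_c^\infty(M\times\mathbb R)$, where $\lambda$ is the second projection and $X\otimes 1$ is the extension of $X$ to $M\times\mathbb R$ tangent along $M$. A *bi-submersion* for $(M,\mathcal F)$ is a manifold $U$ with two submersions $s,t:U\to M$ such that $s^{-1}(\mathcal F)=t^{-1}(\mathcal F)=C_c^\infty(U;\ker ds)+C_c^\infty(U;\ker dt)$. A *morphism* of bi-submersions is a smooth map commuting with $s$ and with $t$. A bi-submersion $U$ is *adapted* to a family $(U_i)_{i\in I}$ of bi-submersions if every $u\in U$ has an open neighbourhood with a morphism to some $U_i$. The family $(U_i,t_i,s_i)_{i\in I}$ is an *atlas* for $(M,\mathcal F)$ if $\bigcup_i s_i(U_i)=M$ and all inverses $(U_i,s_i,t_i)$ and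 all compositions $U_i\circ U_j=U_i\times_{s_i,t_j}U_j$ are adapted to it. The *path holonomy atlas* is the minimal atlas, i.e. the atlas (unique up to equivalence) all of whose members are adapted to every atlas of $(M,\mathcal F)$. An *identity bisection* of $(U,t,s)$ is a locally closed submanifold $V\subset U$ (possibly empty) on which $s$ and $t$ coincide and are étale. For such $V$, $D(U,V)=U\times\mathbb R^*\,\cup\, N\times\{0\}$ denotes the deformation to the normal cone of $V$ in $U$, where $N$ is the normal bundle of $V$ in $U$, with its usual smooth structure, and $q:D(U,V)\to U\times\mathbb R$ is the canonical map (the identity on $U\times\mathbb R^*$, and the bundle projection $N\to V$ at parameter $0$). **Proposition.** Let $\mathcal U=(U_i,t_i,s_i)_{i\in I}$ be an atlas for $(M,\mathcal F)$, and let $V_i\subset U_i$ be identity bisections such that $\bigcup_{i\in I}s_i(V_i)=M$. Then $\mathcal{TF}$ is a foliation on $M\times\mathbb R$ and: 1. $\widetilde{\mathcal U}=\big(D(U_i,V_i),\,(t_i\times\mathrm{id})\circ q_i,\,(s_i\times\mathrm{id})\circ q_i\big)_{i\in I}$ is an atlas for $(M\times\mathbb R,\mathcal{TF})$; in particular each $D(U_i,V_i)$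 is a bi-submersion for $\mathcal{TF}$. 2. If moreover $\mathcal U$ is the path holonomy atlas for $(M,\mathcal F)$, then $\widetilde{\mathcal U}$ is the path holonomy atlas for $(M\times\mathbb R,\mathcal{TF})$. -/

import Mathlib

open Set Filter Topology Manifold
open scoped ContDiff Manifold

universe u

namespace SingFol

set_option linter.unusedSectionVars false

noncomputable section

/-- Integrals over `[0, 1]` of smooth functions are smooth in the parameter. -/
theorem contDiff_integral_param {X Y : Type} [NormedAddCommGroup X] [NormedSpace ℝ X]
    [NormedAddCommGroup Y] [NormedSpace ℝ Y] {F : X × ℝ → Y} (hF : ContDiff ℝ ∞ F) :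
    ContDiff ℝ ∞ (fun x => ∫ s in (0 : ℝ)..1, F (x, s)) := by
  let ρ : ContDiffBump (1 / 2 : ℝ) := ⟨1, 2, by norm_num, by norm_num⟩
  have hρ1 : ∀ t ∈ Ioc (0 : ℝ) 1, ρ t = 1 := fun t ht => ρ.one_of_mem_closedBall (by
    rw [Metric.mem_closedBall, Real.dist_eq, abs_le]
    constructor <;> simp only [ρ] <;> linarith [ht.1, ht.2])
  have key := MeasureTheory.contDiffOn_convolution_right_with_param (𝕜 := ℝ) (n := (⊤ : ℕ∞)) (P := X) (G := ℝ)
    (μ := MeasureTheory.volume) (ContinuousLinearMap.lsmul ℝ ℝ)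
    (f := (Ioc (0 : ℝ) 1).indicator (fun _ => (1 : ℝ)))
    (g := fun p y => ρ (-y) • F (p, -y)) (s := univ)
    (k := Metric.closedBall (-(1 / 2)) 2) isOpen_univ (isCompact_closedBall _ _)
    (by
      intro p y _ hy
      have : ρ (-y) = 0 := ρ.zero_of_le_dist (by
        rw [Metric.mem_closedBall, not_le, Real.dist_eq] at hy
        rw [Real.dist_eq, show -y - 1 / 2 = -(y - -(1 / 2)) by ring, abs_neg]
        exact hy.le)
      simp [this])
    ((MeasureTheory.integrable_indicator_iff measurableSet_Ioc).2
      (by simp [MeasureTheory.integrableOn_const_iff])).locallyIntegrable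
    (by
      have h1 : ContDiff ℝ ∞ (fun q : X × ℝ => ρ (-q.2) • F (q.1, -q.2)) :=
        (ρ.contDiff.comp contDiff_snd.neg).smul (hF.comp (contDiff_fst.prodMk contDiff_snd.neg))
      exact h1.contDiffOn)
  rw [univ_prod_univ, contDiffOn_univ] at key
  have := key.comp (contDiff_id.prodMk (contDiff_const (c := (0 : ℝ))))
  convert this using 1
  funext x
  simp only [Function.comp, MeasureTheory.convolution, id]
  rw [intervalIntegral.integral_of_le zero_le_one,
    ← MeasureTheory.integral_indicator measurableSet_Ioc]
  congr 1
  ext t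
  by_cases ht : t ∈ Ioc (0 : ℝ) 1
  · simp [ht, hρ1 t ht]
  · simp [ht]

/-- If the smooth function `h (x, β)` vanishes for `β = 0`, then `h (x, β) / β`, extended by the
`β`-derivative, is smooth. -/
theorem contDiffAt_divided {X Y : Type} [NormedAddCommGroup X] [NormedSpace ℝ X]
    [FiniteDimensional ℝ X] [NormedAddCommGroup Y] [NormedSpace ℝ Y] [CompleteSpace Y]
    {h : X × ℝ → Y} {Ω : Set (X × ℝ)} (hΩ : IsOpen Ω) (hh : ContDiffOn ℝ ∞ h Ω)
    (h0 : ∀ x, (x, (0 : ℝ)) ∈ Ω → h (x, 0) = 0) {x₀ : X} (hx₀ : (x₀, (0 : ℝ)) ∈ Ω) :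
    ContDiffAt ℝ ∞ (fun p : X × ℝ =>
      if p.2 = 0 then fderiv ℝ h (p.1, 0) (0, 1) else p.2⁻¹ • h p) (x₀, 0) := by
  obtain ⟨b, hb⟩ : ∃ b : ContDiffBump ((x₀, 0) : X × ℝ), Metric.closedBall (x₀, 0) b.rOut ⊆ Ω := by
    obtain ⟨r, hr, hb⟩ := Metric.nhds_basis_closedBall.mem_iff.1 (hΩ.mem_nhds hx₀)
    exact ⟨⟨r / 2, r, by positivity, by linarith⟩, hb⟩
  set H : X × ℝ → Y := fun p => b p • h p with hH
  have hHs : ContDiff ℝ ∞ H := by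
    rw [contDiff_iff_contDiffAt]
    intro p
    by_cases hp : p ∈ Ω
    · exact b.contDiff.contDiffAt.smul (hh.contDiffAt (hΩ.mem_nhds hp))
    · have : H =ᶠ[𝓝 p] fun _ => 0 := by
        have h1 : p ∉ tsupport b := by
          rw [b.tsupport_eq]; exact fun h => hp (hb h)
        filter_upwards [notMem_tsupport_iff_eventuallyEq.mp h1] with q hq
        simp [hH, hq]
      exact contDiffAt_const.congr_of_eventuallyEq this
  have hH0 : ∀ x, H (x, 0) = 0 := by
    intro x
    by_cases hp : (x, (0:ℝ)) ∈ Ω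
    · simp [hH, h0 x hp]
    · have h1 : (x, (0:ℝ)) ∉ tsupport b := by
        rw [b.tsupport_eq]; exact fun h => hp (hb h)
      simp [hH, image_eq_zero_of_notMem_tsupport h1]
  have hK : ContDiff ℝ ∞ (fun p : X × ℝ => ∫ s in (0 : ℝ)..1, fderiv ℝ H (p.1, s * p.2) (0, 1)) := by
    refine contDiff_integral_param (F := fun q : (X × ℝ) × ℝ =>
      fderiv ℝ H (q.1.1, q.2 * q.1.2) (0, 1)) ?_
    have h1 : ContDiff ℝ ∞ (fderiv ℝ H) := hHs.fderiv_right (by simp)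
    have h2 : ContDiff ℝ ∞ (fun q : (X × ℝ) × ℝ => ((q.1.1, q.2 * q.1.2) : X × ℝ)) := by fun_prop
    exact (h1.comp h2).clm_apply contDiff_const
  refine hK.contDiffAt.congr_of_eventuallyEq ?_
  have hev : ∀ᶠ p in 𝓝 ((x₀, 0) : X × ℝ), h =ᶠ[𝓝 p] H := by
    have := b.eventuallyEq_one
    filter_upwards [this.eventuallyEq_nhds] with p hp
    filter_upwards [hp] with q hq
    simp [hH, hq]
  filter_upwards [hev] with p hp
  obtain ⟨x, β⟩ := p
  by_cases hβ : β = 0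
  · subst hβ
    simp [hp.fderiv_eq]
  · have hd : ∀ s ∈ uIcc (0:ℝ) 1, HasDerivAt (fun s : ℝ => H (x, s * β))
        (β • fderiv ℝ H (x, s * β) (0, 1)) s := by
      intro s _
      have h1 : HasFDerivAt H (fderiv ℝ H (x, s * β)) (x, s * β) :=
        (hHs.differentiable (by simp) _).hasFDerivAt
      have h2 : HasDerivAt (fun s : ℝ => ((x, s * β) : X × ℝ)) (0, β) s := by
        refine (hasDerivAt_const s x).prodMk ?_
        simpa using (hasDerivAt_id s).mul_const β
      have h3 := h1.comp_hasDerivAt s h2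
      have h4 : β • fderiv ℝ H (x, s * β) (0, 1) = fderiv ℝ H (x, s * β) (0, β) := by
        rw [← ContinuousLinearMap.map_smul]; simp
      rw [h4]; exact h3
    have hint := intervalIntegral.integral_eq_sub_of_hasDerivAt hd (by
      apply Continuous.intervalIntegrable
      have h1 : Continuous (fderiv ℝ H) := hHs.continuous_fderiv (by simp)
      fun_prop)
    rw [intervalIntegral.integral_smul] at hint
    simp only [one_mul, zero_mul, hH0, sub_zero] at hint
    simp only [hβ, if_false]
    rw [hp.eq_of_nhds, ← hint, smul_smul, inv_mul_cancel₀ hβ, one_smul]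
section Submanifolds

variable {G : Type} [NormedAddCommGroup G] [NormedSpace ℝ G]
  {U : Type u} [TopologicalSpace U] [ChartedSpace G U]

variable (G) in
/-- The tangent space `T_v V ⊆ T_v U` at `v` of a submanifold `V` of `U`: the vectors annihilated by
the differentials of all smooth functions that vanish on `V`. -/
def tangentTo (V : Set U) (v : U) : Submodule ℝ (TangentSpace 𝓘(ℝ, G) v) :=
  ⨅ (f : U → ℝ) (_ : ContMDiffAt 𝓘(ℝ, G) 𝓘(ℝ, ℝ) ∞ f v) (_ : ∀ᶠ u in 𝓝[V] v, f u = 0),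
    LinearMap.ker (mfderiv 𝓘(ℝ, G) 𝓘(ℝ, ℝ) f v).toLinearMap

theorem mem_tangentTo {V : Set U} {v : U} {ξ : TangentSpace 𝓘(ℝ, G) v} :
    ξ ∈ tangentTo G V v ↔ ∀ f : U → ℝ, ContMDiffAt 𝓘(ℝ, G) 𝓘(ℝ, ℝ) ∞ f v →
      (∀ᶠ u in 𝓝[V] v, f u = 0) → mfderiv 𝓘(ℝ, G) 𝓘(ℝ, ℝ) f v ξ = 0 := by
  simp [tangentTo, Submodule.mem_iInf]

variable (G) in
/-- The fibre `N_v = T_v U / T_v V` of the normal bundle. -/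
abbrev NormalSpace (V : Set U) (v : U) : Type := TangentSpace 𝓘(ℝ, G) v ⧸ tangentTo G V v

variable (G) in
/-- The set `D(U, V) = U × ℝ* ∪ N × {0}` underlying the deformation to the normal cone of `U` along
`V`, where `N` is the total space of the normal bundle of `V` in `U`. -/
inductive DNC (V : Set U) : Type u
  | ext (u : U) (β : ℝ) (hβ : β ≠ 0) : DNC V
  | nor (v : U) (hv : v ∈ V) (n : NormalSpace G V v) : DNC V

namespace DNC
variable {V : Set U}
/-- The `U`-component of `q : D(U, V) → U × ℝ`. -/
def base : DNC G V → U
  | ext u _ _ => u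
  | nor v _ _ => v

/-- The `ℝ`-component of `q : D(U, V) → U × ℝ`. -/
def time : DNC G V → ℝ
  | ext _ β _ => β
  | nor _ _ _ => 0

/-- The map `q : D(U, V) → U × ℝ`: the identity on `U × ℝ*`, and `(v, n) ↦ (v, 0)` on `N`. -/
def q (d : DNC G V) : U × ℝ := (d.base, d.time)

theorem nor_congr {v v' : U} (h : v = v') (hv : v ∈ V) (hv' : v' ∈ V) (ξ ξ' : G)
    (hξ : (ξ - ξ' : G) ∈ tangentTo G V v') :
    (nor v hv (Submodule.Quotient.mk (p := tangentTo G V v) ξ) : DNC G V) =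
      nor v' hv' (Submodule.Quotient.mk (p := tangentTo G V v') ξ') := by
  subst h
  congr 1
  exact (Submodule.Quotient.eq _).2 hξ

end DNC
end Submanifolds

section Slice
variable {E B : Type} [NormedAddCommGroup E] [NormedSpace ℝ E] [NormedAddCommGroup B]
  [NormedSpace ℝ B] {U : Type u} [TopologicalSpace U] [ChartedSpace (E × B) U]

/-- `φ` is a chart of `U` in which `V` is the slice `E × {0}` of `E × B`. -/
structure IsSliceChart (V : Set U) (φ : OpenPartialHomeomorph U (E × B)) : Prop where
  mem_maximalAtlas : φ ∈ IsManifold.maximalAtlas 𝓘(ℝ, E × B) ∞ U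
  mem_iff : ∀ u ∈ φ.source, u ∈ V ↔ (φ u).2 = 0

variable (E B) in
/-- `V` is a (locally closed) smooth submanifold of `U` modelled on `E`. -/
def IsSliceSubmanifold (V : Set U) : Prop :=
  ∀ v ∈ V, ∃ φ : OpenPartialHomeomorph U (E × B), IsSliceChart V φ ∧ v ∈ φ.source

theorem mdiffAt_of_mem {φ : OpenPartialHomeomorph U (E × B)}
    (hφ : φ ∈ IsManifold.maximalAtlas 𝓘(ℝ, E × B) ∞ U) {v : U} (hv : v ∈ φ.source) :
    MDifferentiableAt 𝓘(ℝ, E × B) 𝓘(ℝ, E × B) φ v :=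
  (contMDiffAt_of_mem_maximalAtlas hφ hv).mdifferentiableAt (by simp)

theorem mdiffAt_symm_of_mem {φ : OpenPartialHomeomorph U (E × B)}
    (hφ : φ ∈ IsManifold.maximalAtlas 𝓘(ℝ, E × B) ∞ U) {x : E × B} (hx : x ∈ φ.target) :
    MDifferentiableAt 𝓘(ℝ, E × B) 𝓘(ℝ, E × B) φ.symm x :=
  (contMDiffAt_symm_of_mem_maximalAtlas hφ hx).mdifferentiableAt (by simp)

/-- In a slice chart the tangent space of `V` is `E × {0}`. -/
theorem IsSliceChart.mem_tangentTo_iff {V : Set U} {φ : OpenPartialHomeomorph U (E × B)}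
    (h : IsSliceChart V φ) {v : U} (hv : v ∈ φ.source) (hvV : v ∈ V)
    (ξ : TangentSpace 𝓘(ℝ, E × B) v) :
    ξ ∈ tangentTo (E × B) V v ↔
      (mfderiv 𝓘(ℝ, E × B) 𝓘(ℝ, E × B) φ v ξ : E × B).2 = 0 := by
  have hφd := (mdiffAt_of_mem h.mem_maximalAtlas hv).hasMFDerivAt
  constructor
  · intro hξ
    refine (SeparatingDual.eq_zero_iff_forall_dual_eq_zero (R := ℝ) _).2 fun ℓ => ?_
    have hL : HasMFDerivAt 𝓘(ℝ, E × B) 𝓘(ℝ, ℝ) (fun y : E × B => ℓ y.2) (φ v)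
        (ℓ.comp (ContinuousLinearMap.snd ℝ E B)) :=
      (ℓ.comp (ContinuousLinearMap.snd ℝ E B)).hasFDerivAt.hasMFDerivAt
    have hc := hL.comp v hφd
    have h1 := mem_tangentTo.1 hξ ((fun y : E × B => ℓ y.2) ∘ φ)
      (ContMDiffAt.comp (g := fun y : E × B => ℓ y.2) v (I' := 𝓘(ℝ, E × B))
        ((ℓ.comp (ContinuousLinearMap.snd ℝ E B)).contDiff.contMDiff.contMDiffAt)
        (contMDiffAt_of_mem_maximalAtlas h.mem_maximalAtlas hv)) (by
        filter_upwards [mem_nhdsWithin_of_mem_nhds (φ.open_source.mem_nhds hv),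
          self_mem_nhdsWithin] with u hu huV
        simp [(h.mem_iff u hu).1 huV])
    rw [hc.mfderiv] at h1
    exact h1
  · intro hξ
    refine mem_tangentTo.2 fun f hf h0 => ?_
    set g : E × B → ℝ := f ∘ φ.symm with hg
    have hgd : MDifferentiableAt 𝓘(ℝ, E × B) 𝓘(ℝ, ℝ) g (φ v) := by
      refine MDifferentiableAt.comp (I' := 𝓘(ℝ, E × B)) (φ v) ?_
        (mdiffAt_symm_of_mem h.mem_maximalAtlas (φ.map_source hv))
      rw [φ.left_inv hv]
      exact hf.mdifferentiableAt (by simp)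
    have hgd' : DifferentiableAt ℝ g (φ v) := hgd.differentiableAt
    have hc := hgd'.hasFDerivAt.hasMFDerivAt.comp v hφd
    have hfe : f =ᶠ[𝓝 v] g ∘ φ := by
      filter_upwards [φ.open_source.mem_nhds hv] with u hu
      simp [hg, φ.left_inv hu]
    rw [hfe.mfderiv_eq, hc.mfderiv]
    change fderiv ℝ g (φ v) (mfderiv 𝓘(ℝ, E × B) 𝓘(ℝ, E × B) φ v ξ) = 0
    have hv2 : (φ v).2 = 0 := (h.mem_iff v hv).1 hvV
    set η : E × B := mfderiv 𝓘(ℝ, E × B) 𝓘(ℝ, E × B) φ v ξ with hη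
    have hcurve : HasDerivAt (fun r : ℝ => φ v + r • η) η 0 := by
      simpa using ((hasDerivAt_id (0 : ℝ)).smul_const η).const_add (φ v)
    have hgd0 : HasFDerivAt g (fderiv ℝ g (φ v)) (φ v + (0 : ℝ) • η) := by
      simpa using hgd'.hasFDerivAt
    have hcomp := hgd0.comp_hasDerivAt (0 : ℝ) hcurve
    have hzero : (g ∘ fun r : ℝ => φ v + r • η) =ᶠ[𝓝 0] fun _ => 0 := by
      have hcont : Tendsto (fun r : ℝ => φ v + r • η) (𝓝 0) (𝓝 (φ v)) := by
        have := hcurve.continuousAt.tendsto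
        simpa using this
      have ht := hcont.eventually (φ.open_target.mem_nhds (φ.map_source hv))
      have h0' := eventually_nhdsWithin_iff.1 h0
      have hs : Tendsto (fun r : ℝ => φ.symm (φ v + r • η)) (𝓝 0) (𝓝 v) := by
        have := (φ.continuousAt_symm (φ.map_source hv)).tendsto.comp hcont
        rwa [φ.left_inv hv] at this
      filter_upwards [ht, hs.eventually h0'] with r hr hr0
      refine hr0 ?_
      rw [h.mem_iff _ (φ.map_target hr), φ.right_inv hr]
      simp [hv2, hξ]
    exact hcomp.unique ((hasDerivAt_const (0 : ℝ) (0 : ℝ)).congr_of_eventuallyEq hzero)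

namespace DNC
variable {V : Set U}

/-- The coordinates on `D(U, V)` given by the chart `φ` of `U`: `(u, β) ↦ (φ₁ u, β, φ₂ u / β)` and
`(v, [ξ]) ↦ (φ₁ v, 0, (dφ_v ξ)₂)`. For a slice chart `φ` the latter does not depend on the
representative `ξ`, see `coord_nor_mk`. -/
def coord (φ : OpenPartialHomeomorph U (E × B)) : DNC (E × B) V → (E × ℝ) × B
  | ext u β _ => (((φ u).1, β), β⁻¹ • (φ u).2)
  | nor v _ n => (((φ v).1, 0), (mfderiv 𝓘(ℝ, E × B) 𝓘(ℝ, E × B) φ v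
      (Function.surjInv (Submodule.Quotient.mk_surjective (tangentTo (E × B) V v)) n) : E × B).2)

open Classical in
/-- The inverse of the chart. -/
def coordInv (V : Set U) (φ : OpenPartialHomeomorph U (E × B)) (p : (E × ℝ) × B) :
    DNC (E × B) V :=
  if hβ : p.1.2 ≠ 0 then ext (φ.symm (p.1.1, p.1.2 • p.2)) p.1.2 hβ
  else if hv : φ.symm (p.1.1, 0) ∈ V then
    nor (φ.symm (p.1.1, 0)) hv (Submodule.Quotient.mk
      (mfderiv 𝓘(ℝ, E × B) 𝓘(ℝ, E × B) φ.symm (p.1.1, 0) ((0, p.2) : E × B)))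
  else ext (φ.symm (p.1.1, 0)) 1 one_ne_zero

theorem coord_nor_mk {φ : OpenPartialHomeomorph U (E × B)} (h : IsSliceChart V φ) {v : U}
    (hv : v ∈ φ.source) (hvV : v ∈ V) (ξ : TangentSpace 𝓘(ℝ, E × B) v) :
    coord φ (nor v hvV (Submodule.Quotient.mk ξ)) =
      (((φ v).1, 0), (mfderiv 𝓘(ℝ, E × B) 𝓘(ℝ, E × B) φ v ξ : E × B).2) := by
  simp only [coord]
  congr 1
  set ξ' := Function.surjInv (Submodule.Quotient.mk_surjective (tangentTo (E × B) V v))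
    (Submodule.Quotient.mk ξ) with hξ'
  have h1 : (Submodule.Quotient.mk ξ' : NormalSpace (E × B) V v) = Submodule.Quotient.mk ξ :=
    Function.surjInv_eq _ _
  have h2 := (h.mem_tangentTo_iff hv hvV _).1 ((Submodule.Quotient.eq _).1 h1)
  rw [map_sub] at h2
  exact sub_eq_zero.1 h2

/-- The charts of `D(U, V)` are the coordinates `coord φ` on the set of the points over
`φ.source × S`, where `S ⊆ ℝ` is open and `φ` is a slice chart in case `0 ∈ S`. -/
structure IsAdmissible (V : Set U) (φ : OpenPartialHomeomorph U (E × B)) (S : Set ℝ) : Prop where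
  mem_maximalAtlas : φ ∈ IsManifold.maximalAtlas 𝓘(ℝ, E × B) ∞ U
  isOpen : IsOpen S
  slice : 0 ∈ S → IsSliceChart V φ

theorem mfderiv_comp_symm {φ φ' : OpenPartialHomeomorph U (E × B)}
    (hφ : φ ∈ IsManifold.maximalAtlas 𝓘(ℝ, E × B) ∞ U)
    (hφ' : φ' ∈ IsManifold.maximalAtlas 𝓘(ℝ, E × B) ∞ U) {x : E × B} (hx : x ∈ φ.target)
    (hx' : φ.symm x ∈ φ'.source) (η : E × B) :
    (mfderiv 𝓘(ℝ, E × B) 𝓘(ℝ, E × B) φ' (φ.symm x)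
      (mfderiv 𝓘(ℝ, E × B) 𝓘(ℝ, E × B) φ.symm x η) : E × B) =
      fderiv ℝ (φ' ∘ φ.symm) x η := by
  have h1 := (mdiffAt_symm_of_mem hφ hx).hasMFDerivAt
  have h2 := (mdiffAt_of_mem hφ' hx').hasMFDerivAt
  have h3 := (h2.comp x h1).mfderiv
  rw [mfderiv_eq_fderiv] at h3
  exact congrArg (fun L : (E × B) →L[ℝ] (E × B) => L η) h3.symm

theorem mfderiv_mfderiv_symm {φ : OpenPartialHomeomorph U (E × B)}
    (hφ : φ ∈ IsManifold.maximalAtlas 𝓘(ℝ, E × B) ∞ U) {x : E × B} (hx : x ∈ φ.target) {v : U}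
    (hv : φ.symm x = v) (η : E × B) :
    (mfderiv 𝓘(ℝ, E × B) 𝓘(ℝ, E × B) φ v
      (mfderiv 𝓘(ℝ, E × B) 𝓘(ℝ, E × B) φ.symm x η : E × B) : E × B) = η := by
  subst hv
  refine (mfderiv_comp_symm hφ hφ hx (φ.map_target hx) η).trans ?_
  have : φ ∘ φ.symm =ᶠ[𝓝 x] id := by
    filter_upwards [φ.open_target.mem_nhds hx] with u hu
    simp [φ.right_inv hu]
  rw [this.fderiv_eq, fderiv_id]
  rfl

/-- The chart `coord φ` over `φ.source × S`. -/
def chart (φ : OpenPartialHomeomorph U (E × B)) (S : Set ℝ) (h : IsAdmissible V φ S) :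
    PartialEquiv (DNC (E × B) V) ((E × ℝ) × B) where
  toFun := coord φ
  invFun := coordInv V φ
  source := {d | d.base ∈ φ.source ∧ d.time ∈ S}
  target := {p | (p.1.1, p.1.2 • p.2) ∈ φ.target ∧ p.1.2 ∈ S}
  map_source' := by
    rintro (⟨u, β, hβ⟩ | ⟨v, hv, n⟩) ⟨h1, h2⟩
    · simpa [coord, smul_smul, mul_inv_cancel₀ hβ] using ⟨φ.map_source h1, h2⟩
    · simp only [base] at h1
      have := ((h.slice h2).mem_iff v h1).1 hv
      refine ⟨?_, h2⟩
      have h3 : (((φ v).1, 0) : E × B) = φ v := Prod.ext rfl this.symm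
      simpa [coord, h3] using φ.map_source h1
  map_target' := by
    rintro ⟨⟨a, β⟩, b⟩ ⟨h1, h2⟩
    simp only at h1 h2
    by_cases hβ : β = 0
    · subst hβ
      rw [zero_smul] at h1
      have hv : φ.symm (a, 0) ∈ V := by
        rw [(h.slice h2).mem_iff _ (φ.map_target h1), φ.right_inv h1]
      simpa [coordInv, hv, base, time] using ⟨φ.map_target h1, h2⟩
    · simpa [coordInv, hβ, base, time] using ⟨φ.map_target h1, h2⟩
  left_inv' := by
    rintro (⟨u, β, hβ⟩ | ⟨v, hv, n⟩) ⟨h1, h2⟩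
    · simp only [base] at h1
      simp [coord, coordInv, hβ, smul_smul, φ.left_inv h1]
    · simp only [base, time] at h1 h2
      have h0 := ((h.slice h2).mem_iff v h1).1 hv
      have h3 : (((φ v).1, 0) : E × B) = φ v := Prod.ext rfl h0.symm
      obtain ⟨ξ, rfl⟩ := Submodule.Quotient.mk_surjective _ n
      rw [coord_nor_mk (h.slice h2) h1 hv]
      have h4 : φ.symm ((φ v).1, 0) = v := by rw [h3, φ.left_inv h1]
      have h5 : φ.symm ((φ v).1, 0) ∈ V := by rwa [h4]
      simp only [coordInv, ne_eq, not_true_eq_false, dite_false, h5, dite_true]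
      refine nor_congr h4 h5 hv _ _ ?_
      refine ((h.slice h2).mem_tangentTo_iff h1 hv _).2 ?_
      have h6 := mfderiv_mfderiv_symm h.mem_maximalAtlas (h3 ▸ φ.map_source h1) h4
        ((0, (mfderiv 𝓘(ℝ, E × B) 𝓘(ℝ, E × B) φ v ξ : E × B).2) : E × B)
      have h7 := map_sub (mfderiv 𝓘(ℝ, E × B) 𝓘(ℝ, E × B) φ v)
        ((mfderiv 𝓘(ℝ, E × B) 𝓘(ℝ, E × B) φ.symm ((φ v).1, 0)
          ((0, (mfderiv 𝓘(ℝ, E × B) 𝓘(ℝ, E × B) φ v ξ : E × B).2) : E × B) : E × B) :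
            TangentSpace 𝓘(ℝ, E × B) v) ξ
      refine (congrArg Prod.snd h7).trans ?_
      have h8 := congrArg (fun z : E × B => z.2) h6
      exact sub_eq_zero.2 h8
  right_inv' := by
    rintro ⟨⟨a, β⟩, b⟩ ⟨h1, h2⟩
    simp only at h1 h2
    by_cases hβ : β = 0
    · subst hβ
      rw [zero_smul] at h1
      have hv : φ.symm (a, 0) ∈ V := by
        rw [(h.slice h2).mem_iff _ (φ.map_target h1), φ.right_inv h1]
      simp only [coordInv, ne_eq, not_true_eq_false, dite_false, hv, dite_true]
      rw [coord_nor_mk (h.slice h2) (φ.map_target h1) hv, φ.right_inv h1]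
      have h6 := mfderiv_mfderiv_symm h.mem_maximalAtlas h1 rfl ((0, b) : E × B)
      have h8 := congrArg (fun z : E × B => z.2) h6
      refine Prod.ext rfl ?_
      exact h8
    · simp [coordInv, hβ, coord, φ.right_inv h1, smul_smul]

theorem base_coordInv {φ : OpenPartialHomeomorph U (E × B)} {S : Set ℝ}
    (h : IsAdmissible V φ S) {p : (E × ℝ) × B} (hp : p ∈ (chart φ S h).target) :
    (coordInv V φ p).base = φ.symm (p.1.1, p.1.2 • p.2) ∧ (coordInv V φ p).time = p.1.2 := by
  obtain ⟨⟨a, β⟩, b⟩ := p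
  obtain ⟨h1, h2⟩ := hp
  simp only at h1 h2
  by_cases hβ : β = 0
  · subst hβ
    rw [zero_smul] at h1
    have hv : φ.symm (a, 0) ∈ V := by
      rw [(h.slice h2).mem_iff _ (φ.map_target h1), φ.right_inv h1]
    simp [coordInv, hv, base, time]
  · simp [coordInv, hβ, base, time]

theorem trans_source {φ φ' : OpenPartialHomeomorph U (E × B)} {S S' : Set ℝ}
    (h : IsAdmissible V φ S) (h' : IsAdmissible V φ' S') :
    ((chart φ S h).symm.trans (chart φ' S' h')).source =
      (fun p : (E × ℝ) × B => ((p.1.1, p.1.2 • p.2), p.1.2)) ⁻¹'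
        ((φ.symm.trans φ').source ×ˢ (S ∩ S')) := by
  ext p
  simp only [PartialEquiv.trans_source, PartialEquiv.symm_source, mem_inter_iff, mem_preimage,
    OpenPartialHomeomorph.trans_source, OpenPartialHomeomorph.symm_source, mem_prod]
  constructor
  · rintro ⟨h1, h2, h3⟩
    obtain ⟨h4, h5⟩ := base_coordInv h h1
    exact ⟨⟨h1.1, h4 ▸ h2⟩, h1.2, h5 ▸ h3⟩
  · rintro ⟨⟨h1, h2⟩, h3, h4⟩
    have h0 : p ∈ (chart φ S h).target := ⟨h1, h3⟩
    obtain ⟨h5, h6⟩ := base_coordInv h h0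
    exact ⟨h0, h5.symm ▸ h2, h6.symm ▸ h4⟩

theorem isOpen_trans_source {φ φ' : OpenPartialHomeomorph U (E × B)} {S S' : Set ℝ}
    (h : IsAdmissible V φ S) (h' : IsAdmissible V φ' S') :
    IsOpen ((chart φ S h).symm.trans (chart φ' S' h')).source := by
  rw [trans_source]
  exact ((φ.symm.trans φ').open_source.prod (h.isOpen.inter h'.isOpen)).preimage (by fun_prop)

theorem contDiffOn_trans [IsManifold 𝓘(ℝ, E × B) ∞ U] [FiniteDimensional ℝ E]
    [FiniteDimensional ℝ B]
    {φ φ' : OpenPartialHomeomorph U (E × B)} {S S' : Set ℝ}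
    (h : IsAdmissible V φ S) (h' : IsAdmissible V φ' S') :
    ContDiffOn ℝ ∞ ((chart φ S h).symm.trans (chart φ' S' h'))
      ((chart φ S h).symm.trans (chart φ' S' h')).source := by
  intro p hp
  refine ContDiffAt.contDiffWithinAt ?_
  have hpO := (isOpen_trans_source h h').mem_nhds hp
  have hψ : ContDiffOn ℝ ∞ (φ' ∘ φ.symm) (φ.symm.trans φ').source := by
    have := contMDiffOn_of_mem_maximalAtlas h'.mem_maximalAtlas
    rw [← contMDiffOn_iff_contDiffOn]
    exact this.comp ((contMDiffOn_symm_of_mem_maximalAtlas h.mem_maximalAtlas).mono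
      (fun x hx => hx.1)) (fun x hx => hx.2)
  have hψa : ∀ x ∈ (φ.symm.trans φ').source, ContDiffAt ℝ ∞ (φ' ∘ φ.symm) x := fun x hx =>
    hψ.contDiffAt ((φ.symm.trans φ').open_source.mem_nhds hx)
  have hm : ContDiff ℝ ∞ (fun p : (E × ℝ) × B => ((p.1.1, p.1.2 • p.2) : E × B)) := by fun_prop
  have hp' := hp
  rw [trans_source] at hp'
  have hcomp : ContDiffAt ℝ ∞ (fun p : (E × ℝ) × B =>
      (φ' ∘ φ.symm) ((p.1.1, p.1.2 • p.2) : E × B)) p :=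
    ContDiffAt.comp (g := φ' ∘ φ.symm) (f := fun p : (E × ℝ) × B => ((p.1.1, p.1.2 • p.2) : E × B))
      p (hψa _ hp'.1) hm.contDiffAt
  by_cases hβ : p.1.2 = 0
  · obtain ⟨⟨a, β⟩, b⟩ := p
    simp only at hβ
    subst hβ
    have hd := contDiffAt_divided (X := E × B) (Y := B)
      (h := fun q => ((φ' ∘ φ.symm) (q.1.1, q.2 • q.1.2)).2)
      (Ω := (fun q : (E × B) × ℝ => ((q.1.1, q.2 • q.1.2), q.2)) ⁻¹'
        ((φ.symm.trans φ').source ×ˢ (S ∩ S')))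
      (((φ.symm.trans φ').open_source.prod (h.isOpen.inter h'.isOpen)).preimage (by fun_prop))
      (by
        refine contDiff_snd.comp_contDiffOn (hψ.comp (ContDiff.contDiffOn (by fun_prop)) ?_)
        exact fun q hq => hq.1)
      (by
        rintro ⟨x, y⟩ ⟨⟨h1, h2⟩, h3, h4⟩
        simp only [zero_smul, mem_preimage] at h1 h2 h3 h4
        replace h1 : (x, 0) ∈ φ.target := h1
        replace h2 : φ.symm (x, 0) ∈ φ'.source := h2
        simp only [zero_smul, Function.comp]
        rw [← (h'.slice h4).mem_iff _ h2, (h.slice h3).mem_iff _ (φ.map_target h1),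
          φ.right_inv h1])
      (x₀ := (a, b)) hp'
    have hr : ContDiff ℝ ∞ (fun p : (E × ℝ) × B => (((p.1.1, p.2), p.1.2) : (E × B) × ℝ)) := by
      fun_prop
    have hd' := ContDiffAt.comp (((a, 0), b) : (E × ℝ) × B) (by exact hd) hr.contDiffAt
    have := ((contDiff_fst.contDiffAt.comp _ hcomp).prodMk
      (contDiff_fst.snd.contDiffAt (x := (((a, 0), b) : (E × ℝ) × B)))).prodMk hd'
    refine this.congr_of_eventuallyEq ?_
    filter_upwards [hpO] with q hq
    have hq' := hq
    rw [trans_source] at hq'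
    obtain ⟨⟨x, β⟩, y⟩ := q
    obtain ⟨⟨h1, h2⟩, h3, h4⟩ := hq'
    simp only [mem_preimage] at h1 h2 h3 h4
    change coord φ' (coordInv V φ ((x, β), y)) = _
    by_cases hβ : β = 0
    · subst hβ
      rw [zero_smul] at h1 h2
      replace h1 : (x, 0) ∈ φ.target := h1
      replace h2 : φ.symm (x, 0) ∈ φ'.source := h2
      have hv : φ.symm (x, 0) ∈ V := by
        rw [(h.slice h3).mem_iff _ (φ.map_target h1), φ.right_inv h1]
      simp only [coordInv, ne_eq, not_true_eq_false, dite_false, hv, dite_true]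
      refine (coord_nor_mk (h'.slice h4) h2 hv _).trans ?_
      have h5 := mfderiv_comp_symm h.mem_maximalAtlas h'.mem_maximalAtlas h1 h2 ((0, y) : E × B)
      have hψd : DifferentiableAt ℝ (φ' ∘ φ.symm) ((x, (0 : ℝ) • y) : E × B) := by
        rw [zero_smul]
        exact (hψa _ ⟨h1, h2⟩).differentiableAt (by simp)
      have hm' : DifferentiableAt ℝ (fun q : (E × B) × ℝ => ((q.1.1, q.2 • q.1.2) : E × B))
          ((x, y), 0) := by fun_prop
      have hd3 : DifferentiableAt ℝ (fun q : (E × B) × ℝ =>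
          ((φ' ∘ φ.symm) (q.1.1, q.2 • q.1.2)).2) ((x, y), 0) :=
        (DifferentiableAt.comp (g := φ' ∘ φ.symm)
          (f := fun q : (E × B) × ℝ => ((q.1.1, q.2 • q.1.2) : E × B)) ((x, y), 0) hψd hm').snd
      have hc1 : HasDerivAt (fun r : ℝ => (((x, y), r) : (E × B) × ℝ)) (0, 1) 0 :=
        (hasDerivAt_const (0 : ℝ) (x, y)).prodMk (hasDerivAt_id 0)
      have hc2 : HasDerivAt (fun r : ℝ => ((x, r • y) : E × B)) (0, y) 0 := by
        refine (hasDerivAt_const (0 : ℝ) x).prodMk ?_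
        simpa using (hasDerivAt_id (0 : ℝ)).smul_const y
      have e1 := hd3.hasFDerivAt.comp_hasDerivAt (0 : ℝ) hc1
      have e2 := (ContinuousLinearMap.snd ℝ E B).hasFDerivAt.comp_hasDerivAt (0 : ℝ)
        (hψd.hasFDerivAt.comp_hasDerivAt (0 : ℝ) hc2)
      have e3 := e1.unique e2
      rw [zero_smul] at e3
      refine Prod.ext ?_ ?_
      · simp
      · simp only [Function.comp, if_true]
        refine Eq.trans ?_ e3.symm
        exact congrArg (fun z : E × B => z.2) h5
    · simp [coordInv, hβ, coord]
  · have := ((contDiff_fst.contDiffAt.comp p hcomp).prodMk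
      (contDiff_fst.snd.contDiffAt (x := p))).prodMk
      ((contDiff_fst.snd.contDiffAt (x := p)).inv hβ |>.smul (contDiff_snd.contDiffAt.comp p hcomp))
    refine this.congr_of_eventuallyEq ?_
    have hβ' : ∀ᶠ q : (E × ℝ) × B in 𝓝 p, q.1.2 ≠ 0 :=
      (continuous_fst.snd.continuousAt (x := p)).eventually_ne hβ
    filter_upwards [hβ'] with q hq
    change coord φ' (coordInv V φ q) = _
    simp [coordInv, hq, coord]

theorem isAdmissible_chartAt [IsManifold 𝓘(ℝ, E × B) ∞ U] (V : Set U) (u : U) :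
    IsAdmissible V (chartAt (E × B) u) {0}ᶜ :=
  ⟨IsManifold.chart_mem_maximalAtlas u, isOpen_compl_singleton, fun h => absurd rfl h⟩

theorem isAdmissible_slice (hV : IsSliceSubmanifold E B V) {v : U} (hv : v ∈ V) :
    IsAdmissible V (hV v hv).choose univ :=
  ⟨(hV v hv).choose_spec.1.mem_maximalAtlas, isOpen_univ, fun _ => (hV v hv).choose_spec.1⟩

/-- A choice of a chart at each point. -/
def prefChart [IsManifold 𝓘(ℝ, E × B) ∞ U] (hV : IsSliceSubmanifold E B V) :
    DNC (E × B) V → PartialEquiv (DNC (E × B) V) ((E × ℝ) × B)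
  | ext u _ _ => chart (chartAt (E × B) u) {0}ᶜ (isAdmissible_chartAt V u)
  | nor v hv _ => chart (hV v hv).choose univ (isAdmissible_slice hV hv)

variable [IsManifold 𝓘(ℝ, E × B) ∞ U] [FiniteDimensional ℝ E] [FiniteDimensional ℝ B]

/-- The smooth structure of `D(U, V)`. -/
def chartedSpaceCore (hV : IsSliceSubmanifold E B V) :
    ChartedSpaceCore ((E × ℝ) × B) (DNC (E × B) V) where
  atlas := {e | ∃ φ S, ∃ h : IsAdmissible V φ S, e = chart φ S h}
  chartAt := prefChart hV
  mem_chart_source := by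
    rintro (⟨u, β, hβ⟩ | ⟨v, hv, n⟩)
    · exact ⟨mem_chart_source _ u, hβ⟩
    · exact ⟨(hV v hv).choose_spec.2, mem_univ _⟩
  chart_mem_atlas := by
    rintro (⟨u, β, hβ⟩ | ⟨v, hv, n⟩)
    · exact ⟨_, _, isAdmissible_chartAt V u, rfl⟩
    · exact ⟨_, _, isAdmissible_slice hV hv, rfl⟩
  open_source := by
    rintro _ _ ⟨φ, S, h, rfl⟩ ⟨φ', S', h', rfl⟩
    exact isOpen_trans_source h h'
  continuousOn_toFun := by
    rintro _ _ ⟨φ, S, h, rfl⟩ ⟨φ', S', h', rfl⟩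
    exact (contDiffOn_trans h h').continuousOn

theorem isManifold (hV : IsSliceSubmanifold E B V) :
    letI := (chartedSpaceCore hV).toTopologicalSpace
    letI := (chartedSpaceCore hV).toChartedSpace
    IsManifold 𝓘(ℝ, (E × ℝ) × B) ∞ (DNC (E × B) V) := by
  let := (chartedSpaceCore hV).toTopologicalSpace
  let := (chartedSpaceCore hV).toChartedSpace
  refine isManifold_of_contDiffOn _ _ _ fun e e' he he' => ?_
  obtain ⟨_, ⟨φ, S, h, rfl⟩, he⟩ := mem_iUnion₂.1 he
  obtain ⟨_, ⟨φ', S', h', rfl⟩, he'⟩ := mem_iUnion₂.1 he'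
  rw [mem_singleton_iff] at he he'
  subst he he'
  have key := contDiffOn_trans h h'
  simp only [modelWithCornersSelf_coe, modelWithCornersSelf_coe_symm, Function.comp_id,
    Function.id_comp, range_id, inter_univ, preimage_id]
  exact key

end DNC
end Slice

section FiberProduct

variable {E B B' : Type} [NormedAddCommGroup E] [NormedSpace ℝ E] [NormedAddCommGroup B]
  [NormedSpace ℝ B] [NormedAddCommGroup B'] [NormedSpace ℝ B']
  {M U W : Type u} [TopologicalSpace M] [ChartedSpace E M]
  [TopologicalSpace U] [ChartedSpace (E × B) U]
  [TopologicalSpace W] [ChartedSpace (E × B') W]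

/-- The charts `φ` of `U` and `χ` of `M` turn `f : U → M` into the projection `E × B → E`. -/
structure IsAdaptedPair (f : U → M) (φ : OpenPartialHomeomorph U (E × B))
    (χ : OpenPartialHomeomorph M E) : Prop where
  mem_maximalAtlas : φ ∈ IsManifold.maximalAtlas 𝓘(ℝ, E × B) ∞ U
  mem_maximalAtlas' : χ ∈ IsManifold.maximalAtlas 𝓘(ℝ, E) ∞ M
  mapsTo : ∀ x ∈ φ.source, f x ∈ χ.source
  eq : ∀ x ∈ φ.source, (φ x).1 = χ (f x)

theorem exists_isAdaptedPair [IsManifold 𝓘(ℝ, E × B) ∞ U] [FiniteDimensional ℝ E]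
    [FiniteDimensional ℝ B] {f : U → M}
    (hf : Manifold.IsSubmersion 𝓘(ℝ, E × B) 𝓘(ℝ, E) ∞ f) (u : U) :
    ∃ c : OpenPartialHomeomorph U (E × B) × OpenPartialHomeomorph M E,
      IsAdaptedPair f c.1 c.2 ∧ u ∈ c.1.source := by
  obtain ⟨F, _, _, hF⟩ := hf
  have h := hF u
  have : FiniteDimensional ℝ (E × F) := h.equiv.toLinearEquiv.finiteDimensional
  have : FiniteDimensional ℝ F :=
    FiniteDimensional.of_surjective (LinearMap.snd ℝ E F) LinearMap.snd_surjective
  have hrk : Module.finrank ℝ F = Module.finrank ℝ B := by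
    have := h.equiv.toLinearEquiv.finrank_eq
    rw [Module.finrank_prod, Module.finrank_prod] at this
    omega
  let L : (E × B) ≃L[ℝ] (E × B) := h.equiv.trans
    ((ContinuousLinearEquiv.refl ℝ E).prodCongr (ContinuousLinearEquiv.ofFinrankEq hrk))
  have hL : ∀ x, (L x).1 = (h.equiv x).1 := fun x => rfl
  refine ⟨(h.domChart.transHomeomorph L.toHomeomorph, h.codChart), ⟨?_, ?_, ?_, ?_⟩, ?_⟩
  · apply OpenPartialHomeomorph.mem_maximalAtlas_of_contMDiffOn
    · exact L.contDiff.contMDiff.comp_contMDiffOn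
        (contMDiffOn_of_mem_maximalAtlas h.domChart_mem_maximalAtlas)
    · exact (contMDiffOn_symm_of_mem_maximalAtlas h.domChart_mem_maximalAtlas).comp
        L.symm.contDiff.contMDiff.contMDiffOn (fun x hx => hx)
  · exact h.codChart_mem_maximalAtlas
  · exact fun x hx => h.source_subset_preimage_source hx
  · intro x hx
    replace hx : x ∈ h.domChart.source := hx
    have h0 : h.domChart x ∈ (h.domChart.extend 𝓘(ℝ, E × B)).target := by
      simpa [OpenPartialHomeomorph.extend_target] using h.domChart.map_source hx
    have h1 := h.writtenInCharts h0
    simp only [OpenPartialHomeomorph.extend, PartialEquiv.coe_trans, Function.comp,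
      PartialEquiv.coe_trans_symm] at h1
    simp only [ModelWithCorners.toPartialEquiv_coe, modelWithCornersSelf_coe, id] at h1
    have h2 : h.domChart.symm (h.domChart x) = x := h.domChart.left_inv hx
    refine (hL _).trans ?_
    refine h1.symm.trans ?_
    exact congrArg (fun z => h.codChart (f z)) h2
  · exact h.mem_domChart_source

/-- The fibre product `U ×_M W`. -/
abbrev FiberProd (f : U → M) (g : W → M) : Type u := {p : U × W // f p.1 = g p.2}

namespace FiberProd
variable {f : U → M} {g : W → M}

/-- The point of `U × W` with given coordinates. -/
def symmPair (g : W → M) (φ : OpenPartialHomeomorph U (E × B)) (χ : OpenPartialHomeomorph M E)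
    (ψ : OpenPartialHomeomorph W (E × B')) (p : E × (B × B')) : U × W :=
  (φ.symm (χ (g (ψ.symm (p.1, p.2.2))), p.2.1), ψ.symm (p.1, p.2.2))

/-- The target of the chart. -/
def chartTarget (g : W → M) (φ : OpenPartialHomeomorph U (E × B)) (χ : OpenPartialHomeomorph M E)
    (ψ : OpenPartialHomeomorph W (E × B')) : Set (E × (B × B')) :=
  {p | ((p.1, p.2.2) ∈ ψ.target ∧ g (ψ.symm (p.1, p.2.2)) ∈ χ.source) ∧
    (χ (g (ψ.symm (p.1, p.2.2))), p.2.1) ∈ φ.target}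

open Classical in
/-- The inverse of the chart. -/
def chartInv (f : U → M) (g : W → M) (φ : OpenPartialHomeomorph U (E × B))
    (χ : OpenPartialHomeomorph M E) (ψ : OpenPartialHomeomorph W (E × B')) (z₀ : FiberProd f g)
    (p : E × (B × B')) : FiberProd f g :=
  if hp : f (symmPair g φ χ ψ p).1 = g (symmPair g φ χ ψ p).2 then ⟨symmPair g φ χ ψ p, hp⟩ else z₀

theorem chartInv_val {φ : OpenPartialHomeomorph U (E × B)} {χ : OpenPartialHomeomorph M E}
    (h : IsAdaptedPair f φ χ) {ψ : OpenPartialHomeomorph W (E × B')} (z₀ : FiberProd f g)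
    {p : E × (B × B')} (hp : p ∈ chartTarget g φ χ ψ) :
    (chartInv f g φ χ ψ z₀ p).1 = symmPair g φ χ ψ p := by
  obtain ⟨⟨h1, h2⟩, h3⟩ := hp
  have h0 : f (symmPair g φ χ ψ p).1 = g (symmPair g φ χ ψ p).2 := by
    have h4 := φ.map_target h3
    refine χ.injOn (h.mapsTo _ h4) h2 ?_
    simp only [symmPair]
    rw [← h.eq _ h4, φ.right_inv h3]
  rw [chartInv, dif_pos h0]

theorem mapsTo_and_continuousOn (hg : Continuous g) {φ : OpenPartialHomeomorph U (E × B)}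
    {χ : OpenPartialHomeomorph M E} (ψ : OpenPartialHomeomorph W (E × B')) :
    IsOpen (chartTarget g φ χ ψ) ∧
      ContinuousOn (symmPair g φ χ ψ) (chartTarget g φ χ ψ) := by
  have hO1 : IsOpen {p : E × (B × B') | (p.1, p.2.2) ∈ ψ.target} :=
    ψ.open_target.preimage (by fun_prop)
  have hc1 : ContinuousOn (fun p : E × (B × B') => ψ.symm (p.1, p.2.2))
      {p : E × (B × B') | (p.1, p.2.2) ∈ ψ.target} :=
    ψ.symm.continuousOn.comp (Continuous.continuousOn (by fun_prop)) (fun p hp => hp)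
  have hc2 := hg.comp_continuousOn hc1
  have hO2 := hc2.isOpen_inter_preimage hO1 χ.open_source
  have hc3 : ContinuousOn (fun p : E × (B × B') => ((χ (g (ψ.symm (p.1, p.2.2))), p.2.1) : E × B))
      ({p : E × (B × B') | (p.1, p.2.2) ∈ ψ.target} ∩
        (g ∘ fun p : E × (B × B') => ψ.symm (p.1, p.2.2)) ⁻¹' χ.source) :=
    (χ.continuousOn.comp (hc2.mono inter_subset_left) (fun p hp => hp.2)).prodMk
      (Continuous.continuousOn (by fun_prop))
  refine ⟨hc3.isOpen_inter_preimage hO2 φ.open_target, ?_⟩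
  refine ContinuousOn.prodMk ?_ (hc1.mono fun p hp => hp.1.1)
  exact φ.symm.continuousOn.comp (hc3.mono fun p hp => hp.1) (fun p hp => hp.2)

theorem map_source_chart {φ : OpenPartialHomeomorph U (E × B)}
    {χ : OpenPartialHomeomorph M E} (h : IsAdaptedPair f φ χ)
    {ψ : OpenPartialHomeomorph W (E × B')} {z : FiberProd f g}
    (hm : z.1.1 ∈ φ.source ∧ z.1.2 ∈ ψ.source) :
    ((ψ z.1.2).1, ((φ z.1.1).2, (ψ z.1.2).2)) ∈ chartTarget g φ χ ψ := by
  obtain ⟨⟨u, w⟩, hz⟩ := z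
  obtain ⟨h1, h2⟩ := hm
  simp only at h1 h2 hz
  have h3 : ψ.symm ((ψ w).1, (ψ w).2) = w := ψ.left_inv h2
  refine ⟨⟨ψ.map_source h2, ?_⟩, ?_⟩
  · simp only [h3]
    rw [← hz]
    exact h.mapsTo u h1
  · simp only [h3]
    rw [← hz, ← h.eq u h1]
    exact φ.map_source h1

/-- The chart `(u, w) ↦ (ψ w, φ₂ u)`, up to the order of the factors. -/
def chart (hg : Continuous g) {φ : OpenPartialHomeomorph U (E × B)}
    {χ : OpenPartialHomeomorph M E} (h : IsAdaptedPair f φ χ)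
    (ψ : OpenPartialHomeomorph W (E × B')) (z₀ : FiberProd f g) :
    OpenPartialHomeomorph (FiberProd f g) (E × (B × B')) where
  toFun z := ((ψ z.1.2).1, ((φ z.1.1).2, (ψ z.1.2).2))
  invFun := chartInv f g φ χ ψ z₀
  source := {z | z.1.1 ∈ φ.source ∧ z.1.2 ∈ ψ.source}
  target := chartTarget g φ χ ψ
  map_source' := fun z hz => map_source_chart h hz
  map_target' := by
    rintro p hp
    have h0 := chartInv_val h z₀ hp
    obtain ⟨⟨h1, h2⟩, h3⟩ := hp
    change _ ∈ φ.source ∧ _ ∈ ψ.source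
    rw [h0]
    exact ⟨φ.map_target h3, ψ.map_target h1⟩
  left_inv' := by
    rintro ⟨⟨u, w⟩, hz⟩ hz'
    have hm := map_source_chart h hz'
    obtain ⟨h1, h2⟩ := hz'
    simp only at h1 h2 hz
    have h3 : ψ.symm ((ψ w).1, (ψ w).2) = w := ψ.left_inv h2
    have h4 : φ.symm (χ (g w), (φ u).2) = u := by
      rw [← hz, ← h.eq u h1]
      exact φ.left_inv h1
    apply Subtype.ext
    rw [chartInv_val h z₀ hm]
    simp only [symmPair, h3, h4]
  right_inv' := by
    rintro p hp
    have h0 := chartInv_val h z₀ hp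
    obtain ⟨⟨h1, h2⟩, h3⟩ := hp
    simp only [h0, symmPair, φ.right_inv h3, ψ.right_inv h1]
  open_source := by
    have : Continuous (fun z : FiberProd f g => z.1) := continuous_subtype_val
    exact (φ.open_source.preimage this.fst).inter (ψ.open_source.preimage this.snd)
  open_target := (mapsTo_and_continuousOn hg ψ).1
  continuousOn_toFun := by
    have hc : Continuous (fun z : FiberProd f g => z.1) := continuous_subtype_val
    have h1 : ContinuousOn (fun z : FiberProd f g => φ z.1.1)
        {z | z.1.1 ∈ φ.source ∧ z.1.2 ∈ ψ.source} :=
      φ.continuousOn.comp hc.fst.continuousOn (fun z hz => hz.1)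
    have h2 : ContinuousOn (fun z : FiberProd f g => ψ z.1.2)
        {z | z.1.1 ∈ φ.source ∧ z.1.2 ∈ ψ.source} :=
      ψ.continuousOn.comp hc.snd.continuousOn (fun z hz => hz.2)
    exact h2.fst.prodMk (h1.snd.prodMk h2.snd)
  continuousOn_invFun := by
    refine (Topology.IsInducing.continuousOn_iff (g := Subtype.val) ⟨rfl⟩).2 ?_
    exact (mapsTo_and_continuousOn hg ψ).2.congr fun p hp => chartInv_val h z₀ hp

variable [IsManifold 𝓘(ℝ, E × B) ∞ U] [IsManifold 𝓘(ℝ, E × B') ∞ W] [IsManifold 𝓘(ℝ, E) ∞ M]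
  [FiniteDimensional ℝ E] [FiniteDimensional ℝ B]

theorem contDiffOn_trans (hg : ContMDiff 𝓘(ℝ, E × B') 𝓘(ℝ, E) ∞ g)
    {φ φ' : OpenPartialHomeomorph U (E × B)} {χ χ' : OpenPartialHomeomorph M E}
    (h : IsAdaptedPair f φ χ) (h' : IsAdaptedPair f φ' χ')
    {ψ ψ' : OpenPartialHomeomorph W (E × B')}
    (hψ : ψ ∈ IsManifold.maximalAtlas 𝓘(ℝ, E × B') ∞ W)
    (hψ' : ψ' ∈ IsManifold.maximalAtlas 𝓘(ℝ, E × B') ∞ W) (z₀ z₀' : FiberProd f g) :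
    ContDiffOn ℝ ∞ ((chart hg.continuous h ψ z₀).symm.trans (chart hg.continuous h' ψ' z₀'))
      ((chart hg.continuous h ψ z₀).symm.trans (chart hg.continuous h' ψ' z₀')).source := by
  rintro p ⟨hp, hp'⟩
  have hev := (chart hg.continuous h ψ z₀).open_target.mem_nhds hp
  replace hp : p ∈ chartTarget g φ χ ψ := hp
  replace hp' : (chartInv f g φ χ ψ z₀ p).1.1 ∈ φ'.source ∧
    (chartInv f g φ χ ψ z₀ p).1.2 ∈ ψ'.source := hp'
  rw [chartInv_val h z₀ hp] at hp'
  obtain ⟨⟨h1, h2⟩, h3⟩ := hp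
  obtain ⟨h4, h5⟩ := hp'
  have hm : ContMDiffAt 𝓘(ℝ, E × (B × B')) 𝓘(ℝ, E × B') ∞
      (fun p : E × (B × B') => ((p.1, p.2.2) : E × B')) p :=
    ContDiff.contMDiff (by fun_prop) |>.contMDiffAt
  have hw : ContMDiffAt 𝓘(ℝ, E × (B × B')) 𝓘(ℝ, E × B') ∞
      (fun p : E × (B × B') => ψ.symm (p.1, p.2.2)) p :=
    ContMDiffAt.comp p (contMDiffAt_symm_of_mem_maximalAtlas hψ h1) hm
  have ha : ContMDiffAt 𝓘(ℝ, E × (B × B')) 𝓘(ℝ, E) ∞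
      (fun p : E × (B × B') => χ (g (ψ.symm (p.1, p.2.2)))) p :=
    ContMDiffAt.comp p (contMDiffAt_of_mem_maximalAtlas h.mem_maximalAtlas' h2)
      (ContMDiffAt.comp p hg.contMDiffAt hw)
  have hb : ContMDiffAt 𝓘(ℝ, E × (B × B')) 𝓘(ℝ, E × B) ∞
      (fun p : E × (B × B') => ((χ (g (ψ.symm (p.1, p.2.2))), p.2.1) : E × B)) p :=
    (ContDiffAt.prodMk ha.contDiffAt (ContDiff.contDiffAt (by fun_prop))).contMDiffAt
  have hu : ContMDiffAt 𝓘(ℝ, E × (B × B')) 𝓘(ℝ, E × B) ∞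
      (fun p : E × (B × B') => φ.symm (χ (g (ψ.symm (p.1, p.2.2))), p.2.1)) p :=
    ContMDiffAt.comp p (contMDiffAt_symm_of_mem_maximalAtlas h.mem_maximalAtlas h3) hb
  have hu' : ContMDiffAt 𝓘(ℝ, E × (B × B')) 𝓘(ℝ, E × B) ∞
      (fun p : E × (B × B') => φ' (symmPair g φ χ ψ p).1) p :=
    ContMDiffAt.comp p (contMDiffAt_of_mem_maximalAtlas h'.mem_maximalAtlas h4) hu
  have hw' : ContMDiffAt 𝓘(ℝ, E × (B × B')) 𝓘(ℝ, E × B') ∞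
      (fun p : E × (B × B') => ψ' (symmPair g φ χ ψ p).2) p :=
    ContMDiffAt.comp p (contMDiffAt_of_mem_maximalAtlas hψ' h5) hw
  have key : ContDiffAt ℝ ∞ (fun p => ((ψ' (symmPair g φ χ ψ p).2).1,
      ((φ' (symmPair g φ χ ψ p).1).2, (ψ' (symmPair g φ χ ψ p).2).2))) p :=
    hw'.contDiffAt.fst.prodMk (hu'.contDiffAt.snd.prodMk hw'.contDiffAt.snd)
  refine (key.congr_of_eventuallyEq ?_).contDiffWithinAt
  filter_upwards [hev] with q hq
  have hq' := chartInv_val h z₀ hq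
  change ((ψ' (chartInv f g φ χ ψ z₀ q).1.2).1, ((φ' (chartInv f g φ χ ψ z₀ q).1.1).2,
    (ψ' (chartInv f g φ χ ψ z₀ q).1.2).2)) = _
  rw [hq']

/-- The smooth structure on the fibre product of a submersion and a smooth map. -/
@[reducible]
def chartedSpace (hf : Manifold.IsSubmersion 𝓘(ℝ, E × B) 𝓘(ℝ, E) ∞ f)
    (hg : ContMDiff 𝓘(ℝ, E × B') 𝓘(ℝ, E) ∞ g) :
    ChartedSpace (E × (B × B')) (FiberProd f g) where
  atlas := {e | ∃ (φ : OpenPartialHomeomorph U (E × B)) (χ : OpenPartialHomeomorph M E)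
    (ψ : OpenPartialHomeomorph W (E × B')) (h : IsAdaptedPair f φ χ) (z : FiberProd f g),
    ψ ∈ IsManifold.maximalAtlas 𝓘(ℝ, E × B') ∞ W ∧ e = chart hg.continuous h ψ z}
  chartAt z := chart hg.continuous (exists_isAdaptedPair hf z.1.1).choose_spec.1
    (chartAt (E × B') z.1.2) z
  mem_chart_source z :=
    ⟨(exists_isAdaptedPair hf z.1.1).choose_spec.2, mem_chart_source _ z.1.2⟩
  chart_mem_atlas z := ⟨_, _, _, (exists_isAdaptedPair hf z.1.1).choose_spec.1, z,
    IsManifold.chart_mem_maximalAtlas z.1.2, rfl⟩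

theorem isManifold (hf : Manifold.IsSubmersion 𝓘(ℝ, E × B) 𝓘(ℝ, E) ∞ f)
    (hg : ContMDiff 𝓘(ℝ, E × B') 𝓘(ℝ, E) ∞ g) :
    letI := chartedSpace hf hg
    IsManifold 𝓘(ℝ, E × (B × B')) ∞ (FiberProd f g) := by
  let := chartedSpace hf hg
  refine isManifold_of_contDiffOn _ _ _ fun e e' he he' => ?_
  obtain ⟨φ, χ, ψ, h, z, hψ, rfl⟩ := he
  obtain ⟨φ', χ', ψ', h', z', hψ', rfl⟩ := he'
  have key := contDiffOn_trans hg h h' hψ hψ' z z'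
  simp only [modelWithCornersSelf_coe, modelWithCornersSelf_coe_symm, Function.comp_id,
    Function.id_comp, range_id, inter_univ, preimage_id]
  exact key

end FiberProd
end FiberProduct

section Foliations

variable {G : Type} [NormedAddCommGroup G] [NormedSpace ℝ G]
  {X : Type u} [TopologicalSpace X] [ChartedSpace G X]

variable (G X) in
/-- (Not necessarily continuous) vector fields on the manifold `X` modelled on `G`. -/
abbrev VField : Type u := ∀ x : X, TangentSpace 𝓘(ℝ, G) x

/-- The vector field `Y` belongs to `C_c^∞(X; TX)`. -/
def IsSmoothCompact [IsManifold 𝓘(ℝ, G) ∞ X] (Y : VField G X) : Prop :=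
  ContMDiff 𝓘(ℝ, G) 𝓘(ℝ, G).tangent ∞ (fun x => (⟨x, Y x⟩ : TangentBundle 𝓘(ℝ, G) X)) ∧
    IsCompact (closure {x | Y x ≠ 0})

/-- The function `f` belongs to `C_c^∞(X)`. -/
def IsTestFunction (f : X → ℝ) : Prop :=
  ContMDiff 𝓘(ℝ, G) 𝓘(ℝ, ℝ) ∞ f ∧ HasCompactSupport f

/-- A (singular) foliation on `X`: a `C^∞(X)`-submodule of `C_c^∞(X; TX)` that is stable under
Lie brackets and locally finitely generated: every point has an open neighbourhood `W` such that
the elements of `F` supported in `W` are `C_c^∞(W)`-combinations of finitely many elements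
of `F`. -/
structure IsFoliation [IsManifold 𝓘(ℝ, G) ∞ X] (F : Set (VField G X)) : Prop where
  smooth : ∀ Y ∈ F, IsSmoothCompact Y
  zero_mem : (fun _ => 0) ∈ F
  add_mem : ∀ Y ∈ F, ∀ Z ∈ F, (fun x => Y x + Z x) ∈ F
  smul_mem : ∀ f : X → ℝ, ContMDiff 𝓘(ℝ, G) 𝓘(ℝ, ℝ) ∞ f → ∀ Y ∈ F, (fun x => f x • Y x) ∈ F
  bracket_mem : ∀ Y ∈ F, ∀ Z ∈ F, VectorField.mlieBracket 𝓘(ℝ, G) Y Z ∈ F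
  locally_fg : ∀ x : X, ∃ W : Set X, IsOpen W ∧ x ∈ W ∧ ∃ (n : ℕ) (Y : Fin n → VField G X),
    (∀ i, Y i ∈ F) ∧ ∀ Z ∈ F, closure {y | Z y ≠ 0} ⊆ W →
      ∃ f : Fin n → X → ℝ, (∀ i, IsTestFunction (G := G) (f i) ∧ tsupport (f i) ⊆ W) ∧
        ∀ y, Z y = ∑ i, f i y • Y i y

variable {E : Type} [NormedAddCommGroup E] [NormedSpace ℝ E]
  {M : Type u} [TopologicalSpace M] [ChartedSpace E M]

/-- The pull-back `f⁻¹(F)` of `F` by a submersion `f : X → M`: the fields `Y ∈ C_c^∞(X; TX)` such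
that `df(Y)` is a `C_c^∞(X)`-combination of fields `Z ∘ f` with `Z ∈ F`. For a submersion this is
the span of the vertical fields and of the `C_c^∞(X)`-multiples of lifts of elements of `F`. -/
def pullback [IsManifold 𝓘(ℝ, G) ∞ X] (f : X → M) (F : Set (VField E M)) : Set (VField G X) :=
  {Y | IsSmoothCompact Y ∧ ∃ (n : ℕ) (g : Fin n → X → ℝ) (Z : Fin n → VField E M),
    (∀ i, IsTestFunction (G := G) (g i) ∧ Z i ∈ F) ∧
      ∀ x, mfderiv 𝓘(ℝ, G) 𝓘(ℝ, E) f x (Y x) = ∑ i, g i x • Z i (f x)}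

variable (E) in
/-- `C_c^∞(X; ker df)`. -/
def vertical [IsManifold 𝓘(ℝ, G) ∞ X] (f : X → M) : Set (VField G X) :=
  {Y | IsSmoothCompact Y ∧ ∀ x, mfderiv 𝓘(ℝ, G) 𝓘(ℝ, E) f x (Y x) = 0}

/-- The product manifold `M × ℝ`, with the model `E × ℝ`. -/
instance prodRealChartedSpace : ChartedSpace (E × ℝ) (M × ℝ) :=
  inferInstanceAs (ChartedSpace (ModelProd E ℝ) (M × ℝ))

instance prodRealIsManifold [IsManifold 𝓘(ℝ, E) ∞ M] : IsManifold 𝓘(ℝ, E × ℝ) ∞ (M × ℝ) := by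
  rw [modelWithCornersSelf_prod]
  exact IsManifold.prod M ℝ

/-- The extension `Z ⊗ 1` of `Z` to a vector field on `M × ℝ` tangent along `M`. -/
def tensorOne (Z : VField E M) : VField (E × ℝ) (M × ℝ) := fun p => ((Z p.1, 0) : E × ℝ)

/-- The adiabatic foliation `TF` on `M × ℝ`: the finite sums `∑ fᵢ (Zᵢ ⊗ 1)` with `Zᵢ ∈ F` and
`fᵢ = λ gᵢ`, where `λ` is the second projection and `gᵢ ∈ C_c^∞(M × ℝ)`. -/
def adiabatic (F : Set (VField E M)) : Set (VField (E × ℝ) (M × ℝ)) :=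
  {Y | ∃ (n : ℕ) (g : Fin n → M × ℝ → ℝ) (Z : Fin n → VField E M),
    (∀ i, IsTestFunction (G := E × ℝ) (g i) ∧ Z i ∈ F) ∧
      ∀ p, Y p = ∑ i, (p.2 * g i p) • tensorOne (Z i) p}

end Foliations

/-- A smooth manifold (the `carrier`) with two maps `t`, `s` to `M`. As `M` is modelled on `E` and
the total spaces of interest submerse onto `M`, the model space is written as `E × fib`. -/
structure Span (E : Type) [NormedAddCommGroup E] [NormedSpace ℝ E] (M : Type u) where
  /-- the manifold -/
  carrier : Type u
  /-- the model of the fibres -/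
  fib : Type
  [normedAddCommGroup : NormedAddCommGroup fib]
  [normedSpace : NormedSpace ℝ fib]
  [finiteDimensional : FiniteDimensional ℝ fib]
  [topologicalSpace : TopologicalSpace carrier]
  [chartedSpace : ChartedSpace (E × fib) carrier]
  [isManifold : IsManifold 𝓘(ℝ, E × fib) ∞ carrier]
  /-- the target map -/
  t : carrier → M
  /-- the source map -/
  s : carrier → M

attribute [instance] Span.normedAddCommGroup Span.normedSpace Span.finiteDimensional
  Span.topologicalSpace Span.chartedSpace Span.isManifold

section Bisubmersions

variable {E : Type} [NormedAddCommGroup E] [NormedSpace ℝ E]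
  {M : Type u} [TopologicalSpace M] [ChartedSpace E M]

/-- `(U, t, s)` is a bi-submersion for `(M, F)`. -/
structure IsBisubmersion (F : Set (VField E M)) (A : Span E M) : Prop where
  t2 : T2Space A.carrier
  secondCountable : SecondCountableTopology A.carrier
  submersion_s : Manifold.IsSubmersion 𝓘(ℝ, E × A.fib) 𝓘(ℝ, E) ∞ A.s
  submersion_t : Manifold.IsSubmersion 𝓘(ℝ, E × A.fib) 𝓘(ℝ, E) ∞ A.t
  pullback_eq : pullback (G := E × A.fib) A.s F = pullback A.t F
  pullback_eq_add : pullback (G := E × A.fib) A.s F =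
    {Y | ∃ Y₁ ∈ vertical E A.s, ∃ Y₂ ∈ vertical E A.t, Y = fun u => Y₁ u + Y₂ u}

/-- The inverse `(U, s, t)`. -/
def Span.inv (A : Span E M) : Span E M where
  carrier := A.carrier
  fib := A.fib
  t := A.s
  s := A.t

/-- The composition `U ∘ V = U ×_{s, t} V`, with `t (u, v) = t u` and `s (u, v) = s v`. -/
def Span.comp [FiniteDimensional ℝ E] [IsManifold 𝓘(ℝ, E) ∞ M] (A B : Span E M)
    (hA : Manifold.IsSubmersion 𝓘(ℝ, E × A.fib) 𝓘(ℝ, E) ∞ A.s)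
    (hB : ContMDiff 𝓘(ℝ, E × B.fib) 𝓘(ℝ, E) ∞ B.t) : Span E M :=
  letI := FiberProd.chartedSpace hA hB
  haveI := FiberProd.isManifold hA hB
  { carrier := FiberProd A.s B.t
    fib := A.fib × B.fib
    t := fun z => A.t z.1.1
    s := fun z => B.s z.1.2 }

/-- `A` is adapted to the family `𝒰`: near every point there is a local morphism of bi-submersions
to a member of `𝒰`. -/
def IsAdapted {ι : Type*} (A : Span E M) (𝒰 : ι → Span E M) : Prop :=
  ∀ u : A.carrier, ∃ (i : ι) (O : Set A.carrier) (f : A.carrier → (𝒰 i).carrier),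
    IsOpen O ∧ u ∈ O ∧ ContMDiffOn 𝓘(ℝ, E × A.fib) 𝓘(ℝ, E × (𝒰 i).fib) ∞ f O ∧
      ∀ x ∈ O, (𝒰 i).s (f x) = A.s x ∧ (𝒰 i).t (f x) = A.t x

/-- The family `𝒰` is an atlas of bi-submersions for `(M, F)`. -/
structure IsAtlas [FiniteDimensional ℝ E] [IsManifold 𝓘(ℝ, E) ∞ M] {ι : Type*}
    (F : Set (VField E M)) (𝒰 : ι → Span E M) : Prop where
  bisubmersion : ∀ i, IsBisubmersion F (𝒰 i)
  cover : ⋃ i, range (𝒰 i).s = univ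
  inv : ∀ i, IsAdapted (𝒰 i).inv 𝒰
  comp : ∀ i j, IsAdapted ((𝒰 i).comp (𝒰 j) (bisubmersion i).submersion_s
    (bisubmersion j).submersion_t.contMDiff) 𝒰

/-- `𝒰` is a path holonomy atlas, that is, a minimal atlas: it is adapted to every atlas of
`(M, F)`. It is unique up to equivalence of atlases. -/
def IsPathHolonomyAtlas [FiniteDimensional ℝ E] [IsManifold 𝓘(ℝ, E) ∞ M] {ι : Type*}
    (F : Set (VField E M)) (𝒰 : ι → Span E M) : Prop :=
  IsAtlas F 𝒰 ∧ ∀ 𝒲 : Set (Span E M), IsAtlas F (fun A : 𝒲 => (A : Span E M)) →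
    ∀ i, IsAdapted (𝒰 i) (fun A : 𝒲 => (A : Span E M))

/-- `V` is an identity bisection of `(U, t, s)`: a locally closed submanifold on which `s` and `t`
coincide and are étale. (Étale forces `dim V = dim M = dim E`, whence the form of the submanifold
charts.) -/
structure IsIdentityBisection (A : Span E M) (V : Set A.carrier) : Prop where
  submanifold : IsSliceSubmanifold E A.fib V
  eqOn : ∀ v ∈ V, A.s v = A.t v
  etale_s : ∀ v ∈ V, Function.Bijective (fun ξ : tangentTo (E × A.fib) V v =>
    mfderiv 𝓘(ℝ, E × A.fib) 𝓘(ℝ, E) A.s v ξ)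
  etale_t : ∀ v ∈ V, Function.Bijective (fun ξ : tangentTo (E × A.fib) V v =>
    mfderiv 𝓘(ℝ, E × A.fib) 𝓘(ℝ, E) A.t v ξ)

/-- The deformation `(D(U, V), t ∘ q, s ∘ q)` over `M × ℝ`, where `t` and `s` stand for `t × id`
and `s × id`. -/
def Span.dnc [FiniteDimensional ℝ E] (A : Span E M) (V : Set A.carrier)
    (hV : IsSliceSubmanifold E A.fib V) : Span (E × ℝ) (M × ℝ) :=
  letI := (DNC.chartedSpaceCore hV).toTopologicalSpace
  letI := (DNC.chartedSpaceCore hV).toChartedSpace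
  haveI := DNC.isManifold hV
  { carrier := DNC (E × A.fib) V
    fib := A.fib
    t := Prod.map A.t id ∘ DNC.q
    s := Prod.map A.s id ∘ DNC.q }

end Bisubmersions

end

end SingFol

open SingFol

/-! All conditions are checked in charts of `U` that turn `s` into the projection `E × B → E`. Write
`τ` for `t` in such a chart. Being a bi-submersion then splits into two local statements about `τ`:
its derivatives along `B` are smooth combinations of elements of `F` (`VertIn`), and every element
of `F` is such a derivative (`VertGen`). Together with the same statements for `s` in charts adapted
to `t`, partitions of unity recover the global definition (`isBisubmersion_of_isFibreAdapted`). In a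
chart of `D(U, V)` the map `t` reads `(a, β, b) ↦ (τ (a, βb), β)`. Its derivative along `b` is `β`
times that of `τ`, which is precisely the factor `λ` in the adiabatic foliation, so both statements
pass from `F` to `adiabatic F` (`VertIn.dncMap`, `VertGen.dncMap`). That `adiabatic F` is a
foliation follows from the Leibniz rule for brackets and from cutting off local generators.

Morphisms near units come from an ordinary differential equation. Take two bi-submersions in charts
where `E × {0}` consists of units over the same points. The radial path from `(a, 0)` to `(a, y)` in
the first has as `t`-image an integral curve of a time-dependent combination of fields of `F`. By
`VertGen` this combination lifts to the fibres of the second, and solving the lifted equation gives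
an endpoint `g (a, y)` that depends smoothly on `(a, y)` and vanishes for `y = 0`
(`exists_ode_solution_param`, `exists_factorization`). Hence a bi-submersion is, near a unit,
adapted to any other bi-submersion having a unit over the same point (`IsUnitPoint.adaptedAt`).

For the atlas property, points with `β ≠ 0` use the morphisms of `𝒰` times the identity of `ℝ*`. At
`β = 0` an inverse or a composition of deformations lies over units. There the morphism `g` above
satisfies `g (a, 0) = 0`, so `g (a, βy) / β` extends smoothly across `β = 0` and defines a morphism
into the deformation (`AdaptedAt.dnc_of_isUnitChart`).

For minimality, let `𝒲` be an atlas for `adiabatic F`. Every atlas has units over every point,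
obtained as products `u⁻¹u` (`IsAtlas.exists_isUnitPoint`), so unit points of arbitrary
bi-submersions are adapted to `𝒲`. Writing `d = (d d'⁻¹) d'` shows that adaptedness to `𝒲` is a
closed condition along the fibres of `s`, and it is clearly open. A normal vector is joined to the
zero section by scaling, which settles `β = 0`. For fixed `β ≠ 0` the bi-submersions of `F` that are
adapted to `𝒲` at time `β` form an atlas for `F` (`isAtlas_adaptedSpans`), and the minimality of `𝒰`
applies to this atlas. -/

namespace SingFol

set_option linter.unusedSectionVars false

noncomputable section

/-! ### Smoothness of postcomposition on spaces of continuous maps -/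

section Nemytskii

variable {K X Y : Type} [TopologicalSpace K] [CompactSpace K] [NormedAddCommGroup X]
  [NormedSpace ℝ X] [NormedAddCommGroup Y] [NormedSpace ℝ Y]

/-- The pointwise application `C(K, X →L Y) → C(K, X) →L C(K, Y)`. -/
def pointwiseApply : C(K, X →L[ℝ] Y) →L[ℝ] C(K, X) →L[ℝ] C(K, Y) :=
  LinearMap.mkContinuous₂
    (LinearMap.mk₂ ℝ (fun (A : C(K, X →L[ℝ] Y)) (h : C(K, X)) => (⟨fun k => A k (h k), by fun_prop⟩ : C(K, Y)))
      (fun _ _ _ => by ext; simp) (fun _ _ _ => by ext; simp) (fun _ _ _ => by ext; simp)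
      (fun _ _ _ => by ext; simp)) 1 fun A h => by
    rw [one_mul, ContinuousMap.norm_le _ (by positivity)]
    intro k
    exact (A k).le_of_opNorm_le_of_le (A.norm_coe_le_norm k) (h.norm_coe_le_norm k)

@[simp]
theorem pointwiseApply_apply (A : C(K, X →L[ℝ] Y)) (h : C(K, X)) (k : K) :
    pointwiseApply A h k = A k (h k) := rfl

/-- The mean value inequality for `g` bounds the remainder at each `k`; the bound is uniform in `k`
because postcomposition with `fderiv ℝ g` is continuous on `C(K, X)`. -/
theorem hasFDerivAt_postcomp {g : X → Y} (hg : ContDiff ℝ 1 g) (z : C(K, X)) :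
    HasFDerivAt (fun z : C(K, X) => (ContinuousMap.mk g hg.continuous).comp z)
      (pointwiseApply ((ContinuousMap.mk (fderiv ℝ g) (hg.continuous_fderiv one_ne_zero)).comp z))
      z := by
  set D : C(X, X →L[ℝ] Y) := ⟨fderiv ℝ g, hg.continuous_fderiv one_ne_zero⟩ with hD
  rw [hasFDerivAt_iff_isLittleO_nhds_zero, Asymptotics.isLittleO_iff]
  intro ε hε
  have hc : ContinuousAt (fun w : C(K, X) => D.comp w) z :=
    (ContinuousMap.continuous_postcomp (X := K) D).continuousAt
  obtain ⟨δ, hδ, hδ'⟩ := (Metric.continuousAt_iff (f := fun w : C(K, X) => D.comp w) (a := z)).1 hc ε hε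
  filter_upwards [Metric.ball_mem_nhds (0 : C(K, X)) hδ] with h hh
  rw [ContinuousMap.norm_le _ (by positivity)]
  intro k
  -- Testing continuity on the translate of `z` by the constant `x - z k` turns the estimate in the
  -- sup norm into a pointwise one, with `δ` independent of `k`.
  have hball : ∀ x ∈ Metric.ball (z k) δ, ‖fderiv ℝ g x - fderiv ℝ g (z k)‖ ≤ ε := by
    intro x hx
    have h1 : dist (z + ContinuousMap.const K (x - z k)) z < δ := by
      rw [dist_eq_norm, add_sub_cancel_left]
      refine lt_of_le_of_lt ((ContinuousMap.norm_le _ (norm_nonneg (x - z k))).2 fun _ => le_rfl) ?_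
      rwa [← dist_eq_norm]
    have h2 := hδ' h1
    have h3 := (ContinuousMap.dist_apply_le_dist k).trans h2.le
    rw [← dist_eq_norm]
    simpa [hD] using h3
  have h4 := (convex_ball (z k) δ).norm_image_sub_le_of_norm_hasFDerivWithin_le'
    (f := g) (f' := fderiv ℝ g) (φ := fderiv ℝ g (z k)) (C := ε) (x := z k) (y := z k + h k)
    (fun x _ => (hg.differentiable one_ne_zero x).hasFDerivAt.hasFDerivWithinAt) hball
    (Metric.mem_ball_self hδ) (by
      rw [Metric.mem_ball, dist_eq_norm, add_sub_cancel_left]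
      refine (h.norm_coe_le_norm k).trans_lt ?_
      simpa using hh)
  simp only [add_sub_cancel_left] at h4
  refine le_trans (le_of_eq ?_) (h4.trans ?_)
  · simp [hD]
  · gcongr
    exact h.norm_coe_le_norm k

end Nemytskii

/-- The derivative is `pointwiseApply`, which is continuous linear, after postcomposition with
`fderiv ℝ g`. The induction therefore changes the target space, and `Y` has to be quantified inside
it. -/
theorem contDiff_postcomp {K X : Type} [TopologicalSpace K] [CompactSpace K]
    [NormedAddCommGroup X] [NormedSpace ℝ X] (n : ℕ) :
    ∀ {Y : Type} [NormedAddCommGroup Y] [NormedSpace ℝ Y] {g : X → Y} (hg : ContDiff ℝ ∞ g),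
    ContDiff ℝ n (fun z : C(K, X) => (ContinuousMap.mk g hg.continuous).comp z) := by
  induction n with
  | zero =>
    intro Y _ _ g hg
    exact contDiff_zero.2 (ContinuousMap.continuous_postcomp _)
  | succ n ih =>
    intro Y _ _ g hg
    have h1 : ContDiff ℝ 1 g := hg.of_le (by simp)
    have h2 : ContDiff ℝ ∞ (fderiv ℝ g) := hg.fderiv_right (by simp)
    rw [Nat.cast_succ, contDiff_succ_iff_hasFDerivAt]
    exact ⟨fun z => pointwiseApply ((ContinuousMap.mk (fderiv ℝ g) h2.continuous).comp z),
      ContDiff.comp (g := fun A => pointwiseApply (K := K) (X := X) (Y := Y) A)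
        (ContinuousLinearMap.contDiff _) (ih h2),
      fun z => hasFDerivAt_postcomp h1 z⟩


/-! ### Smooth dependence of solutions on parameters -/

section ParametricODE

open unitInterval MeasureTheory

variable {C : Type} [NormedAddCommGroup C] [NormedSpace ℝ C]

/-- The primitive `r ↦ ∫₀ʳ z` as an operator on `C([0, 1], C)`. -/
def primitive [CompleteSpace C] : C(I, C) →L[ℝ] C(I, C) :=
  LinearMap.mkContinuous
    { toFun := fun z => ⟨fun r => ∫ s in (0 : ℝ)..r, IccExtend zero_le_one z s,
        (intervalIntegral.continuous_primitive (fun _ _ =>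
          (z.continuous.Icc_extend' (h := zero_le_one)).intervalIntegrable _ _) 0).comp
            continuous_subtype_val⟩
      map_add' := fun z w => by
        ext r
        have h1 := (z.continuous.Icc_extend' (h := zero_le_one' ℝ)).intervalIntegrable
          (μ := volume) 0 (r : ℝ)
        have h2 := (w.continuous.Icc_extend' (h := zero_le_one' ℝ)).intervalIntegrable
          (μ := volume) 0 (r : ℝ)
        simpa using! intervalIntegral.integral_add h1 h2
      map_smul' := fun c z => by
        ext r
        exact intervalIntegral.integral_smul (μ := volume) (a := 0) (b := (r : ℝ)) c
          (IccExtend zero_le_one z) } 1 fun z => by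
    rw [one_mul, ContinuousMap.norm_le _ (by positivity)]
    intro r
    refine (intervalIntegral.norm_integral_le_of_norm_le_const (C := ‖z‖)
      (fun s _ => z.norm_coe_le_norm _)).trans ?_
    refine mul_le_of_le_one_right (norm_nonneg _) ?_
    rw [sub_zero, abs_of_nonneg r.2.1]
    exact r.2.2

variable {P : Type} [NormedAddCommGroup P] [NormedSpace ℝ P]

/-- The continuous linear map `(p, z) ↦ (r ↦ (r, p, z r))`, up to the affine part. -/
def paramPath : P × C(I, C) →L[ℝ] C(I, ℝ × P × C) :=
  LinearMap.mkContinuous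
    { toFun := fun q => ⟨fun r => (0, q.1, q.2 r), by fun_prop⟩
      map_add' := fun _ _ => by ext <;> simp
      map_smul' := fun _ _ => by ext <;> simp } 1 fun q => by
    rw [one_mul, ContinuousMap.norm_le _ (by positivity)]
    intro r
    have := q.2.norm_coe_le_norm r
    simp only [LinearMap.coe_mk, AddHom.coe_mk, ContinuousMap.coe_mk, Prod.norm_def, norm_zero]
    refine max_le (by positivity) (max_le (le_max_left _ _) (this.trans (le_max_right _ _)))

/-- Smooth dependence on the parameter `p` of the solution on `[0, 1]` of `z' = G (r, p, z)`,
`z 0 = 0`, near a parameter `p₀` for which `G` vanishes. -/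
theorem exists_ode_solution_param [CompleteSpace C] [CompleteSpace P] {G : ℝ × P × C → C}
    (hG : ContDiff ℝ ∞ G) {p₀ : P} (hG0 : ∀ r z, G (r, p₀, z) = 0) :
    ∃ z : P → ℝ → C, (∀ᶠ p in 𝓝 p₀, ContDiffAt ℝ ∞ (fun p => z p 1) p) ∧
      (∀ᶠ p in 𝓝 p₀, z p 0 = 0 ∧ ∀ r ∈ Icc (0 : ℝ) 1,
        HasDerivWithinAt (z p) (G (r, p, z p r)) (Icc 0 1) r) ∧
      (∀ ε > 0, ∀ᶠ p in 𝓝 p₀, ∀ r, ‖z p r‖ < ε) ∧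
      (∀ᶠ p in 𝓝 p₀, (∀ r, G (r, p, 0) = 0) → ∀ r, z p r = 0) := by
  let κ : C(I, ℝ × P × C) := ⟨fun r => (r, 0, 0), by fun_prop⟩
  let N : P × C(I, C) → C(I, C) := fun q =>
    (ContinuousMap.mk G hG.continuous).comp (κ + paramPath q)
  have hN : ContDiff ℝ ∞ N := by
    refine ContDiff.comp (g := fun z => (ContinuousMap.mk G hG.continuous).comp z)
      (contDiff_infty.2 fun n => contDiff_postcomp n hG) ?_
    exact contDiff_const.add (ContinuousLinearMap.contDiff (paramPath (C := C) (P := P)))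
  have hNa : ∀ q r, N q r = G (r, q.1, q.2 r) := fun q r => by
    simp [N, κ, paramPath]
  -- For given `p` the solutions are the zeros of the second component, the equation being in
  -- integral form. Keeping `p` as the first component lets the inverse function theorem act as the
  -- implicit one.
  let Ψ : P × C(I, C) → P × C(I, C) := fun q => (q.1, q.2 - primitive (N q))
  have hΨ : ContDiff ℝ ∞ Ψ :=
    contDiff_fst.prodMk (contDiff_snd.sub ((ContinuousLinearMap.contDiff (primitive (C := C))).comp hN))
  have hN0 : ∀ z, N (p₀, z) = 0 := fun z => by ext r; simp [hNa, hG0]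
  have hΨ0 : ∀ z, Ψ (p₀, z) = (p₀, z) := fun z => by simp [Ψ, hN0]
  set D := fderiv ℝ Ψ (p₀, 0) with hD
  have hDd : HasFDerivAt Ψ D (p₀, 0) := (hΨ.differentiable (by simp) _).hasFDerivAt
  have hD1 : ∀ v, (D v).1 = v.1 := fun v => by
    have h1 := (ContinuousLinearMap.fst ℝ P C(I, C)).hasFDerivAt.comp (p₀, (0 : C(I, C))) hDd
    have h2 := h1.unique (ContinuousLinearMap.fst ℝ P C(I, C)).hasFDerivAt
    exact congrArg (fun L => L v) h2
  have hD2 : ∀ w, D (0, w) = (0, w) := fun w => by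
    have h1 := hDd.comp (0 : C(I, C)) (hasFDerivAt_prodMk_right p₀ (0 : C(I, C)))
    have h3 : (Ψ ∘ fun z => (p₀, z)) = fun z => (p₀, z) := funext hΨ0
    rw [h3] at h1
    have h2 := h1.unique (hasFDerivAt_prodMk_right p₀ (0 : C(I, C)))
    exact congrArg (fun L => L w) h2
  -- As `G` vanishes at `p₀`, the derivative of `Ψ` at `(p₀, 0)` is block triangular with identities
  -- on the diagonal, hence invertible.
  let D' : (P × C(I, C)) ≃L[ℝ] (P × C(I, C)) :=
    (ContinuousLinearEquiv.refl ℝ P).skewProd (ContinuousLinearEquiv.refl ℝ C(I, C))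
      ((ContinuousLinearMap.snd ℝ P C(I, C)).comp (D.comp (ContinuousLinearMap.inl ℝ P C(I, C))))
  have hDD' : D = D' := by
    refine ContinuousLinearMap.ext fun v => ?_
    obtain ⟨a, w⟩ := v
    have h1 : D (a, w) = D (a, 0) + D (0, w) := by rw [← map_add]; simp
    rw [h1, hD2]
    refine Prod.ext ?_ ?_
    · simp [D', hD1]
    · simp [D', add_comm]
  have hstrict : HasStrictFDerivAt Ψ (D' : P × C(I, C) →L[ℝ] P × C(I, C)) (p₀, 0) := by
    rw [← hDD']
    exact hΨ.contDiffAt.hasStrictFDerivAt (by simp)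
  let e := hstrict.toOpenPartialHomeomorph Ψ
  have he : ∀ q, e q = Ψ q := fun q => rfl
  have hmem : (p₀, (0 : C(I, C))) ∈ e.source := hstrict.mem_toOpenPartialHomeomorph_source
  have hsymm0 : e.symm (p₀, 0) = (p₀, 0) := by
    have := e.left_inv hmem
    rwa [he, hΨ0] at this
  have hmem' : (p₀, (0 : C(I, C))) ∈ e.target := by
    have := e.map_source hmem
    rwa [he, hΨ0] at this
  have hc : Continuous fun p : P => (p, (0 : C(I, C))) := by fun_prop
  have ht : ∀ᶠ p in 𝓝 p₀, (p, (0 : C(I, C))) ∈ e.target :=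
    hc.continuousAt.eventually (e.open_target.mem_nhds hmem')
  have hsc : Tendsto (fun p => e.symm (p, 0)) (𝓝 p₀) (𝓝 (p₀, 0)) := by
    have := (e.continuousAt_symm hmem').tendsto.comp hc.continuousAt
    rwa [hsymm0] at this
  -- Smoothness of the inverse is needed near `p₀` and not only at it; invertibility of the
  -- derivative is an open condition.
  have hsm : ∀ᶠ p in 𝓝 p₀, ContDiffAt ℝ ∞ e.symm (p, 0) := by
    have h1 : ∀ᶠ q in 𝓝 (p₀, (0 : C(I, C))),
        fderiv ℝ Ψ q ∈ range ((↑) : ((P × C(I, C)) ≃L[ℝ] (P × C(I, C))) → _) := by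
      refine (hΨ.continuous_fderiv (by simp)).continuousAt.eventually ?_
      rw [← hD, hDD']
      exact ContinuousLinearEquiv.nhds D'
    filter_upwards [ht, hsc.eventually h1] with p hp ⟨D1, hD1⟩
    refine e.contDiffAt_symm hp (f₀' := D1) ?_ hΨ.contDiffAt
    rw [hD1]
    exact (hΨ.differentiable (by simp) _).hasFDerivAt
  have hsol : ∀ᶠ p in 𝓝 p₀, (e.symm (p, 0)).1 = p ∧
      (e.symm (p, 0)).2 = primitive (N (p, (e.symm (p, 0)).2)) := by
    filter_upwards [ht] with p hp
    have h1 := e.right_inv hp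
    rw [he] at h1
    have h2 := congrArg Prod.fst h1
    have h3 := congrArg Prod.snd h1
    simp only [Ψ] at h2 h3
    refine ⟨h2, ?_⟩
    nth_rewrite 2 [← h2]
    exact sub_eq_zero.1 h3
  refine ⟨fun p => IccExtend zero_le_one (e.symm (p, 0)).2, ?_, ?_, ?_, ?_⟩
  · filter_upwards [hsm] with p hp
    have h1 : (fun p : P => IccExtend zero_le_one ((e.symm (p, 0)).2 : I → C) 1) =
        fun p => ContinuousMap.evalCLM ℝ (1 : I) (e.symm (p, 0)).2 := by
      funext p
      rw [IccExtend_of_mem _ _ (right_mem_Icc.2 zero_le_one)]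
      rfl
    rw [h1]
    exact (ContinuousMap.evalCLM ℝ (1 : I)).contDiff.contDiffAt.comp p
      (contDiff_snd.contDiffAt.comp p (hp.comp p (contDiff_id.prodMk contDiff_const).contDiffAt))
  · filter_upwards [hsol] with p ⟨hp1, hp2⟩
    set z := (e.symm (p, 0)).2 with hz
    have h1 : ∀ r ∈ Icc (0 : ℝ) 1, IccExtend zero_le_one (z : I → C) r =
        ∫ s in (0 : ℝ)..r, IccExtend zero_le_one (N (p, z) : I → C) s := fun r hr => by
      rw [IccExtend_of_mem _ _ hr]
      conv_lhs => rw [hp2]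
      rfl
    refine ⟨?_, fun r hr => ?_⟩
    · rw [h1 0 (left_mem_Icc.2 zero_le_one), intervalIntegral.integral_same]
    · have hcont : Continuous (IccExtend zero_le_one (N (p, z) : I → C)) :=
        (N (p, z)).continuous.Icc_extend'
      have h2 := (hcont.integral_hasStrictDerivAt 0 r).hasDerivAt.hasDerivWithinAt (s := Icc 0 1)
      have h3 := h2.congr h1 (h1 r hr)
      rw [IccExtend_of_mem _ _ hr, hNa] at h3
      rwa [IccExtend_of_mem _ _ hr]
  · intro ε hε
    have h1 := hsc.eventually (Metric.ball_mem_nhds _ hε)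
    filter_upwards [h1] with p hp r
    rw [dist_eq_norm] at hp
    have h2 := (norm_snd_le _).trans_lt hp
    simp only [Prod.snd_sub, sub_zero] at h2
    exact ((e.symm (p, 0)).2.norm_coe_le_norm _).trans_lt h2
  -- If `G` vanishes along the zero path, then `Ψ` fixes `(p, 0)`, so the local inverse returns the
  -- zero path.
  · have h1 : ∀ᶠ p in 𝓝 p₀, (p, (0 : C(I, C))) ∈ e.source :=
      hc.continuousAt.eventually (e.open_source.mem_nhds hmem)
    filter_upwards [h1] with p hp h0 r
    have h2 : N (p, 0) = 0 := by ext r; simp [hNa, h0]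
    have h3 : e (p, 0) = (p, 0) := by simp [he, Ψ, h2]
    have h4 := e.left_inv hp
    rw [h3] at h4
    rw [h4]
    simp [IccExtend]

end ParametricODE

/-! ### Factorization of one family of maps through another -/

/-- A function that is smooth near a point agrees near this point with a smooth function. -/
theorem exists_contDiff_eventuallyEq {X Y : Type} [NormedAddCommGroup X] [NormedSpace ℝ X]
    [FiniteDimensional ℝ X] [NormedAddCommGroup Y] [NormedSpace ℝ Y] {f : X → Y} {x₀ : X}
    (hf : ∀ᶠ x in 𝓝 x₀, ContDiffAt ℝ ∞ f x) :
    ∃ g : X → Y, ContDiff ℝ ∞ g ∧ g =ᶠ[𝓝 x₀] f := by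
  obtain ⟨r, hr, hb⟩ := Metric.nhds_basis_closedBall.mem_iff.1 hf
  let b : ContDiffBump x₀ := ⟨r / 2, r, by positivity, by linarith⟩
  refine ⟨fun x => b x • f x, contDiff_iff_contDiffAt.2 fun x => ?_, ?_⟩
  · by_cases hx : x ∈ tsupport b
    · rw [b.tsupport_eq] at hx
      exact b.contDiff.contDiffAt.smul (hb hx)
    · have : (fun x => b x • f x) =ᶠ[𝓝 x] fun _ => 0 := by
        filter_upwards [notMem_tsupport_iff_eventuallyEq.mp hx] with q hq
        simp [hq]
      exact contDiffAt_const.congr_of_eventuallyEq this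
  · filter_upwards [b.eventuallyEq_one] with x hx
    simp [hx]

theorem lipschitzOnWith_sum_smul {E ι : Type} [NormedAddCommGroup E] [NormedSpace ℝ E] [Fintype ι]
    {X : ι → E → E} {K : ι → NNReal} {s : Set E} (hX : ∀ i, LipschitzOnWith (K i) (X i) s)
    {c : ι → ℝ} {m : NNReal} (hc : ∀ i, ‖c i‖ ≤ m) :
    LipschitzOnWith (∑ i, m * K i) (fun x => ∑ i, c i • X i x) s := by
  refine LipschitzOnWith.of_dist_le_mul fun x hx y hy => ?_
  rw [dist_eq_norm, ← Finset.sum_sub_distrib, NNReal.coe_sum, Finset.sum_mul]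
  refine norm_sum_le_of_le _ fun i _ => ?_
  rw [← smul_sub, norm_smul, NNReal.coe_mul, mul_assoc]
  have := (hX i).dist_le_mul x hx y hy
  rw [dist_eq_norm (X i x)] at this
  gcongr
  exact hc i

/-- Let `S : E × B → E` and `T : E × C → E` agree on `E × 0`. If the vertical derivatives of `S` are
combinations of fields `X i` along `S`, and if the `X i` along `T` are vertical derivatives of `T`,
then `S` locally factors through `T` over `E`. -/
theorem exists_factorization {E B C ι : Type} [NormedAddCommGroup E] [NormedSpace ℝ E]
    [FiniteDimensional ℝ E] [NormedAddCommGroup B] [NormedSpace ℝ B] [FiniteDimensional ℝ B]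
    [NormedAddCommGroup C] [NormedSpace ℝ C] [FiniteDimensional ℝ C] [Fintype ι]
    {S : E × B → E} {T : E × C → E} {c : ι → E × B → B →L[ℝ] ℝ} {e : ι → E × C → C}
    {X : ι → E → E} {a₀ : E}
    (hc : ∀ i, ∀ᶠ p in 𝓝 (a₀, (0 : B)), ContDiffAt ℝ ∞ (c i) p)
    (he : ∀ i, ∀ᶠ p in 𝓝 (a₀, (0 : C)), ContDiffAt ℝ ∞ (e i) p)
    (hX : ∀ i, ContDiffAt ℝ 1 (X i) (S (a₀, 0)))
    (hS : ∀ᶠ p in 𝓝 (a₀, (0 : B)), DifferentiableAt ℝ S p ∧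
      ∀ b, fderiv ℝ S p (0, b) = ∑ i, c i p b • X i (S p))
    (hT : ∀ᶠ p in 𝓝 (a₀, (0 : C)), DifferentiableAt ℝ T p ∧
      ∀ i, fderiv ℝ T p (0, e i p) = X i (T p))
    (h0 : ∀ᶠ a in 𝓝 a₀, S (a, 0) = T (a, 0)) :
    ∃ g : E × B → C, (∀ᶠ p in 𝓝 (a₀, (0 : B)), ContDiffAt ℝ ∞ g p ∧ T (p.1, g p) = S p) ∧
      ∀ᶠ a in 𝓝 a₀, g (a, 0) = 0 := by
  have := FiniteDimensional.complete ℝ C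
  have := FiniteDimensional.complete ℝ E
  have := FiniteDimensional.complete ℝ B
  -- The coefficients are replaced by globally smooth ones, since the result on parameters asks for
  -- a globally defined right-hand side.
  choose c' hc' hcc' using fun i => exists_contDiff_eventuallyEq (hc i)
  choose e' he' hee' using fun i => exists_contDiff_eventuallyEq (he i)
  -- The equation for a path `z` with `T (a, z r) = S (a, r y)`: the right side moves with velocity
  -- `∑ cᵢ(a, r y)(y) Xᵢ`, and `eᵢ` lifts `Xᵢ` to the fibres of `T`.
  let G : ℝ × (E × B) × C → C := fun q =>
    ∑ i, c' i (q.2.1.1, q.1 • q.2.1.2) q.2.1.2 • e' i (q.2.1.1, q.2.2)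
  have hG : ContDiff ℝ ∞ G := by
    refine ContDiff.sum fun i _ => ContDiff.smul ?_ ?_
    · exact ((hc' i).comp (f := fun q : ℝ × (E × B) × C => (q.2.1.1, q.1 • q.2.1.2))
        (by fun_prop)).clm_apply (by fun_prop)
    · exact (he' i).comp (f := fun q : ℝ × (E × B) × C => (q.2.1.1, q.2.2)) (by fun_prop)
  have hG0 : ∀ a r z, G (r, (a, 0), z) = 0 := fun a r z => by simp [G]
  obtain ⟨z, hz1, hz2, hz3, hz4⟩ := exists_ode_solution_param hG (p₀ := (a₀, (0 : B)))
    (fun r z => hG0 a₀ r z)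
  refine ⟨fun p => z p 1, ?_, ?_⟩
  swap
  · have hcont : ContinuousAt (fun a : E => (a, (0 : B))) a₀ := by fun_prop
    filter_upwards [hcont.eventually hz4] with a ha
    exact ha (fun r => hG0 a r 0) 1
  -- Only the lift is smooth in `C`; in `E` nothing but uniqueness of integral curves is used, for
  -- which local Lipschitz constants of the `Xᵢ` suffice.
  choose K s hs hK using fun i => (hX i).exists_lipschitzOnWith
  have hs' : ⋂ i, s i ∈ 𝓝 (S (a₀, 0)) := iInter_mem.2 hs
  have hSc : ContinuousAt S (a₀, 0) := hS.self_of_nhds.1.continuousAt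
  have hTc : ContinuousAt T (a₀, 0) := hT.self_of_nhds.1.continuousAt
  have hT0 : T (a₀, 0) = S (a₀, 0) := h0.self_of_nhds.symm
  have hPS : ∀ᶠ p in 𝓝 (a₀, (0 : B)), (DifferentiableAt ℝ S p ∧
      ∀ b, fderiv ℝ S p (0, b) = ∑ i, c' i p b • X i (S p)) ∧ S p ∈ ⋂ i, s i := by
    filter_upwards [hS, hSc.eventually hs', eventually_all.2 hcc'] with p h1 h2 h3
    exact ⟨⟨h1.1, fun b => by simp only [h3, h1.2]⟩, h2⟩
  have hPT : ∀ᶠ p in 𝓝 (a₀, (0 : C)), (DifferentiableAt ℝ T p ∧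
      ∀ i, fderiv ℝ T p (0, e' i p) = X i (T p)) ∧ T p ∈ ⋂ i, s i := by
    filter_upwards [hT, hTc.eventually (hT0 ▸ hs'), eventually_all.2 hee'] with p h1 h2 h3
    exact ⟨⟨h1.1, fun b => by simp only [h3, h1.2]⟩, h2⟩
  obtain ⟨δ, hδ, hδS⟩ := Metric.eventually_nhds_iff.1 hPS
  obtain ⟨δ', hδ', hδT⟩ := Metric.eventually_nhds_iff.1 hPT
  filter_upwards [hz1, hz2, hz3 δ' hδ', Metric.ball_mem_nhds _ (lt_min hδ hδ'),
    (continuous_fst.tendsto (a₀, (0 : B))).eventually h0] with p hp1 hp2 hp3 hp4 hp5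
  refine ⟨hp1, ?_⟩
  obtain ⟨a, y⟩ := p
  rw [Metric.mem_ball, Prod.dist_eq, max_lt_iff] at hp4
  obtain ⟨hpa, hpy⟩ := hp4
  have hSr : ∀ r ∈ Icc (0 : ℝ) 1, dist (a, r • y) (a₀, (0 : B)) < δ := fun r hr => by
    rw [Prod.dist_eq, max_lt_iff]
    refine ⟨hpa.trans_le (min_le_left _ _), ?_⟩
    rw [dist_zero_right] at hpy ⊢
    rw [norm_smul, Real.norm_of_nonneg hr.1]
    exact (mul_le_of_le_one_left (norm_nonneg _) hr.2).trans_lt (hpy.trans_le (min_le_left _ _))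
  have hTr : ∀ r, dist (a, z (a, y) r) (a₀, (0 : C)) < δ' := fun r => by
    rw [Prod.dist_eq, max_lt_iff, dist_zero_right]
    exact ⟨hpa.trans_le (min_le_right _ _), hp3 r⟩
  obtain ⟨m, hm⟩ : ∃ m : NNReal, ∀ r ∈ Icc (0 : ℝ) 1, ∀ i, ‖c' i (a, r • y) y‖ ≤ m := by
    have h1 : ∀ i, ∃ m : ℝ, ∀ r ∈ Icc (0 : ℝ) 1, ‖c' i (a, r • y) y‖ ≤ m := fun i => by
      refine isCompact_Icc.exists_bound_of_continuousOn (Continuous.continuousOn ?_)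
      have := (hc' i).continuous
      fun_prop
    choose m hm using h1
    refine ⟨∑ i, (m i).toNNReal, fun r hr i => (hm i r hr).trans ?_⟩
    refine (Real.le_coe_toNNReal (m i)).trans ?_
    exact_mod_cast Finset.single_le_sum (f := fun i => (m i).toNNReal)
      (fun i _ => zero_le) (Finset.mem_univ i)
  have hSd : ∀ r ∈ Icc (0 : ℝ) 1, HasDerivAt (fun r : ℝ => S (a, r • y))
      (∑ i, c' i (a, r • y) y • X i (S (a, r • y))) r := fun r hr => by
    obtain ⟨⟨h1, h2⟩, -⟩ := hδS (hSr r hr)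
    rw [← h2]
    refine h1.hasFDerivAt.comp_hasDerivAt r ?_
    refine (hasDerivAt_const r a).prodMk ?_
    simpa using (hasDerivAt_id r).smul_const y
  have hTd : ∀ r ∈ Icc (0 : ℝ) 1, HasDerivWithinAt (fun r : ℝ => T (a, z (a, y) r))
      (∑ i, c' i (a, r • y) y • X i (T (a, z (a, y) r))) (Icc 0 1) r := fun r hr => by
    obtain ⟨⟨h1, h2⟩, -⟩ := hδT (hTr r)
    have h3 := h1.hasFDerivAt.comp_hasDerivWithinAt r
      ((hasDerivWithinAt_const r (Icc 0 1) a).prodMk (hp2.2 r hr))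
    refine h3.congr_deriv ?_
    have h4 : ((0, G (r, (a, y), z (a, y) r)) : E × C) =
        ∑ i, c' i (a, r • y) y • ((0, e' i (a, z (a, y) r)) : E × C) := by
      refine Prod.ext ?_ ?_
      · simp [Prod.fst_sum]
      · simp [Prod.snd_sum, G]
    rw [h4, map_sum]
    exact Finset.sum_congr rfl fun i _ => by rw [map_smul, h2]
  -- Both `T (a, z r)` and `S (a, r y)` are integral curves of `∑ cᵢ(a, r y)(y) Xᵢ`, and they start
  -- at the same point because `S` and `T` agree on `E × {0}`.
  have key := ODE_solution_unique_of_mem_Icc_right (a := 0) (b := 1)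
    (v := fun r x => ∑ i, c' i (a, r • y) y • X i x) (s := fun _ => ⋂ i, s i)
    (K := ∑ i, m * K i) (f := fun r : ℝ => T (a, z (a, y) r)) (g := fun r : ℝ => S (a, r • y))
    (fun r hr => lipschitzOnWith_sum_smul (fun i => (hK i).mono (iInter_subset _ i))
      (hm r (Ico_subset_Icc_self hr)))
    (fun r hr => (hTd r hr).continuousWithinAt)
    (fun r hr => (hTd r (Ico_subset_Icc_self hr)).mono_of_mem_nhdsWithin
      (Icc_mem_nhdsGE_of_mem hr))
    (fun r _ => (hδT (hTr r)).2)
    (fun r hr => (hSd r hr).continuousAt.continuousWithinAt)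
    (fun r hr => (hSd r (Ico_subset_Icc_self hr)).hasDerivWithinAt)
    (fun r hr => (hδS (hSr r (Ico_subset_Icc_self hr))).2)
    (by simp only [hp2.1, zero_smul]; exact hp5.symm)
  simpa using key (right_mem_Icc.2 zero_le_one)

/-! ### Smooth vector fields, test functions and charts -/

section Fields

variable {G : Type} [NormedAddCommGroup G] [NormedSpace ℝ G]
  {X : Type u} [TopologicalSpace X] [ChartedSpace G X] [IsManifold 𝓘(ℝ, G) ∞ X]
  {G' : Type} [NormedAddCommGroup G'] [NormedSpace ℝ G']
  {X' : Type*} [TopologicalSpace X'] [ChartedSpace G' X'] [IsManifold 𝓘(ℝ, G') ∞ X']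

/-- The vector field `Y` is smooth at `x`. -/
abbrev SmoothFieldAt (Y : VField G X) (x : X) : Prop :=
  ContMDiffAt 𝓘(ℝ, G) 𝓘(ℝ, G).tangent ∞ (fun x => (⟨x, Y x⟩ : TangentBundle 𝓘(ℝ, G) X)) x

/-- Meant for charts, which are smooth on an open set only; there the tangent map within the set is
the ordinary one. -/
theorem contMDiffAt_tangentMap_comp {H : Type} [NormedAddCommGroup H] [NormedSpace ℝ H]
    {X : Type*} [TopologicalSpace X] [ChartedSpace G X] [IsManifold 𝓘(ℝ, G) ∞ X]
    {N : Type*} [TopologicalSpace N] [ChartedSpace H N] {f : X → X'} {O : Set X} (hO : IsOpen O)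
    (hf : ContMDiffOn 𝓘(ℝ, G) 𝓘(ℝ, G') ∞ f O) {Y : N → TangentBundle 𝓘(ℝ, G) X} {n : N}
    (hY : ContMDiffAt 𝓘(ℝ, H) 𝓘(ℝ, G).tangent ∞ Y n) (hn : (Y n).1 ∈ O) :
    ContMDiffAt 𝓘(ℝ, H) 𝓘(ℝ, G').tangent ∞
      (fun n => tangentMap 𝓘(ℝ, G) 𝓘(ℝ, G') f (Y n)) n := by
  have h1 := hf.contMDiffOn_tangentMapWithin (m := ∞) (by simp) hO.uniqueMDiffOn
  have hO' : IsOpen (Bundle.TotalSpace.proj ⁻¹' O : Set (TangentBundle 𝓘(ℝ, G) X)) :=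
    hO.preimage (FiberBundle.continuous_proj G (TangentSpace 𝓘(ℝ, G)))
  have h2 := (h1.contMDiffAt (hO'.mem_nhds hn)).comp n hY
  refine h2.congr_of_eventuallyEq ?_
  filter_upwards [hY.continuousAt.eventually (hO'.mem_nhds hn)] with m hm
  exact (tangentMapWithin_eq_tangentMap (hO.uniqueMDiffOn _ hm)
    ((hf.contMDiffAt (hO.mem_nhds hm)).mdifferentiableAt (by simp))).symm

theorem SmoothFieldAt.mfderiv_apply {Y : VField G X} {x : X} (hY : SmoothFieldAt Y x) {O : Set X}
    (hO : IsOpen O) (hx : x ∈ O) {F : X → G'} (hF : ContMDiffOn 𝓘(ℝ, G) 𝓘(ℝ, G') ∞ F O) :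
    ContMDiffAt 𝓘(ℝ, G) 𝓘(ℝ, G') ∞
      (fun x => (mfderiv 𝓘(ℝ, G) 𝓘(ℝ, G') F x (Y x) : G')) x := by
  have h1 := contMDiffAt_tangentMap_comp hO hF hY hx
  exact (contMDiff_snd_tangentBundle_modelSpace G' 𝓘(ℝ, G')).contMDiffAt.comp x h1

theorem smoothFieldAt_symm {φ : OpenPartialHomeomorph X G}
    (hφ : φ ∈ IsManifold.maximalAtlas 𝓘(ℝ, G) ∞ X) {x : X} (hx : x ∈ φ.source) {h : X → G}
    (hh : ContMDiffAt 𝓘(ℝ, G) 𝓘(ℝ, G) ∞ h x) :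
    SmoothFieldAt (fun x => (mfderiv 𝓘(ℝ, G) 𝓘(ℝ, G) φ.symm (φ x) (h x) : G)) x := by
  have h0 : ContMDiffAt 𝓘(ℝ, G) 𝓘(ℝ, G).tangent ∞
      (fun x => (⟨φ x, h x⟩ : TangentBundle 𝓘(ℝ, G) G)) x := by
    refine Bundle.contMDiffAt_totalSpace.2 ⟨contMDiffAt_of_mem_maximalAtlas hφ hx, ?_⟩
    simpa using hh
  have h1 := contMDiffAt_tangentMap_comp φ.open_target
    (contMDiffOn_symm_of_mem_maximalAtlas hφ) h0 (φ.map_source hx)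
  refine h1.congr_of_eventuallyEq ?_
  filter_upwards [φ.open_source.mem_nhds hx] with y hy
  simp only [tangentMap]
  -- The base points `φ.symm (φ y)` and `y` are equal but not definitionally so; as all tangent
  -- spaces are the model `G`, the vector itself is not changed.
  have key : ∀ (y' : X) (_ : y' = y) (w : G),
      (⟨y, w⟩ : TangentBundle 𝓘(ℝ, G) X) = ⟨y', w⟩ := by rintro _ rfl w; rfl
  exact key _ (φ.left_inv hy) _

theorem mfderiv_symm_mfderiv {φ : OpenPartialHomeomorph X G}
    (hφ : φ ∈ IsManifold.maximalAtlas 𝓘(ℝ, G) ∞ X) {x : X} (hx : x ∈ φ.source) (ξ : G) :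
    (mfderiv 𝓘(ℝ, G) 𝓘(ℝ, G) φ.symm (φ x) (mfderiv 𝓘(ℝ, G) 𝓘(ℝ, G) φ x ξ) : G) = ξ := by
  have h1 := (contMDiffAt_symm_of_mem_maximalAtlas hφ
    (φ.map_source hx)).mdifferentiableAt (by simp) |>.hasMFDerivAt
  have h2 := (contMDiffAt_of_mem_maximalAtlas hφ hx).mdifferentiableAt (by simp) |>.hasMFDerivAt
  have h3 := h1.comp x h2
  have h4 : φ.symm ∘ φ =ᶠ[𝓝 x] id := by
    filter_upwards [φ.open_source.mem_nhds hx] with y hy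
    exact φ.left_inv hy
  have h5 := h3.congr_of_eventuallyEq h4.symm
  have h6 := hasMFDerivAt_unique h5 (hasMFDerivAt_id x)
  exact congrArg (fun L : G →L[ℝ] G => L ξ) h6

theorem mfderiv_chart_symm {φ : OpenPartialHomeomorph X G}
    (hφ : φ ∈ IsManifold.maximalAtlas 𝓘(ℝ, G) ∞ X) {p : G} (hp : p ∈ φ.target) {x : X}
    (hx : φ.symm p = x) (ξ : G) :
    (mfderiv 𝓘(ℝ, G) 𝓘(ℝ, G) φ x (mfderiv 𝓘(ℝ, G) 𝓘(ℝ, G) φ.symm p ξ : G) : G) = ξ := by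
  subst hx
  have h1 := (contMDiffAt_symm_of_mem_maximalAtlas hφ hp).mdifferentiableAt
    (by simp) |>.hasMFDerivAt
  have h2 := (contMDiffAt_of_mem_maximalAtlas hφ (φ.map_target hp)).mdifferentiableAt
    (by simp) |>.hasMFDerivAt
  have h3 := h2.comp p h1
  have h4 : φ ∘ φ.symm =ᶠ[𝓝 p] id := by
    filter_upwards [φ.open_target.mem_nhds hp] with y hy
    exact φ.right_inv hy
  have h5 := h3.congr_of_eventuallyEq h4.symm
  have h6 := hasMFDerivAt_unique h5 (hasMFDerivAt_id p)
  exact congrArg (fun L : G →L[ℝ] G => L ξ) h6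

/-- The differential of a map in terms of a chart of the source. -/
theorem mfderiv_eq_mfderiv_comp_symm {φ : OpenPartialHomeomorph X G}
    (hφ : φ ∈ IsManifold.maximalAtlas 𝓘(ℝ, G) ∞ X) {x : X} (hx : x ∈ φ.source) {f : X → X'}
    (hf : MDifferentiableAt 𝓘(ℝ, G) 𝓘(ℝ, G') f x) (ξ : G) :
    (mfderiv 𝓘(ℝ, G) 𝓘(ℝ, G') f x ξ : G') =
      mfderiv 𝓘(ℝ, G) 𝓘(ℝ, G') (f ∘ φ.symm) (φ x) (mfderiv 𝓘(ℝ, G) 𝓘(ℝ, G) φ x ξ) := by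
  have h1 : MDifferentiableAt 𝓘(ℝ, G) 𝓘(ℝ, G) φ.symm (φ x) :=
    (contMDiffAt_symm_of_mem_maximalAtlas hφ (φ.map_source hx)).mdifferentiableAt (by simp)
  have h3 := mfderiv_comp_apply_of_eq (g := f) (f := φ.symm) (x := φ x) (y := x) hf h1
    (φ.left_inv hx) (mfderiv 𝓘(ℝ, G) 𝓘(ℝ, G) φ x ξ : G)
  refine Eq.trans ?_ h3.symm
  exact congrArg (fun v : G => (mfderiv 𝓘(ℝ, G) 𝓘(ℝ, G') f x v : G'))
    (mfderiv_symm_mfderiv hφ hx ξ).symm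

theorem mfderiv_comp_symm_apply {φ : OpenPartialHomeomorph X G}
    (hφ : φ ∈ IsManifold.maximalAtlas 𝓘(ℝ, G) ∞ X) {p : G} (hp : p ∈ φ.target) {x : X}
    (hx : φ.symm p = x) {f : X → X'}
    (hf : MDifferentiableAt 𝓘(ℝ, G) 𝓘(ℝ, G') f x) (ξ : G) :
    (mfderiv 𝓘(ℝ, G) 𝓘(ℝ, G') (f ∘ φ.symm) p ξ : G') =
      mfderiv 𝓘(ℝ, G) 𝓘(ℝ, G') f x (mfderiv 𝓘(ℝ, G) 𝓘(ℝ, G) φ.symm p ξ : G) := by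
  have h1 : MDifferentiableAt 𝓘(ℝ, G) 𝓘(ℝ, G) φ.symm p :=
    (contMDiffAt_symm_of_mem_maximalAtlas hφ hp).mdifferentiableAt (by simp)
  exact mfderiv_comp_apply_of_eq (g := f) (f := φ.symm) (x := p) (y := x) hf h1 hx ξ

/-- The expression of the vector field `Z` in the chart `χ`. -/
def chartField (χ : OpenPartialHomeomorph X G) (Z : VField G X) : G → G := fun p =>
  mfderiv 𝓘(ℝ, G) 𝓘(ℝ, G) χ (χ.symm p) (Z (χ.symm p))

theorem contDiffOn_chartField {χ : OpenPartialHomeomorph X G}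
    (hχ : χ ∈ IsManifold.maximalAtlas 𝓘(ℝ, G) ∞ X) {Z : VField G X} (hZ : IsSmoothCompact Z) :
    ContDiffOn ℝ ∞ (chartField χ Z) χ.target := by
  intro p hp
  refine ContDiffAt.contDiffWithinAt ?_
  rw [← contMDiffAt_iff_contDiffAt]
  have h1 := SmoothFieldAt.mfderiv_apply (hZ.1 (χ.symm p)) χ.open_source (χ.map_target hp)
    (contMDiffOn_of_mem_maximalAtlas hχ)
  exact h1.comp p (contMDiffAt_symm_of_mem_maximalAtlas hχ hp)

theorem SmoothFieldAt.add {Y Z : VField G X} {x : X} (hY : SmoothFieldAt Y x)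
    (hZ : SmoothFieldAt Z x) : SmoothFieldAt (fun x => Y x + Z x) x :=
  ContMDiffAt.add_section hY hZ

theorem SmoothFieldAt.sub {Y Z : VField G X} {x : X} (hY : SmoothFieldAt Y x)
    (hZ : SmoothFieldAt Z x) : SmoothFieldAt (fun x => Y x - Z x) x :=
  ContMDiffAt.sub_section hY hZ

theorem SmoothFieldAt.smul {f : X → ℝ} {Y : VField G X} {x : X}
    (hf : ContMDiffAt 𝓘(ℝ, G) 𝓘(ℝ, ℝ) ∞ f x) (hY : SmoothFieldAt Y x) :
    SmoothFieldAt (fun x => f x • Y x) x :=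
  ContMDiffAt.smul_section hf hY

theorem smoothFieldAt_zero (x : X) : SmoothFieldAt (fun x => (0 : TangentSpace 𝓘(ℝ, G) x)) x :=
  Bundle.contMDiff_zeroSection ℝ (TangentSpace 𝓘(ℝ, G) (M := X)) x

theorem SmoothFieldAt.congr {Y Z : VField G X} {x : X} (hY : SmoothFieldAt Y x)
    (h : ∀ᶠ y in 𝓝 x, Z y = Y y) : SmoothFieldAt Z x :=
  ContMDiffAt.congr_of_eventuallyEq hY (h.mono fun y hy => by simp only [hy])

variable [T2Space X]

theorem isSmoothCompact_of_subset {Y : VField G X} (hY : ∀ x, SmoothFieldAt Y x) {K : Set X}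
    (hK : IsCompact K) (h : ∀ x, x ∉ K → Y x = 0) : IsSmoothCompact Y :=
  ⟨hY, hK.closure_of_subset fun x hx => by_contra fun h' => hx (h x h')⟩

theorem IsSmoothCompact.add {Y Z : VField G X} (hY : IsSmoothCompact Y) (hZ : IsSmoothCompact Z) :
    IsSmoothCompact (fun x => Y x + Z x) := by
  refine isSmoothCompact_of_subset (fun x => SmoothFieldAt.add (hY.1 x) (hZ.1 x)) (hY.2.union hZ.2) fun x hx => ?_
  rw [mem_union, not_or] at hx
  have h1 : Y x = 0 := by_contra fun h => hx.1 (subset_closure h)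
  have h2 : Z x = 0 := by_contra fun h => hx.2 (subset_closure h)
  rw [h1, h2, add_zero]

theorem IsSmoothCompact.sub {Y Z : VField G X} (hY : IsSmoothCompact Y) (hZ : IsSmoothCompact Z) :
    IsSmoothCompact (fun x => Y x - Z x) := by
  refine isSmoothCompact_of_subset (fun x => SmoothFieldAt.sub (hY.1 x) (hZ.1 x)) (hY.2.union hZ.2) fun x hx => ?_
  rw [mem_union, not_or] at hx
  have h1 : Y x = 0 := by_contra fun h => hx.1 (subset_closure h)
  have h2 : Z x = 0 := by_contra fun h => hx.2 (subset_closure h)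
  rw [h1, h2, sub_zero]

/-- Cutting off a locally defined field. -/
theorem isSmoothCompact_smul {ρ : X → ℝ} (hρ : IsTestFunction (G := G) ρ) {Y : VField G X}
    (hY : ∀ x ∈ tsupport ρ, SmoothFieldAt Y x) : IsSmoothCompact (fun x => ρ x • Y x) := by
  refine isSmoothCompact_of_subset (fun x => ?_) hρ.2 fun x hx => ?_
  · by_cases hx : x ∈ tsupport ρ
    · exact SmoothFieldAt.smul (hρ.1 x) (hY x hx)
    · refine SmoothFieldAt.congr (smoothFieldAt_zero x) ?_
      filter_upwards [notMem_tsupport_iff_eventuallyEq.mp hx] with y hy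
      rw [hy, Pi.zero_apply, zero_smul]
  · rw [image_eq_zero_of_notMem_tsupport hx, zero_smul]

theorem isSmoothCompact_zero : IsSmoothCompact (fun x : X => (0 : TangentSpace 𝓘(ℝ, G) x)) :=
  isSmoothCompact_of_subset smoothFieldAt_zero isCompact_empty fun _ _ => rfl

theorem IsSmoothCompact.sum {ι : Type*} (s : Finset ι) {Y : ι → VField G X}
    (hY : ∀ i ∈ s, IsSmoothCompact (Y i)) : IsSmoothCompact (fun x => ∑ i ∈ s, Y i x) := by
  classical
  induction s using Finset.induction_on with
  | empty => simpa using isSmoothCompact_zero (G := G) (X := X)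
  | insert i s hi ih =>
    simp only [Finset.sum_insert hi]
    exact (hY i (Finset.mem_insert_self i s)).add
      (ih fun j hj => hY j (Finset.mem_insert_of_mem hj))

theorem exists_isTestFunction_nhds [FiniteDimensional ℝ G] {x : X} {O : Set X} (hO : O ∈ 𝓝 x) :
    ∃ ρ : X → ℝ, IsTestFunction (G := G) ρ ∧ tsupport ρ ⊆ O ∧ ρ =ᶠ[𝓝 x] 1 := by
  obtain ⟨f, -, hf⟩ := (SmoothBumpFunction.nhds_basis_tsupport (I := 𝓘(ℝ, G)) x).mem_iff.1 hO
  exact ⟨f, ⟨f.contMDiff, f.hasCompactSupport⟩, hf, f.eventuallyEq_one⟩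

theorem exists_isTestFunction_compact [FiniteDimensional ℝ G] [SecondCountableTopology X]
    {K O : Set X} (hK : IsCompact K) (hO : IsOpen O) (hKO : K ⊆ O) :
    ∃ ρ : X → ℝ, IsTestFunction (G := G) ρ ∧ tsupport ρ ⊆ O ∧ ∀ᶠ x in 𝓝ˢ K, ρ x = 1 := by
  have : LocallyCompactSpace X := ChartedSpace.locallyCompactSpace G X
  obtain ⟨L, hL, hKL, hLO⟩ := exists_compact_between hK hO hKO
  obtain ⟨f, hf1, hf0, -⟩ := exists_contMDiffMap_one_nhds_of_subset_interior (n := (⊤ : ℕ∞))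
    𝓘(ℝ, G) hK.isClosed hKL
  have hs : tsupport f ⊆ L := closure_minimal (fun x hx => by_contra fun h => hx (hf0 x h))
    hL.isClosed
  exact ⟨f, ⟨f.contMDiff, hL.of_isClosed_subset (isClosed_tsupport _) hs⟩, hs.trans hLO, hf1⟩

/-- The product of a test function with a function that is smooth near its support. -/
theorem isTestFunction_mul {ρ : X → ℝ} (hρ : IsTestFunction (G := G) ρ) {f : X → ℝ}
    (hf : ∀ x ∈ tsupport ρ, ContMDiffAt 𝓘(ℝ, G) 𝓘(ℝ, ℝ) ∞ f x) :
    IsTestFunction (G := G) (fun x => ρ x * f x) := by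
  refine ⟨fun x => ?_, hρ.2.mul_right⟩
  by_cases hx : x ∈ tsupport ρ
  · exact (hρ.1 x).mul (hf x hx)
  · refine (contMDiffAt_const (c := (0 : ℝ))).congr_of_eventuallyEq ?_
    filter_upwards [notMem_tsupport_iff_eventuallyEq.mp hx] with y hy
    simp [hy]

end Fields

/-! ### The product with the real line, and Lie brackets in charts -/

/-- The model space as a manifold; it takes precedence over `prodRealChartedSpace`. -/
instance modelProdRealChartedSpace {H : Type} [NormedAddCommGroup H] [NormedSpace ℝ H] :
    ChartedSpace (H × ℝ) (H × ℝ) := chartedSpaceSelf (H × ℝ)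

theorem two_le_infty : (2 : WithTop ℕ∞) ≤ ∞ := by
  have : ((2 : ℕ∞) : WithTop ℕ∞) ≤ ((⊤ : ℕ∞) : WithTop ℕ∞) := WithTop.coe_le_coe.2 le_top
  exact this

theorem mlieBracket_vectorSpace {H : Type} [NormedAddCommGroup H] [NormedSpace ℝ H]
    (V W : H → H) (p : H) :
    VectorField.mlieBracket 𝓘(ℝ, H) (M := H) V W p = VectorField.lieBracket ℝ V W p := by
  have h := congrFun (VectorField.mlieBracketWithin_eq_lieBracketWithin (𝕜 := ℝ) (V := V) (W := W)
    (s := univ)) p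
  rw [VectorField.lieBracketWithin_univ] at h
  exact (congrFun VectorField.mlieBracketWithin_univ p).symm.trans h

section ProductWithReal

variable {E : Type} [NormedAddCommGroup E] [NormedSpace ℝ E]
  {M : Type u} [TopologicalSpace M] [ChartedSpace E M]
  {H : Type} [NormedAddCommGroup H] [NormedSpace ℝ H]
  {N : Type*} [TopologicalSpace N] [ChartedSpace H N]

theorem contMDiff_fst_real : ContMDiff 𝓘(ℝ, E × ℝ) 𝓘(ℝ, E) ∞ (Prod.fst : M × ℝ → M) := by
  rw [modelWithCornersSelf_prod]
  exact contMDiff_fst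

theorem contMDiff_snd_real : ContMDiff 𝓘(ℝ, E × ℝ) 𝓘(ℝ, ℝ) ∞ (Prod.snd : M × ℝ → ℝ) := by
  rw [modelWithCornersSelf_prod]
  exact contMDiff_snd

theorem hasMFDerivAt_fst_real (p : M × ℝ) : HasMFDerivAt 𝓘(ℝ, E × ℝ) 𝓘(ℝ, E)
    (Prod.fst : M × ℝ → M) p (ContinuousLinearMap.fst ℝ E ℝ) := by
  rw [modelWithCornersSelf_prod]
  exact hasMFDerivAt_fst p

theorem hasMFDerivAt_snd_real (p : M × ℝ) : HasMFDerivAt 𝓘(ℝ, E × ℝ) 𝓘(ℝ, ℝ)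
    (Prod.snd : M × ℝ → ℝ) p (ContinuousLinearMap.snd ℝ E ℝ) := by
  rw [modelWithCornersSelf_prod]
  exact hasMFDerivAt_snd p

theorem contMDiffAt_prodMk_real {f : N → M} {g : N → ℝ} {x : N}
    (hf : ContMDiffAt 𝓘(ℝ, H) 𝓘(ℝ, E) ∞ f x) (hg : ContMDiffAt 𝓘(ℝ, H) 𝓘(ℝ, ℝ) ∞ g x) :
    ContMDiffAt 𝓘(ℝ, H) 𝓘(ℝ, E × ℝ) ∞ (fun x => (f x, g x)) x := by
  rw [modelWithCornersSelf_prod]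
  exact hf.prodMk hg

theorem contMDiffAt_prodMk_space {B : Type} [NormedAddCommGroup B] [NormedSpace ℝ B] {f : N → E}
    {g : N → B} {x : N} (hf : ContMDiffAt 𝓘(ℝ, H) 𝓘(ℝ, E) ∞ f x)
    (hg : ContMDiffAt 𝓘(ℝ, H) 𝓘(ℝ, B) ∞ g x) :
    ContMDiffAt 𝓘(ℝ, H) 𝓘(ℝ, E × B) ∞ (fun x => (f x, g x)) x :=
  hf.prodMk_space hg

theorem hasMFDerivAt_prodMk_space {B : Type} [NormedAddCommGroup B] [NormedSpace ℝ B] {f : N → E}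
    {g : N → B} {x : N} {f' : H →L[ℝ] E} {g' : H →L[ℝ] B} (hf : HasMFDerivAt 𝓘(ℝ, H) 𝓘(ℝ, E) f x f')
    (hg : HasMFDerivAt 𝓘(ℝ, H) 𝓘(ℝ, B) g x g') :
    HasMFDerivAt 𝓘(ℝ, H) 𝓘(ℝ, E × B) (fun x => (f x, g x)) x (f'.prod g') := by
  rw [modelWithCornersSelf_prod, ← chartedSpaceSelf_prod]
  exact hf.prodMk hg

theorem hasMFDerivAt_prodMk_real {f : N → M} {g : N → ℝ} {x : N} {f' : H →L[ℝ] E}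
    {g' : H →L[ℝ] ℝ} (hf : HasMFDerivAt 𝓘(ℝ, H) 𝓘(ℝ, E) f x f')
    (hg : HasMFDerivAt 𝓘(ℝ, H) 𝓘(ℝ, ℝ) g x g') :
    HasMFDerivAt 𝓘(ℝ, H) 𝓘(ℝ, E × ℝ) (fun x => (f x, g x)) x (f'.prod g') := by
  rw [modelWithCornersSelf_prod]
  exact hf.prodMk hg

variable [IsManifold 𝓘(ℝ, E) ∞ M]

theorem prod_refl_mem_maximalAtlas {χ : OpenPartialHomeomorph M E}
    (hχ : χ ∈ IsManifold.maximalAtlas 𝓘(ℝ, E) ∞ M) :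
    (χ.prod (OpenPartialHomeomorph.refl ℝ) : OpenPartialHomeomorph (M × ℝ) (E × ℝ)) ∈
      IsManifold.maximalAtlas 𝓘(ℝ, E × ℝ) ∞ (M × ℝ) := by
  refine OpenPartialHomeomorph.mem_maximalAtlas_of_contMDiffOn _ (fun p hp => ?_) (fun p hp => ?_)
  · refine ContMDiffAt.contMDiffWithinAt ?_
    have h1 : ContMDiffAt 𝓘(ℝ, E × ℝ) 𝓘(ℝ, E) ∞ (fun p : M × ℝ => χ p.1) p :=
      ContMDiffAt.comp p (contMDiffAt_of_mem_maximalAtlas hχ hp.1) contMDiff_fst_real.contMDiffAt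
    have h2 : ContMDiffAt 𝓘(ℝ, E × ℝ) 𝓘(ℝ, ℝ) ∞ (fun p : M × ℝ => p.2) p :=
      contMDiff_snd_real.contMDiffAt
    exact contMDiffAt_prodMk_space h1 h2
  · refine ContMDiffAt.contMDiffWithinAt ?_
    exact contMDiffAt_prodMk_real (ContMDiffAt.comp (g := χ.symm) (f := fun p : E × ℝ => p.1) p
      (contMDiffAt_symm_of_mem_maximalAtlas hχ hp.1)
      contDiff_fst.contMDiff.contMDiffAt) contDiff_snd.contMDiff.contMDiffAt

theorem chartField_prod {χ : OpenPartialHomeomorph M E}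
    (hχ : χ ∈ IsManifold.maximalAtlas 𝓘(ℝ, E) ∞ M) (Z : VField E M) {p : E × ℝ}
    (hp : p.1 ∈ χ.target) :
    chartField (G := E × ℝ) (χ.prod (OpenPartialHomeomorph.refl ℝ)) (tensorOne Z) p =
      (chartField χ Z p.1, 0) := by
  have h1 := ((contMDiffAt_of_mem_maximalAtlas hχ (χ.map_target hp)).mdifferentiableAt
    (by simp)).hasMFDerivAt
  have h2 := hasMFDerivAt_prodMk_space
    (HasMFDerivAt.comp (x := ((χ.symm p.1, p.2) : M × ℝ)) (g := χ)
      (f := (Prod.fst : M × ℝ → M)) h1 (hasMFDerivAt_fst_real (χ.symm p.1, p.2)))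
    (hasMFDerivAt_snd_real (E := E) (χ.symm p.1, p.2))
  have h3 : mfderiv 𝓘(ℝ, E × ℝ) 𝓘(ℝ, E × ℝ) (χ.prod (OpenPartialHomeomorph.refl ℝ))
      ((χ.symm p.1, p.2) : M × ℝ) = _ := h2.mfderiv
  simp only [chartField]
  change (mfderiv 𝓘(ℝ, E × ℝ) 𝓘(ℝ, E × ℝ) (χ.prod (OpenPartialHomeomorph.refl ℝ))
      ((χ.symm p.1, p.2) : M × ℝ) ((Z (χ.symm p.1), 0) : E × ℝ) : E × ℝ) = _
  rw [h3]
  rfl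

theorem eq_of_chartField_eq {X : Type u} [TopologicalSpace X] [ChartedSpace H X]
    [IsManifold 𝓘(ℝ, H) ∞ X] {χ : OpenPartialHomeomorph X H}
    (hχ : χ ∈ IsManifold.maximalAtlas 𝓘(ℝ, H) ∞ X) {x : X} (hx : x ∈ χ.source)
    {Y Z : VField H X} (h : chartField χ Y (χ x) = chartField χ Z (χ x)) : Y x = Z x := by
  have key : ∀ W : VField H X, W x =
      (mfderiv 𝓘(ℝ, H) 𝓘(ℝ, H) χ.symm (χ x) (chartField χ W (χ x) : H) : H) := fun W => by
    have h1 := mfderiv_symm_mfderiv hχ hx (W x)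
    have h2 : chartField χ W (χ x) = (mfderiv 𝓘(ℝ, H) 𝓘(ℝ, H) χ x (W x) : H) := by
      simp only [chartField]
      rw [χ.left_inv hx]
    rw [h2]
    exact h1.symm
  rw [key Y, key Z, h]

theorem smoothFieldAt_of_chartField {X : Type u} [TopologicalSpace X] [ChartedSpace H X]
    [IsManifold 𝓘(ℝ, H) ∞ X] {χ : OpenPartialHomeomorph X H}
    (hχ : χ ∈ IsManifold.maximalAtlas 𝓘(ℝ, H) ∞ X) {x : X} (hx : x ∈ χ.source)
    {Y : VField H X} (h : ContDiffOn ℝ ∞ (chartField χ Y) χ.target) : SmoothFieldAt Y x := by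
  have h1 : ContMDiffAt 𝓘(ℝ, H) 𝓘(ℝ, H) ∞ (fun y => chartField χ Y (χ y)) x :=
    ((h.contDiffAt (χ.open_target.mem_nhds (χ.map_source hx))).contMDiffAt).comp x
      (contMDiffAt_of_mem_maximalAtlas hχ hx)
  refine SmoothFieldAt.congr (smoothFieldAt_symm hχ hx h1) ?_
  filter_upwards [χ.open_source.mem_nhds hx] with y hy
  have h2 : chartField χ Y (χ y) = mfderiv 𝓘(ℝ, H) 𝓘(ℝ, H) χ y (Y y) := by
    simp only [chartField]
    rw [χ.left_inv hy]
  rw [h2]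
  exact (mfderiv_symm_mfderiv hχ hy (Y y)).symm

theorem smoothFieldAt_tensorOne {Z : VField E M} (hZ : IsSmoothCompact Z) (p : M × ℝ) :
    SmoothFieldAt (tensorOne Z) p := by
  have hχ := IsManifold.chart_mem_maximalAtlas (I := 𝓘(ℝ, E)) (n := ∞) p.1
  refine smoothFieldAt_of_chartField (prod_refl_mem_maximalAtlas hχ) (x := p)
    ⟨mem_chart_source E p.1, mem_univ _⟩ ?_
  have h1 : ContDiffOn ℝ ∞ (fun q : E × ℝ => ((chartField (chartAt E p.1) Z q.1, 0) : E × ℝ))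
      (chartAt E p.1 |>.prod (OpenPartialHomeomorph.refl ℝ)).target :=
    ((contDiffOn_chartField hχ hZ).comp contDiff_fst.contDiffOn (fun q hq => hq.1)).prodMk
      contDiffOn_const
  exact h1.congr fun q hq => chartField_prod hχ Z hq.1

/-- Lie brackets are natural under pull-back, and `chartField χ` is locally the pull-back along
`χ.symm`. -/
theorem chartField_mlieBracket [CompleteSpace H] {X : Type u} [TopologicalSpace X]
    [ChartedSpace H X] [IsManifold 𝓘(ℝ, H) ∞ X] {χ : OpenPartialHomeomorph X H}
    (hχ : χ ∈ IsManifold.maximalAtlas 𝓘(ℝ, H) ∞ X) {p : H} (hp : p ∈ χ.target) {V W : VField H X}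
    (hV : SmoothFieldAt V (χ.symm p)) (hW : SmoothFieldAt W (χ.symm p)) :
    chartField χ (VectorField.mlieBracket 𝓘(ℝ, H) V W) p =
      VectorField.lieBracket ℝ (chartField χ V) (chartField χ W) p := by
  -- The pull-back is defined through the inverse of the differential of `χ.symm`, which is the
  -- differential of `χ`.
  have h2 : ∀ q ∈ χ.target, ∀ v : H,
      (mfderiv 𝓘(ℝ, H) 𝓘(ℝ, H) χ.symm q).inverse v =
        mfderiv 𝓘(ℝ, H) 𝓘(ℝ, H) χ (χ.symm q) v := fun q hq v => by
    let e : H ≃L[ℝ] H := ContinuousLinearEquiv.equivOfInverse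
      (mfderiv 𝓘(ℝ, H) 𝓘(ℝ, H) χ.symm q : H →L[ℝ] H)
      (mfderiv 𝓘(ℝ, H) 𝓘(ℝ, H) χ (χ.symm q) : H →L[ℝ] H)
      (fun ξ => mfderiv_chart_symm hχ hq rfl ξ) (fun ξ => by
        have := mfderiv_symm_mfderiv hχ (χ.map_target hq) ξ
        rw [χ.right_inv hq] at this
        exact this)
    exact congrArg (fun L : H →L[ℝ] H => L v) (ContinuousLinearMap.inverse_equiv e)
  have h3 : ∀ V : VField H X, VectorField.mpullback 𝓘(ℝ, H) 𝓘(ℝ, H) χ.symm V =ᶠ[𝓝 p]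
      chartField χ V := fun V => by
    filter_upwards [χ.open_target.mem_nhds hp] with q hq
    exact h2 q hq _
  have : IsManifold 𝓘(ℝ, H) (minSmoothness ℝ 2) X :=
    IsManifold.of_le (n := ∞) (by simp only [minSmoothness_of_isRCLikeNormedField]; exact two_le_infty)
  have h1 := VectorField.mpullback_mlieBracket (I := 𝓘(ℝ, H)) (I' := 𝓘(ℝ, H)) (x₀ := p)
    (n := ∞) (f := χ.symm) (V := V) (W := W) (hV.mdifferentiableAt (by simp))
    (hW.mdifferentiableAt (by simp)) (contMDiffAt_symm_of_mem_maximalAtlas hχ hp)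
    (by simp only [minSmoothness_of_isRCLikeNormedField]; exact two_le_infty)
  rw [(h3 V).mlieBracket_vectorField_eq (h3 W)] at h1
  refine ((h2 p hp _).symm.trans h1).trans ?_
  exact mlieBracket_vectorSpace _ _ _

/-- In a product chart both fields have zero `ℝ`-component and do not depend on the `ℝ`-coordinate,
so their bracket is computed in `E`. -/
theorem mlieBracket_tensorOne [CompleteSpace E] {Y Z : VField E M} (hY : IsSmoothCompact Y)
    (hZ : IsSmoothCompact Z) :
    VectorField.mlieBracket 𝓘(ℝ, E × ℝ) (tensorOne Y) (tensorOne Z) =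
      tensorOne (VectorField.mlieBracket 𝓘(ℝ, E) Y Z) := by
  funext p
  have hχ := IsManifold.chart_mem_maximalAtlas (I := 𝓘(ℝ, E)) (n := ∞) p.1
  set χ := chartAt E p.1
  have hp : p.1 ∈ χ.source := mem_chart_source E p.1
  have hχp := χ.map_source hp
  refine eq_of_chartField_eq (prod_refl_mem_maximalAtlas hχ) (x := p) ⟨hp, mem_univ _⟩ ?_
  have e1 : (χ.prod (OpenPartialHomeomorph.refl ℝ)) p = (χ p.1, p.2) := rfl
  rw [e1, chartField_prod hχ _ (by exact hχp), chartField_mlieBracket hχ hχp (hY.1 _) (hZ.1 _),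
    chartField_mlieBracket (prod_refl_mem_maximalAtlas hχ) ⟨hχp, mem_univ _⟩
      (smoothFieldAt_tensorOne hY _) (smoothFieldAt_tensorOne hZ _)]
  have h3 : ∀ Z : VField E M, chartField (G := E × ℝ) (χ.prod (OpenPartialHomeomorph.refl ℝ))
      (tensorOne Z) =ᶠ[𝓝 (χ p.1, p.2)] fun q : E × ℝ => (chartField χ Z q.1, 0) := fun Z => by
    filter_upwards [(continuous_fst.continuousAt (x := (χ p.1, p.2))).eventually
      (χ.open_target.mem_nhds hχp)] with q hq
    exact chartField_prod hχ Z hq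
  rw [(h3 Y).lieBracket_vectorField_eq (h3 Z)]
  have h4 : ∀ {Z : VField E M}, IsSmoothCompact Z → HasFDerivAt
      (fun q : E × ℝ => ((chartField χ Z q.1, 0) : E × ℝ))
      (((fderiv ℝ (chartField χ Z) (χ p.1)).comp (ContinuousLinearMap.fst ℝ E ℝ)).prod 0)
      (χ p.1, p.2) := fun {Z} hZ => by
    have h5 := ((contDiffOn_chartField hχ hZ).contDiffAt
      (χ.open_target.mem_nhds hχp)).differentiableAt (by simp) |>.hasFDerivAt
    have h6 : HasFDerivAt (fun q : E × ℝ => q.1) (ContinuousLinearMap.fst ℝ E ℝ) (χ p.1, p.2) :=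
      hasFDerivAt_fst
    exact (HasFDerivAt.comp (g := chartField χ Z) ((χ p.1, p.2) : E × ℝ) h5 h6).prodMk
      (hasFDerivAt_const (0 : ℝ) ((χ p.1, p.2) : E × ℝ))
  simp only [VectorField.lieBracket, (h4 hY).fderiv, (h4 hZ).fderiv]
  refine Prod.ext ?_ ?_ <;> simp

end ProductWithReal

/-! ### The adiabatic foliation is a foliation -/

section Adiabatic

variable {E : Type} [NormedAddCommGroup E] [NormedSpace ℝ E]
  {M : Type u} [TopologicalSpace M] [ChartedSpace E M] {F : Set (VField E M)}

/-- Arbitrary finite index types spare the reindexing of disjoint unions. -/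
theorem adiabatic_of_fintype {κ : Type*} [Fintype κ] {g : κ → M × ℝ → ℝ} {Z : κ → VField E M}
    (h : ∀ i, IsTestFunction (G := E × ℝ) (g i) ∧ Z i ∈ F) :
    (fun p => ∑ i, (p.2 * g i p) • tensorOne (Z i) p : VField (E × ℝ) (M × ℝ)) ∈ adiabatic F := by
  refine ⟨Fintype.card κ, fun i => g ((Fintype.equivFin κ).symm i),
    fun i => Z ((Fintype.equivFin κ).symm i), fun i => h _, fun p => ?_⟩
  exact (Equiv.sum_comp (Fintype.equivFin κ).symm
    (fun i => (p.2 * g i p) • tensorOne (Z i) p)).symm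

theorem adiabatic_single {g : M × ℝ → ℝ} {Z : VField E M}
    (hg : IsTestFunction (G := E × ℝ) g) (hZ : Z ∈ F) :
    (fun p => (p.2 * g p) • tensorOne Z p : VField (E × ℝ) (M × ℝ)) ∈ adiabatic F := by
  have := adiabatic_of_fintype (κ := Unit) (F := F) (g := fun _ => g) (Z := fun _ => Z)
    fun _ => ⟨hg, hZ⟩
  simpa using this

theorem adiabatic_zero : (fun _ => 0 : VField (E × ℝ) (M × ℝ)) ∈ adiabatic F :=
  ⟨0, Fin.elim0, Fin.elim0, fun i => i.elim0, fun p => by simp⟩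

theorem adiabatic_add {Y Z : VField (E × ℝ) (M × ℝ)} (hY : Y ∈ adiabatic F)
    (hZ : Z ∈ adiabatic F) : (fun p => Y p + Z p) ∈ adiabatic F := by
  obtain ⟨m, g, A, h, hY⟩ := hY
  obtain ⟨n, g', A', h', hZ⟩ := hZ
  have := adiabatic_of_fintype (κ := Fin m ⊕ Fin n) (F := F) (g := Sum.elim g g')
    (Z := Sum.elim A A') (by rintro (i | i); exacts [h i, h' i])
  simp only [Fintype.sum_sum_type, Sum.elim_inl, Sum.elim_inr] at this
  simpa only [hY, hZ] using this

theorem adiabatic_sum {κ : Type*} (s : Finset κ) {Y : κ → VField (E × ℝ) (M × ℝ)}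
    (hY : ∀ i ∈ s, Y i ∈ adiabatic F) : (fun p => ∑ i ∈ s, Y i p) ∈ adiabatic F := by
  classical
  induction s using Finset.induction_on with
  | empty => simpa using adiabatic_zero (F := F)
  | insert i s hi ih =>
    simp only [Finset.sum_insert hi]
    exact adiabatic_add (hY i (Finset.mem_insert_self i s))
      (ih fun j hj => hY j (Finset.mem_insert_of_mem hj))

/-- Additively, the adiabatic foliation is spanned by the fields `λ g (Z ⊗ 1)`; additive properties
need be checked on these only. -/
theorem adiabatic_induction {P : VField (E × ℝ) (M × ℝ) → Prop} (h0 : P fun _ => 0)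
    (hadd : ∀ Y ∈ adiabatic F, ∀ Z ∈ adiabatic F, P Y → P Z → P fun p => Y p + Z p)
    (h1 : ∀ g : M × ℝ → ℝ, IsTestFunction (G := E × ℝ) g → ∀ Z ∈ F,
      P fun p => (p.2 * g p) • tensorOne Z p)
    {Y : VField (E × ℝ) (M × ℝ)} (hY : Y ∈ adiabatic F) : P Y := by
  classical
  obtain ⟨n, g, A, h, hY⟩ := hY
  obtain rfl : Y = fun p => ∑ i, (p.2 * g i p) • tensorOne (A i) p := funext hY
  clear hY
  generalize (Finset.univ : Finset (Fin n)) = s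
  induction s using Finset.induction_on with
  | empty => simpa using h0
  | insert i s hi ih =>
    simp only [Finset.sum_insert hi]
    exact hadd _ (adiabatic_single (h i).1 (h i).2) _
      (adiabatic_sum s fun j _ => adiabatic_single (h j).1 (h j).2) (h1 _ (h i).1 _ (h i).2) ih

variable [IsManifold 𝓘(ℝ, E) ∞ M] [T2Space M]

theorem isTestFunction_real_mul {g : M × ℝ → ℝ} (hg : IsTestFunction (G := E × ℝ) g) :
    IsTestFunction (G := E × ℝ) (fun p => p.2 * g p) :=
  ⟨contMDiff_snd_real.mul hg.1, hg.2.mul_left⟩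

theorem isSmoothCompact_adiabatic (hF : ∀ Z ∈ F, IsSmoothCompact Z) {Y : VField (E × ℝ) (M × ℝ)}
    (hY : Y ∈ adiabatic F) : IsSmoothCompact Y :=
  adiabatic_induction (P := IsSmoothCompact) isSmoothCompact_zero (fun _ _ _ _ h h' => h.add h')
    (fun _ hg Z hZ => isSmoothCompact_smul (isTestFunction_real_mul hg)
      fun p _ => smoothFieldAt_tensorOne (hF Z hZ) p) hY

theorem adiabatic_smul {f : M × ℝ → ℝ} (hf : ContMDiff 𝓘(ℝ, E × ℝ) 𝓘(ℝ, ℝ) ∞ f)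
    {Y : VField (E × ℝ) (M × ℝ)} (hY : Y ∈ adiabatic F) : (fun p => f p • Y p) ∈ adiabatic F := by
  obtain ⟨n, g, A, h, hY⟩ := hY
  refine ⟨n, fun i p => g i p * f p, A,
    fun i => ⟨isTestFunction_mul (h i).1 fun p _ => hf p, (h i).2⟩, fun p => ?_⟩
  simp only [hY, Finset.smul_sum]
  refine Finset.sum_congr rfl fun i _ => ?_
  rw [smul_smul]
  congr 1
  ring

/-- The derivative `Y f` of the function `f` along the field `Y`. -/
def fieldDeriv {X : Type u} [TopologicalSpace X] {G : Type} [NormedAddCommGroup G]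
    [NormedSpace ℝ G] [ChartedSpace G X] (Y : VField G X) (f : X → ℝ) : X → ℝ :=
  fun x => mfderiv 𝓘(ℝ, G) 𝓘(ℝ, ℝ) f x (Y x)

theorem contMDiff_fieldDeriv {X : Type u} [TopologicalSpace X] {G : Type}
    [NormedAddCommGroup G] [NormedSpace ℝ G] [ChartedSpace G X] [IsManifold 𝓘(ℝ, G) ∞ X]
    {f : X → ℝ} (hf : ContMDiff 𝓘(ℝ, G) 𝓘(ℝ, ℝ) ∞ f) {Y : VField G X} (hY : ∀ x, SmoothFieldAt Y x) :
    ContMDiff 𝓘(ℝ, G) 𝓘(ℝ, ℝ) ∞ (fieldDeriv Y f) :=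
  fun x => SmoothFieldAt.mfderiv_apply (hY x) isOpen_univ (mem_univ x) hf.contMDiffOn

/-- By biadditivity only generators matter, and the Leibniz rule gives `[λg A, λg' A'] = λg A(λg')
A' - λg' A'(λg) A + λ²gg' [A, A']`. Each term retains a factor `λ` and a compactly supported one. -/
theorem adiabatic_bracket [CompleteSpace E] (hF : IsFoliation F) {Y Z : VField (E × ℝ) (M × ℝ)}
    (hY : Y ∈ adiabatic F) (hZ : Z ∈ adiabatic F) :
    VectorField.mlieBracket 𝓘(ℝ, E × ℝ) Y Z ∈ adiabatic F := by
  have hs : ∀ Y ∈ adiabatic F, ∀ p, MDifferentiableAt 𝓘(ℝ, E × ℝ) 𝓘(ℝ, E × ℝ).tangent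
      (fun x => (⟨x, Y x⟩ : TangentBundle 𝓘(ℝ, E × ℝ) (M × ℝ))) p := fun Y hY p =>
    ((isSmoothCompact_adiabatic hF.smooth hY).1 p).mdifferentiableAt (by simp)
  refine adiabatic_induction (F := F)
    (P := fun Y => VectorField.mlieBracket 𝓘(ℝ, E × ℝ) Y Z ∈ adiabatic F) ?_ ?_ ?_ hY
  · have : VectorField.mlieBracket 𝓘(ℝ, E × ℝ) (0 : VField (E × ℝ) (M × ℝ)) Z = 0 :=
      VectorField.mlieBracket_zero_left
    exact this.symm ▸ adiabatic_zero
  · intro Y hY Y' hY' h h'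
    have : VectorField.mlieBracket 𝓘(ℝ, E × ℝ) (fun p => Y p + Y' p) Z = fun p =>
        VectorField.mlieBracket 𝓘(ℝ, E × ℝ) Y Z p + VectorField.mlieBracket 𝓘(ℝ, E × ℝ) Y' Z p :=
      funext fun p => VectorField.mlieBracket_add_left (hs Y hY p) (hs Y' hY' p)
    exact this.symm ▸ adiabatic_add h h'
  intro g hg A hA
  refine adiabatic_induction (F := F) (P := fun Z => VectorField.mlieBracket 𝓘(ℝ, E × ℝ)
    (fun p => (p.2 * g p) • tensorOne A p) Z ∈ adiabatic F) ?_ ?_ ?_ hZ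
  · have : VectorField.mlieBracket 𝓘(ℝ, E × ℝ) (fun p => (p.2 * g p) • tensorOne A p)
        (0 : VField (E × ℝ) (M × ℝ)) = 0 := VectorField.mlieBracket_zero_right
    exact this.symm ▸ adiabatic_zero
  · intro Y hY Y' hY' h h'
    have : VectorField.mlieBracket 𝓘(ℝ, E × ℝ) (fun p => (p.2 * g p) • tensorOne A p)
        (fun p => Y p + Y' p) = fun p =>
        VectorField.mlieBracket 𝓘(ℝ, E × ℝ) (fun p => (p.2 * g p) • tensorOne A p) Y p +
          VectorField.mlieBracket 𝓘(ℝ, E × ℝ) (fun p => (p.2 * g p) • tensorOne A p) Y' p :=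
      funext fun p => VectorField.mlieBracket_add_right (hs Y hY p) (hs Y' hY' p)
    exact this.symm ▸ adiabatic_add h h'
  intro g' hg' A' hA'
  have hAs := smoothFieldAt_tensorOne (hF.smooth A hA)
  have hA's := smoothFieldAt_tensorOne (hF.smooth A' hA')
  have hf := isTestFunction_real_mul hg
  have hf' := isTestFunction_real_mul hg'
  have c1 := contMDiff_fieldDeriv hf.1 hA's
  have c2 := contMDiff_fieldDeriv hf'.1 hAs
  have key : VectorField.mlieBracket 𝓘(ℝ, E × ℝ) (fun p => (p.2 * g p) • tensorOne A p)
      (fun p => (p.2 * g' p) • tensorOne A' p) = fun p =>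
      ((-1 : ℝ) • ((p.2 * (g' p * fieldDeriv (tensorOne A') (fun p => p.2 * g p) p)) • tensorOne A p) +
      (p.2 * (g p * fieldDeriv (tensorOne A) (fun p => p.2 * g' p) p)) • tensorOne A' p) +
      (p.2 * (g p * (p.2 * g' p))) •
        tensorOne (VectorField.mlieBracket 𝓘(ℝ, E) A A') p := by
    funext p
    have e1 := VectorField.mlieBracket_smul_left (I := 𝓘(ℝ, E × ℝ)) (x := p)
      (W := fun p => (p.2 * g' p) • tensorOne A' p) ((hf.1 p).mdifferentiableAt (by simp))
      ((hAs p).mdifferentiableAt (by simp))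
    have e2 := VectorField.mlieBracket_smul_right (I := 𝓘(ℝ, E × ℝ)) (x := p)
      (V := tensorOne A) ((hf'.1 p).mdifferentiableAt (by simp))
      ((hA's p).mdifferentiableAt (by simp))
    have e0 := congrFun (mlieBracket_tensorOne (hF.smooth A hA) (hF.smooth A' hA')) p
    rw [e0] at e2
    have e3 : VectorField.mlieBracket 𝓘(ℝ, E × ℝ) (tensorOne A)
        (fun p => (p.2 * g' p) • tensorOne A' p) p =
        fieldDeriv (tensorOne A) (fun p => p.2 * g' p) p • tensorOne A' p +
          (p.2 * g' p) • tensorOne (VectorField.mlieBracket 𝓘(ℝ, E) A A') p := e2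
    have e4 : fieldDeriv (fun p => (p.2 * g' p) • tensorOne A' p) (fun p => p.2 * g p) p =
        (p.2 * g' p) * fieldDeriv (tensorOne A') (fun p => p.2 * g p) p :=
      (mfderiv 𝓘(ℝ, E × ℝ) 𝓘(ℝ, ℝ) (fun p => p.2 * g p) p).map_smul _ _
    have e5 : VectorField.mlieBracket 𝓘(ℝ, E × ℝ) (fun p => (p.2 * g p) • tensorOne A p)
        (fun p => (p.2 * g' p) • tensorOne A' p) p =
        -fieldDeriv (fun p => (p.2 * g' p) • tensorOne A' p) (fun p => p.2 * g p) p •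
          tensorOne A p + (p.2 * g p) • VectorField.mlieBracket 𝓘(ℝ, E × ℝ) (tensorOne A)
            (fun p => (p.2 * g' p) • tensorOne A' p) p := e1
    rw [e5, e4, e3]
    module
  rw [key]
  refine adiabatic_add (adiabatic_add ?_ ?_) ?_
  · exact adiabatic_smul contMDiff_const (adiabatic_single (isTestFunction_mul hg' fun p _ => c1 p) hA)
  · exact adiabatic_single (isTestFunction_mul hg fun p _ => c2 p) hA'
  · exact adiabatic_single (isTestFunction_mul hg fun p _ => hf'.1 p) (hF.bracket_mem A hA A' hA')

theorem isFoliation_adiabatic [FiniteDimensional ℝ E] [SecondCountableTopology M]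
    (hF : IsFoliation F) : IsFoliation (adiabatic F) where
  smooth _ hY := isSmoothCompact_adiabatic hF.smooth hY
  zero_mem := adiabatic_zero
  add_mem _ hY _ hZ := adiabatic_add hY hZ
  smul_mem _ hf _ hY := adiabatic_smul hf hY
  bracket_mem _ hY _ hZ := by
    have : CompleteSpace E := FiniteDimensional.complete ℝ E
    exact adiabatic_bracket hF hY hZ
  locally_fg := by
    rintro ⟨x, β⟩
    obtain ⟨W₀, hW₀, hx, n, Y, hY, hgen⟩ := hF.locally_fg x
    -- Elements of the foliation have compact support, so the local generators `λ (Yᵢ ⊗ 1)` have to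
    -- be cut off by a function that equals `1` on the neighbourhood.
    obtain ⟨b, hb, -, hb1⟩ := exists_isTestFunction_nhds (G := E × ℝ) (x := (x, β)) univ_mem
    refine ⟨interior {p | b p = 1} ∩ Prod.fst ⁻¹' W₀,
      isOpen_interior.inter (hW₀.preimage continuous_fst), ⟨mem_interior_iff_mem_nhds.2 hb1, hx⟩, n,
      fun i p => (p.2 * b p) • tensorOne (Y i) p, fun i => adiabatic_single hb (hY i), ?_⟩
    set W := interior {p | b p = 1} ∩ Prod.fst ⁻¹' W₀ with hW
    have hWo : IsOpen W := isOpen_interior.inter (hW₀.preimage continuous_fst)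
    intro Z hZ hZW
    obtain ⟨m, g, A, hA, hZA⟩ := hZ
    have hZs := isSmoothCompact_adiabatic hF.smooth ⟨m, g, A, hA, hZA⟩
    -- The coefficients must be supported in `W`; multiplying them by `ρ` does not change `Z`, as `ρ
    -- = 1` near its support.
    obtain ⟨ρ, hρ, hρW, hρ1⟩ := exists_isTestFunction_compact (G := E × ℝ) hZs.2 hWo hZW
    -- The generation property of `F` concerns fields supported in `W₀`. It applies to `a Aⱼ`, which
    -- agrees with `Aⱼ` below the support of `ρ`.
    have hKc : IsCompact (Prod.fst '' tsupport ρ : Set M) := hρ.2.isCompact.image continuous_fst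
    obtain ⟨a, ha, haW, ha1⟩ := exists_isTestFunction_compact (G := E) hKc hW₀ (by
      rintro _ ⟨p, hp, rfl⟩
      exact (hρW hp).2)
    have hch : ∀ j, ∃ f : Fin n → M → ℝ, (∀ i, IsTestFunction (G := E) (f i) ∧
        tsupport (f i) ⊆ W₀) ∧ ∀ y, a y • A j y = ∑ i, f i y • Y i y := fun j =>
      hgen _ (hF.smul_mem a ha.1 _ (hA j).2) (subset_trans (closure_mono fun y hy => by
        exact fun h0 => hy (by simp only [h0, zero_smul])) haW)
    choose f hf hfA using hch
    have hsm : ∀ i, ContMDiff 𝓘(ℝ, E × ℝ) 𝓘(ℝ, ℝ) ∞ (fun p : M × ℝ => ∑ j, g j p * f j i p.1) :=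
      fun i => ContMDiff.sum fun j _ => (hA j).1.1.mul ((hf j i).1.1.comp contMDiff_fst_real)
    refine ⟨fun i p => ρ p * ∑ j, g j p * f j i p.1, fun i =>
      ⟨isTestFunction_mul hρ fun p _ => hsm i p,
        (closure_mono (Function.support_mul_subset_left _ _)).trans hρW⟩, fun p => ?_⟩
    by_cases hp : p ∈ tsupport ρ
    · have h1 : a p.1 = 1 := ha1.self_of_nhdsSet _ ⟨p, hp, rfl⟩
      have h2 : b p = 1 := interior_subset (s := {p | b p = 1}) (hρW hp).1
      have h3 : Z p = ρ p • Z p := by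
        by_cases h0 : Z p = 0
        · rw [h0, smul_zero]
        · rw [hρ1.self_of_nhdsSet p (subset_closure h0), one_smul]
      have h4 : ∀ j, tensorOne (A j) p = ∑ i, f j i p.1 • tensorOne (Y i) p := fun j => by
        have := hfA j p.1
        rw [h1, one_smul] at this
        refine Prod.ext ?_ ?_
        · refine this.trans ?_
          exact (Prod.fst_sum (s := Finset.univ)
            (f := fun i => (f j i p.1 • (tensorOne (Y i) p : E × ℝ) : E × ℝ))).symm
        · refine Eq.trans ?_ (Prod.snd_sum (s := Finset.univ)
            (f := fun i => (f j i p.1 • (tensorOne (Y i) p : E × ℝ) : E × ℝ))).symm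
          exact (Finset.sum_eq_zero fun i _ => smul_zero _).symm
      rw [h3, hZA]
      simp only [h4, h2, Finset.smul_sum, Finset.mul_sum, smul_smul]
      rw [Finset.sum_comm]
      refine Finset.sum_congr rfl fun i _ => ?_
      rw [Finset.sum_mul, Finset.sum_smul]
      refine Finset.sum_congr rfl fun j _ => ?_
      congr 1
      ring
    · have h0 : ρ p = 0 := image_eq_zero_of_notMem_tsupport hp
      have h1 : Z p = 0 := by
        by_contra h
        have := hρ1.self_of_nhdsSet p (subset_closure h)
        rw [h0] at this
        exact zero_ne_one this
      simp [h0, h1]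

end Adiabatic

/-! ### Finite partitions of unity -/

section Partition

variable {G : Type} [NormedAddCommGroup G] [NormedSpace ℝ G] [FiniteDimensional ℝ G]
  {X : Type u} [TopologicalSpace X] [ChartedSpace G X] [IsManifold 𝓘(ℝ, G) ∞ X]
  [T2Space X] [SecondCountableTopology X]

/-- Shrinking each neighbourhood into a compact one makes the members of the partition compactly
supported, and compactness of `K` makes them finite in number. -/
theorem exists_finite_partition {K : Set X} (hK : IsCompact K) {N : X → Set X}
    (hN : ∀ x ∈ K, N x ∈ 𝓝 x) : ∃ (n : ℕ) (x : Fin n → X) (ρ : Fin n → X → ℝ),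
      (∀ i, x i ∈ K ∧ IsTestFunction (G := G) (ρ i) ∧ tsupport (ρ i) ⊆ N (x i)) ∧
        ∀ y ∈ K, ∑ i, ρ i y = 1 := by
  have : LocallyCompactSpace X := ChartedSpace.locallyCompactSpace G X
  have hch : ∀ x ∈ K, ∃ C, IsCompact C ∧ C ∈ 𝓝 x ∧ C ⊆ N x := fun x hx => by
    obtain ⟨C, h1, h2, h3⟩ := local_compact_nhds (hN x hx)
    exact ⟨C, h3, h1, h2⟩
  choose! C hC hCx hCN using hch
  obtain ⟨s, hs, hKs⟩ := hK.elim_nhds_subcover (fun x => interior (N x) ∩ interior (C x))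
    fun x hx => inter_mem (interior_mem_nhds.2 (hN x hx)) (interior_mem_nhds.2 (hCx x hx))
  let e := s.equivFin
  let x : Fin s.card → X := fun i => (e.symm i : X)
  have hx : ∀ i, x i ∈ K := fun i => hs _ (e.symm i).2
  obtain ⟨f, hf⟩ := SmoothPartitionOfUnity.exists_isSubordinate 𝓘(ℝ, G) (s := K) hK.isClosed
    (fun i : Fin s.card => interior (N (x i)) ∩ interior (C (x i)))
    (fun i => isOpen_interior.inter isOpen_interior) (by
      intro y hy
      obtain ⟨z, hz, hyz⟩ := mem_iUnion₂.1 (hKs hy)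
      refine mem_iUnion.2 ⟨e ⟨z, hz⟩, ?_⟩
      simpa only [x, e.symm_apply_apply] using hyz)
  refine ⟨s.card, x, fun i => f i, fun i => ⟨hx i, ⟨(f i).contMDiff, ?_⟩, ?_⟩, fun y hy => ?_⟩
  · exact (hC _ (hx i)).of_isClosed_subset (isClosed_tsupport _)
      ((hf i).trans (inter_subset_right.trans interior_subset))
  · exact (hf i).trans (inter_subset_left.trans interior_subset)
  · rw [← finsum_eq_sum_of_fintype]
    exact f.sum_eq_one hy

end Partition

/-! ### Differentials in charts adapted to a submersion -/

section AdaptedPairs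

variable {E B : Type} [NormedAddCommGroup E] [NormedSpace ℝ E] [NormedAddCommGroup B]
  [NormedSpace ℝ B] {M U : Type u} [TopologicalSpace M] [ChartedSpace E M]
  [TopologicalSpace U] [ChartedSpace (E × B) U]
  {f : U → M} {φ : OpenPartialHomeomorph U (E × B)} {χ : OpenPartialHomeomorph M E}

theorem IsAdaptedPair.contMDiffAt (h : IsAdaptedPair f φ χ) {x : U} (hx : x ∈ φ.source) :
    ContMDiffAt 𝓘(ℝ, E × B) 𝓘(ℝ, E) ∞ f x := by
  have h1 : ContMDiffAt 𝓘(ℝ, E × B) 𝓘(ℝ, E) ∞ (fun y => (φ y).1) x :=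
    ContMDiffAt.comp (g := Prod.fst) x contDiff_fst.contMDiff.contMDiffAt
      (contMDiffAt_of_mem_maximalAtlas h.mem_maximalAtlas hx)
  have h2 : χ (f x) ∈ χ.target := χ.map_source (h.mapsTo x hx)
  rw [← h.eq x hx] at h2
  refine (ContMDiffAt.comp (g := χ.symm) x
    (contMDiffAt_symm_of_mem_maximalAtlas h.mem_maximalAtlas' h2) h1).congr_of_eventuallyEq ?_
  filter_upwards [φ.open_source.mem_nhds hx] with y hy
  simp only [Function.comp, h.eq y hy, χ.left_inv (h.mapsTo y hy)]

theorem IsAdaptedPair.mfderiv_fst (h : IsAdaptedPair f φ χ) {x : U} (hx : x ∈ φ.source)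
    (ξ : TangentSpace 𝓘(ℝ, E × B) x) : (mfderiv 𝓘(ℝ, E × B) 𝓘(ℝ, E × B) φ x ξ : E × B).1 =
      mfderiv 𝓘(ℝ, E) 𝓘(ℝ, E) χ (f x) (mfderiv 𝓘(ℝ, E × B) 𝓘(ℝ, E) f x ξ) := by
  have h1 := (mdiffAt_of_mem h.mem_maximalAtlas hx).hasMFDerivAt
  have h2 : HasMFDerivAt 𝓘(ℝ, E × B) 𝓘(ℝ, E) (Prod.fst : E × B → E) (φ x)
      (ContinuousLinearMap.fst ℝ E B) := (hasFDerivAt_fst (𝕜 := ℝ)).hasMFDerivAt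
  have h3 := h2.comp x h1
  have h4 := ((h.contMDiffAt hx).mdifferentiableAt (by simp)).hasMFDerivAt
  have h5 := ((contMDiffAt_of_mem_maximalAtlas h.mem_maximalAtlas'
    (h.mapsTo x hx)).mdifferentiableAt (by simp)).hasMFDerivAt
  have h6 := h5.comp x h4
  have h7 := hasMFDerivAt_unique (h3.congr_of_eventuallyEq (f₁ := χ ∘ f) (by
    filter_upwards [φ.open_source.mem_nhds hx] with y hy
    exact (h.eq y hy).symm)) h6
  exact congrArg (fun L : E × B →L[ℝ] E => L ξ) h7

variable [IsManifold 𝓘(ℝ, E) ∞ M]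

theorem IsAdaptedPair.mfderiv_eq (h : IsAdaptedPair f φ χ) {x : U} (hx : x ∈ φ.source)
    (ξ : TangentSpace 𝓘(ℝ, E × B) x) : (mfderiv 𝓘(ℝ, E × B) 𝓘(ℝ, E) f x ξ : E) =
      mfderiv 𝓘(ℝ, E) 𝓘(ℝ, E) χ.symm (χ (f x))
        (mfderiv 𝓘(ℝ, E × B) 𝓘(ℝ, E × B) φ x ξ : E × B).1 := by
  rw [h.mfderiv_fst hx]
  exact (mfderiv_symm_mfderiv h.mem_maximalAtlas' (h.mapsTo x hx) _).symm

variable [IsManifold 𝓘(ℝ, E × B) ∞ U]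

theorem IsAdaptedPair.mfderiv_symm (h : IsAdaptedPair f φ χ) {x : U} (hx : x ∈ φ.source)
    (η : E × B) : (mfderiv 𝓘(ℝ, E × B) 𝓘(ℝ, E) f x
      (mfderiv 𝓘(ℝ, E × B) 𝓘(ℝ, E × B) φ.symm (φ x) η : E × B) : E) =
        mfderiv 𝓘(ℝ, E) 𝓘(ℝ, E) χ.symm (χ (f x)) η.1 := by
  refine (h.mfderiv_eq hx _).trans ?_
  have := mfderiv_chart_symm h.mem_maximalAtlas (φ.map_source hx) (φ.left_inv hx) η
  exact congrArg (fun v : E × B => (mfderiv 𝓘(ℝ, E) 𝓘(ℝ, E) χ.symm (χ (f x)) v.1 : E)) this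

/-- In adapted charts the lifts of `Z` along `f` are the fields whose `E`-component is that of `Z`;
the component along `B` is arbitrary. -/
theorem IsAdaptedPair.mfderiv_lift (h : IsAdaptedPair f φ χ) {x : U} (hx : x ∈ φ.source)
    (Z : VField E M) (b : B) : (mfderiv 𝓘(ℝ, E × B) 𝓘(ℝ, E) f x
      (mfderiv 𝓘(ℝ, E × B) 𝓘(ℝ, E × B) φ.symm (φ x) ((chartField χ Z (χ (f x)), b) : E × B) :
        E × B) : E) = Z (f x) := by
  refine (h.mfderiv_symm hx _).trans ?_
  have h1 : chartField χ Z (χ (f x)) = (mfderiv 𝓘(ℝ, E) 𝓘(ℝ, E) χ (f x) (Z (f x)) : E) := by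
    simp only [chartField]
    rw [χ.left_inv (h.mapsTo x hx)]
  exact (congrArg (fun v : E => (mfderiv 𝓘(ℝ, E) 𝓘(ℝ, E) χ.symm (χ (f x)) v : E)) h1).trans
    (mfderiv_symm_mfderiv h.mem_maximalAtlas' (h.mapsTo x hx) _)

theorem isSubmersion_of_isAdaptedPair {f : U → M} (h : ∀ u, ∃ (φ : OpenPartialHomeomorph U (E × B))
    (χ : OpenPartialHomeomorph M E), IsAdaptedPair f φ χ ∧ u ∈ φ.source) :
    Manifold.IsSubmersion 𝓘(ℝ, E × B) 𝓘(ℝ, E) ∞ f := by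
  refine ⟨B, inferInstance, inferInstance, fun u => ?_⟩
  obtain ⟨φ, χ, h, hu⟩ := h u
  refine IsSubmersionAtOfComplement.mk_of_charts (ContinuousLinearEquiv.refl ℝ (E × B)) φ χ hu
    (h.mapsTo u hu) h.mem_maximalAtlas h.mem_maximalAtlas' (fun x hx => h.mapsTo x hx) ?_
  intro p hp
  have hp' : p ∈ φ.target := by simpa [OpenPartialHomeomorph.extend_target] using hp
  have := h.eq _ (φ.map_target hp')
  rw [φ.right_inv hp'] at this
  exact this.symm

end AdaptedPairs

/-! ### From pull-back conditions to local conditions in charts -/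

section LocalConditions

variable {E B : Type} [NormedAddCommGroup E] [NormedSpace ℝ E] [NormedAddCommGroup B]
  [NormedSpace ℝ B] {M : Type u} [TopologicalSpace M] [ChartedSpace E M]

/-- Near `p₀` the derivatives of `τ` along `B` are smooth combinations of elements of `F`. -/
def VertIn (F : Set (VField E M)) (τ : E × B → M) (p₀ : E × B) : Prop :=
  ∃ (κ : Type) (_ : Fintype κ) (c : κ → E × B → B →L[ℝ] ℝ) (Z : κ → VField E M),
    (∀ i, Z i ∈ F) ∧ ∀ᶠ p in 𝓝 p₀, (∀ i, ContDiffAt ℝ ∞ (c i) p) ∧ ∀ b : B,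
      (mfderiv 𝓘(ℝ, E × B) 𝓘(ℝ, E) τ p ((0, b) : E × B) : E) = ∑ i, c i p b • (Z i (τ p) : E)

/-- Near `p₀` the elements of `F` are derivatives of `τ` along `B`. -/
def VertGen (F : Set (VField E M)) (τ : E × B → M) (p₀ : E × B) : Prop :=
  ∀ Z ∈ F, ∃ e : E × B → B, ∀ᶠ p in 𝓝 p₀, ContDiffAt ℝ ∞ e p ∧
    (mfderiv 𝓘(ℝ, E × B) 𝓘(ℝ, E) τ p ((0, e p) : E × B) : E) = Z (τ p)

/-- Near `p₀` the derivatives of `τ` along the horizontal lifts of the elements of `F` are smooth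
combinations of elements of `F`. -/
def HorIn (F : Set (VField E M)) (χ : OpenPartialHomeomorph M E) (τ : E × B → M) (p₀ : E × B) :
    Prop :=
  ∀ Z ∈ F, ∃ (κ : Type) (_ : Fintype κ) (c : κ → E × B → ℝ) (Z' : κ → VField E M),
    (∀ i, Z' i ∈ F) ∧ ∀ᶠ p in 𝓝 p₀, (∀ i, ContDiffAt ℝ ∞ (c i) p) ∧
      (mfderiv 𝓘(ℝ, E × B) 𝓘(ℝ, E) τ p ((chartField χ Z p.1, 0) : E × B) : E) =
        ∑ i, c i p • (Z' i (τ p) : E)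

variable {U : Type u} [TopologicalSpace U] [ChartedSpace (E × B) U]

theorem pullback_of_fintype {G : Type} [NormedAddCommGroup G] [NormedSpace ℝ G]
    {X : Type u} [TopologicalSpace X] [ChartedSpace G X] [IsManifold 𝓘(ℝ, G) ∞ X]
    {F : Set (VField E M)} {f : X → M} {Y : VField G X} (hY : IsSmoothCompact Y) {κ : Type*}
    [Fintype κ] {g : κ → X → ℝ} {Z : κ → VField E M}
    (h : ∀ i, IsTestFunction (G := G) (g i) ∧ Z i ∈ F)
    (hs : ∀ x, (mfderiv 𝓘(ℝ, G) 𝓘(ℝ, E) f x (Y x) : E) = ∑ i, g i x • (Z i (f x) : E)) :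
    Y ∈ pullback f F := by
  refine ⟨hY, Fintype.card κ, fun i => g ((Fintype.equivFin κ).symm i),
    fun i => Z ((Fintype.equivFin κ).symm i), fun i => h _, fun x => ?_⟩
  refine (hs x).trans ?_
  exact (Equiv.sum_comp (Fintype.equivFin κ).symm (fun i => g i x • (Z i (f x) : E))).symm

theorem eventually_nhds_chart {X G : Type*} [TopologicalSpace X] [TopologicalSpace G]
    {φ : OpenPartialHomeomorph X G} {u : X} (hu : u ∈ φ.source) {P : G → Prop} :
    (∀ᶠ p in 𝓝 (φ u), P p) ↔ ∀ᶠ x in 𝓝 u, P (φ x) := by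
  rw [← φ.map_nhds_eq hu, eventually_map]

theorem eventually_nhds_chart_symm {X G : Type*} [TopologicalSpace X] [TopologicalSpace G]
    {φ : OpenPartialHomeomorph X G} {u : X} (hu : u ∈ φ.source) {P : X → Prop} :
    (∀ᶠ x in 𝓝 u, P x) ↔ ∀ᶠ p in 𝓝 (φ u), P (φ.symm p) := by
  have h1 := φ.symm.map_nhds_eq (φ.map_source hu)
  rw [φ.left_inv hu] at h1
  rw [← h1, eventually_map]

variable [IsManifold 𝓘(ℝ, E) ∞ M] [IsManifold 𝓘(ℝ, E × B) ∞ U] [FiniteDimensional ℝ E] [FiniteDimensional ℝ B] [T2Space U]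
  {F : Set (VField E M)} {s t : U → M} {φ : OpenPartialHomeomorph U (E × B)}

/-- The field with components `h` is cut off to a global one, the pull-back condition is applied to
it, and the result is read off where the cut-off is `1`. -/
theorem exists_local_of_pullback (hφ : φ ∈ IsManifold.maximalAtlas 𝓘(ℝ, E × B) ∞ U) {u : U}
    (hu : u ∈ φ.source) (ht : ContMDiff 𝓘(ℝ, E × B) 𝓘(ℝ, E) ∞ t) {h : U → E × B}
    (hp : ∀ ρ : U → ℝ, IsTestFunction (G := E × B) ρ → tsupport ρ ⊆ φ.source →
      (fun x => ρ x • (mfderiv 𝓘(ℝ, E × B) 𝓘(ℝ, E × B) φ.symm (φ x) (h x) : E × B) :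
        VField (E × B) U) ∈ pullback t F) :
    ∃ (n : ℕ) (c : Fin n → E × B → ℝ) (Z : Fin n → VField E M), (∀ i, Z i ∈ F) ∧
      ∀ᶠ p in 𝓝 (φ u), (∀ i, ContDiffAt ℝ ∞ (c i) p) ∧
        (mfderiv 𝓘(ℝ, E × B) 𝓘(ℝ, E) (t ∘ φ.symm) p (h (φ.symm p)) : E) =
          ∑ i, c i p • (Z i ((t ∘ φ.symm) p) : E) := by
  obtain ⟨ρ, hρ, hρs, hρ1⟩ := exists_isTestFunction_nhds (G := E × B)
    (φ.open_source.mem_nhds hu)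
  obtain ⟨-, n, g, Z, hg, hgs⟩ := hp ρ hρ hρs
  refine ⟨n, fun i p => g i (φ.symm p), Z, fun i => (hg i).2, ?_⟩
  filter_upwards [φ.open_target.mem_nhds (φ.map_source hu),
    (eventually_nhds_chart_symm hu).1 hρ1] with p hp hp1
  refine ⟨fun i => ?_, ?_⟩
  · have := ((hg i).1.1 (φ.symm p)).comp p (contMDiffAt_symm_of_mem_maximalAtlas hφ hp)
    exact this.contDiffAt
  · have h1 := hgs (φ.symm p)
    have h2 : (mfderiv 𝓘(ℝ, E × B) 𝓘(ℝ, E) t (φ.symm p) (ρ (φ.symm p) •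
        (mfderiv 𝓘(ℝ, E × B) 𝓘(ℝ, E × B) φ.symm (φ (φ.symm p)) (h (φ.symm p)) : E × B)) : E) =
        mfderiv 𝓘(ℝ, E × B) 𝓘(ℝ, E) t (φ.symm p)
          (mfderiv 𝓘(ℝ, E × B) 𝓘(ℝ, E × B) φ.symm p (h (φ.symm p)) : E × B) := by
      rw [hp1, φ.right_inv hp, Pi.one_apply, one_smul]
    rw [← mfderiv_comp_symm_apply hφ hp rfl ((ht _).mdifferentiableAt (by simp))] at h2
    exact h2.symm.trans h1

/-- The constant fields along a basis of `B` are vertical for `s`, so each is a combination of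
fields of `F` after applying the differential of `t`; linearity gives all of `B`. -/
theorem vertIn_of_subset {χ : OpenPartialHomeomorph M E}
    (h : IsAdaptedPair s φ χ) {u : U} (hu : u ∈ φ.source)
    (ht : ContMDiff 𝓘(ℝ, E × B) 𝓘(ℝ, E) ∞ t) (hst : vertical E s ⊆ pullback (G := E × B) t F) :
    VertIn F (t ∘ φ.symm) (φ u) := by
  let b := Module.finBasis ℝ B
  have key := fun j => exists_local_of_pullback (F := F) h.mem_maximalAtlas hu ht
    (h := fun _ => ((0, b j) : E × B)) (fun ρ hρ hρs => hst ⟨isSmoothCompact_smul hρ fun x hx =>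
      smoothFieldAt_symm h.mem_maximalAtlas (hρs hx) contMDiffAt_const, fun x => by
        by_cases hx : x ∈ φ.source
        · have h1 := h.mfderiv_symm hx ((0, b j) : E × B)
          refine ((mfderiv 𝓘(ℝ, E × B) 𝓘(ℝ, E) s x).map_smul _ _).trans ?_
          refine (congrArg (fun v : E => ρ x • v) h1).trans ?_
          refine (congrArg (fun v : E => ρ x • v) (map_zero _)).trans (smul_zero _)
        · have h0 : ρ x = 0 := image_eq_zero_of_notMem_tsupport fun h' => hx (hρs h')
          simp only [h0, zero_smul]
          exact map_zero _⟩)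
  choose n c Z hZ hc using key
  refine ⟨Σ j, Fin (n j), inferInstance,
    fun i p => c i.1 i.2 p • LinearMap.toContinuousLinearMap (b.coord i.1), fun i => Z i.1 i.2,
    fun i => hZ _ _, ?_⟩
  filter_upwards [eventually_all.2 hc] with p hp
  refine ⟨fun i => ((hp i.1).1 i.2).smul contDiffAt_const, fun v => ?_⟩
  have h1 : ((0, v) : E × B) = ∑ j, b.coord j v • ((0, b j) : E × B) := by
    refine Prod.ext ?_ ?_
    · simp [Prod.fst_sum]
    · simp [Prod.snd_sum, b.sum_repr]
  rw [h1]
  refine (map_sum (mfderiv 𝓘(ℝ, E × B) 𝓘(ℝ, E) (t ∘ φ.symm) p) _ _).trans ?_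
  rw [Fintype.sum_sigma]
  refine Finset.sum_congr rfl fun j _ => ?_
  refine ((mfderiv 𝓘(ℝ, E × B) 𝓘(ℝ, E) (t ∘ φ.symm) p).map_smul _ _).trans ?_
  refine (congrArg (fun w : E => b.coord j v • w) (hp j).2).trans ?_
  refine (Finset.smul_sum (N := E)).trans (Finset.sum_congr rfl fun i _ => ?_)
  have h2 : ∀ (r r' : ℝ) (w : E), r • r' • w = (r' * r) • w := fun r r' w => by
    rw [smul_smul, mul_comm]
  exact h2 _ _ _

/-- Cut-offs of the horizontal lifts of `Z` belong to the pull-back along `s`, hence to the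
pull-back along `t`. -/
theorem horIn_of_subset {χ : OpenPartialHomeomorph M E}
    (h : IsAdaptedPair s φ χ) {u : U} (hu : u ∈ φ.source)
    (hF : ∀ Z ∈ F, IsSmoothCompact Z)
    (ht : ContMDiff 𝓘(ℝ, E × B) 𝓘(ℝ, E) ∞ t)
    (hst : pullback (G := E × B) s F ⊆ pullback t F) :
    HorIn F χ (t ∘ φ.symm) (φ u) := by
  intro Z hZ
  have hsm : ∀ x ∈ φ.source, ContMDiffAt 𝓘(ℝ, E × B) 𝓘(ℝ, E × B) ∞
      (fun x => ((chartField χ Z (χ (s x)), 0) : E × B)) x := fun x hx => by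
    have h1 := (contDiffOn_chartField h.mem_maximalAtlas' (hF Z hZ)).contDiffAt
      (χ.open_target.mem_nhds (χ.map_source (h.mapsTo x hx)))
    have h2 := h1.contMDiffAt.comp x ((contMDiffAt_of_mem_maximalAtlas h.mem_maximalAtlas'
      (h.mapsTo x hx)).comp x (h.contMDiffAt hx))
    exact h2.prodMk_space contMDiffAt_const
  obtain ⟨n, c, Z', hZ', hc⟩ := exists_local_of_pullback (F := F) h.mem_maximalAtlas hu ht
    (h := fun x => ((chartField χ Z (χ (s x)), 0) : E × B)) (fun ρ hρ hρs => hst <|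
      pullback_of_fintype (κ := Unit) (g := fun _ => ρ) (Z := fun _ => Z)
        (isSmoothCompact_smul hρ fun x hx => smoothFieldAt_symm h.mem_maximalAtlas (hρs hx)
          (hsm x (hρs hx))) (fun _ => ⟨hρ, hZ⟩) fun x => by
        simp only [Finset.univ_unique, Finset.sum_singleton]
        by_cases hx : x ∈ φ.source
        · refine ((mfderiv 𝓘(ℝ, E × B) 𝓘(ℝ, E) s x).map_smul _ _).trans ?_
          exact congrArg (fun v : E => ρ x • v) (h.mfderiv_lift hx Z 0)
        · have h0 : ρ x = 0 := image_eq_zero_of_notMem_tsupport fun h' => hx (hρs h')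
          simp only [h0, zero_smul]
          exact map_zero _)
  refine ⟨Fin n, inferInstance, c, Z', hZ', ?_⟩
  filter_upwards [hc, φ.open_target.mem_nhds (φ.map_source hu)] with p hp hpt
  refine ⟨hp.1, ?_⟩
  have h1 := h.eq _ (φ.map_target hpt)
  rw [φ.right_inv hpt] at h1
  rw [h1]
  exact hp.2

/-- A cut-off lift of `Z` along `t`, constructed in a chart adapted to `t`, splits into an
`s`-vertical and a `t`-vertical field. The `s`-vertical summand still lifts `Z`, and in the chart
adapted to `s` it points along `B`. -/
theorem vertGen_of_subset {χ χ' : OpenPartialHomeomorph M E} {φ' : OpenPartialHomeomorph U (E × B)}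
    (h : IsAdaptedPair s φ χ) (h' : IsAdaptedPair t φ' χ') {u : U} (hu : u ∈ φ.source)
    (hu' : u ∈ φ'.source) (hF : ∀ Z ∈ F, IsSmoothCompact Z)
    (hst : pullback (G := E × B) t F ⊆
      {Y | ∃ Y₁ ∈ vertical E s, ∃ Y₂ ∈ vertical E t, Y = fun u => Y₁ u + Y₂ u}) :
    VertGen F (t ∘ φ.symm) (φ u) := by
  intro Z hZ
  obtain ⟨ρ, hρ, hρs, hρ1⟩ := exists_isTestFunction_nhds (G := E × B)
    (φ'.open_source.mem_nhds hu')
  have hsm : ∀ x ∈ φ'.source, ContMDiffAt 𝓘(ℝ, E × B) 𝓘(ℝ, E × B) ∞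
      (fun x => ((chartField χ' Z (χ' (t x)), 0) : E × B)) x := fun x hx => by
    have h1 := (contDiffOn_chartField h'.mem_maximalAtlas' (hF Z hZ)).contDiffAt
      (χ'.open_target.mem_nhds (χ'.map_source (h'.mapsTo x hx)))
    have h2 := h1.contMDiffAt.comp x ((contMDiffAt_of_mem_maximalAtlas h'.mem_maximalAtlas'
      (h'.mapsTo x hx)).comp x (h'.contMDiffAt hx))
    exact h2.prodMk_space contMDiffAt_const
  have hlift : ∀ x, (mfderiv 𝓘(ℝ, E × B) 𝓘(ℝ, E) t x (ρ x •
      (mfderiv 𝓘(ℝ, E × B) 𝓘(ℝ, E × B) φ'.symm (φ' x)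
        ((chartField χ' Z (χ' (t x)), 0) : E × B) : E × B)) : E) = ρ x • (Z (t x) : E) := by
    intro x
    by_cases hx : x ∈ φ'.source
    · refine ((mfderiv 𝓘(ℝ, E × B) 𝓘(ℝ, E) t x).map_smul _ _).trans ?_
      exact congrArg (fun v : E => ρ x • v) (h'.mfderiv_lift hx Z 0)
    · have h0 : ρ x = 0 := image_eq_zero_of_notMem_tsupport fun h' => hx (hρs h')
      simp only [h0, zero_smul]
      exact map_zero _
  obtain ⟨Y₁, ⟨hY₁, hY₁v⟩, Y₂, ⟨hY₂, hY₂v⟩, hY⟩ := hst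
    (pullback_of_fintype (κ := Unit) (g := fun _ => ρ) (Z := fun _ => Z)
        (isSmoothCompact_smul hρ fun x hx => smoothFieldAt_symm h'.mem_maximalAtlas (hρs hx)
          (hsm x (hρs hx))) (fun _ => ⟨hρ, hZ⟩) fun x => by
        exact (hlift x).trans (Fintype.sum_unique fun _ : Unit => (ρ x • (Z (t x) : E) : E)).symm)
  refine ⟨fun p => (chartField φ Y₁ p).2, ?_⟩
  have hN : φ.source ∩ φ'.source ∈ 𝓝 u :=
    inter_mem (φ.open_source.mem_nhds hu) (φ'.open_source.mem_nhds hu')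
  filter_upwards [φ.open_target.mem_nhds (φ.map_source hu), (eventually_nhds_chart_symm hu).1 hρ1,
    (eventually_nhds_chart_symm hu).1 hN] with p hp hp1 hpN
  refine ⟨((contDiffOn_chartField h.mem_maximalAtlas hY₁).contDiffAt
    (φ.open_target.mem_nhds hp)).snd, ?_⟩
  have h1 : (chartField φ Y₁ p).1 = 0 := by
    have := h.mfderiv_fst hpN.1 (Y₁ (φ.symm p))
    rw [hY₁v] at this
    exact this.trans (map_zero _)
  have h2 : ((0, (chartField φ Y₁ p).2) : E × B) = chartField φ Y₁ p := Prod.ext h1.symm rfl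
  rw [h2]
  have ht := (h'.contMDiffAt hpN.2).mdifferentiableAt (by simp)
  refine (mfderiv_comp_symm_apply h.mem_maximalAtlas hp rfl ht _).trans ?_
  have h3 := mfderiv_symm_mfderiv h.mem_maximalAtlas hpN.1 (Y₁ (φ.symm p))
  rw [φ.right_inv hp] at h3
  refine (congrArg (fun v : E × B => (mfderiv 𝓘(ℝ, E × B) 𝓘(ℝ, E) t (φ.symm p) v : E)) h3).trans ?_
  have h4 := hlift (φ.symm p)
  have h5 := congrFun hY (φ.symm p)
  have h6 : (mfderiv 𝓘(ℝ, E × B) 𝓘(ℝ, E) t (φ.symm p) (Y₁ (φ.symm p) + Y₂ (φ.symm p)) : E) =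
      mfderiv 𝓘(ℝ, E × B) 𝓘(ℝ, E) t (φ.symm p) (Y₁ (φ.symm p)) := by
    refine (map_add _ _ _).trans ?_
    rw [hY₂v, add_zero]
  refine h6.symm.trans ?_
  refine (congrArg (fun v : E × B => (mfderiv 𝓘(ℝ, E × B) 𝓘(ℝ, E) t (φ.symm p) v : E))
    h5.symm).trans ?_
  refine h4.trans ?_
  rw [hp1, Pi.one_apply, one_smul]
  rfl

end LocalConditions

/-! ### The local criterion for bi-submersions -/

section Criterion

variable {E : Type} [NormedAddCommGroup E] [NormedSpace ℝ E] {M : Type u} [TopologicalSpace M]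
  [ChartedSpace E M]

theorem vfield_congr (Z : VField E M) {x y : M} (h : x = y) : (Z x : E) = Z y := by
  subst h
  rfl

section Gluing

variable {G : Type} [NormedAddCommGroup G] [NormedSpace ℝ G] [FiniteDimensional ℝ G]
  {X : Type u} [TopologicalSpace X] [ChartedSpace G X] [IsManifold 𝓘(ℝ, G) ∞ X]
  [T2Space X] [SecondCountableTopology X] {F : Set (VField E M)}

/-- Only the coefficients are glued by the partition of unity; the field `Y` is already global. -/
theorem mem_pullback_of_local {f : X → M} {Y : VField G X} (hY : IsSmoothCompact Y)
    (hloc : ∀ u, ∃ (κ : Type) (_ : Fintype κ) (g : κ → X → ℝ) (Z : κ → VField E M),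
      (∀ i, Z i ∈ F) ∧ ∀ᶠ x in 𝓝 u, (∀ i, ContMDiffAt 𝓘(ℝ, G) 𝓘(ℝ, ℝ) ∞ (g i) x) ∧
        (mfderiv 𝓘(ℝ, G) 𝓘(ℝ, E) f x (Y x) : E) = ∑ i, g i x • (Z i (f x) : E)) :
    Y ∈ pullback f F := by
  choose κ hκ g Z hZ hg using hloc
  obtain ⟨n, x, ρ, hρ, hρ1⟩ := exists_finite_partition (G := G) hY.2 fun u _ => hg u
  refine pullback_of_fintype (κ := Σ k, κ (x k)) (g := fun i y => ρ i.1 y * g (x i.1) i.2 y)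
    (Z := fun i => Z (x i.1) i.2) hY (fun i => ⟨isTestFunction_mul (hρ i.1).2.1 fun y hy =>
      ((hρ i.1).2.2 hy).1 i.2, hZ _ _⟩) fun y => ?_
  rw [Fintype.sum_sigma]
  have h1 : ∀ k, ∑ i, (ρ k y * g (x k) i y) • (Z (x k) i (f y) : E) =
      ρ k y • (mfderiv 𝓘(ℝ, G) 𝓘(ℝ, E) f y (Y y) : E) := fun k => by
    by_cases hy : y ∈ tsupport (ρ k)
    · refine Eq.trans ?_ (congrArg (fun v : E => ρ k y • v) ((hρ k).2.2 hy).2.symm)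
      refine Eq.trans ?_ (Finset.smul_sum (N := E)).symm
      exact Finset.sum_congr rfl fun i _ => mul_smul _ _ _
    · have h0 := image_eq_zero_of_notMem_tsupport hy
      simp [h0]
  refine Eq.trans ?_ (Finset.sum_congr rfl fun k _ => h1 k).symm
  refine Eq.trans ?_ (Finset.sum_smul (M := E))
  have hone : ∀ r : ℝ, r = 1 → ∀ v : E, r • v = v := fun r hr v => by rw [hr, one_smul]
  by_cases hy : y ∈ closure {x | Y x ≠ 0}
  · exact (hone _ (hρ1 y hy) _).symm
  · have h0 : Y y = 0 := by_contra fun h => hy (subset_closure h)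
    have h2 : (mfderiv 𝓘(ℝ, G) 𝓘(ℝ, E) f y (Y y) : E) = 0 := by rw [h0]; exact map_zero _
    exact h2.trans ((congrArg (fun v : E => (∑ k, ρ k y) • v) h2).trans (smul_zero (A := E) _)).symm

/-- Both conditions on the lift are linear over functions, so local lifts can be glued; off the
support of `Y` the right side vanishes and the partition need not sum to `1`. -/
theorem exists_vertical_lift {s t : X → M} {Y : VField G X} (hY : IsSmoothCompact Y)
    (hloc : ∀ u, ∃ L : VField G X, ∀ᶠ x in 𝓝 u, SmoothFieldAt L x ∧
      (mfderiv 𝓘(ℝ, G) 𝓘(ℝ, E) t x (L x) : E) = 0 ∧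
        (mfderiv 𝓘(ℝ, G) 𝓘(ℝ, E) s x (L x) : E) = mfderiv 𝓘(ℝ, G) 𝓘(ℝ, E) s x (Y x)) :
    ∃ Y₂ ∈ vertical (G := G) E t, ∀ x, (mfderiv 𝓘(ℝ, G) 𝓘(ℝ, E) s x (Y₂ x) : E) =
      mfderiv 𝓘(ℝ, G) 𝓘(ℝ, E) s x (Y x) := by
  choose L hL using hloc
  obtain ⟨n, x, ρ, hρ, hρ1⟩ := exists_finite_partition (G := G) hY.2 fun u _ => hL u
  have hd : ∀ (f : X → M) (k : Fin n) (y : X), (mfderiv 𝓘(ℝ, G) 𝓘(ℝ, E) f y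
      (ρ k y • L (x k) y) : E) = ρ k y • (mfderiv 𝓘(ℝ, G) 𝓘(ℝ, E) f y (L (x k) y) : E) :=
    fun f k y => (mfderiv 𝓘(ℝ, G) 𝓘(ℝ, E) f y).map_smul _ _
  have h0 : ∀ (k : Fin n) (y : X), y ∉ tsupport (ρ k) → ∀ v : E, ρ k y • v = 0 :=
    fun k y hy v => by rw [image_eq_zero_of_notMem_tsupport hy, zero_smul]
  refine ⟨fun y => ∑ k, ρ k y • L (x k) y, ⟨IsSmoothCompact.sum _ fun k _ =>
    isSmoothCompact_smul (hρ k).2.1 fun y hy => ((hρ k).2.2 hy).1, fun y => ?_⟩, fun y => ?_⟩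
  · refine (map_sum _ _ _).trans (Finset.sum_eq_zero fun k _ => (hd t k y).trans ?_)
    by_cases hy : y ∈ tsupport (ρ k)
    · exact (congrArg (fun v : E => ρ k y • v) ((hρ k).2.2 hy).2.1).trans (smul_zero (A := E) _)
    · exact h0 k y hy _
  · refine (map_sum _ _ _).trans ?_
    have h1 : ∀ k, (mfderiv 𝓘(ℝ, G) 𝓘(ℝ, E) s y (ρ k y • L (x k) y) : E) =
        ρ k y • (mfderiv 𝓘(ℝ, G) 𝓘(ℝ, E) s y (Y y) : E) := fun k => by
      refine (hd s k y).trans ?_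
      by_cases hy : y ∈ tsupport (ρ k)
      · exact congrArg (fun v : E => ρ k y • v) ((hρ k).2.2 hy).2.2
      · exact (h0 k y hy _).trans (h0 k y hy _).symm
    refine (Finset.sum_congr rfl fun k _ => h1 k).trans ?_
    refine (Finset.sum_smul (M := E)).symm.trans ?_
    have hone : ∀ r : ℝ, r = 1 → ∀ v : E, r • v = v := fun r hr v => by rw [hr, one_smul]
    by_cases hy : y ∈ closure {x | Y x ≠ 0}
    · exact hone _ (hρ1 y hy) _
    · have h0 : Y y = 0 := by_contra fun h => hy (subset_closure h)
      have h2 : (mfderiv 𝓘(ℝ, G) 𝓘(ℝ, E) s y (Y y) : E) = 0 := by rw [h0]; exact map_zero _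
      exact ((congrArg (fun v : E => (∑ k, ρ k y) • v) h2).trans (smul_zero (A := E) _)).trans h2.symm

theorem pullback_add {f : X → M} {Y Z : VField G X} (hY : Y ∈ pullback f F)
    (hZ : Z ∈ pullback f F) : (fun x => Y x + Z x) ∈ pullback f F := by
  obtain ⟨hY, m, g, A, h, hYA⟩ := hY
  obtain ⟨hZ, n, g', A', h', hZA⟩ := hZ
  refine pullback_of_fintype (κ := Fin m ⊕ Fin n) (hY.add hZ) (g := Sum.elim g g')
    (Z := Sum.elim A A') (by rintro (i | i); exacts [h i, h' i]) fun x => ?_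
  rw [Fintype.sum_sum_type]
  exact (map_add (mfderiv 𝓘(ℝ, G) 𝓘(ℝ, E) f x) (Y x) (Z x)).trans
    (congrArg₂ (fun v w : E => v + w) (hYA x) (hZA x))

theorem vertical_subset_pullback (f : X → M) : vertical E f ⊆ pullback (G := G) f F :=
  fun _ hY => pullback_of_fintype (κ := Empty) (g := fun _ _ => 0) (Z := fun _ _ => 0) hY.1
    (fun i => i.elim) fun x => (hY.2 x).trans (Finset.sum_empty (M := E)).symm

end Gluing

/-- Near `u` the span `(U, t, s)` is a bi-submersion, as far as the fibres of `s` are concerned. -/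
def IsFibreAdapted (B : Type) [NormedAddCommGroup B] [NormedSpace ℝ B] {U : Type u}
    [TopologicalSpace U] [ChartedSpace (E × B) U] (F : Set (VField E M)) (s t : U → M) (u : U) :
    Prop :=
  ∃ (φ : OpenPartialHomeomorph U (E × B)) (χ : OpenPartialHomeomorph M E), IsAdaptedPair s φ χ ∧
    u ∈ φ.source ∧ VertIn F (t ∘ φ.symm) (φ u) ∧ VertGen F (t ∘ φ.symm) (φ u)

variable {B : Type} [NormedAddCommGroup B] [NormedSpace ℝ B] [FiniteDimensional ℝ E]
  [FiniteDimensional ℝ B] {U : Type u}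
  [TopologicalSpace U] [ChartedSpace (E × B) U] [IsManifold 𝓘(ℝ, E) ∞ M]
  [IsManifold 𝓘(ℝ, E × B) ∞ U] [T2Space U] [SecondCountableTopology U]
  {F : Set (VField E M)} {s t : U → M}

/-- An `s`-vertical field has only a `B`-component in the adapted chart; inserting it into the
covectors of `VertIn` yields the coefficients. -/
theorem vertical_subset_pullback_of_isFibreAdapted (ht : ContMDiff 𝓘(ℝ, E × B) 𝓘(ℝ, E) ∞ t)
    (h : ∀ u, IsFibreAdapted B F s t u) : vertical E s ⊆ pullback (G := E × B) t F := by
  rintro Y ⟨hY, hYs⟩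
  refine mem_pullback_of_local hY fun u => ?_
  obtain ⟨φ, χ, hφ, hu, ⟨κ, hκ, c, Z, hZ, hc⟩, -⟩ := h u
  refine ⟨κ, hκ, fun i x => c i (φ x) (mfderiv 𝓘(ℝ, E × B) 𝓘(ℝ, E × B) φ x (Y x) : E × B).2, Z,
    hZ, ?_⟩
  filter_upwards [(eventually_nhds_chart hu).1 hc, φ.open_source.mem_nhds hu] with x hx hxs
  have h2 : (mfderiv 𝓘(ℝ, E × B) 𝓘(ℝ, E × B) φ x (Y x) : E × B).1 = 0 := by
    refine (hφ.mfderiv_fst hxs _).trans ?_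
    rw [hYs]
    exact map_zero _
  refine ⟨fun i => ?_, ?_⟩
  · have h1 : ContMDiffAt 𝓘(ℝ, E × B) 𝓘(ℝ, B →L[ℝ] ℝ) ∞ (fun x => c i (φ x)) x :=
      (hx.1 i).contMDiffAt.comp x (contMDiffAt_of_mem_maximalAtlas hφ.mem_maximalAtlas hxs)
    have h3 : ContMDiffAt 𝓘(ℝ, E × B) 𝓘(ℝ, B) ∞
        (fun x => (mfderiv 𝓘(ℝ, E × B) 𝓘(ℝ, E × B) φ x (Y x) : E × B).2) x :=
      ContMDiffAt.comp (g := Prod.snd) x contDiff_snd.contMDiff.contMDiffAt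
        (SmoothFieldAt.mfderiv_apply (hY.1 x) φ.open_source hxs
          (contMDiffOn_of_mem_maximalAtlas hφ.mem_maximalAtlas))
    exact h1.clm_apply h3
  · have h3 := mfderiv_eq_mfderiv_comp_symm hφ.mem_maximalAtlas hxs
      ((ht x).mdifferentiableAt (by simp)) (Y x)
    refine h3.trans ?_
    have h4 := hx.2 (mfderiv 𝓘(ℝ, E × B) 𝓘(ℝ, E × B) φ x (Y x) : E × B).2
    have h5 : ((0, (mfderiv 𝓘(ℝ, E × B) 𝓘(ℝ, E × B) φ x (Y x) : E × B).2) : E × B) =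
      mfderiv 𝓘(ℝ, E × B) 𝓘(ℝ, E × B) φ x (Y x) := Prod.ext h2.symm rfl
    rw [h5] at h4
    refine h4.trans (Finset.sum_congr rfl fun i _ => ?_)
    exact congrArg (fun v : E => c i (φ x) (mfderiv 𝓘(ℝ, E × B) 𝓘(ℝ, E × B) φ x (Y x) : E × B).2 • v)
      (vfield_congr (Z i) (congrArg t (φ.left_inv hxs)))

/-- `VertGen` along the fibres of `t` provides a `t`-vertical field with the same image under the
differential of `s` as `Y`; the difference is `s`-vertical. -/
theorem pullback_subset_of_isFibreAdapted (hs : ContMDiff 𝓘(ℝ, E × B) 𝓘(ℝ, E) ∞ s) (h : ∀ u, IsFibreAdapted B F t s u) :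
    pullback (G := E × B) s F ⊆
      {Y | ∃ Y₁ ∈ vertical E s, ∃ Y₂ ∈ vertical E t, Y = fun u => Y₁ u + Y₂ u} := by
  rintro Y ⟨hY, n, g, Z, hg, hYg⟩
  obtain ⟨Y₂, hY₂, hY₂s⟩ := exists_vertical_lift (s := s) (t := t) hY fun u => by
    obtain ⟨φ, χ, hφ, hu, -, hV⟩ := h u
    choose e he using fun i => hV (Z i) (hg i).2
    refine ⟨fun x => (mfderiv 𝓘(ℝ, E × B) 𝓘(ℝ, E × B) φ.symm (φ x)
      ((0, ∑ i, g i x • e i (φ x)) : E × B) : E × B), ?_⟩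
    filter_upwards [eventually_all.2 fun i => (eventually_nhds_chart hu).1 (he i),
      φ.open_source.mem_nhds hu] with x hx hxs
    refine ⟨?_, ?_, ?_⟩
    · refine smoothFieldAt_symm hφ.mem_maximalAtlas hxs ?_
      refine contMDiffAt_const.prodMk_space ?_
      refine ContMDiffAt.sum fun i _ => ContMDiffAt.smul ((hg i).1.1 x) ?_
      exact (hx i).1.contMDiffAt.comp x (contMDiffAt_of_mem_maximalAtlas hφ.mem_maximalAtlas hxs)
    · exact (hφ.mfderiv_symm hxs _).trans (map_zero _)
    · have h1 := mfderiv_comp_symm_apply hφ.mem_maximalAtlas (φ.map_source hxs) (φ.left_inv hxs)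
        ((hs x).mdifferentiableAt (by simp)) ((0, ∑ i, g i x • e i (φ x)) : E × B)
      refine h1.symm.trans (Eq.trans ?_ (hYg x).symm)
      have h2 : ((0, ∑ i, g i x • e i (φ x)) : E × B) =
          ∑ i, g i x • ((0, e i (φ x)) : E × B) := by
        refine Prod.ext ?_ ?_
        · simp [Prod.fst_sum]
        · simp [Prod.snd_sum]
      rw [h2]
      refine (map_sum (mfderiv 𝓘(ℝ, E × B) 𝓘(ℝ, E) (s ∘ φ.symm) (φ x)) _ _).trans ?_
      refine Finset.sum_congr rfl fun i _ => ?_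
      refine ((mfderiv 𝓘(ℝ, E × B) 𝓘(ℝ, E) (s ∘ φ.symm) (φ x)).map_smul _ _).trans ?_
      refine (congrArg (fun v : E => g i x • v) (hx i).2).trans ?_
      exact congrArg (fun v : E => g i x • v) (vfield_congr (Z i) (congrArg s (φ.left_inv hxs)))
  refine ⟨fun x => Y x - Y₂ x, ⟨hY.sub hY₂.1, fun x => ?_⟩, Y₂, hY₂, by
    funext x; exact (sub_add_cancel _ _).symm⟩
  refine (map_sub _ _ _).trans ?_
  exact sub_eq_zero.2 (hY₂s x).symm

/-- `VertIn` on one side gives the inclusion of vertical fields in the opposite pull-back, and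
`VertGen` gives the decomposition of the pull-back into vertical fields. Both sides identify the two
pull-backs with the same sum. -/
theorem isBisubmersion_of_isFibreAdapted {A : Span E M}
    (hA : T2Space A.carrier) (hA' : SecondCountableTopology A.carrier)
    (h : ∀ u, IsFibreAdapted A.fib F A.s A.t u) (h' : ∀ u, IsFibreAdapted A.fib F A.t A.s u) :
    IsBisubmersion F A := by
  have hs : Manifold.IsSubmersion 𝓘(ℝ, E × A.fib) 𝓘(ℝ, E) ∞ A.s :=
    isSubmersion_of_isAdaptedPair fun u => by
      obtain ⟨φ, χ, h1, h2, -⟩ := h u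
      exact ⟨φ, χ, h1, h2⟩
  have ht : Manifold.IsSubmersion 𝓘(ℝ, E × A.fib) 𝓘(ℝ, E) ∞ A.t :=
    isSubmersion_of_isAdaptedPair fun u => by
      obtain ⟨φ, χ, h1, h2, -⟩ := h' u
      exact ⟨φ, χ, h1, h2⟩
  have key : ∀ {s t : A.carrier → M}, Manifold.IsSubmersion 𝓘(ℝ, E × A.fib) 𝓘(ℝ, E) ∞ s →
      Manifold.IsSubmersion 𝓘(ℝ, E × A.fib) 𝓘(ℝ, E) ∞ t → (∀ u, IsFibreAdapted A.fib F s t u) →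
      (∀ u, IsFibreAdapted A.fib F t s u) → pullback (G := E × A.fib) s F =
        {Y | ∃ Y₁ ∈ vertical E s, ∃ Y₂ ∈ vertical E t, Y = fun u => Y₁ u + Y₂ u} :=
    fun {s t} hs ht h h' => Subset.antisymm (pullback_subset_of_isFibreAdapted hs.contMDiff h')
      (by
        rintro _ ⟨Y₁, h₁, Y₂, h₂, rfl⟩
        exact pullback_add (vertical_subset_pullback s h₁)
          (vertical_subset_pullback_of_isFibreAdapted hs.contMDiff h' h₂))
  refine ⟨hA, hA', hs, ht, ?_, key hs ht h h'⟩
  rw [key hs ht h h', key ht hs h' h]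
  ext Y
  constructor
  · rintro ⟨Y₁, h₁, Y₂, h₂, rfl⟩
    exact ⟨Y₂, h₂, Y₁, h₁, funext fun u => add_comm _ _⟩
  · rintro ⟨Y₁, h₁, Y₂, h₂, rfl⟩
    exact ⟨Y₂, h₂, Y₁, h₁, funext fun u => add_comm _ _⟩

theorem IsBisubmersion.inv {A : Span E M} (h : IsBisubmersion F A) : IsBisubmersion F A.inv where
  t2 := h.t2
  secondCountable := h.secondCountable
  submersion_s := h.submersion_t
  submersion_t := h.submersion_s
  pullback_eq := h.pullback_eq.symm
  pullback_eq_add := h.pullback_eq.symm.trans <| h.pullback_eq_add.trans <| by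
    ext Y
    constructor
    · rintro ⟨Y₁, h₁, Y₂, h₂, rfl⟩
      exact ⟨Y₂, h₂, Y₁, h₁, funext fun u => add_comm _ _⟩
    · rintro ⟨Y₁, h₁, Y₂, h₂, rfl⟩
      exact ⟨Y₂, h₂, Y₁, h₁, funext fun u => add_comm _ _⟩

/-- Decompose `Y` as `Y + 0`. -/
theorem IsBisubmersion.vertical_subset {A : Span E M} (h : IsBisubmersion F A) :
    vertical E A.s ⊆ pullback (G := E × A.fib) A.t F := by
  intro Y hY
  rw [← h.pullback_eq, h.pullback_eq_add]
  have := h.t2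
  exact ⟨Y, hY, fun _ => 0, ⟨isSmoothCompact_zero, fun x => map_zero _⟩,
    funext fun u => (add_zero _).symm⟩

theorem IsBisubmersion.vertIn {A : Span E M} (h : IsBisubmersion F A)
    {φ : OpenPartialHomeomorph A.carrier (E × A.fib)} {χ : OpenPartialHomeomorph M E}
    (hφ : IsAdaptedPair A.s φ χ) {u : A.carrier} (hu : u ∈ φ.source) :
    VertIn F (A.t ∘ φ.symm) (φ u) := by
  have := h.t2
  exact vertIn_of_subset hφ hu h.submersion_t.contMDiff h.vertical_subset

theorem IsBisubmersion.horIn (hF : ∀ Z ∈ F, IsSmoothCompact Z) {A : Span E M}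
    (h : IsBisubmersion F A)
    {φ : OpenPartialHomeomorph A.carrier (E × A.fib)} {χ : OpenPartialHomeomorph M E}
    (hφ : IsAdaptedPair A.s φ χ) {u : A.carrier} (hu : u ∈ φ.source) :
    HorIn F χ (A.t ∘ φ.symm) (φ u) := by
  have := h.t2
  exact horIn_of_subset hφ hu hF h.submersion_t.contMDiff h.pullback_eq.subset

theorem IsBisubmersion.vertGen (hF : ∀ Z ∈ F, IsSmoothCompact Z) {A : Span E M}
    (h : IsBisubmersion F A)
    {φ : OpenPartialHomeomorph A.carrier (E × A.fib)} {χ : OpenPartialHomeomorph M E}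
    (hφ : IsAdaptedPair A.s φ χ) {u : A.carrier} (hu : u ∈ φ.source) :
    VertGen F (A.t ∘ φ.symm) (φ u) := by
  have := h.t2
  obtain ⟨⟨φ', χ'⟩, hφ', hu'⟩ := exists_isAdaptedPair h.submersion_t u
  exact vertGen_of_subset hφ hφ' hu hu' hF (h.pullback_eq.symm.trans h.pullback_eq_add).subset

end Criterion

/-! ### Local morphisms between bi-submersions near units -/

section Morphisms

variable {E B C : Type} [NormedAddCommGroup E] [NormedSpace ℝ E] [FiniteDimensional ℝ E]
  [NormedAddCommGroup B] [NormedSpace ℝ B] [FiniteDimensional ℝ B]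
  [NormedAddCommGroup C] [NormedSpace ℝ C] [FiniteDimensional ℝ C]
  {M U W : Type u} [TopologicalSpace M] [ChartedSpace E M] [IsManifold 𝓘(ℝ, E) ∞ M]
  [TopologicalSpace U] [ChartedSpace (E × B) U] [IsManifold 𝓘(ℝ, E × B) ∞ U]
  [TopologicalSpace W] [ChartedSpace (E × C) W] [IsManifold 𝓘(ℝ, E × C) ∞ W]

theorem chartField_apply {χ : OpenPartialHomeomorph M E} {x : M} (hx : x ∈ χ.source)
    (Z : VField E M) : chartField χ Z (χ x) = (mfderiv 𝓘(ℝ, E) 𝓘(ℝ, E) χ x (Z x) : E) := by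
  simp only [chartField]
  rw [χ.left_inv hx]

theorem hasFDerivAt_chart_comp {H : Type} [NormedAddCommGroup H] [NormedSpace ℝ H]
    {χ : OpenPartialHomeomorph M E} (hχ : χ ∈ IsManifold.maximalAtlas 𝓘(ℝ, E) ∞ M) {τ : H → M}
    {p : H} (hτ : ContMDiffAt 𝓘(ℝ, H) 𝓘(ℝ, E) ∞ τ p) (hp : τ p ∈ χ.source) :
    HasFDerivAt (χ ∘ τ) ((mfderiv 𝓘(ℝ, E) 𝓘(ℝ, E) χ (τ p) : E →L[ℝ] E).comp
      (mfderiv 𝓘(ℝ, H) 𝓘(ℝ, E) τ p : H →L[ℝ] E)) p := by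
  have h1 := (hτ.mdifferentiableAt (by simp)).hasMFDerivAt
  have h2 := ((contMDiffAt_of_mem_maximalAtlas hχ hp).mdifferentiableAt (by simp)).hasMFDerivAt
  exact (h2.comp p h1).hasFDerivAt

variable {s t : U → M} {s' t' : W → M} {F : Set (VField E M)}
  {φ : OpenPartialHomeomorph U (E × B)} {χ χ' : OpenPartialHomeomorph M E}
  {ψ : OpenPartialHomeomorph W (E × C)}

/-- The map `t` in a chart adapted to `s` for which `E × {0}` corresponds to units. -/
def IsUnitChart (t : U → M) (φ : OpenPartialHomeomorph U (E × B)) (χ : OpenPartialHomeomorph M E)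
    (v : U) : Prop :=
  v ∈ φ.source ∧ (φ v).2 = 0 ∧ ∀ᶠ a in 𝓝 (φ v).1, t (φ.symm (a, 0)) = χ.symm a

/-- The manifold form of `exists_factorization`, with `S` and `T` the two target maps read in the
chart `χ` of `M`. The unit condition makes them agree on `E × {0}`, since both restrict to the
inclusion of `M` there. -/
theorem exists_fibre_factorization (hF : ∀ Z ∈ F, IsSmoothCompact Z)
    (hφ : IsAdaptedPair s φ χ) (hψ : IsAdaptedPair s' ψ χ')
    (ht : ContMDiff 𝓘(ℝ, E × B) 𝓘(ℝ, E) ∞ t) (ht' : ContMDiff 𝓘(ℝ, E × C) 𝓘(ℝ, E) ∞ t')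
    {v : U} {w : W} (hv : IsUnitChart t φ χ v) (hw : IsUnitChart t' ψ χ' w)
    (hvw : s v = s' w) (hA : VertIn F (t ∘ φ.symm) (φ v)) (hB : VertGen F (t' ∘ ψ.symm) (ψ w)) :
    ∃ g : E × B → C, (∀ᶠ p in 𝓝 (φ v), ContDiffAt ℝ ∞ g p ∧
      (χ' (χ.symm p.1), g p) ∈ ψ.target ∧
        t' (ψ.symm (χ' (χ.symm p.1), g p)) = t (φ.symm p)) ∧
      ∀ᶠ a in 𝓝 (φ v).1, g (a, 0) = 0 := by
  obtain ⟨hvs, hv0, hv1⟩ := hv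
  obtain ⟨hws, hw0, hw1⟩ := hw
  obtain ⟨κ, _, c, Z, hZ, hc⟩ := hA
  choose e he using fun i => hB (Z i) (hZ i)
  set a₀ : E := (φ v).1 with ha₀
  have hp₀ : φ v = (a₀, 0) := Prod.ext rfl hv0
  have hχv : s v ∈ χ.source := hφ.mapsTo v hvs
  have ha₀χ : a₀ = χ (s v) := hφ.eq v hvs
  have hχa : χ.symm a₀ = s v := by rw [ha₀χ, χ.left_inv hχv]
  have ha₀t : a₀ ∈ χ.target := ha₀χ ▸ χ.map_source hχv
  have hχw : s v ∈ χ'.source := hvw ▸ hψ.mapsTo w hws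
  have hκ₀ : χ' (χ.symm a₀) = (ψ w).1 := by rw [hχa, hvw, hψ.eq w hws]
  have hq₀ : (χ' (χ.symm a₀), (0 : C)) = ψ w := Prod.ext hκ₀ hw0.symm
  have htv : t v = s v := by
    have := hv1.self_of_nhds
    rw [← hχa, ← this, ← hp₀, φ.left_inv hvs]
  have htw : t' w = s v := by
    have h1 := hw1.self_of_nhds
    have h2 : ψ.symm ((ψ w).1, 0) = w := by rw [← hw0, Prod.mk.eta, ψ.left_inv hws]
    rw [h2, ← hκ₀, hχa, χ'.left_inv hχw] at h1
    exact h1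
  have hκs : ∀ᶠ a in 𝓝 a₀, a ∈ χ.target ∧ χ.symm a ∈ χ'.source ∧
      ContDiffAt ℝ ∞ (fun a => χ' (χ.symm a)) a := by
    have h1 : ∀ᶠ a in 𝓝 a₀, χ.symm a ∈ χ'.source :=
      (χ.continuousAt_symm ha₀t).eventually (hχa ▸ χ'.open_source.mem_nhds hχw)
    filter_upwards [χ.open_target.mem_nhds ha₀t, h1] with a h2 h3
    refine ⟨h2, h3, ?_⟩
    exact (ContMDiffAt.comp (g := χ') a (contMDiffAt_of_mem_maximalAtlas hψ.mem_maximalAtlas' h3)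
      (contMDiffAt_symm_of_mem_maximalAtlas hφ.mem_maximalAtlas' h2)).contDiffAt
  -- The two source charts may use different charts of `M`; `K` changes the base coordinate from `χ`
  -- to `χ'` and leaves the fibres alone.
  set K : E × C → E × C := fun p => (χ' (χ.symm p.1), p.2) with hK
  have hKs : ∀ᶠ p in 𝓝 ((a₀, 0) : E × C), ContDiffAt ℝ ∞ K p := by
    filter_upwards [(continuous_fst.tendsto ((a₀, 0) : E × C)).eventually hκs] with p hp
    exact (hp.2.2.comp p contDiffAt_fst).prodMk contDiffAt_snd
  have hKc : Tendsto K (𝓝 (a₀, 0)) (𝓝 (ψ w)) := by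
    have h : Tendsto K (𝓝 (a₀, 0)) (𝓝 (K (a₀, 0))) := hKs.self_of_nhds.continuousAt
    rwa [show K (a₀, 0) = ψ w from hq₀] at h
  have hSt : ∀ᶠ p in 𝓝 (φ v), p ∈ φ.target ∧ t (φ.symm p) ∈ χ.source := by
    refine (φ.open_target.eventually_mem (φ.map_source hvs)).and ?_
    have h1 : Tendsto (fun p => t (φ.symm p)) (𝓝 (φ v)) (𝓝 (t v)) := by
      have := (ht.continuous.tendsto _).comp (φ.continuousAt_symm (φ.map_source hvs)).tendsto
      rwa [φ.left_inv hvs] at this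
    exact h1.eventually (χ.open_source.mem_nhds (htv ▸ hχv))
  have hTt : ∀ᶠ p in 𝓝 (ψ w), p ∈ ψ.target ∧ t' (ψ.symm p) ∈ χ.source := by
    refine (ψ.open_target.eventually_mem (ψ.map_source hws)).and ?_
    have h1 : Tendsto (fun p => t' (ψ.symm p)) (𝓝 (ψ w)) (𝓝 (t' w)) := by
      have := (ht'.continuous.tendsto _).comp (ψ.continuousAt_symm (ψ.map_source hws)).tendsto
      rwa [ψ.left_inv hws] at this
    exact h1.eventually (χ.open_source.mem_nhds (htw ▸ hχv))
  have hτ : ∀ p ∈ φ.target, ContMDiffAt 𝓘(ℝ, E × B) 𝓘(ℝ, E) ∞ (t ∘ φ.symm) p := fun p hp =>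
    (ht _).comp p (contMDiffAt_symm_of_mem_maximalAtlas hφ.mem_maximalAtlas hp)
  have hτ' : ∀ p ∈ ψ.target, ContMDiffAt 𝓘(ℝ, E × C) 𝓘(ℝ, E) ∞ (t' ∘ ψ.symm) p := fun p hp =>
    (ht' _).comp p (contMDiffAt_symm_of_mem_maximalAtlas hψ.mem_maximalAtlas hp)
  rw [hp₀] at hc hSt
  have key := exists_factorization (S := χ ∘ (t ∘ φ.symm)) (T := fun p => χ (t' (ψ.symm (K p))))
    (c := c) (e := fun i p => e i (K p)) (X := fun i => chartField χ (Z i)) (a₀ := a₀)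
    (fun i => hc.mono fun p hp => hp.1 i)
    (fun i => by
      filter_upwards [hKs, hKc.eventually (he i)] with p h1 h2
      exact h2.1.comp p h1)
    (fun i => by
      have h1 : (χ ∘ (t ∘ φ.symm)) (a₀, 0) ∈ χ.target := by
        rw [← hp₀]
        simp only [Function.comp, φ.left_inv hvs, htv]
        exact χ.map_source hχv
      exact ((contDiffOn_chartField hφ.mem_maximalAtlas' (hF _ (hZ i))).contDiffAt
        (χ.open_target.mem_nhds h1)).of_le (by simp))
    (by
      filter_upwards [hc, hSt] with p h1 h2
      have h3 := hasFDerivAt_chart_comp hφ.mem_maximalAtlas' (hτ p h2.1) h2.2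
      refine ⟨HasFDerivAt.differentiableAt h3, fun b => ?_⟩
      have h9 : fderiv ℝ (χ ∘ (t ∘ φ.symm)) p = _ := HasFDerivAt.fderiv h3
      rw [h9]
      refine (congrArg (fun v : E => (mfderiv 𝓘(ℝ, E) 𝓘(ℝ, E) χ ((t ∘ φ.symm) p) v : E))
        (h1.2 b)).trans ?_
      refine (map_sum (mfderiv 𝓘(ℝ, E) 𝓘(ℝ, E) χ ((t ∘ φ.symm) p)) _ _).trans ?_
      refine Finset.sum_congr rfl fun i _ => ?_
      refine ((mfderiv 𝓘(ℝ, E) 𝓘(ℝ, E) χ ((t ∘ φ.symm) p)).map_smul _ _).trans ?_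
      exact congrArg (fun v : E => c i p b • v) (chartField_apply h2.2 (Z i)).symm)
    (by
      filter_upwards [hKc.eventually hTt, hKs, hKc.eventually (eventually_all.2 he),
        (continuous_fst.tendsto ((a₀, 0) : E × C)).eventually hκs] with p h1 h2 h3 h4
      have h5 := hasFDerivAt_chart_comp hφ.mem_maximalAtlas' (hτ' _ h1.1) h1.2
      have h6 : HasFDerivAt (fun p : E × C => χ' (χ.symm p.1))
          ((fderiv ℝ (fun a => χ' (χ.symm a)) p.1).comp (ContinuousLinearMap.fst ℝ E C)) p :=
        HasFDerivAt.comp (g := fun a => χ' (χ.symm a)) p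
          ((h4.2.2.differentiableAt (by simp)).hasFDerivAt) hasFDerivAt_fst
      have h7 : HasFDerivAt K _ p := h6.prodMk hasFDerivAt_snd
      have h8 := h5.comp p h7
      refine ⟨h8.differentiableAt, fun i => ?_⟩
      have h9 : fderiv ℝ (fun p => χ (t' (ψ.symm (K p)))) p = _ := h8.fderiv
      rw [h9]
      have h10 := (h3 i).2
      have h11 : (((fderiv ℝ (fun a => χ' (χ.symm a)) p.1).comp
          (ContinuousLinearMap.fst ℝ E C)).prod (ContinuousLinearMap.snd ℝ E C))
            ((0, e i (K p)) : E × C) = (0, e i (K p)) := by simp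
      refine (congrArg (fun v : E × C => (mfderiv 𝓘(ℝ, E) 𝓘(ℝ, E) χ ((t' ∘ ψ.symm) (K p))
        (mfderiv 𝓘(ℝ, E × C) 𝓘(ℝ, E) (t' ∘ ψ.symm) (K p) v) : E)) h11).trans ?_
      refine (congrArg (fun v : E => (mfderiv 𝓘(ℝ, E) 𝓘(ℝ, E) χ ((t' ∘ ψ.symm) (K p)) v : E))
        h10).trans ?_
      exact (chartField_apply h1.2 (Z i)).symm)
    (by
      have h1 : Tendsto (fun a : E => χ' (χ.symm a)) (𝓝 a₀) (𝓝 (ψ w).1) := by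
        have := hκs.self_of_nhds.2.2.continuousAt.tendsto
        rwa [hκ₀] at this
      filter_upwards [hv1, h1.eventually hw1, hκs] with a h2 h3 h4
      simp only [Function.comp, hK, h2, h3, χ'.left_inv h4.2.1])
  obtain ⟨g, hg, hg0⟩ := key
  refine ⟨g, ?_, hg0⟩
  have hgc : Tendsto (fun p : E × B => ((p.1, g p) : E × C)) (𝓝 (a₀, 0)) (𝓝 (a₀, 0)) := by
    have h1 : ContinuousAt g (a₀, 0) := hg.self_of_nhds.1.continuousAt
    have h2 := hg0.self_of_nhds
    have h3 : ContinuousAt (fun p : E × B => ((p.1, g p) : E × C)) (a₀, 0) :=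
      continuousAt_fst.prodMk h1
    simpa [ContinuousAt, h2] using h3
  rw [hp₀]
  filter_upwards [hg, hSt, hgc.eventually (hKc.eventually hTt)] with p h1 h2 h3
  exact ⟨h1.1, h3.1, χ.injOn h3.2 h2.2 h1.2⟩

end Morphisms

/-! ### Pointwise adaptedness, unit points and flattened sections -/

section Adaptedness

variable {E : Type} [NormedAddCommGroup E] [NormedSpace ℝ E] {M : Type u} [TopologicalSpace M]
  [ChartedSpace E M]

/-- Near `u` there is a morphism of bi-submersions from `A` to `B`. -/
def AdaptedAt (A B : Span E M) (u : A.carrier) : Prop :=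
  ∃ f : A.carrier → B.carrier, ∀ᶠ x in 𝓝 u,
    ContMDiffAt 𝓘(ℝ, E × A.fib) 𝓘(ℝ, E × B.fib) ∞ f x ∧ B.s (f x) = A.s x ∧ B.t (f x) = A.t x

theorem isAdapted_iff {ι : Type*} {A : Span E M} {𝒰 : ι → Span E M} :
    IsAdapted A 𝒰 ↔ ∀ u, ∃ i, AdaptedAt A (𝒰 i) u := by
  refine forall_congr' fun u => exists_congr fun i => ⟨?_, ?_⟩
  · rintro ⟨O, f, hO, hu, hf, hst⟩
    refine ⟨f, ?_⟩
    filter_upwards [hO.mem_nhds hu] with x hx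
    exact ⟨hf.contMDiffAt (hO.mem_nhds hx), hst x hx⟩
  · rintro ⟨f, hf⟩
    obtain ⟨O, hOf, hO, hu⟩ := eventually_nhds_iff.1 hf
    exact ⟨O, f, hO, hu, fun x hx => (hOf x hx).1.contMDiffWithinAt, fun x hx => (hOf x hx).2⟩

/-- The source `A` need not be a bi-submersion here: composing local morphisms is all that is
involved. -/
theorem AdaptedAt.of_map {A B C : Span E M} {u : A.carrier} {f : A.carrier → B.carrier}
    (hf : ∀ᶠ x in 𝓝 u, ContMDiffAt 𝓘(ℝ, E × A.fib) 𝓘(ℝ, E × B.fib) ∞ f x ∧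
      B.s (f x) = A.s x ∧ B.t (f x) = A.t x) (h : AdaptedAt B C (f u)) : AdaptedAt A C u := by
  obtain ⟨g, hg⟩ := h
  refine ⟨g ∘ f, ?_⟩
  filter_upwards [hf, hf.self_of_nhds.1.continuousAt.eventually hg] with x h1 h2
  exact ⟨h2.1.comp x h1.1, h2.2.1.trans h1.2.1, h2.2.2.trans h1.2.2⟩

theorem AdaptedAt.inv {A B : Span E M} {u : A.carrier} (h : AdaptedAt A B u) :
    AdaptedAt A.inv B.inv u := by
  obtain ⟨f, hf⟩ := h
  exact ⟨f, hf.mono fun x hx => ⟨hx.1, hx.2.2, hx.2.1⟩⟩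

theorem AdaptedAt.refl (A : Span E M) (u : A.carrier) : AdaptedAt A A u :=
  ⟨id, Eventually.of_forall fun _ => ⟨contMDiffAt_id, rfl, rfl⟩⟩

theorem AdaptedAt.eventually {A B : Span E M} {u : A.carrier} (h : AdaptedAt A B u) :
    ∀ᶠ x in 𝓝 u, AdaptedAt A B x := by
  obtain ⟨f, hf⟩ := h
  filter_upwards [hf.eventually_nhds] with x hx
  exact ⟨f, hx⟩

/-- `A` has a chart at `v` that is adapted to `s` and in which `E × {0}` consists of units. -/
def IsUnitPoint (A : Span E M) (v : A.carrier) : Prop :=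
  ∃ (φ : OpenPartialHomeomorph A.carrier (E × A.fib)) (χ : OpenPartialHomeomorph M E),
    IsAdaptedPair A.s φ χ ∧ IsUnitChart A.t φ χ v

variable [FiniteDimensional ℝ E] [IsManifold 𝓘(ℝ, E) ∞ M] {F : Set (VField E M)}

/-- In charts the morphism keeps the base point and sends the fibre coordinate through the solution
`g` of the lifted differential equation. This is the source of all morphisms that are not given by
an atlas. -/
theorem IsUnitPoint.adaptedAt (hF : ∀ Z ∈ F, IsSmoothCompact Z) {A B : Span E M}
    (hA : IsBisubmersion F A) (hB : IsBisubmersion F B) {v : A.carrier} {w : B.carrier}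
    (hv : IsUnitPoint A v) (hw : IsUnitPoint B w) (hvw : A.s v = B.s w) : AdaptedAt A B v := by
  obtain ⟨φ, χ, hφ, hv⟩ := hv
  obtain ⟨ψ, χ', hψ, hw⟩ := hw
  obtain ⟨g, hg, -⟩ := exists_fibre_factorization hF hφ hψ hA.submersion_t.contMDiff
    hB.submersion_t.contMDiff hv hw hvw (hA.vertIn hφ hv.1) (hB.vertGen hF hψ hw.1)
  refine ⟨fun x => ψ.symm (χ' (χ.symm (φ x).1), g (φ x)), ?_⟩
  have hw' : A.s v ∈ χ'.source := hvw ▸ hψ.mapsTo w hw.1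
  have hs : ∀ᶠ x in 𝓝 v, A.s x ∈ χ'.source :=
    hA.submersion_s.contMDiff.continuous.continuousAt.eventually (χ'.open_source.mem_nhds hw')
  filter_upwards [(eventually_nhds_chart hv.1).1 hg, φ.open_source.mem_nhds hv.1, hs]
    with x h1 h2 h3
  have h4 : χ.symm (φ x).1 = A.s x := by rw [hφ.eq x h2, χ.left_inv (hφ.mapsTo x h2)]
  have h5 : ContMDiffAt 𝓘(ℝ, E × A.fib) 𝓘(ℝ, E) ∞ (fun x => χ' (χ.symm (φ x).1)) x := by
    have h6 : ContMDiffAt 𝓘(ℝ, E × A.fib) 𝓘(ℝ, E) ∞ (fun x => χ' (A.s x)) x :=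
      (contMDiffAt_of_mem_maximalAtlas hψ.mem_maximalAtlas' h3).comp x
        (hA.submersion_s.contMDiff x)
    refine h6.congr_of_eventuallyEq ?_
    filter_upwards [φ.open_source.mem_nhds h2] with y hy
    rw [hφ.eq y hy, χ.left_inv (hφ.mapsTo y hy)]
  have h6 : ContMDiffAt 𝓘(ℝ, E × A.fib) 𝓘(ℝ, B.fib) ∞ (fun x => g (φ x)) x :=
    h1.1.contMDiffAt.comp x (contMDiffAt_of_mem_maximalAtlas hφ.mem_maximalAtlas h2)
  refine ⟨ContMDiffAt.comp (g := ψ.symm) x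
    (contMDiffAt_symm_of_mem_maximalAtlas hψ.mem_maximalAtlas h1.2.1) (h5.prodMk_space h6), ?_, ?_⟩
  · have h7 := hψ.eq _ (ψ.map_target h1.2.1)
    rw [ψ.right_inv h1.2.1, h4] at h7
    exact (χ'.injOn (hψ.mapsTo _ (ψ.map_target h1.2.1)) h3 (by rw [h4]; exact h7.symm))
  · rw [h1.2.2, φ.left_inv h2]

/-- The shear `(a, y) ↦ (a, y - h a)` over `N`. -/
def shear {B : Type} [NormedAddCommGroup B] [NormedSpace ℝ B] {h : E → B} {N : Set E}
    (hN : IsOpen N) (hh : ContDiffOn ℝ ∞ h N) : OpenPartialHomeomorph (E × B) (E × B) where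
  toFun p := (p.1, p.2 - h p.1)
  invFun p := (p.1, p.2 + h p.1)
  source := Prod.fst ⁻¹' N
  target := Prod.fst ⁻¹' N
  map_source' _ hp := hp
  map_target' _ hp := hp
  left_inv' p _ := by simp
  right_inv' p _ := by simp
  open_source := hN.preimage continuous_fst
  open_target := hN.preimage continuous_fst
  continuousOn_toFun := continuousOn_fst.prodMk (continuousOn_snd.sub
    (hh.continuousOn.comp continuousOn_fst fun _ hp => hp))
  continuousOn_invFun := continuousOn_fst.prodMk (continuousOn_snd.add
    (hh.continuousOn.comp continuousOn_fst fun _ hp => hp))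

theorem IsAdaptedPair.shear {B : Type} [NormedAddCommGroup B] [NormedSpace ℝ B] {U : Type u}
    [TopologicalSpace U] [ChartedSpace (E × B) U] [IsManifold 𝓘(ℝ, E × B) ∞ U] {s : U → M}
    {φ : OpenPartialHomeomorph U (E × B)} {χ : OpenPartialHomeomorph M E}
    (hφ : IsAdaptedPair s φ χ) {h : E → B} {N : Set E} (hN : IsOpen N)
    (hh : ContDiffOn ℝ ∞ h N) : IsAdaptedPair s (φ.trans (SingFol.shear hN hh)) χ where
  mem_maximalAtlas := by
    refine OpenPartialHomeomorph.mem_maximalAtlas_of_contMDiffOn _ (fun x hx => ?_) fun p hp => ?_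
    · rw [OpenPartialHomeomorph.trans_source] at hx
      have h1 : ContDiffAt ℝ ∞ (fun p : E × B => (p.1, p.2 - h p.1)) (φ x) :=
        contDiffAt_fst.prodMk (contDiffAt_snd.sub
          ((hh.contDiffAt (hN.mem_nhds hx.2)).comp (φ x) contDiffAt_fst))
      exact (h1.contMDiffAt.comp x (contMDiffAt_of_mem_maximalAtlas hφ.mem_maximalAtlas
        hx.1)).contMDiffWithinAt
    · rw [OpenPartialHomeomorph.trans_target] at hp
      have h1 : ContDiffAt ℝ ∞ (fun p : E × B => (p.1, p.2 + h p.1)) p :=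
        contDiffAt_fst.prodMk (contDiffAt_snd.add
          ((hh.contDiffAt (hN.mem_nhds hp.1)).comp p contDiffAt_fst))
      exact (ContMDiffAt.comp (g := φ.symm) p (contMDiffAt_symm_of_mem_maximalAtlas
        hφ.mem_maximalAtlas hp.2) h1.contMDiffAt).contMDiffWithinAt
  mem_maximalAtlas' := hφ.mem_maximalAtlas'
  mapsTo x hx := hφ.mapsTo x (by rw [OpenPartialHomeomorph.trans_source] at hx; exact hx.1)
  eq x hx := hφ.eq x (by rw [OpenPartialHomeomorph.trans_source] at hx; exact hx.1)

/-- A chart adapted to `s` in which the image of a given local section of `s` is `E × {0}`. -/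
theorem exists_isAdaptedPair_section {B : Type} [NormedAddCommGroup B] [NormedSpace ℝ B]
    {U : Type u} [TopologicalSpace U] [ChartedSpace (E × B) U] [IsManifold 𝓘(ℝ, E × B) ∞ U]
    {s : U → M} {φ₁ : OpenPartialHomeomorph U (E × B)} {χ : OpenPartialHomeomorph M E}
    (hφ : IsAdaptedPair s φ₁ χ) {v : U} (hv : v ∈ φ₁.source) {e : M → U}
    (he : ∀ᶠ x in 𝓝 (s v), ContMDiffAt 𝓘(ℝ, E) 𝓘(ℝ, E × B) ∞ e x ∧ s (e x) = x)
    (hev : e (s v) = v) :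
    ∃ φ : OpenPartialHomeomorph U (E × B), IsAdaptedPair s φ χ ∧ v ∈ φ.source ∧
      (∀ u ∈ φ.source, (φ u).2 = 0 ↔ u = e (s u)) ∧ (φ v).2 = 0 ∧
      ∀ᶠ a in 𝓝 (φ v).1, φ.symm (a, 0) = e (χ.symm a) := by
  have hχv := hφ.mapsTo v hv
  have ha₀ : χ (s v) ∈ χ.target := χ.map_source hχv
  have h1 : ∀ᶠ x in 𝓝 (s v), (ContMDiffAt 𝓘(ℝ, E) 𝓘(ℝ, E × B) ∞ e x ∧ s (e x) = x) ∧
      e x ∈ φ₁.source := he.and (he.self_of_nhds.1.continuousAt.eventually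
        (φ₁.open_source.mem_nhds (by rwa [hev])))
  have h2 := (eventually_nhds_chart_symm hχv).1 h1
  obtain ⟨N, hNP, hN, haN⟩ := eventually_nhds_iff.1 (h2.and (χ.open_target.eventually_mem ha₀))
  -- In `φ₁` the section is the graph of `h`; the shear by `h` moves the graph to `E × {0}` and
  -- respects the projection to `E`.
  set h : E → B := fun a => (φ₁ (e (χ.symm a))).2 with hh
  have hhs : ContDiffOn ℝ ∞ h N := fun a ha => by
    have h3 : ContMDiffAt 𝓘(ℝ, E) 𝓘(ℝ, E × B) ∞ (fun a => φ₁ (e (χ.symm a))) a :=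
      ContMDiffAt.comp a (contMDiffAt_of_mem_maximalAtlas hφ.mem_maximalAtlas (hNP a ha).1.2)
        ((hNP a ha).1.1.1.comp a
          (contMDiffAt_symm_of_mem_maximalAtlas hφ.mem_maximalAtlas' (hNP a ha).2))
    exact h3.contDiffAt.snd.contDiffWithinAt
  have key : ∀ u ∈ φ₁.source, (φ₁ u).1 ∈ N → ((φ₁ u).2 = h (φ₁ u).1 ↔ u = e (s u)) := by
    intro u hu huN
    have h4 : χ.symm (φ₁ u).1 = s u := by rw [hφ.eq u hu, χ.left_inv (hφ.mapsTo u hu)]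
    have h5 := hNP _ huN
    rw [h4] at h5
    simp only [hh, h4]
    constructor
    · intro h6
      refine φ₁.injOn hu h5.1.2 (Prod.ext ?_ h6)
      rw [hφ.eq u hu, hφ.eq _ h5.1.2, h5.1.1.2]
    · intro h6
      rw [← h6]
  have hsrc : ∀ u, u ∈ (φ₁.trans (SingFol.shear hN hhs)).source ↔
      u ∈ φ₁.source ∧ (φ₁ u).1 ∈ N := fun u => by
    rw [OpenPartialHomeomorph.trans_source]
    rfl
  have hv' : v ∈ (φ₁.trans (SingFol.shear hN hhs)).source :=
    (hsrc v).2 ⟨hv, by rw [hφ.eq v hv]; exact haN⟩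
  have hzero : ∀ u ∈ (φ₁.trans (SingFol.shear hN hhs)).source,
      ((φ₁.trans (SingFol.shear hN hhs)) u).2 = 0 ↔ u = e (s u) := by
    intro u hu
    obtain ⟨h3, h4⟩ := (hsrc u).1 hu
    rw [← key u h3 h4]
    exact sub_eq_zero
  refine ⟨φ₁.trans (SingFol.shear hN hhs), hφ.shear hN hhs, hv', hzero,
    (hzero v hv').2 hev.symm, ?_⟩
  have h3 : ((φ₁.trans (SingFol.shear hN hhs)) v).1 = χ (s v) := hφ.eq v hv
  rw [h3]
  filter_upwards [hN.mem_nhds haN] with a ha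
  obtain ⟨⟨⟨-, h4⟩, h5⟩, h6⟩ := hNP a ha
  have h7 : (φ₁ (e (χ.symm a))).1 = a := by rw [hφ.eq _ h5, h4, χ.right_inv h6]
  have h8 : φ₁.symm (a, 0 + h a) = e (χ.symm a) := by
    rw [zero_add, hh]
    have : ((a, (φ₁ (e (χ.symm a))).2) : E × B) = φ₁ (e (χ.symm a)) := Prod.ext h7.symm rfl
    rw [this, φ₁.left_inv h5]
  exact h8

/-- Units given by a local section yield unit points. -/
theorem isUnitPoint_of_section {A : Span E M} {v : A.carrier}
    (hs : Manifold.IsSubmersion 𝓘(ℝ, E × A.fib) 𝓘(ℝ, E) ∞ A.s) {e : M → A.carrier}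
    (he : ∀ᶠ x in 𝓝 (A.s v), ContMDiffAt 𝓘(ℝ, E) 𝓘(ℝ, E × A.fib) ∞ e x ∧ A.s (e x) = x ∧
      A.t (e x) = x) (hev : e (A.s v) = v) : IsUnitPoint A v := by
  obtain ⟨⟨φ₁, χ⟩, hφ₁, hv⟩ := exists_isAdaptedPair hs v
  obtain ⟨φ, hφ, hvφ, -, h0, h1⟩ := exists_isAdaptedPair_section hφ₁ hv
    (he.mono fun x hx => ⟨hx.1, hx.2.1⟩) hev
  refine ⟨φ, χ, hφ, hvφ, h0, ?_⟩
  have h2 : (φ v).1 = χ (A.s v) := hφ.eq v hvφ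
  filter_upwards [h1, h2 ▸ (eventually_nhds_chart_symm (hφ.mapsTo v hvφ)).1 he] with a h3 h4
  rw [h3, h4.2.2]

end Adaptedness

/-! ### Charts adapted to an identity bisection -/

section IdentityBisections

variable {E : Type} [NormedAddCommGroup E] [NormedSpace ℝ E] [FiniteDimensional ℝ E]

/-- The inverse function theorem, with smoothness of the inverse at all points near `σ a₀`; the
derivative stays invertible nearby. In finite dimension injectivity of the derivative is enough. -/
theorem exists_smooth_local_inverse {σ : E → E} {a₀ : E} (hσ : ∀ᶠ a in 𝓝 a₀, ContDiffAt ℝ ∞ σ a)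
    (hi : Function.Injective (fderiv ℝ σ a₀)) :
    ∃ θ : E → E, (∀ᶠ b in 𝓝 (σ a₀), ContDiffAt ℝ ∞ θ b ∧ σ (θ b) = b) ∧
      ∀ᶠ a in 𝓝 a₀, θ (σ a) = a := by
  have := FiniteDimensional.complete ℝ E
  let L : E ≃L[ℝ] E :=
    (LinearEquiv.ofInjectiveEndo (fderiv ℝ σ a₀).toLinearMap hi).toContinuousLinearEquiv
  have hL : (L : E →L[ℝ] E) = fderiv ℝ σ a₀ := by
    ext w
    rfl
  have hσ₀ := hσ.self_of_nhds
  have hd : HasFDerivAt σ (L : E →L[ℝ] E) a₀ := by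
    rw [hL]
    exact (hσ₀.differentiableAt (by simp)).hasFDerivAt
  let P := hσ₀.toOpenPartialHomeomorph σ hd (by simp)
  have hP : (P : E → E) = σ := hσ₀.toOpenPartialHomeomorph_coe hd (by simp)
  have ha : a₀ ∈ P.source := hσ₀.mem_toOpenPartialHomeomorph_source hd (by simp)
  have hb : σ a₀ ∈ P.target := hP ▸ P.map_source ha
  have hsymm : P.symm (σ a₀) = a₀ := by
    rw [← hP]
    exact P.left_inv ha
  refine ⟨P.symm, ?_, ?_⟩
  · have h1 : ∀ᶠ a in 𝓝 a₀, ∃ L' : E ≃L[ℝ] E, (L' : E →L[ℝ] E) = fderiv ℝ σ a := by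
      have h2 : ContinuousAt (fderiv ℝ σ) a₀ :=
        (hσ₀.fderiv_right (m := 0) (by simp)).continuousAt
      have h3 := L.nhds
      rw [hL] at h3
      exact h2.eventually h3
    have h4 : Tendsto P.symm (𝓝 (σ a₀)) (𝓝 a₀) := by
      have := P.continuousAt_symm hb
      rwa [ContinuousAt, hsymm] at this
    filter_upwards [P.open_target.mem_nhds hb, h4.eventually h1, h4.eventually hσ]
      with b h5 ⟨L', h6⟩ h7
    refine ⟨P.contDiffAt_symm (f₀' := L') h5 ?_ (by rwa [hP]), ?_⟩
    · rw [hP, h6]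
      exact (h7.differentiableAt (by simp)).hasFDerivAt
    · rw [← hP]
      exact P.right_inv h5
  · filter_upwards [P.open_source.mem_nhds ha] with a h5
    rw [← hP]
    exact P.left_inv h5

variable {M : Type u} [TopologicalSpace M] [ChartedSpace E M] [IsManifold 𝓘(ℝ, E) ∞ M]

theorem IsAdaptedPair.restr {B : Type} [NormedAddCommGroup B] [NormedSpace ℝ B] {U : Type u}
    [TopologicalSpace U] [ChartedSpace (E × B) U] [IsManifold 𝓘(ℝ, E × B) ∞ U] {s : U → M}
    {φ : OpenPartialHomeomorph U (E × B)} {χ : OpenPartialHomeomorph M E}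
    (hφ : IsAdaptedPair s φ χ) {O : Set U} (hO : IsOpen O) :
    IsAdaptedPair s (φ.restrOpen O hO) χ where
  mem_maximalAtlas := OpenPartialHomeomorph.mem_maximalAtlas_of_contMDiffOn _
    ((contMDiffOn_of_mem_maximalAtlas hφ.mem_maximalAtlas).mono fun _ hx => hx.1)
    ((contMDiffOn_symm_of_mem_maximalAtlas hφ.mem_maximalAtlas).mono fun _ hx => hx.1)
  mem_maximalAtlas' := hφ.mem_maximalAtlas'
  mapsTo x hx := hφ.mapsTo x hx.1
  eq x hx := hφ.eq x hx.1

theorem IsIdentityBisection.inv {A : Span E M} {V : Set A.carrier} (h : IsIdentityBisection A V) :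
    IsIdentityBisection A.inv V where
  submanifold := h.submanifold
  eqOn v hv := (h.eqOn v hv).symm
  etale_s := h.etale_t
  etale_t := h.etale_s

/-- Since `s` is étale on `V`, the bisection is locally the image of a section `e` of `s`.
Flattening `e` in a chart adapted to `s` gives one chart that is at once adapted, a slice chart for
`V` and a unit chart, because `s = t` on `V`. -/
theorem IsIdentityBisection.exists_chart {A : Span E M} {V : Set A.carrier}
    (h : IsIdentityBisection A V) (hs : Manifold.IsSubmersion 𝓘(ℝ, E × A.fib) 𝓘(ℝ, E) ∞ A.s)
    {v : A.carrier} (hv : v ∈ V) :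
    ∃ (φ : OpenPartialHomeomorph A.carrier (E × A.fib)) (χ : OpenPartialHomeomorph M E),
      IsAdaptedPair A.s φ χ ∧ IsSliceChart V φ ∧ IsUnitChart A.t φ χ v := by
  obtain ⟨φ₀, hφ₀, hv₀⟩ := h.submanifold v hv
  obtain ⟨⟨φ₁, χ⟩, hφ₁, hv₁⟩ := exists_isAdaptedPair hs v
  simp only at hφ₁ hv₁
  have hsc := hs.contMDiff
  set a₀ : E := (φ₀ v).1 with ha₀
  have hp₀ : ((a₀, 0) : E × A.fib) = φ₀ v := Prod.ext rfl ((hφ₀.mem_iff v hv₀).1 hv).symm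
  have hp₀v : φ₀.symm (a₀, 0) = v := by rw [hp₀, φ₀.left_inv hv₀]
  have hχv := hφ₁.mapsTo v hv₁
  set j : E → E × A.fib := fun a => (a, 0) with hj
  have hjs : ContDiff ℝ ∞ j := contDiff_id.prodMk contDiff_const
  have hjt : ∀ᶠ a in 𝓝 a₀, j a ∈ φ₀.target := by
    have h1 : φ₀.target ∈ 𝓝 (j a₀) := φ₀.open_target.mem_nhds (by
      rw [show j a₀ = φ₀ v from hp₀]
      exact φ₀.map_source hv₀)
    exact hjs.continuous.continuousAt.eventually h1
  have hτ : ∀ a, j a ∈ φ₀.target → ContMDiffAt 𝓘(ℝ, E) 𝓘(ℝ, E × A.fib) ∞ (φ₀.symm ∘ j) a :=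
    fun a ha => ContMDiffAt.comp (g := φ₀.symm) a
      (contMDiffAt_symm_of_mem_maximalAtlas hφ₀.mem_maximalAtlas ha) hjs.contMDiff.contMDiffAt
  have hp₀j : (φ₀.symm ∘ j) a₀ = v := hp₀v
  have hτt : Tendsto (φ₀.symm ∘ j) (𝓝 a₀) (𝓝 v) := by
    have := (hτ a₀ hjt.self_of_nhds).continuousAt
    rwa [ContinuousAt, hp₀j] at this
  -- This is `s` restricted to `V`, in the slice coordinates of `V` and the chart `χ` of `M`.
  set σ : E → E := χ ∘ (A.s ∘ (φ₀.symm ∘ j)) with hσ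
  have hτs : ∀ᶠ a in 𝓝 a₀, A.s (φ₀.symm (j a)) ∈ χ.source :=
    hτt.eventually (hsc.continuous.continuousAt.eventually (χ.open_source.mem_nhds hχv))
  have hσs : ∀ᶠ a in 𝓝 a₀, ContDiffAt ℝ ∞ σ a := by
    filter_upwards [hjt, hτs] with a h1 h2
    exact (ContMDiffAt.comp (g := χ) a (contMDiffAt_of_mem_maximalAtlas hφ₁.mem_maximalAtlas' h2)
      ((hsc _).comp a (hτ a h1))).contDiffAt
  -- A kernel vector of the derivative of `σ` corresponds to a vector tangent to `V` that is killed
  -- by the differential of `s`, so it vanishes as `s` is étale on `V`.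
  have hinj : Function.Injective (fderiv ℝ σ a₀) := by
    refine (injective_iff_map_eq_zero (fderiv ℝ σ a₀)).2 fun w hw => ?_
    have h1 := hasFDerivAt_chart_comp hφ₁.mem_maximalAtlas'
      ((hsc _).comp a₀ (hτ a₀ hjt.self_of_nhds)) hτs.self_of_nhds
    have h2 : fderiv ℝ σ a₀ = _ := HasFDerivAt.fderiv h1
    set ξ : TangentSpace 𝓘(ℝ, E × A.fib) v :=
      (mfderiv 𝓘(ℝ, E × A.fib) 𝓘(ℝ, E × A.fib) φ₀.symm (a₀, 0) ((w, 0) : E × A.fib) :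
        E × A.fib) with hξ
    have h3 : (mfderiv 𝓘(ℝ, E × A.fib) 𝓘(ℝ, E × A.fib) φ₀ v ξ : E × A.fib) = (w, 0) :=
      mfderiv_chart_symm hφ₀.mem_maximalAtlas hjt.self_of_nhds hp₀v _
    have h4 : ξ ∈ tangentTo (E × A.fib) V v :=
      (hφ₀.mem_tangentTo_iff hv₀ hv ξ).2 (congrArg Prod.snd h3)
    have h5 : (mfderiv 𝓘(ℝ, E) 𝓘(ℝ, E) (A.s ∘ (φ₀.symm ∘ j)) a₀ w : E) =
        mfderiv 𝓘(ℝ, E × A.fib) 𝓘(ℝ, E) A.s v ξ := by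
      have e1 : HasMFDerivAt 𝓘(ℝ, E) 𝓘(ℝ, E × A.fib) j a₀ (ContinuousLinearMap.inl ℝ E A.fib) :=
        ((hasFDerivAt_id a₀).prodMk (hasFDerivAt_const (0 : A.fib) a₀)).hasMFDerivAt
      have e2 := ((contMDiffAt_symm_of_mem_maximalAtlas hφ₀.mem_maximalAtlas
        (φ₀.map_source hv₀)).mdifferentiableAt (by simp)).hasMFDerivAt
      rw [← hp₀] at e2
      have e3 := ((hsc ((φ₀.symm ∘ j) a₀)).mdifferentiableAt (by simp)).hasMFDerivAt
      have e4 := (e3.comp a₀ (HasMFDerivAt.comp a₀ (g := φ₀.symm) e2 e1)).mfderiv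
      have e5 := congrArg (fun L : E →L[ℝ] E => L w) e4
      refine e5.trans ?_
      have e6 : ∀ v', v' = v → (mfderiv 𝓘(ℝ, E × A.fib) 𝓘(ℝ, E) A.s v' ξ : E) =
        mfderiv 𝓘(ℝ, E × A.fib) 𝓘(ℝ, E) A.s v ξ := by rintro _ rfl; rfl
      refine Eq.trans ?_ (e6 _ hp₀j)
      rfl
    have h6 : (mfderiv 𝓘(ℝ, E) 𝓘(ℝ, E) (A.s ∘ (φ₀.symm ∘ j)) a₀ w : E) = 0 := by
      have e1 := mfderiv_symm_mfderiv hφ₁.mem_maximalAtlas' hτs.self_of_nhds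
        (mfderiv 𝓘(ℝ, E) 𝓘(ℝ, E) (A.s ∘ (φ₀.symm ∘ j)) a₀ w : E)
      rw [h2] at hw
      refine e1.symm.trans ?_
      exact (congrArg (fun v : E => (mfderiv 𝓘(ℝ, E) 𝓘(ℝ, E) χ.symm _ v : E)) hw).trans
        (map_zero _)
    have h7 : (⟨ξ, h4⟩ : tangentTo (E × A.fib) V v) = 0 := by
      apply (h.etale_s v hv).1
      exact (h5.symm.trans h6).trans (map_zero _).symm
    have h8 : ξ = 0 := congrArg Subtype.val h7
    rw [h8] at h3
    have h9 := (map_zero (mfderiv 𝓘(ℝ, E × A.fib) 𝓘(ℝ, E × A.fib) φ₀ v)).symm.trans h3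
    exact (congrArg (fun z : E × A.fib => z.1) h9).symm
  obtain ⟨θ, hθ, hθσ⟩ := exists_smooth_local_inverse hσs hinj
  have hσa₀ : σ a₀ = χ (A.s v) := by simp only [hσ, Function.comp_apply] at hp₀j ⊢; rw [hp₀j]
  rw [hσa₀] at hθ
  have hθ₀ : θ (χ (A.s v)) = a₀ := hσa₀ ▸ hθσ.self_of_nhds
  have hχt : Tendsto χ (𝓝 (A.s v)) (𝓝 (χ (A.s v))) := χ.continuousAt hχv
  have hθt : Tendsto (fun x => θ (χ x)) (𝓝 (A.s v)) (𝓝 a₀) := by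
    have := hθ.self_of_nhds.1.continuousAt.tendsto
    rw [hθ₀] at this
    exact this.comp hχt
  set e : M → A.carrier := fun x => φ₀.symm (j (θ (χ x))) with he
  have hev : e (A.s v) = v := by simp only [he, hθ₀, hj, hp₀v]
  have heV : ∀ᶠ x in 𝓝 (A.s v), e x ∈ V := by
    filter_upwards [hθt.eventually hjt] with x hx
    rw [hφ₀.mem_iff _ (φ₀.map_target hx), φ₀.right_inv hx]
  have hes : ∀ᶠ x in 𝓝 (A.s v), ContMDiffAt 𝓘(ℝ, E) 𝓘(ℝ, E × A.fib) ∞ e x ∧ A.s (e x) = x := by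
    filter_upwards [χ.open_source.mem_nhds hχv, hχt.eventually hθ, hθt.eventually hjt,
      hθt.eventually hτs] with x h1 h2 h3 h4
    refine ⟨?_, χ.injOn h4 h1 h2.2⟩
    exact ContMDiffAt.comp (g := φ₀.symm ∘ j) x (hτ _ h3)
      (h2.1.contMDiffAt.comp x (contMDiffAt_of_mem_maximalAtlas hφ₁.mem_maximalAtlas' h1))
  obtain ⟨φ, hφ, hvφ, hzero, h0, hu⟩ := exists_isAdaptedPair_section hφ₁ hv₁ hes hev
  have hφ₀t : Tendsto (fun u => (φ₀ u).1) (𝓝 v) (𝓝 a₀) :=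
    (φ₀.continuousAt hv₀).fst
  -- Near `v` the set `V` is exactly the image of `e`; this is what turns the flattened chart into a
  -- slice chart.
  have hVe : ∀ᶠ u in 𝓝 v, (u ∈ V → u = e (A.s u)) ∧ e (A.s u) ∈ V := by
    filter_upwards [φ₀.open_source.mem_nhds hv₀, hφ₀t.eventually hθσ,
      hsc.continuous.continuousAt.eventually heV] with u h1 h2 h3
    refine ⟨fun huV => ?_, h3⟩
    have h4 : j (φ₀ u).1 = φ₀ u := Prod.ext rfl ((hφ₀.mem_iff u h1).1 huV).symm
    simp only [hσ, Function.comp_apply, h4, φ₀.left_inv h1] at h2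
    simp only [he, h2, h4, φ₀.left_inv h1]
  obtain ⟨O, hOP, hO, hvO⟩ := eventually_nhds_iff.1 hVe
  refine ⟨φ.restrOpen O hO, χ, hφ.restr hO, ⟨(hφ.restr hO).mem_maximalAtlas, fun u hu => ?_⟩,
    ⟨hvφ, hvO⟩, h0, ?_⟩
  · refine Iff.trans ?_ (hzero u hu.1).symm
    refine ⟨(hOP u hu.2).1, fun h1 => ?_⟩
    rw [h1]
    exact (hOP u hu.2).2
  · have h2 : (φ v).1 = χ (A.s v) := hφ.eq v hvφ
    have h3 := (eventually_nhds_chart_symm hχv).1 (heV.and hes)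
    rw [← h2] at h3
    change ∀ᶠ a in 𝓝 (φ v).1, A.t (φ.symm (a, 0)) = χ.symm a
    filter_upwards [hu, h3] with a h4 h5
    rw [h4, ← h.eqOn _ h5.1, h5.2.2]

end IdentityBisections

/-! ### The local conditions for compositions, in coordinates -/

section CompositionCharts

variable {E B B' : Type} [NormedAddCommGroup E] [NormedSpace ℝ E] [FiniteDimensional ℝ E]
  [NormedAddCommGroup B] [NormedSpace ℝ B] [FiniteDimensional ℝ B]
  [NormedAddCommGroup B'] [NormedSpace ℝ B'] [FiniteDimensional ℝ B']
  {M : Type u} [TopologicalSpace M] [ChartedSpace E M] [IsManifold 𝓘(ℝ, E) ∞ M]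
  {F : Set (VField E M)}

/-- The coordinates of the first factor of a composition. -/
def compCoord (χ : OpenPartialHomeomorph M E) (τ : E × B' → M) (p : E × (B × B')) : E × B :=
  (χ (τ (p.1, p.2.2)), p.2.1)

/-- Moving in the fibre of the second factor shifts the base point of the first one, by the
derivative of `τ'`; moving in the first fibre leaves the base point fixed. -/
theorem hasFDerivAt_compCoord {χ : OpenPartialHomeomorph M E}
    (hχ : χ ∈ IsManifold.maximalAtlas 𝓘(ℝ, E) ∞ M) {τ : E × B' → M} {p : E × (B × B')}
    (hτ : ContMDiffAt 𝓘(ℝ, E × B') 𝓘(ℝ, E) ∞ τ (p.1, p.2.2)) (hp : τ (p.1, p.2.2) ∈ χ.source) :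
    ContDiffAt ℝ ∞ (compCoord (B := B) χ τ) p ∧
      ∃ L : E × (B × B') →L[ℝ] E × B, HasFDerivAt (compCoord (B := B) χ τ) L p ∧
        ∀ (b : B) (b' : B'), L (0, (b, b')) =
          ((mfderiv 𝓘(ℝ, E) 𝓘(ℝ, E) χ (τ (p.1, p.2.2))
            (mfderiv 𝓘(ℝ, E × B') 𝓘(ℝ, E) τ (p.1, p.2.2) ((0, b') : E × B') : E) : E), b) := by
  set π : E × (B × B') →L[ℝ] E × B' := (ContinuousLinearMap.fst ℝ E (B × B')).prod
    ((ContinuousLinearMap.snd ℝ B B').comp (ContinuousLinearMap.snd ℝ E (B × B'))) with hπ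
  have h0 : HasFDerivAt (fun p : E × (B × B') => ((p.1, p.2.2) : E × B')) π p := π.hasFDerivAt
  have h1 := hasFDerivAt_chart_comp hχ hτ hp
  have h2 : ContDiffAt ℝ ∞ (χ ∘ τ) (p.1, p.2.2) :=
    (ContMDiffAt.comp (p.1, p.2.2) (contMDiffAt_of_mem_maximalAtlas hχ hp) hτ).contDiffAt
  have h3 : HasFDerivAt (fun p : E × (B × B') => p.2.1) ((ContinuousLinearMap.fst ℝ B B').comp
      (ContinuousLinearMap.snd ℝ E (B × B'))) p :=
    ((ContinuousLinearMap.fst ℝ B B').comp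
      (ContinuousLinearMap.snd ℝ E (B × B'))).hasFDerivAt
  refine ⟨?_, _, (HasFDerivAt.comp p (g := χ ∘ τ) h1 h0).prodMk h3, fun b b' => ?_⟩
  · refine ContDiffAt.prodMk ?_ (ContDiff.contDiffAt (by fun_prop))
    exact ContDiffAt.comp p (g := χ ∘ τ) h2 (ContDiff.contDiffAt (by fun_prop))
  · refine Prod.ext ?_ ?_
    · rfl
    · rfl

theorem mfderiv_comp_compCoord {χ : OpenPartialHomeomorph M E} {τ : E × B → M} {τ' : E × B' → M}
    {p : E × (B × B')} {L : E × (B × B') →L[ℝ] E × B}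
    (hτ : ContMDiffAt 𝓘(ℝ, E × B) 𝓘(ℝ, E) ∞ τ (compCoord χ τ' p))
    (hL : HasFDerivAt (compCoord (B := B) χ τ') L p) (ξ : E × (B × B')) :
    (mfderiv 𝓘(ℝ, E × (B × B')) 𝓘(ℝ, E) (τ ∘ compCoord χ τ') p ξ : E) =
      mfderiv 𝓘(ℝ, E × B) 𝓘(ℝ, E) τ (compCoord χ τ' p) (L ξ : E × B) := by
  have h1 := ((hτ.mdifferentiableAt (by simp)).hasMFDerivAt.comp p hL.hasMFDerivAt).mfderiv
  exact congrArg (fun L : E × (B × B') →L[ℝ] E => L ξ) h1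

variable {χ : OpenPartialHomeomorph M E} {τ : E × B → M} {τ' : E × B' → M} {p₀ : E × (B × B')}

theorem eventually_compCoord (hχ : χ ∈ IsManifold.maximalAtlas 𝓘(ℝ, E) ∞ M)
    (hτ : ∀ᶠ q in 𝓝 (compCoord χ τ' p₀), ContMDiffAt 𝓘(ℝ, E × B) 𝓘(ℝ, E) ∞ τ q)
    (hτ' : ∀ᶠ q in 𝓝 (p₀.1, p₀.2.2), ContMDiffAt 𝓘(ℝ, E × B') 𝓘(ℝ, E) ∞ τ' q)
    (hp₀ : τ' (p₀.1, p₀.2.2) ∈ χ.source)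
    : Tendsto (compCoord (B := B) χ τ') (𝓝 p₀)
      (𝓝 (compCoord (B := B) χ τ' p₀)) ∧ ∀ᶠ p in 𝓝 p₀,
    ContMDiffAt 𝓘(ℝ, E × B') 𝓘(ℝ, E) ∞ τ' (p.1, p.2.2) ∧ τ' (p.1, p.2.2) ∈ χ.source ∧
      ContMDiffAt 𝓘(ℝ, E × B) 𝓘(ℝ, E) ∞ τ (compCoord χ τ' p) := by
  have h1 : Tendsto (fun p : E × (B × B') => ((p.1, p.2.2) : E × B')) (𝓝 p₀)
      (𝓝 (p₀.1, p₀.2.2)) := Continuous.tendsto (by fun_prop) p₀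
  have h2 : Tendsto (compCoord (B := B) χ τ') (𝓝 p₀) (𝓝 (compCoord (B := B) χ τ' p₀)) :=
    (hasFDerivAt_compCoord hχ hτ'.self_of_nhds hp₀).1.continuousAt
  refine ⟨h2, ?_⟩
  filter_upwards [h1.eventually hτ', h1.eventually (hτ'.self_of_nhds.continuousAt.eventually
    (χ.open_source.mem_nhds hp₀)), h2.eventually hτ] with p h3 h4 h5
  exact ⟨h3, h4, h5⟩

/-- A displacement in the second fibre moves the base point of the first factor along fields of `F`
(`h'`), and horizontal lifts of these are turned into fields of `F` by `hh`. A displacement in the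
first fibre is covered by `h`. -/
theorem VertIn.comp (hχ : χ ∈ IsManifold.maximalAtlas 𝓘(ℝ, E) ∞ M)
    (hτ : ∀ᶠ q in 𝓝 (compCoord χ τ' p₀), ContMDiffAt 𝓘(ℝ, E × B) 𝓘(ℝ, E) ∞ τ q)
    (hτ' : ∀ᶠ q in 𝓝 (p₀.1, p₀.2.2), ContMDiffAt 𝓘(ℝ, E × B') 𝓘(ℝ, E) ∞ τ' q)
    (hp₀ : τ' (p₀.1, p₀.2.2) ∈ χ.source)
    (h : VertIn F τ (compCoord χ τ' p₀)) (h' : VertIn F τ' (p₀.1, p₀.2.2))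
    (hh : HorIn F χ τ (compCoord χ τ' p₀)) : VertIn F (τ ∘ compCoord χ τ') p₀ := by
  obtain ⟨κ, _, c, Z, hZ, hc⟩ := h
  obtain ⟨κ', _, c', Z', hZ', hc'⟩ := h'
  choose ν hν d Y hY hd using fun i => hh (Z' i) (hZ' i)
  have h1 : Tendsto (fun p : E × (B × B') => ((p.1, p.2.2) : E × B')) (𝓝 p₀)
      (𝓝 (p₀.1, p₀.2.2)) := Continuous.tendsto (by fun_prop) p₀
  obtain ⟨h2, h3⟩ := eventually_compCoord hχ hτ hτ' hp₀
  refine ⟨(Σ i, ν i) ⊕ κ, inferInstance, Sum.elim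
    (fun i p => d i.1 i.2 (compCoord χ τ' p) • (c' i.1 (p.1, p.2.2)).comp
      (ContinuousLinearMap.snd ℝ B B'))
    (fun j p => (c j (compCoord χ τ' p)).comp (ContinuousLinearMap.fst ℝ B B')),
    Sum.elim (fun i => Y i.1 i.2) Z, ?_, ?_⟩
  · rintro (i | j)
    exacts [hY _ _, hZ j]
  filter_upwards [h3, h1.eventually hc', h2.eventually hc, h2.eventually (eventually_all.2 hd)]
    with p h4 h5 h6 h7
  obtain ⟨h8, L, hL, hLb⟩ := hasFDerivAt_compCoord (B := B) hχ h4.1 h4.2.1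
  refine ⟨?_, ?_⟩
  · rintro (i | j)
    · refine ContDiffAt.smul (((h7 i.1).1 i.2).comp p h8) ?_
      refine ContDiffAt.clm_comp ?_ contDiffAt_const
      exact ContDiffAt.comp p (h5.1 i.1) (ContDiff.contDiffAt (by fun_prop))
    · exact ContDiffAt.clm_comp ((h6.1 j).comp p h8) contDiffAt_const
  · rintro ⟨b, b'⟩
    refine (mfderiv_comp_compCoord h4.2.2 hL _).trans ?_
    rw [Fintype.sum_sum_type, Fintype.sum_sigma]
    -- The velocity of the first factor is split into horizontal lifts of the `Z' i` and the
    -- vertical vector `b`.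
    have e1 : L (0, (b, b')) = (∑ i, c' i (p.1, p.2.2) b' •
        ((chartField χ (Z' i) (compCoord (B := B) χ τ' p).1, 0) : E × B)) + ((0, b) : E × B) := by
      rw [hLb]
      refine Prod.ext ?_ ?_
      · rw [Prod.fst_add, Prod.fst_sum, add_zero]
        refine (congrArg (fun v : E => (mfderiv 𝓘(ℝ, E) 𝓘(ℝ, E) χ (τ' (p.1, p.2.2)) v : E))
          (h5.2 b')).trans ?_
        refine (map_sum (mfderiv 𝓘(ℝ, E) 𝓘(ℝ, E) χ (τ' (p.1, p.2.2))) _ _).trans ?_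
        refine Finset.sum_congr rfl fun i _ => ?_
        refine ((mfderiv 𝓘(ℝ, E) 𝓘(ℝ, E) χ (τ' (p.1, p.2.2))).map_smul _ _).trans ?_
        exact congrArg (fun v : E => c' i (p.1, p.2.2) b' • v)
          (chartField_apply h4.2.1 (Z' i)).symm
      · simp [Prod.snd_sum]
    refine (congrArg (fun v : E × B => (mfderiv 𝓘(ℝ, E × B) 𝓘(ℝ, E) τ (compCoord χ τ' p) v : E))
      e1).trans ?_
    refine (map_add (mfderiv 𝓘(ℝ, E × B) 𝓘(ℝ, E) τ (compCoord χ τ' p)) _ _).trans ?_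
    refine congrArg₂ (fun v w : E => v + w) ?_ (h6.2 b)
    refine (map_sum (mfderiv 𝓘(ℝ, E × B) 𝓘(ℝ, E) τ (compCoord χ τ' p)) _ _).trans ?_
    refine Finset.sum_congr rfl fun i _ => ?_
    refine ((mfderiv 𝓘(ℝ, E × B) 𝓘(ℝ, E) τ (compCoord χ τ' p)).map_smul _ _).trans ?_
    refine (congrArg (fun v : E => c' i (p.1, p.2.2) b' • v) (h7 i).2).trans ?_
    refine (Finset.smul_sum (N := E)).trans (Finset.sum_congr rfl fun k _ => ?_)
    have e2 : ∀ (r r' : ℝ) (w : E), r • r' • w = (r' * r) • w := fun r r' w => by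
      rw [smul_smul, mul_comm]
    exact e2 _ _ _

/-- It suffices to move in the fibre of the first factor, keeping the second one fixed. -/
theorem VertGen.comp (hχ : χ ∈ IsManifold.maximalAtlas 𝓘(ℝ, E) ∞ M)
    (hτ : ∀ᶠ q in 𝓝 (compCoord χ τ' p₀), ContMDiffAt 𝓘(ℝ, E × B) 𝓘(ℝ, E) ∞ τ q)
    (hτ' : ∀ᶠ q in 𝓝 (p₀.1, p₀.2.2), ContMDiffAt 𝓘(ℝ, E × B') 𝓘(ℝ, E) ∞ τ' q)
    (hp₀ : τ' (p₀.1, p₀.2.2) ∈ χ.source)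
    (h : VertGen F τ (compCoord χ τ' p₀)) : VertGen F (τ ∘ compCoord χ τ') p₀ := by
  intro Z hZ
  obtain ⟨e, he⟩ := h Z hZ
  obtain ⟨h2, h3⟩ := eventually_compCoord hχ hτ hτ' hp₀
  refine ⟨fun p => (e (compCoord χ τ' p), 0), ?_⟩
  filter_upwards [h3, h2.eventually he] with p h4 h5
  obtain ⟨h8, L, hL, hLb⟩ := hasFDerivAt_compCoord (B := B) hχ h4.1 h4.2.1
  refine ⟨(h5.1.comp p h8).prodMk contDiffAt_const, ?_⟩
  refine (mfderiv_comp_compCoord h4.2.2 hL _).trans ?_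
  refine Eq.trans (congrArg (fun v : E × B =>
    (mfderiv 𝓘(ℝ, E × B) 𝓘(ℝ, E) τ (compCoord χ τ' p) v : E)) ?_) h5.2
  rw [hLb]
  refine Prod.ext ?_ rfl
  exact (congrArg (fun v : E => (mfderiv 𝓘(ℝ, E) 𝓘(ℝ, E) χ (τ' (p.1, p.2.2)) v : E))
    (map_zero (mfderiv 𝓘(ℝ, E × B') 𝓘(ℝ, E) τ' (p.1, p.2.2)))).trans (map_zero _)

end CompositionCharts

/-! ### Invariance of the local conditions -/

section Congruence

variable {E B : Type} [NormedAddCommGroup E] [NormedSpace ℝ E] [NormedAddCommGroup B]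
  [NormedSpace ℝ B] {M : Type u} [TopologicalSpace M] [ChartedSpace E M] {F : Set (VField E M)}

theorem VertIn.congr {τ τ' : E × B → M} {p₀ : E × B} (h : VertIn F τ p₀) (hτ : τ' =ᶠ[𝓝 p₀] τ) :
    VertIn F τ' p₀ := by
  obtain ⟨κ, hκ, c, Z, hZ, hc⟩ := h
  refine ⟨κ, hκ, c, Z, hZ, ?_⟩
  filter_upwards [hc, hτ.eventuallyEq_nhds] with p h1 h2
  refine ⟨h1.1, fun b => ?_⟩
  refine (congrArg (fun L : E × B →L[ℝ] E => L (0, b)) h2.mfderiv_eq).trans ?_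
  refine (h1.2 b).trans (Finset.sum_congr rfl fun i _ => ?_)
  exact congrArg (fun v : E => c i p b • v) (vfield_congr (Z i) h2.eq_of_nhds.symm)

theorem VertGen.congr {τ τ' : E × B → M} {p₀ : E × B} (h : VertGen F τ p₀)
    (hτ : τ' =ᶠ[𝓝 p₀] τ) : VertGen F τ' p₀ := by
  intro Z hZ
  obtain ⟨e, he⟩ := h Z hZ
  refine ⟨e, ?_⟩
  filter_upwards [he, hτ.eventuallyEq_nhds] with p h1 h2
  refine ⟨h1.1, ?_⟩
  refine (congrArg (fun L : E × B →L[ℝ] E => L (0, e p)) h2.mfderiv_eq).trans ?_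
  exact h1.2.trans (vfield_congr Z h2.eq_of_nhds.symm)

variable {B' : Type} [NormedAddCommGroup B'] [NormedSpace ℝ B']

theorem hasMFDerivAt_comp_fibre_equiv (L : B ≃L[ℝ] B') {τ : E × B' → M} {p : E × B}
    (hτ : MDifferentiableAt 𝓘(ℝ, E × B') 𝓘(ℝ, E) τ (p.1, L p.2)) (b : B) :
    (mfderiv 𝓘(ℝ, E × B) 𝓘(ℝ, E) (fun p : E × B => τ (p.1, L p.2)) p ((0, b) : E × B) : E) =
      mfderiv 𝓘(ℝ, E × B') 𝓘(ℝ, E) τ (p.1, L p.2) ((0, L b) : E × B') := by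
  set Λ : E × B →L[ℝ] E × B' := (ContinuousLinearMap.fst ℝ E B).prod
    ((L : B →L[ℝ] B').comp (ContinuousLinearMap.snd ℝ E B)) with hΛ
  have h1 : HasFDerivAt (fun p : E × B => ((p.1, L p.2) : E × B')) Λ p := Λ.hasFDerivAt
  have h2 := (HasMFDerivAt.comp p (g := τ) hτ.hasMFDerivAt h1.hasMFDerivAt).mfderiv
  exact congrArg (fun L : E × B →L[ℝ] E => L (0, b)) h2

theorem VertIn.comp_equiv (L : B ≃L[ℝ] B') {τ : E × B' → M} {p₀ : E × B}
    (hτ : ∀ᶠ p in 𝓝 (p₀.1, L p₀.2), MDifferentiableAt 𝓘(ℝ, E × B') 𝓘(ℝ, E) τ p)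
    (h : VertIn F τ (p₀.1, L p₀.2)) : VertIn F (fun p : E × B => τ (p.1, L p.2)) p₀ := by
  obtain ⟨κ, hκ, c, Z, hZ, hc⟩ := h
  have h0 : ContDiff ℝ ∞ (fun p : E × B => ((p.1, L p.2) : E × B')) :=
    contDiff_fst.prodMk (L.contDiff.comp contDiff_snd)
  refine ⟨κ, hκ, fun i p => (c i (p.1, L p.2)).comp (L : B →L[ℝ] B'), Z, hZ, ?_⟩
  filter_upwards [h0.continuous.continuousAt.eventually hc,
    h0.continuous.continuousAt.eventually hτ] with p h1 h2
  refine ⟨fun i => ((h1.1 i).comp p h0.contDiffAt).clm_comp contDiffAt_const, fun b => ?_⟩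
  exact (hasMFDerivAt_comp_fibre_equiv L h2 b).trans (h1.2 (L b))

theorem VertGen.comp_equiv (L : B ≃L[ℝ] B') {τ : E × B' → M} {p₀ : E × B}
    (hτ : ∀ᶠ p in 𝓝 (p₀.1, L p₀.2), MDifferentiableAt 𝓘(ℝ, E × B') 𝓘(ℝ, E) τ p)
    (h : VertGen F τ (p₀.1, L p₀.2)) : VertGen F (fun p : E × B => τ (p.1, L p.2)) p₀ := by
  intro Z hZ
  obtain ⟨e, he⟩ := h Z hZ
  have h0 : ContDiff ℝ ∞ (fun p : E × B => ((p.1, L p.2) : E × B')) :=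
    contDiff_fst.prodMk (L.contDiff.comp contDiff_snd)
  refine ⟨fun p => L.symm (e (p.1, L p.2)), ?_⟩
  filter_upwards [h0.continuous.continuousAt.eventually he,
    h0.continuous.continuousAt.eventually hτ] with p h1 h2
  refine ⟨L.symm.contDiff.contDiffAt.comp p (h1.1.comp p h0.contDiffAt), ?_⟩
  refine (hasMFDerivAt_comp_fibre_equiv L h2 _).trans ?_
  refine Eq.trans ?_ h1.2
  exact congrArg (fun v : B' => (mfderiv 𝓘(ℝ, E × B') 𝓘(ℝ, E) τ (p.1, L p.2) (0, v) : E))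
    (L.apply_symm_apply _)

variable [FiniteDimensional ℝ E] [IsManifold 𝓘(ℝ, E) ∞ M]
  {U U' : Type u} [TopologicalSpace U] [ChartedSpace (E × B) U] [TopologicalSpace U']
  [ChartedSpace (E × B') U'] [IsManifold 𝓘(ℝ, E × B) ∞ U] [IsManifold 𝓘(ℝ, E × B') ∞ U']

/-- Serves to exchange the factors of a composition, where the two model fibres are different
products and are identified by `L`. -/
theorem IsFibreAdapted.of_homeomorph (L : B ≃L[ℝ] B') (Φ : U ≃ₜ U')
    (hΦ : ContMDiff 𝓘(ℝ, E × B) 𝓘(ℝ, E × B') ∞ Φ)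
    (hΦ' : ContMDiff 𝓘(ℝ, E × B') 𝓘(ℝ, E × B) ∞ Φ.symm) {s t : U → M} {s' t' : U' → M}
    (hs : ∀ x, s' (Φ x) = s x) (ht : ∀ x, t' (Φ x) = t x)
    (htc : ContMDiff 𝓘(ℝ, E × B') 𝓘(ℝ, E) ∞ t') {u : U}
    (h : IsFibreAdapted B' F s' t' (Φ u)) : IsFibreAdapted B F s t u := by
  obtain ⟨φ, χ, hφ, hu, h1, h2⟩ := h
  set Λ : (E × B') ≃L[ℝ] (E × B) := (ContinuousLinearEquiv.refl ℝ E).prodCongr L.symm with hΛ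
  set ψ : OpenPartialHomeomorph U (E × B) :=
    (Φ.transOpenPartialHomeomorph φ).transHomeomorph Λ.toHomeomorph with hψ
  have hψx : ∀ x, ψ x = ((φ (Φ x)).1, L.symm (φ (Φ x)).2) := fun x => rfl
  have hψs : ∀ p, ψ.symm p = Φ.symm (φ.symm (p.1, L p.2)) := fun p => rfl
  have e0 : (((ψ u).1, L (ψ u).2) : E × B') = φ (Φ u) := by
    rw [hψx]
    exact Prod.ext rfl (L.apply_symm_apply _)
  have hτ : ∀ᶠ p in 𝓝 (φ (Φ u)), MDifferentiableAt 𝓘(ℝ, E × B') 𝓘(ℝ, E) (t' ∘ φ.symm) p := by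
    filter_upwards [φ.open_target.mem_nhds (φ.map_source hu)] with p hp
    exact (ContMDiffAt.comp p (htc _) (contMDiffAt_symm_of_mem_maximalAtlas
      hφ.mem_maximalAtlas hp)).mdifferentiableAt (by simp)
  have e1 : t ∘ ψ.symm = fun p => (t' ∘ φ.symm) (p.1, L p.2) := by
    funext p
    simp only [Function.comp, hψs]
    rw [← ht, Φ.apply_symm_apply]
  refine ⟨ψ, χ, ⟨?_, hφ.mem_maximalAtlas', fun x hx => ?_, fun x hx => ?_⟩, hu, ?_, ?_⟩
  · refine OpenPartialHomeomorph.mem_maximalAtlas_of_contMDiffOn _ (fun x hx => ?_) fun p hp => ?_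
    · refine (ContMDiffAt.comp (g := Λ) x Λ.contDiff.contMDiff.contMDiffAt
        (ContMDiffAt.comp x (contMDiffAt_of_mem_maximalAtlas hφ.mem_maximalAtlas hx)
          (hΦ x))).contMDiffWithinAt
    · exact (ContMDiffAt.comp (g := Φ.symm) p (hΦ' _) (ContMDiffAt.comp (g := φ.symm) p
        (contMDiffAt_symm_of_mem_maximalAtlas hφ.mem_maximalAtlas hp)
        Λ.symm.contDiff.contMDiff.contMDiffAt)).contMDiffWithinAt
  · rw [← hs]
    exact hφ.mapsTo _ hx
  · rw [← hs]
    exact hφ.eq _ hx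
  · rw [e1]
    exact VertIn.comp_equiv L (by rw [e0]; exact hτ) (by rw [e0]; exact h1)
  · rw [e1]
    exact VertGen.comp_equiv L (by rw [e0]; exact hτ) (by rw [e0]; exact h2)

end Congruence

/-! ### Compositions of bi-submersions -/

section Composition

variable {E : Type} [NormedAddCommGroup E] [NormedSpace ℝ E] [FiniteDimensional ℝ E] {M : Type u}
  [TopologicalSpace M] [ChartedSpace E M] [IsManifold 𝓘(ℝ, E) ∞ M] {A B : Span E M}
  {hA : Manifold.IsSubmersion 𝓘(ℝ, E × A.fib) 𝓘(ℝ, E) ∞ A.s}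
  {hB : ContMDiff 𝓘(ℝ, E × B.fib) 𝓘(ℝ, E) ∞ B.t}

/-- The first projection of a composition. -/
def compFst (z : (A.comp B hA hB).carrier) : A.carrier := Prod.fst (Subtype.val z)

/-- The second projection of a composition. -/
def compSnd (z : (A.comp B hA hB).carrier) : B.carrier := Prod.snd (Subtype.val z)

theorem comp_eq (z : (A.comp B hA hB).carrier) : A.s (compFst z) = B.t (compSnd z) :=
  Subtype.property z

theorem comp_ext {z z' : (A.comp B hA hB).carrier} (h : compFst z = compFst z')
    (h' : compSnd z = compSnd z') : z = z' := Subtype.ext (Prod.ext h h')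

variable (hA hB) in
/-- The point of the composition with given projections. -/
def compMk (u : A.carrier) (w : B.carrier) (h : A.s u = B.t w) : (A.comp B hA hB).carrier :=
  ⟨(u, w), h⟩

open Classical in
/-- The map to a composition with given projections. -/
def compLift {N : Type*} (a : N → A.carrier) (b : N → B.carrier) (z₀ : (A.comp B hA hB).carrier)
    (y : N) : (A.comp B hA hB).carrier :=
  if h : A.s (a y) = B.t (b y) then compMk hA hB (a y) (b y) h else z₀

theorem compLift_apply {N : Type*} {a : N → A.carrier} {b : N → B.carrier}
    (z₀ : (A.comp B hA hB).carrier) {y : N} (h : A.s (a y) = B.t (b y)) :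
    compLift a b z₀ y = compMk hA hB (a y) (b y) h := dif_pos h

variable (hA hB) in
/-- The charts of a composition. -/
def compChart {φ : OpenPartialHomeomorph A.carrier (E × A.fib)} {χ : OpenPartialHomeomorph M E}
    (h : IsAdaptedPair A.s φ χ) (ψ : OpenPartialHomeomorph B.carrier (E × B.fib))
    (z₀ : (A.comp B hA hB).carrier) :
    OpenPartialHomeomorph (A.comp B hA hB).carrier (E × (A.comp B hA hB).fib) :=
  FiberProd.chart hB.continuous h ψ z₀

variable {φ : OpenPartialHomeomorph A.carrier (E × A.fib)} {χ : OpenPartialHomeomorph M E}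
  {ψ : OpenPartialHomeomorph B.carrier (E × B.fib)} {z₀ : (A.comp B hA hB).carrier}

theorem compChart_mem_maximalAtlas (h : IsAdaptedPair A.s φ χ)
    (hψ : ψ ∈ IsManifold.maximalAtlas 𝓘(ℝ, E × B.fib) ∞ B.carrier) :
    compChart hA hB h ψ z₀ ∈ IsManifold.maximalAtlas 𝓘(ℝ, E × (A.comp B hA hB).fib) ∞
      (A.comp B hA hB).carrier :=
  IsManifold.subset_maximalAtlas ⟨φ, χ, ψ, h, z₀, hψ, rfl⟩

theorem compChart_symm (h : IsAdaptedPair A.s φ χ) {p : E × (A.fib × B.fib)}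
    (hp : p ∈ (compChart hA hB h ψ z₀).target) :
    (p.1, p.2.2) ∈ ψ.target ∧ compCoord χ (B.t ∘ ψ.symm) p ∈ φ.target ∧
      compFst ((compChart hA hB h ψ z₀).symm p) = φ.symm (compCoord χ (B.t ∘ ψ.symm) p) ∧
      compSnd ((compChart hA hB h ψ z₀).symm p) = ψ.symm (p.1, p.2.2) := by
  have h1 := FiberProd.chartInv_val h z₀ hp
  exact ⟨hp.1.1, hp.2, congrArg Prod.fst h1, congrArg Prod.snd h1⟩

/-- The chart contains the full coordinates of the second projection but only the fibre coordinate
of the first. The base coordinate of the first is recovered as `χ (B.t (compSnd y))`, so the second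
projection has to be treated before. -/
theorem contMDiff_compFst_and_compSnd :
    ContMDiff 𝓘(ℝ, E × (A.comp B hA hB).fib) 𝓘(ℝ, E × A.fib) ∞
      (compFst : (A.comp B hA hB).carrier → A.carrier) ∧
    ContMDiff 𝓘(ℝ, E × (A.comp B hA hB).fib) 𝓘(ℝ, E × B.fib) ∞
      (compSnd : (A.comp B hA hB).carrier → B.carrier) := by
  refine forall_and.1 fun z => ?_
  obtain ⟨⟨φ, χ⟩, hφ, hu⟩ := exists_isAdaptedPair hA (compFst z)
  set ψ := chartAt (E × B.fib) (compSnd z) with hψ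
  have hψm : ψ ∈ IsManifold.maximalAtlas 𝓘(ℝ, E × B.fib) ∞ B.carrier :=
    IsManifold.chart_mem_maximalAtlas (compSnd z)
  set c := compChart hA hB hφ ψ z with hc
  have hz : z ∈ c.source := ⟨hu, mem_chart_source _ (compSnd z)⟩
  have hcm := compChart_mem_maximalAtlas (z₀ := z) hφ hψm
  have h1 : ContMDiffAt 𝓘(ℝ, E × (A.comp B hA hB).fib) 𝓘(ℝ, E × (A.comp B hA hB).fib) ∞ c z :=
    contMDiffAt_of_mem_maximalAtlas hcm hz
  have h2 : ContMDiffAt 𝓘(ℝ, E × (A.comp B hA hB).fib) 𝓘(ℝ, E × B.fib) ∞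
      (compSnd : (A.comp B hA hB).carrier → B.carrier) z := by
    have hπ' : ContDiff ℝ ∞ (fun p : E × (A.fib × B.fib) => ((p.1, p.2.2) : E × B.fib)) := by
      fun_prop
    have hπ : ContDiff ℝ ∞ (fun p : E × (A.comp B hA hB).fib =>
        ((p.1, Prod.snd (α := A.fib) (β := B.fib) p.2) : E × B.fib)) := hπ'
    have h3 : ContMDiffAt 𝓘(ℝ, E × (A.comp B hA hB).fib) 𝓘(ℝ, E × B.fib) ∞
        (fun p : E × (A.comp B hA hB).fib =>
          ψ.symm (p.1, Prod.snd (α := A.fib) (β := B.fib) p.2)) (c z) :=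
      ContMDiffAt.comp (g := ψ.symm) (c z)
        (contMDiffAt_symm_of_mem_maximalAtlas hψm (compChart_symm hφ (c.map_source hz)).1)
        hπ.contMDiff.contMDiffAt
    refine (h3.comp z h1).congr_of_eventuallyEq ?_
    filter_upwards [c.open_source.mem_nhds hz] with y hy
    exact (ψ.left_inv hy.2).symm
  refine ⟨?_, h2⟩
  have h4 : ContMDiffAt 𝓘(ℝ, E × (A.comp B hA hB).fib) 𝓘(ℝ, E) ∞
      (fun y : (A.comp B hA hB).carrier => χ (B.t (compSnd y))) z := by
    refine ContMDiffAt.comp z (contMDiffAt_of_mem_maximalAtlas hφ.mem_maximalAtlas' ?_)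
      ((hB _).comp z h2)
    rw [← comp_eq]
    exact hφ.mapsTo _ hu
  have hπ' : ContDiff ℝ ∞ (fun p : E × (A.fib × B.fib) => p.2.1) := by fun_prop
  have hπ : ContDiff ℝ ∞ (fun p : E × (A.comp B hA hB).fib =>
    Prod.fst (α := A.fib) (β := B.fib) p.2) := hπ'
  have h5 : ContMDiffAt 𝓘(ℝ, E × (A.comp B hA hB).fib) 𝓘(ℝ, A.fib) ∞
      (fun y : (A.comp B hA hB).carrier => (c y).2.1) z :=
    ContMDiffAt.comp (g := fun p : E × (A.comp B hA hB).fib =>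
      Prod.fst (α := A.fib) (β := B.fib) p.2) (f := c) z hπ.contMDiff.contMDiffAt h1
  have h6 : ∀ y ∈ c.source, ((χ (B.t (compSnd y)), (c y).2.1) : E × A.fib) = φ (compFst y) := by
    intro y hy
    rw [← comp_eq]
    exact Prod.ext (hφ.eq _ hy.1).symm rfl
  refine (ContMDiffAt.comp (g := φ.symm) z (contMDiffAt_symm_of_mem_maximalAtlas
    hφ.mem_maximalAtlas ?_) (contMDiffAt_prodMk_space h4 h5)).congr_of_eventuallyEq ?_
  · rw [h6 z hz]
    exact φ.map_source hu
  · filter_upwards [c.open_source.mem_nhds hz] with y hy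
    refine (φ.left_inv hy.1).symm.trans ?_
    exact congrArg φ.symm (h6 y hy).symm

theorem contMDiff_compFst : ContMDiff 𝓘(ℝ, E × (A.comp B hA hB).fib) 𝓘(ℝ, E × A.fib) ∞
    (compFst : (A.comp B hA hB).carrier → A.carrier) := contMDiff_compFst_and_compSnd.1

theorem contMDiff_compSnd : ContMDiff 𝓘(ℝ, E × (A.comp B hA hB).fib) 𝓘(ℝ, E × B.fib) ∞
    (compSnd : (A.comp B hA hB).carrier → B.carrier) := contMDiff_compFst_and_compSnd.2

/-- The universal property of the fibre product. The default `z₀` is taken only where `a` and `b` do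
not match, hence nowhere near `x`. -/
theorem contMDiffAt_compLift {H : Type} [NormedAddCommGroup H] [NormedSpace ℝ H] {N : Type*}
    [TopologicalSpace N] [ChartedSpace H N] {a : N → A.carrier} {b : N → B.carrier} {x : N}
    (ha : ContMDiffAt 𝓘(ℝ, H) 𝓘(ℝ, E × A.fib) ∞ a x)
    (hb : ContMDiffAt 𝓘(ℝ, H) 𝓘(ℝ, E × B.fib) ∞ b x) (hab : ∀ᶠ y in 𝓝 x, A.s (a y) = B.t (b y))
    (z₀ : (A.comp B hA hB).carrier) :
    ContMDiffAt 𝓘(ℝ, H) 𝓘(ℝ, E × (A.comp B hA hB).fib) ∞ (compLift a b z₀) x := by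
  obtain ⟨⟨φ, χ⟩, hφ, hu⟩ := exists_isAdaptedPair hA (a x)
  set ψ := chartAt (E × B.fib) (b x) with hψ
  have hψm : ψ ∈ IsManifold.maximalAtlas 𝓘(ℝ, E × B.fib) ∞ B.carrier :=
    IsManifold.chart_mem_maximalAtlas (b x)
  set c := compChart hA hB hφ ψ z₀ with hc
  have hcm := compChart_mem_maximalAtlas (z₀ := z₀) hφ hψm
  have hz : compMk hA hB (a x) (b x) hab.self_of_nhds ∈ c.source :=
    ⟨hu, mem_chart_source _ (b x)⟩
  have h1 : ContMDiffAt 𝓘(ℝ, H) 𝓘(ℝ, E × A.fib) ∞ (fun y => φ (a y)) x :=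
    (contMDiffAt_of_mem_maximalAtlas hφ.mem_maximalAtlas hu).comp x ha
  have h2 : ContMDiffAt 𝓘(ℝ, H) 𝓘(ℝ, E × B.fib) ∞ (fun y => ψ (b y)) x :=
    (contMDiffAt_of_mem_maximalAtlas hψm (mem_chart_source _ (b x))).comp x hb
  have h3 : ContMDiffAt 𝓘(ℝ, H) 𝓘(ℝ, E × (A.comp B hA hB).fib) ∞
      (fun y => (((ψ (b y)).1, ((φ (a y)).2, (ψ (b y)).2)) : E × (A.comp B hA hB).fib)) x :=
    contMDiffAt_prodMk_space (ContMDiffAt.comp x (g := Prod.fst)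
        contDiff_fst.contMDiff.contMDiffAt h2)
      (contMDiffAt_prodMk_space
        (ContMDiffAt.comp x (g := Prod.snd) contDiff_snd.contMDiff.contMDiffAt h1)
        (ContMDiffAt.comp x (g := Prod.snd) contDiff_snd.contMDiff.contMDiffAt h2))
  have h4 : ContMDiffAt 𝓘(ℝ, E × (A.comp B hA hB).fib) 𝓘(ℝ, E × (A.comp B hA hB).fib) ∞ c.symm
      (c (compMk hA hB (a x) (b x) hab.self_of_nhds)) :=
    contMDiffAt_symm_of_mem_maximalAtlas hcm (c.map_source hz)
  refine (ContMDiffAt.comp (I' := 𝓘(ℝ, E × (A.comp B hA hB).fib)) x h4 h3).congr_of_eventuallyEq ?_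
  filter_upwards [hab, ha.continuousAt.eventually (φ.open_source.mem_nhds hu),
    hb.continuousAt.eventually (ψ.open_source.mem_nhds (mem_chart_source _ (b x)))] with y h4 h5 h6
  rw [compLift_apply z₀ h4]
  exact (c.left_inv (x := compMk hA hB (a y) (b y) h4) ⟨h5, h6⟩).symm

variable {F : Set (VField E M)}

theorem isAdaptedPair_compChart (h : IsAdaptedPair A.s φ χ) {χ' : OpenPartialHomeomorph M E}
    (h' : IsAdaptedPair B.s ψ χ') :
    IsAdaptedPair (B := (A.comp B hA hB).fib) (A.comp B hA hB).s (compChart hA hB h ψ z₀) χ' where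
  mem_maximalAtlas := compChart_mem_maximalAtlas h h'.mem_maximalAtlas
  mem_maximalAtlas' := h'.mem_maximalAtlas'
  mapsTo _ hz := h'.mapsTo _ hz.2
  eq _ hz := h'.eq _ hz.2

/-- In the chart of the composition, `t` is `A.t` after `compCoord`, so the coordinate statements
apply; `HorIn` comes from the equality of the two pull-backs for `A`. -/
theorem isFibreAdapted_comp (hF : ∀ Z ∈ F, IsSmoothCompact Z) (hAF : IsBisubmersion F A)
    (hBF : IsBisubmersion F B) (z : (A.comp B hA hB).carrier) :
    IsFibreAdapted (A.comp B hA hB).fib F (A.comp B hA hB).s (A.comp B hA hB).t z := by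
  obtain ⟨⟨φ, χ⟩, hφ, hu⟩ := exists_isAdaptedPair hA (compFst z)
  obtain ⟨⟨ψ, χ'⟩, hψ, hw⟩ := exists_isAdaptedPair hBF.submersion_s (compSnd z)
  simp only at hφ hψ hu hw
  set c := compChart hA hB hφ ψ z with hc
  have hz : z ∈ c.source := ⟨hu, hw⟩
  set p₀ : E × (A.fib × B.fib) := c z with hp₀
  have e1 : (((p₀.1, p₀.2.2) : E × B.fib)) = ψ (compSnd z) := rfl
  have e2 : compCoord χ (B.t ∘ ψ.symm) p₀ = φ (compFst z) := by
    refine Prod.ext ?_ rfl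
    change χ (B.t (ψ.symm (ψ (compSnd z)))) = _
    rw [ψ.left_inv hw, ← comp_eq, hφ.eq _ hu]
  have h1 : (A.comp B hA hB).t ∘ c.symm =ᶠ[𝓝 p₀]
      (A.t ∘ φ.symm) ∘ compCoord χ (B.t ∘ ψ.symm) := by
    filter_upwards [c.open_target.mem_nhds (c.map_source hz)] with p hp
    exact congrArg A.t (compChart_symm hφ hp).2.2.1
  have h2 : ∀ᶠ q in 𝓝 (compCoord χ (B.t ∘ ψ.symm) p₀),
      ContMDiffAt 𝓘(ℝ, E × A.fib) 𝓘(ℝ, E) ∞ (A.t ∘ φ.symm) q := by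
    rw [e2]
    filter_upwards [φ.open_target.mem_nhds (φ.map_source hu)] with q hq
    exact (hAF.submersion_t.contMDiff _).comp q
      (contMDiffAt_symm_of_mem_maximalAtlas hφ.mem_maximalAtlas hq)
  have h3 : ∀ᶠ q in 𝓝 (p₀.1, p₀.2.2),
      ContMDiffAt 𝓘(ℝ, E × B.fib) 𝓘(ℝ, E) ∞ (B.t ∘ ψ.symm) q := by
    rw [e1]
    filter_upwards [ψ.open_target.mem_nhds (ψ.map_source hw)] with q hq
    exact (hB _).comp q (contMDiffAt_symm_of_mem_maximalAtlas hψ.mem_maximalAtlas hq)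
  have h4 : (B.t ∘ ψ.symm) (p₀.1, p₀.2.2) ∈ χ.source := by
    change B.t (ψ.symm (ψ (compSnd z))) ∈ χ.source
    rw [ψ.left_inv hw, ← comp_eq]
    exact hφ.mapsTo _ hu
  have h5 : VertIn F (A.t ∘ φ.symm) (compCoord χ (B.t ∘ ψ.symm) p₀) := by
    rw [e2]
    exact hAF.vertIn hφ hu
  have h6 : HorIn F χ (A.t ∘ φ.symm) (compCoord χ (B.t ∘ ψ.symm) p₀) := by
    rw [e2]
    exact hAF.horIn hF hφ hu
  have h7 : VertGen F (A.t ∘ φ.symm) (compCoord χ (B.t ∘ ψ.symm) p₀) := by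
    rw [e2]
    exact hAF.vertGen hF hφ hu
  refine ⟨c, χ', isAdaptedPair_compChart hφ hψ, hz, ?_, ?_⟩
  · exact VertIn.congr (VertIn.comp hφ.mem_maximalAtlas' h2 h3 h4 h5 (hBF.vertIn hψ hw) h6) h1
  · exact VertGen.congr (VertGen.comp hφ.mem_maximalAtlas' h2 h3 h4 h7) h1

/-- The composition of `A` and `B` is inverse to that of their inverses. -/
def compSwap (hAF : IsBisubmersion F A) (hBF : IsBisubmersion F B) :
    (A.comp B hAF.submersion_s hBF.submersion_t.contMDiff).carrier ≃ₜ
      (B.inv.comp A.inv hBF.submersion_t hAF.submersion_s.contMDiff).carrier where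
  toFun z := compMk hBF.submersion_t hAF.submersion_s.contMDiff (A := B.inv) (B := A.inv)
    (compSnd (A := A) (B := B) z) (compFst (A := A) (B := B) z) (comp_eq (A := A) (B := B) z).symm
  invFun z := compMk hAF.submersion_s hBF.submersion_t.contMDiff
    (compSnd (A := B.inv) (B := A.inv) z) (compFst (A := B.inv) (B := A.inv) z)
    (comp_eq (A := B.inv) (B := A.inv) z).symm
  left_inv _ := rfl
  right_inv _ := rfl
  continuous_toFun := (contMDiff_compSnd.continuous.prodMk contMDiff_compFst.continuous).subtype_mk _
  continuous_invFun := ((contMDiff_compSnd (A := B.inv) (B := A.inv)).continuous.prodMk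
    (contMDiff_compFst (A := B.inv) (B := A.inv)).continuous).subtype_mk _

/-- The condition along the fibres of `t` is that along the fibres of `s` for the composition of the
inverses in the opposite order, transported by `compSwap`. -/
theorem IsBisubmersion.comp (hF : ∀ Z ∈ F, IsSmoothCompact Z) (hAF : IsBisubmersion F A)
    (hBF : IsBisubmersion F B) :
    IsBisubmersion F (A.comp B hAF.submersion_s hBF.submersion_t.contMDiff) := by
  have hA1 := hAF.t2
  have hA2 := hAF.secondCountable
  have hB1 := hBF.t2
  have hB2 := hBF.secondCountable
  refine isBisubmersion_of_isFibreAdapted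
    (inferInstanceAs (T2Space {p : A.carrier × B.carrier // A.s p.1 = B.t p.2}))
    (TopologicalSpace.Subtype.secondCountableTopology {p : A.carrier × B.carrier | A.s p.1 = B.t p.2})
    (isFibreAdapted_comp hF hAF hBF) fun z => ?_
  have key := isFibreAdapted_comp (hA := hBF.inv.submersion_s)
    (hB := hAF.inv.submersion_t.contMDiff) hF hBF.inv hAF.inv (compSwap hAF hBF z)
  refine IsFibreAdapted.of_homeomorph
    (B := (A.comp B hAF.submersion_s hBF.submersion_t.contMDiff).fib)
    (B' := (B.inv.comp A.inv hBF.submersion_t hAF.submersion_s.contMDiff).fib)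
    (s' := (B.inv.comp A.inv hBF.submersion_t hAF.submersion_s.contMDiff).s)
    (t' := (B.inv.comp A.inv hBF.submersion_t hAF.submersion_s.contMDiff).t) (ContinuousLinearEquiv.prodComm ℝ A.fib B.fib)
    (compSwap hAF hBF) (fun x => ?_) (fun x => ?_) (fun x => rfl) (fun x => rfl) ?_ key
  · refine (contMDiffAt_compLift (A := B.inv) (B := A.inv) (hA := hBF.inv.submersion_s)
      (hB := hAF.inv.submersion_t.contMDiff) (contMDiff_compSnd x) (contMDiff_compFst x)
      (Eventually.of_forall fun y => (comp_eq y).symm)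
      (compSwap hAF hBF z)).congr_of_eventuallyEq (Eventually.of_forall fun y => ?_)
    exact (compLift_apply (A := B.inv) (B := A.inv) _ (comp_eq y).symm).symm
  · refine (contMDiffAt_compLift (A := A) (B := B) (hA := hAF.submersion_s)
      (hB := hBF.submersion_t.contMDiff) (contMDiff_compSnd (A := B.inv) (B := A.inv) x)
      (contMDiff_compFst (A := B.inv) (B := A.inv) x)
      (Eventually.of_forall fun y => (comp_eq (A := B.inv) (B := A.inv) y).symm)
      z).congr_of_eventuallyEq (Eventually.of_forall fun y => ?_)
    exact (compLift_apply (A := A) (B := B) _ (comp_eq (A := B.inv) (B := A.inv) y).symm).symm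
  · exact hBF.submersion_s.contMDiff.comp (contMDiff_compFst (A := B.inv) (B := A.inv))

end Composition

/-! ### Topology and charts of the deformation to the normal cone -/

section Deformation

variable {E : Type} [NormedAddCommGroup E] [NormedSpace ℝ E] [FiniteDimensional ℝ E] {M : Type u}
  [TopologicalSpace M] [ChartedSpace E M] {A : Span E M} {V : Set A.carrier}
  {hV : IsSliceSubmanifold E A.fib V}

/-- The projection of `D(U, V)` to `U`. -/
def dncBase (d : (A.dnc V hV).carrier) : A.carrier := DNC.base (G := E × A.fib) (V := V) d

/-- The projection of `D(U, V)` to `ℝ`. -/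
def dncTime (d : (A.dnc V hV).carrier) : ℝ := DNC.time (G := E × A.fib) (V := V) d

theorem dnc_s (d : (A.dnc V hV).carrier) : (A.dnc V hV).s d = (A.s (dncBase d), dncTime d) := rfl

theorem dnc_t (d : (A.dnc V hV).carrier) : (A.dnc V hV).t d = (A.t (dncBase d), dncTime d) := rfl

variable {φ : OpenPartialHomeomorph A.carrier (E × A.fib)} {S : Set ℝ}

variable (hV) in
/-- The charts of `D(U, V)`. -/
def dncChart (h : DNC.IsAdmissible V φ S) :
    OpenPartialHomeomorph (A.dnc V hV).carrier ((E × ℝ) × (A.dnc V hV).fib) :=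
  (DNC.chartedSpaceCore hV).openPartialHomeomorph (DNC.chart φ S h) ⟨φ, S, h, rfl⟩

theorem dncChart_mem_maximalAtlas (h : DNC.IsAdmissible V φ S) :
    dncChart hV h ∈ IsManifold.maximalAtlas 𝓘(ℝ, (E × ℝ) × (A.dnc V hV).fib) ∞
      (A.dnc V hV).carrier :=
  IsManifold.subset_maximalAtlas (mem_iUnion₂.2 ⟨_, ⟨φ, S, h, rfl⟩, rfl⟩)

theorem mem_dncChart_source (h : DNC.IsAdmissible V φ S) {d : (A.dnc V hV).carrier} :
    d ∈ (dncChart hV h).source ↔ dncBase d ∈ φ.source ∧ dncTime d ∈ S := Iff.rfl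

theorem mem_dncChart_target (h : DNC.IsAdmissible V φ S) {p : (E × ℝ) × A.fib} :
    p ∈ (dncChart hV h).target ↔ (p.1.1, p.1.2 • p.2) ∈ φ.target ∧ p.1.2 ∈ S := Iff.rfl

theorem dncBase_symm (h : DNC.IsAdmissible V φ S) {p : (E × ℝ) × A.fib}
    (hp : p ∈ (dncChart hV h).target) :
    dncBase ((dncChart hV h).symm p) = φ.symm (p.1.1, p.1.2 • p.2) ∧
      dncTime ((dncChart hV h).symm p) = p.1.2 :=
  DNC.base_coordInv h hp

theorem dncChart_apply_fst (h : DNC.IsAdmissible V φ S) (d : (A.dnc V hV).carrier) :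
    (dncChart hV h d).1 = ((φ (dncBase d)).1, dncTime d) := by
  match d with
  | .ext _ _ _ => rfl
  | .nor _ _ _ => rfl

/-- The fibre coordinate on the deformation is the normal coordinate on `U` divided by the time. In
multiplied form the relation also holds at time `0`. -/
theorem dncChart_apply_smul (h : DNC.IsAdmissible V φ S) {d : (A.dnc V hV).carrier}
    (hd : d ∈ (dncChart hV h).source) :
    (((φ (dncBase d)).1, dncTime d • (dncChart hV h d).2) : E × A.fib) = φ (dncBase d) := by
  have h1 := (dncChart hV h).map_source hd
  have h2 := dncBase_symm h h1
  rw [(dncChart hV h).left_inv hd] at h2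
  have h3 := h2.1
  rw [← h2.2] at h3
  have h4 := ((mem_dncChart_target h).1 h1).1
  rw [← h2.2, dncChart_apply_fst h d] at h4
  rw [dncChart_apply_fst h d] at h3
  exact (φ.right_inv h4).symm.trans (congrArg φ h3.symm)

theorem exists_mem_dncChart_source (d : (A.dnc V hV).carrier) :
    ∃ (φ : OpenPartialHomeomorph A.carrier (E × A.fib)) (S : Set ℝ) (h : DNC.IsAdmissible V φ S),
      d ∈ (dncChart hV h).source := by
  match d with
  | .ext u β hβ => exact ⟨_, _, DNC.isAdmissible_chartAt V u, mem_chart_source _ u, hβ⟩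
  | .nor v hv n => exact ⟨_, _, DNC.isAdmissible_slice hV hv, (hV v hv).choose_spec.2, mem_univ _⟩

theorem contDiff_smul_coord {B : Type} [NormedAddCommGroup B] [NormedSpace ℝ B] :
    ContDiff ℝ ∞ (fun p : (E × ℝ) × B => ((p.1.1, p.1.2 • p.2) : E × B)) := by
  fun_prop

theorem contMDiff_dncBase : ContMDiff 𝓘(ℝ, (E × ℝ) × (A.dnc V hV).fib) 𝓘(ℝ, E × A.fib) ∞
    (dncBase : (A.dnc V hV).carrier → A.carrier) := by
  intro d
  obtain ⟨φ, S, h, hd⟩ := exists_mem_dncChart_source d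
  have h1 : ContMDiffAt 𝓘(ℝ, (E × ℝ) × (A.dnc V hV).fib) 𝓘(ℝ, (E × ℝ) × (A.dnc V hV).fib) ∞
    (dncChart hV h) d := contMDiffAt_of_mem_maximalAtlas (dncChart_mem_maximalAtlas h) hd
  have h2 : ContMDiffAt 𝓘(ℝ, (E × ℝ) × (A.dnc V hV).fib) 𝓘(ℝ, E × A.fib) ∞
      (fun p : (E × ℝ) × (A.dnc V hV).fib => φ.symm (p.1.1, p.1.2 • (p.2 : A.fib)))
      (dncChart hV h d) :=
    ContMDiffAt.comp (g := φ.symm)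
      (f := fun p : (E × ℝ) × (A.dnc V hV).fib => ((p.1.1, p.1.2 • (p.2 : A.fib)) : E × A.fib)) _ (contMDiffAt_symm_of_mem_maximalAtlas h.mem_maximalAtlas
      ((dncChart hV h).map_source hd).1)
      (ContDiff.contMDiff (contDiff_smul_coord (B := A.fib))).contMDiffAt
  refine (ContMDiffAt.comp (f := dncChart hV h) d h2 h1).congr_of_eventuallyEq ?_
  filter_upwards [(dncChart hV h).open_source.mem_nhds hd] with x hx
  have h3 := (dncBase_symm h ((dncChart hV h).map_source hx)).1
  rw [(dncChart hV h).left_inv hx] at h3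
  exact h3

theorem contMDiff_dncTime : ContMDiff 𝓘(ℝ, (E × ℝ) × (A.dnc V hV).fib) 𝓘(ℝ, ℝ) ∞
    (dncTime : (A.dnc V hV).carrier → ℝ) := by
  intro d
  obtain ⟨φ, S, h, hd⟩ := exists_mem_dncChart_source d
  have h1 : ContMDiffAt 𝓘(ℝ, (E × ℝ) × (A.dnc V hV).fib) 𝓘(ℝ, (E × ℝ) × (A.dnc V hV).fib) ∞
    (dncChart hV h) d := contMDiffAt_of_mem_maximalAtlas (dncChart_mem_maximalAtlas h) hd
  have h2 : ContMDiffAt 𝓘(ℝ, (E × ℝ) × (A.dnc V hV).fib) 𝓘(ℝ, ℝ) ∞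
      (fun p : (E × ℝ) × (A.dnc V hV).fib => p.1.2) (dncChart hV h d) :=
    (contDiff_fst.snd).contMDiff.contMDiffAt
  refine (ContMDiffAt.comp (f := dncChart hV h) d h2 h1).congr_of_eventuallyEq ?_
  exact Eventually.of_forall fun x => congrArg Prod.snd (dncChart_apply_fst h x).symm

/-- Whether a point lies in a given chart depends only on its image under `q`. Points with the same
image are thus separated inside one chart, and the others by the continuous components of `q`. -/
theorem t2Space_dnc (hA : T2Space A.carrier) : T2Space (A.dnc V hV).carrier := by
  refine ⟨fun d d' hdd => ?_⟩
  by_cases hb : dncBase d = dncBase d'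
  · by_cases ht : dncTime d = dncTime d'
    · obtain ⟨φ, S, h, hd⟩ := exists_mem_dncChart_source d
      have hd' : d' ∈ (dncChart hV h).source := by
        rw [mem_dncChart_source, ← hb, ← ht]
        exact hd
      obtain ⟨O, O', hO, hO', h1, h2, h3⟩ := t2_separation fun h4 =>
        hdd ((dncChart hV h).injOn hd hd' h4)
      exact ⟨_, _, (dncChart hV h).isOpen_inter_preimage hO,
        (dncChart hV h).isOpen_inter_preimage hO', ⟨hd, h1⟩, ⟨hd', h2⟩,
        Set.disjoint_left.2 fun x hx hx' => Set.disjoint_left.1 h3 hx.2 hx'.2⟩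
    · exact separated_by_continuous contMDiff_dncTime.continuous ht
  · exact separated_by_continuous contMDiff_dncBase.continuous hb

/-- Countably many charts of `U` cover the part over `ℝ*`. The subspace `V` is second countable as
well, so countably many slice charts cover the normal bundle. -/
theorem secondCountableTopology_dnc (hA : SecondCountableTopology A.carrier) :
    SecondCountableTopology (A.dnc V hV).carrier := by
  obtain ⟨T, hT, hTU⟩ := TopologicalSpace.countable_cover_nhds
    (fun u : A.carrier => chart_source_mem_nhds (E × A.fib) u)
  choose ψ hψ hvψ using fun v : V => hV v.1 v.2
  obtain ⟨T', hT', hT'U⟩ := TopologicalSpace.countable_cover_nhds (fun v : V =>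
    ((ψ v).open_source.preimage continuous_subtype_val).mem_nhds (hvψ v))
  have hadm : ∀ v : T', DNC.IsAdmissible V (ψ v) univ := fun v =>
    ⟨(hψ v).mem_maximalAtlas, isOpen_univ, fun _ => hψ v⟩
  have := hT.to_subtype
  have := hT'.to_subtype
  set C : T ⊕ T' → OpenPartialHomeomorph (A.dnc V hV).carrier ((E × ℝ) × (A.dnc V hV).fib) :=
    Sum.elim (fun u => dncChart hV (DNC.isAdmissible_chartAt V u.1))
      (fun v => dncChart hV (hadm v)) with hC
  have : ∀ i, SecondCountableTopology (C i).source := fun i => (C i).secondCountableTopology_source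
  refine TopologicalSpace.secondCountableTopology_of_countable_cover
    (U := fun i => (C i).source) (fun i => (C i).open_source) ?_
  refine eq_univ_of_forall fun d => mem_iUnion.2 ?_
  match d with
  | .ext u β hβ =>
    obtain ⟨u', hu', hu⟩ := mem_iUnion₂.1 (hTU.symm ▸ mem_univ u)
    exact ⟨Sum.inl ⟨u', hu'⟩, hu, hβ⟩
  | .nor v hv n =>
    obtain ⟨v', hv', hv⟩ := mem_iUnion₂.1 (hT'U.symm ▸ mem_univ (⟨v, hv⟩ : V))
    exact ⟨Sum.inr ⟨v', hv'⟩, hv, mem_univ _⟩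

variable (hV) in
open Classical in
/-- The point `(u, β)` of `D(U, V)`, for `β ≠ 0`. -/
def dncExt (u : A.carrier) (β : ℝ) : (A.dnc V hV).carrier :=
  if hβ : β ≠ 0 then DNC.ext (G := E × A.fib) (V := V) u β hβ
  else DNC.ext (G := E × A.fib) (V := V) u 1 one_ne_zero

theorem dncExt_of_ne {β : ℝ} (hβ : β ≠ 0) (u : A.carrier) :
    dncExt hV u β = DNC.ext (G := E × A.fib) (V := V) u β hβ := dif_pos hβ

theorem dncBase_dncExt (u : A.carrier) (β : ℝ) : dncBase (dncExt hV u β) = u := by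
  by_cases hβ : β = 0
  · subst hβ
    have : dncExt hV u 0 = DNC.ext (G := E × A.fib) (V := V) u 1 one_ne_zero :=
      dif_neg (by simp)
    rw [this]
    rfl
  · rw [dncExt_of_ne hβ]
    rfl

theorem dncTime_dncExt {β : ℝ} (hβ : β ≠ 0) (u : A.carrier) : dncTime (dncExt hV u β) = β := by
  rw [dncExt_of_ne hβ]
  rfl

theorem eq_dncExt {d : (A.dnc V hV).carrier} (hd : dncTime d ≠ 0) :
    d = dncExt hV (dncBase d) (dncTime d) := by
  rw [dncExt_of_ne hd]
  match d with
  | .ext _ _ _ => rfl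
  | .nor _ _ _ => exact absurd rfl hd

theorem dncChart_symm_of_ne (h : DNC.IsAdmissible V φ S) {p : (E × ℝ) × A.fib} (hp : p.1.2 ≠ 0) :
    (dncChart hV h).symm p = dncExt hV (φ.symm (p.1.1, p.1.2 • p.2)) p.1.2 := by
  rw [dncExt_of_ne hp]
  exact dif_pos hp

/-- Away from time `0` any chart of `U` gives a chart of the deformation, and division by the time
is smooth. -/
theorem contMDiffAt_dncExt {H : Type} [NormedAddCommGroup H] [NormedSpace ℝ H] {N : Type*}
    [TopologicalSpace N] [ChartedSpace H N] {a : N → A.carrier} {T : N → ℝ} {x : N}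
    (ha : ContMDiffAt 𝓘(ℝ, H) 𝓘(ℝ, E × A.fib) ∞ a x) (hT : ContMDiffAt 𝓘(ℝ, H) 𝓘(ℝ, ℝ) ∞ T x)
    (hx : T x ≠ 0) : ContMDiffAt 𝓘(ℝ, H) 𝓘(ℝ, (E × ℝ) × (A.dnc V hV).fib) ∞
      (fun y => dncExt hV (a y) (T y)) x := by
  set ψ := chartAt (E × A.fib) (a x) with hψ
  have hψx : a x ∈ ψ.source := mem_chart_source _ _
  have hadm : DNC.IsAdmissible V ψ {0}ᶜ := DNC.isAdmissible_chartAt V (a x)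
  have h1 : ContMDiffAt 𝓘(ℝ, H) 𝓘(ℝ, E × A.fib) ∞ (fun y => ψ (a y)) x :=
    (contMDiffAt_of_mem_maximalAtlas hadm.mem_maximalAtlas hψx).comp x ha
  have h2 : ContMDiffAt 𝓘(ℝ, H) 𝓘(ℝ, E × ℝ) ∞ (fun y => ((ψ (a y)).1, T y)) x :=
    contMDiffAt_prodMk_space (ContMDiffAt.comp (g := Prod.fst) x
      contDiff_fst.contMDiff.contMDiffAt h1) hT
  have h3 : ContMDiffAt 𝓘(ℝ, H) 𝓘(ℝ, A.fib) ∞ (fun y => (T y)⁻¹ • (ψ (a y)).2) x :=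
    ContMDiffAt.comp (g := fun q : ℝ × A.fib => q.1⁻¹ • q.2) x
      ((contDiffAt_fst.inv (by exact hx)).smul contDiffAt_snd).contMDiffAt
      (contMDiffAt_prodMk_space hT (ContMDiffAt.comp (g := Prod.snd) x
        contDiff_snd.contMDiff.contMDiffAt h1))
  have h4 : ∀ᶠ y in 𝓝 x, T y ≠ 0 := hT.continuousAt.eventually_ne hx
  have h5 : ∀ᶠ y in 𝓝 x, a y ∈ ψ.source :=
    ha.continuousAt.eventually (ψ.open_source.mem_nhds hψx)
  have key : ∀ y, T y ≠ 0 → a y ∈ ψ.source →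
      (((((ψ (a y)).1, T y), (T y)⁻¹ • (ψ (a y)).2) : (E × ℝ) × A.fib) ∈
        (dncChart hV hadm).target) ∧ (dncChart hV hadm).symm
          (((ψ (a y)).1, T y), (T y)⁻¹ • (ψ (a y)).2) = dncExt hV (a y) (T y) := by
    intro y hy hy'
    have h6 : ((ψ (a y)).1, T y • (T y)⁻¹ • (ψ (a y)).2) = ψ (a y) := by
      rw [smul_inv_smul₀ hy]
    refine ⟨⟨?_, hy⟩, ?_⟩
    · exact h6.symm ▸ ψ.map_source hy'
    · refine (dncChart_symm_of_ne hadm (p := (((ψ (a y)).1, T y), (T y)⁻¹ • (ψ (a y)).2))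
        hy).trans ?_
      exact congrArg (fun u => dncExt hV u (T y)) ((congrArg ψ.symm h6).trans (ψ.left_inv hy'))
  refine (ContMDiffAt.comp (g := (dncChart hV hadm).symm) x
    (contMDiffAt_symm_of_mem_maximalAtlas (dncChart_mem_maximalAtlas hadm)
      (key x hx hψx).1) (contMDiffAt_prodMk_space h2 h3)).congr_of_eventuallyEq ?_
  filter_upwards [h4, h5] with y hy hy'
  exact (key y hy hy').2.symm

end Deformation

/-! ### Deformations are bi-submersions for the adiabatic foliation -/

section DeformationBisubmersion

variable {E B : Type} [NormedAddCommGroup E] [NormedSpace ℝ E] [FiniteDimensional ℝ E]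
  [NormedAddCommGroup B] [NormedSpace ℝ B] [FiniteDimensional ℝ B] {M : Type u}
  [TopologicalSpace M] [ChartedSpace E M] [IsManifold 𝓘(ℝ, E) ∞ M] [T2Space M]
  {F : Set (VField E M)} {τ : E × B → M}

/-- The map of deformations induced by `τ`, in coordinates. -/
def dncMap (τ : E × B → M) (p : (E × ℝ) × B) : M × ℝ := (τ (p.1.1, p.1.2 • p.2), p.1.2)

/-- By the chain rule the scaling `b ↦ βb` contributes a factor `β`; this is where the `λ` of the
adiabatic foliation arises. -/
theorem mfderiv_dncMap {p : (E × ℝ) × B}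
    (hτ : ContMDiffAt 𝓘(ℝ, E × B) 𝓘(ℝ, E) ∞ τ (p.1.1, p.1.2 • p.2)) :
    ContMDiffAt 𝓘(ℝ, (E × ℝ) × B) 𝓘(ℝ, E × ℝ) ∞ (dncMap τ) p ∧ ∀ b : B,
      (mfderiv 𝓘(ℝ, (E × ℝ) × B) 𝓘(ℝ, E × ℝ) (dncMap τ) p ((0, b) : (E × ℝ) × B) : E × ℝ) =
        (p.1.2 • (mfderiv 𝓘(ℝ, E × B) 𝓘(ℝ, E) τ (p.1.1, p.1.2 • p.2) ((0, b) : E × B) : E), 0) := by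
  have h0 : ContMDiffAt 𝓘(ℝ, (E × ℝ) × B) 𝓘(ℝ, E) ∞
      (fun p : (E × ℝ) × B => τ (p.1.1, p.1.2 • p.2)) p :=
    ContMDiffAt.comp (f := fun p : (E × ℝ) × B => ((p.1.1, p.1.2 • p.2) : E × B)) p hτ
      (ContDiff.contMDiff contDiff_smul_coord).contMDiffAt
  refine ⟨contMDiffAt_prodMk_real h0 (ContDiff.contMDiff contDiff_fst.snd).contMDiffAt, fun b => ?_⟩
  have h1 : HasFDerivAt (fun p : (E × ℝ) × B => p.1.2) ((ContinuousLinearMap.snd ℝ E ℝ).comp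
    (ContinuousLinearMap.fst ℝ (E × ℝ) B)) p :=
    ((ContinuousLinearMap.snd ℝ E ℝ).comp (ContinuousLinearMap.fst ℝ (E × ℝ) B)).hasFDerivAt
  have h2 : HasFDerivAt (fun p : (E × ℝ) × B => p.1.1) ((ContinuousLinearMap.fst ℝ E ℝ).comp
    (ContinuousLinearMap.fst ℝ (E × ℝ) B)) p :=
    ((ContinuousLinearMap.fst ℝ E ℝ).comp (ContinuousLinearMap.fst ℝ (E × ℝ) B)).hasFDerivAt
  have h3 : HasFDerivAt (fun p : (E × ℝ) × B => p.2) (ContinuousLinearMap.snd ℝ (E × ℝ) B) p :=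
    (ContinuousLinearMap.snd ℝ (E × ℝ) B).hasFDerivAt
  have h4 := h2.prodMk (h1.smul h3)
  have h5 := HasMFDerivAt.comp p (f := fun p : (E × ℝ) × B => ((p.1.1, p.1.2 • p.2) : E × B))
    (hτ.mdifferentiableAt (by simp)).hasMFDerivAt h4.hasMFDerivAt
  have h6 := (hasMFDerivAt_prodMk_real h5 h1.hasMFDerivAt).mfderiv
  refine (congrArg (fun L : (E × ℝ) × B →L[ℝ] E × ℝ => L (0, b)) h6).trans ?_
  refine Prod.ext ?_ rfl
  change (mfderiv 𝓘(ℝ, E × B) 𝓘(ℝ, E) τ (p.1.1, p.1.2 • p.2)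
    ((0, p.1.2 • b + (0 : ℝ) • p.2) : E × B) : E) = _
  have h7 : ((0, p.1.2 • b + (0 : ℝ) • p.2) : E × B) = p.1.2 • ((0, b) : E × B) := by simp
  rw [h7]
  exact (mfderiv 𝓘(ℝ, E × B) 𝓘(ℝ, E) τ (p.1.1, p.1.2 • p.2)).map_smul p.1.2 ((0, b) : E × B)

theorem prodMk_smul_sum {κ : Type*} [Fintype κ] {β : ℝ} {v : E} {c : κ → ℝ} {w : κ → E}
    {y : κ → E × ℝ} (hv : v = ∑ i, c i • w i) (hy : ∀ i, y i = (β • c i • w i, 0)) :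
    ((β • v, 0) : E × ℝ) = ∑ i, y i := by
  subst hv
  simp_rw [hy]
  refine Prod.ext ?_ ?_
  · simp [Prod.fst_sum, Finset.smul_sum]
  · simp [Prod.snd_sum]

variable {p₀ : (E × ℝ) × B}

theorem tendsto_smul_coord (p₀ : (E × ℝ) × B) :
    Tendsto (fun p : (E × ℝ) × B => ((p.1.1, p.1.2 • p.2) : E × B)) (𝓝 p₀)
      (𝓝 (p₀.1.1, p₀.1.2 • p₀.2)) :=
  (contDiff_smul_coord (E := E) (B := B)).continuous.tendsto p₀

/-- The derivatives of `τ` are multiplied by `β`, so the fields `Zᵢ` are replaced by `λ (Zᵢ ⊗ 1)`,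
cut off by a function equal to `1` near the image point so as to belong to `adiabatic F`. -/
theorem VertIn.dncMap
    (hτ : ∀ᶠ q in 𝓝 (p₀.1.1, p₀.1.2 • p₀.2), ContMDiffAt 𝓘(ℝ, E × B) 𝓘(ℝ, E) ∞ τ q)
    (h : VertIn F τ (p₀.1.1, p₀.1.2 • p₀.2)) : VertIn (adiabatic F) (dncMap τ) p₀ := by
  obtain ⟨κ, hκ, c, Z, hZ, hc⟩ := h
  obtain ⟨ρ, hρ, -, hρ1⟩ := exists_isTestFunction_nhds (G := E × ℝ) (x := SingFol.dncMap τ p₀)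
    univ_mem
  have hm := tendsto_smul_coord p₀
  have h1 : Tendsto (SingFol.dncMap τ) (𝓝 p₀) (𝓝 (SingFol.dncMap τ p₀)) :=
    (mfderiv_dncMap hτ.self_of_nhds).1.continuousAt
  refine ⟨κ, hκ, fun i p => c i (p.1.1, p.1.2 • p.2),
    fun i q => (q.2 * ρ q) • tensorOne (Z i) q, fun i => adiabatic_single hρ (hZ i), ?_⟩
  filter_upwards [hm.eventually hc, hm.eventually hτ, h1.eventually hρ1] with p h2 h3 h4
  refine ⟨fun i => ContDiffAt.comp p (h2.1 i) contDiff_smul_coord.contDiffAt, fun b => ?_⟩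
  refine ((mfderiv_dncMap h3).2 b).trans ?_
  have h5 : (SingFol.dncMap τ p).2 * ρ (SingFol.dncMap τ p) = p.1.2 := by
    rw [h4]
    exact mul_one _
  have h6 : ∀ i, (c i (p.1.1, p.1.2 • p.2) b • ((((SingFol.dncMap τ p).2 *
      ρ (SingFol.dncMap τ p)) • tensorOne (Z i) (SingFol.dncMap τ p) : E × ℝ)) : E × ℝ) =
      (p.1.2 • c i (p.1.1, p.1.2 • p.2) b • (Z i (τ (p.1.1, p.1.2 • p.2)) : E), 0) := by
    intro i
    rw [h5]
    refine Prod.ext ?_ ?_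
    · exact smul_comm (α := E) _ _ _
    · change c i (p.1.1, p.1.2 • p.2) b * (p.1.2 * 0) = 0
      ring
  exact prodMk_smul_sum (E := E) (h2.2 b) h6

/-- The coefficients `gᵢ`, pulled back by `dncMap τ`, multiply the vectors that generate the `Zᵢ`;
the factor `λ` is supplied by the scaling. -/
theorem VertGen.dncMap
    (hτ : ∀ᶠ q in 𝓝 (p₀.1.1, p₀.1.2 • p₀.2), ContMDiffAt 𝓘(ℝ, E × B) 𝓘(ℝ, E) ∞ τ q)
    (h : VertGen F τ (p₀.1.1, p₀.1.2 • p₀.2)) : VertGen (adiabatic F) (dncMap τ) p₀ := by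
  rintro Y ⟨n, g, Z, hg, hY⟩
  choose e he using fun i => h (Z i) (hg i).2
  have hm := tendsto_smul_coord p₀
  refine ⟨fun p => ∑ i, g i (SingFol.dncMap τ p) • e i (p.1.1, p.1.2 • p.2), ?_⟩
  filter_upwards [hm.eventually (eventually_all.2 he), hm.eventually hτ] with p h2 h3
  obtain ⟨h4, h5⟩ := mfderiv_dncMap h3
  refine ⟨?_, ?_⟩
  · refine ContDiffAt.sum fun i _ => ContDiffAt.smul ?_ ?_
    · exact (ContMDiffAt.comp p ((hg i).1.1 _) h4).contDiffAt
    · exact ContDiffAt.comp p (h2 i).1 contDiff_smul_coord.contDiffAt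
  · refine (h5 _).trans ((Eq.trans ?_ (hY (SingFol.dncMap τ p)).symm))
    have h6 : ((0, ∑ i, g i (SingFol.dncMap τ p) • e i (p.1.1, p.1.2 • p.2)) : E × B) =
        ∑ i, g i (SingFol.dncMap τ p) • ((0, e i (p.1.1, p.1.2 • p.2)) : E × B) := by
      refine Prod.ext ?_ ?_
      · simp [Prod.fst_sum]
      · simp [Prod.snd_sum]
    have h7 : (mfderiv 𝓘(ℝ, E × B) 𝓘(ℝ, E) τ (p.1.1, p.1.2 • p.2)
        ((0, ∑ i, g i (SingFol.dncMap τ p) • e i (p.1.1, p.1.2 • p.2)) : E × B) : E) =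
        ∑ i, g i (SingFol.dncMap τ p) • (Z i (τ (p.1.1, p.1.2 • p.2)) : E) := by
      rw [h6]
      refine (map_sum (mfderiv 𝓘(ℝ, E × B) 𝓘(ℝ, E) τ (p.1.1, p.1.2 • p.2)) _ _).trans ?_
      refine Finset.sum_congr rfl fun i _ => ?_
      refine ((mfderiv 𝓘(ℝ, E × B) 𝓘(ℝ, E) τ (p.1.1, p.1.2 • p.2)).map_smul _ _).trans ?_
      exact congrArg (fun v : E => g i (SingFol.dncMap τ p) • v) (h2 i).2
    have h8 : ∀ i, (((SingFol.dncMap τ p).2 * g i (SingFol.dncMap τ p)) •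
        tensorOne (Z i) (SingFol.dncMap τ p) : E × ℝ) =
        (p.1.2 • g i (SingFol.dncMap τ p) • (Z i (τ (p.1.1, p.1.2 • p.2)) : E), 0) := by
      intro i
      refine Prod.ext ?_ ?_
      · exact mul_smul (β := E) _ _ _
      · exact mul_zero _
    exact prodMk_smul_sum (E := E) h7 h8

variable {A : Span E M} {V : Set A.carrier} {hV : IsSliceSubmanifold E A.fib V}
  {φ : OpenPartialHomeomorph A.carrier (E × A.fib)} {χ : OpenPartialHomeomorph M E} {S : Set ℝ}

theorem isAdaptedPair_dncChart (h : DNC.IsAdmissible V φ S) (hφ : IsAdaptedPair A.s φ χ) :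
    IsAdaptedPair (E := E × ℝ) (B := (A.dnc V hV).fib) (A.dnc V hV).s (dncChart hV h)
      (χ.prod (OpenPartialHomeomorph.refl ℝ)) where
  mem_maximalAtlas := dncChart_mem_maximalAtlas h
  mem_maximalAtlas' := prod_refl_mem_maximalAtlas hφ.mem_maximalAtlas'
  mapsTo d hd := ⟨hφ.mapsTo _ hd.1, mem_univ _⟩
  eq d hd := by
    rw [dncChart_apply_fst, hφ.eq _ ((mem_dncChart_source h).1 hd).1]
    rfl

theorem dnc_t_symm (h : DNC.IsAdmissible V φ S) {p : (E × ℝ) × A.fib}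
    (hp : p ∈ (dncChart hV h).target) :
    (A.dnc V hV).t ((dncChart hV h).symm p) = dncMap (A.t ∘ φ.symm) p := by
  rw [dnc_t, (dncBase_symm h hp).1, (dncBase_symm h hp).2]
  rfl

theorem isFibreAdapted_dnc (hF : ∀ Z ∈ F, IsSmoothCompact Z) (hA : IsBisubmersion F A)
    (h : DNC.IsAdmissible V φ S) (hφ : IsAdaptedPair A.s φ χ) {d : (A.dnc V hV).carrier}
    (hd : d ∈ (dncChart hV h).source) :
    IsFibreAdapted (A.dnc V hV).fib (adiabatic F) (A.dnc V hV).s (A.dnc V hV).t d := by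
  have h1 : (A.dnc V hV).t ∘ (dncChart hV h).symm =ᶠ[𝓝 (dncChart hV h d)]
      dncMap (A.t ∘ φ.symm) := by
    filter_upwards [(dncChart hV h).open_target.mem_nhds ((dncChart hV h).map_source hd)] with p hp
    exact dnc_t_symm h hp
  have hu : dncBase d ∈ φ.source := hd.1
  have e0 : (((dncChart hV h d).1.1, (dncChart hV h d).1.2 •
      ((dncChart hV h d).2 : A.fib)) : E × A.fib) = φ (dncBase d) := by
    refine Eq.trans ?_ (dncChart_apply_smul h hd)
    rw [dncChart_apply_fst]
  have h2 : ∀ᶠ q in 𝓝 (((dncChart hV h d).1.1, (dncChart hV h d).1.2 •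
      ((dncChart hV h d).2 : A.fib)) : E × A.fib),
      ContMDiffAt 𝓘(ℝ, E × A.fib) 𝓘(ℝ, E) ∞ (A.t ∘ φ.symm) q := by
    rw [e0]
    filter_upwards [φ.open_target.mem_nhds (φ.map_source hu)] with q hq
    exact (hA.submersion_t.contMDiff _).comp q
      (contMDiffAt_symm_of_mem_maximalAtlas hφ.mem_maximalAtlas hq)
  refine ⟨dncChart hV h, _, isAdaptedPair_dncChart h hφ, hd, ?_, ?_⟩
  · refine VertIn.congr (VertIn.dncMap h2 ?_) h1
    have := hA.vertIn hφ hu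
    rwa [← e0] at this
  · refine VertGen.congr (VertGen.dncMap h2 ?_) h1
    have := hA.vertGen hF hφ hu
    rwa [← e0] at this

/-- Over `ℝ*` every chart of `U` is admissible, so one adapted to `s` is enough. On the normal
bundle the adapted chart has to be a slice chart too. -/
theorem isFibreAdapted_dnc_of_slice (hF : ∀ Z ∈ F, IsSmoothCompact Z) (hA : IsBisubmersion F A)
    (hVs : ∀ v ∈ V, ∃ (φ : OpenPartialHomeomorph A.carrier (E × A.fib))
      (χ : OpenPartialHomeomorph M E), IsAdaptedPair A.s φ χ ∧ IsSliceChart V φ ∧ v ∈ φ.source)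
    (d : (A.dnc V hV).carrier) :
    IsFibreAdapted (A.dnc V hV).fib (adiabatic F) (A.dnc V hV).s (A.dnc V hV).t d := by
  match d with
  | .ext u β hβ =>
    obtain ⟨⟨φ, χ⟩, hφ, hu⟩ := exists_isAdaptedPair hA.submersion_s u
    exact isFibreAdapted_dnc hF hA (S := {0}ᶜ)
      ⟨hφ.mem_maximalAtlas, isOpen_compl_singleton, fun h => absurd rfl h⟩ hφ ⟨hu, hβ⟩
  | .nor v hv n =>
    obtain ⟨φ, χ, hφ, hs, hu⟩ := hVs v hv
    exact isFibreAdapted_dnc hF hA (S := univ)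
      ⟨hφ.mem_maximalAtlas, isOpen_univ, fun _ => hs⟩ hφ ⟨hu, mem_univ _⟩

theorem IsBisubmersion.dnc (hF : ∀ Z ∈ F, IsSmoothCompact Z) (hA : IsBisubmersion F A)
    (hVA : IsIdentityBisection A V) : IsBisubmersion (adiabatic F) (A.dnc V hVA.submanifold) := by
  refine isBisubmersion_of_isFibreAdapted (t2Space_dnc hA.t2)
    (secondCountableTopology_dnc hA.secondCountable)
    (isFibreAdapted_dnc_of_slice hF hA fun v hv => ?_)
    -- Inversion commutes definitionally with deformation, so the condition on the fibres of `t` is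
    -- the one already proved, applied to the inverse.
    (isFibreAdapted_dnc_of_slice (A := A.inv) hF hA.inv fun v hv => ?_)
  · obtain ⟨φ, χ, h1, h2, h3⟩ := hVA.exists_chart hA.submersion_s hv
    exact ⟨φ, χ, h1, h2, h3.1⟩
  · obtain ⟨φ, χ, h1, h2, h3⟩ := hVA.inv.exists_chart hA.submersion_t hv
    exact ⟨φ, χ, h1, h2, h3.1⟩

end DeformationBisubmersion

/-! ### The deformations form an atlas -/

section DeformationAtlas

theorem contDiffAt_divided_of_mem {X Y : Type} [NormedAddCommGroup X] [NormedSpace ℝ X]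
    [FiniteDimensional ℝ X] [NormedAddCommGroup Y] [NormedSpace ℝ Y] [CompleteSpace Y]
    {h : X × ℝ → Y} {Ω : Set (X × ℝ)} (hΩ : IsOpen Ω) (hh : ContDiffOn ℝ ∞ h Ω)
    (h0 : ∀ x, (x, (0 : ℝ)) ∈ Ω → h (x, 0) = 0) {p : X × ℝ} (hp : p ∈ Ω) :
    ContDiffAt ℝ ∞ (fun p : X × ℝ =>
      if p.2 = 0 then fderiv ℝ h (p.1, 0) (0, 1) else p.2⁻¹ • h p) p := by
  by_cases hβ : p.2 = 0
  · obtain ⟨x, β⟩ := p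
    simp only at hβ
    subst hβ
    exact contDiffAt_divided hΩ hh h0 hp
  · refine ((contDiffAt_snd.inv hβ).smul (hh.contDiffAt (hΩ.mem_nhds hp))).congr_of_eventuallyEq ?_
    filter_upwards [continuousAt_snd.eventually_ne hβ] with q hq
    simp [hq]

variable {E : Type} [NormedAddCommGroup E] [NormedSpace ℝ E] [FiniteDimensional ℝ E] {M : Type u}
  [TopologicalSpace M] [ChartedSpace E M] [IsManifold 𝓘(ℝ, E) ∞ M]
  {F : Set (VField E M)} {X B : Span E M} {W : Set B.carrier}
  {𝒳 : Span (E × ℝ) (M × ℝ)} {f : 𝒳.carrier → X.carrier} {T : 𝒳.carrier → ℝ} {z₀ : 𝒳.carrier}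

/-- Away from time `0` the deformation is `B.carrier × ℝ*`, and a morphism into `B` is paired with
the time. -/
theorem AdaptedAt.dnc_of_ne (hW : IsSliceSubmanifold E B.fib W)
    (hf : ∀ᶠ z in 𝓝 z₀, ContMDiffAt 𝓘(ℝ, (E × ℝ) × 𝒳.fib) 𝓘(ℝ, E × X.fib) ∞ f z ∧
      ContMDiffAt 𝓘(ℝ, (E × ℝ) × 𝒳.fib) 𝓘(ℝ, ℝ) ∞ T z ∧ 𝒳.s z = (X.s (f z), T z) ∧
      𝒳.t z = (X.t (f z), T z)) (hT : T z₀ ≠ 0) (h : AdaptedAt X B (f z₀)) :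
    AdaptedAt 𝒳 (B.dnc W hW) z₀ := by
  obtain ⟨g, hg⟩ := h
  refine ⟨fun z => dncExt hW (g (f z)) (T z), ?_⟩
  filter_upwards [hf, hf.self_of_nhds.1.continuousAt.eventually hg,
    hf.self_of_nhds.2.1.continuousAt.eventually_ne hT] with z h1 h2 h3
  refine ⟨contMDiffAt_dncExt (h2.1.comp z h1.1) h1.2.1 h3, ?_, ?_⟩
  · rw [dnc_s, dncBase_dncExt, dncTime_dncExt h3, h2.2.1, h1.2.2.1]
  · rw [dnc_t, dncBase_dncExt, dncTime_dncExt h3, h2.2.2, h1.2.2.2]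

/-- The morphism from `X` to `B` near a unit has a fibre component `g` with `g (a, 0) = 0`. As the
fibre coordinate of `f z` is `T z • y z`, the quotient `g (a, T y) / T` is smooth across `T = 0` and
serves as normal coordinate in the deformation of `B`. The span `𝒳` is kept general because the
inverse of a deformation and a composition of two deformations are both needed. -/
theorem AdaptedAt.dnc_of_isUnitChart (hF : ∀ Z ∈ F, IsSmoothCompact Z) (hX : IsBisubmersion F X)
    (hB : IsBisubmersion F B) (hW : IsIdentityBisection B W)
    (hf : ∀ᶠ z in 𝓝 z₀, ContMDiffAt 𝓘(ℝ, (E × ℝ) × 𝒳.fib) 𝓘(ℝ, E × X.fib) ∞ f z ∧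
      ContMDiffAt 𝓘(ℝ, (E × ℝ) × 𝒳.fib) 𝓘(ℝ, ℝ) ∞ T z ∧ 𝒳.s z = (X.s (f z), T z) ∧
      𝒳.t z = (X.t (f z), T z))
    {φ : OpenPartialHomeomorph X.carrier (E × X.fib)} {χ : OpenPartialHomeomorph M E}
    (hφ : IsAdaptedPair X.s φ χ) (hv : IsUnitChart X.t φ χ (f z₀)) {y : 𝒳.carrier → X.fib}
    (hy : ∀ᶠ z in 𝓝 z₀, ContMDiffAt 𝓘(ℝ, (E × ℝ) × 𝒳.fib) 𝓘(ℝ, X.fib) ∞ y z ∧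
      (φ (f z)).2 = T z • y z) {w : B.carrier} (hw : w ∈ W) (hvw : X.s (f z₀) = B.s w) :
    AdaptedAt 𝒳 (B.dnc W hW.submanifold) z₀ := by
  obtain ⟨ψ, χ', hψ, hψW, hψw⟩ := hW.exists_chart hB.submersion_s hw
  obtain ⟨g, hg, hg0⟩ := exists_fibre_factorization hF hφ hψ hX.submersion_t.contMDiff
    hB.submersion_t.contMDiff hv hψw hvw (hX.vertIn hφ hv.1) (hB.vertGen hF hψ hψw.1)
  set p₀ := φ (f z₀) with hp₀
  have hp₀' : p₀ = (p₀.1, 0) := Prod.ext rfl hv.2.1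
  obtain ⟨N, hNg, hN, hpN⟩ := eventually_nhds_iff.1 hg
  obtain ⟨N', hNg', hN', hpN'⟩ := eventually_nhds_iff.1 hg0
  -- For `β = 0` this vanishes wherever `g (a, 0) = 0`, which is the condition for dividing it by
  -- `β`.
  set h : (E × X.fib) × ℝ → B.fib := fun q => g (q.1.1, q.2 • q.1.2) with hh
  set Ω : Set ((E × X.fib) × ℝ) := {q | (q.1.1, q.2 • q.1.2) ∈ N ∧ q.1.1 ∈ N'} with hΩ
  have hm : ContDiff ℝ ∞ (fun q : (E × X.fib) × ℝ => ((q.1.1, q.2 • q.1.2) : E × X.fib)) := by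
    fun_prop
  have hΩo : IsOpen Ω := (hN.preimage hm.continuous).inter (hN'.preimage (by fun_prop))
  have hhs : ContDiffOn ℝ ∞ h Ω := fun q hq =>
    (ContDiffAt.comp q (hNg _ hq.1).1 hm.contDiffAt).contDiffWithinAt
  have hh0 : ∀ x, (x, (0 : ℝ)) ∈ Ω → h (x, 0) = 0 := fun x hx => by
    simp only [hh, zero_smul]
    exact hNg' _ hx.2
  -- `G` is `h / β`, completed by the `β`-derivative at `β = 0`; the relation `β G = g (a, βy)`
  -- below then holds for all `β`.
  set G : (E × X.fib) × ℝ → B.fib := fun p =>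
    if p.2 = 0 then fderiv ℝ h (p.1, 0) (0, 1) else p.2⁻¹ • h p with hG
  have hGs : ∀ q ∈ Ω, ContDiffAt ℝ ∞ G q := fun q hq => contDiffAt_divided_of_mem hΩo hhs hh0 hq
  have hG0 : ∀ q ∈ Ω, q.2 • G q = g (q.1.1, q.2 • q.1.2) := by
    rintro ⟨⟨a, b⟩, β⟩ hq
    by_cases hβ : β = 0
    · subst hβ
      simp only [zero_smul]
      exact (hNg' _ hq.2).symm
    · simp only [hG, hβ, if_false, hh]
      exact smul_inv_smul₀ hβ _
  have hadm : DNC.IsAdmissible W ψ univ := ⟨hψ.mem_maximalAtlas, isOpen_univ, fun _ => hψW⟩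
  have hfc := hf.self_of_nhds.1.continuousAt
  have hsrc : ∀ᶠ z in 𝓝 z₀, f z ∈ φ.source := hfc.eventually (φ.open_source.mem_nhds hv.1)
  have hs' : ∀ᶠ z in 𝓝 z₀, X.s (f z) ∈ χ'.source :=
    (hX.submersion_s.contMDiff.continuous.continuousAt.comp hfc).eventually
      (χ'.open_source.mem_nhds (by
        simp only [Function.comp, hvw]
        exact hψ.mapsTo w hψw.1))
  have hN1 : ∀ᶠ z in 𝓝 z₀, φ (f z) ∈ N :=
    (ContinuousAt.comp (φ.continuousAt hv.1) hfc).eventually (hN.mem_nhds hpN)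
  have hN2 : ∀ᶠ z in 𝓝 z₀, (φ (f z)).1 ∈ N' :=
    (continuousAt_fst.comp (ContinuousAt.comp (φ.continuousAt hv.1) hfc)).eventually
      (hN'.mem_nhds hpN')
  set P : 𝒳.carrier → (E × ℝ) × B.fib := fun z =>
    ((χ' (X.s (f z)), T z), G (((φ (f z)).1, y z), T z)) with hP
  refine ⟨fun z => (dncChart hW.submanifold hadm).symm (P z), ?_⟩
  filter_upwards [hf, hsrc, hs', hN1, hN2, hy] with z h1 h2 h3 h4 h5 h6
  have e1 : (((φ (f z)).1, T z • y z) : E × X.fib) = φ (f z) := by rw [← h6.2]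
  have hzΩ : (((φ (f z)).1, y z), T z) ∈ Ω := by
    refine ⟨?_, h5⟩
    rw [e1]
    exact h4
  have e2 : T z • G (((φ (f z)).1, y z), T z) = g (φ (f z)) := by
    rw [hG0 _ hzΩ, e1]
  have e3 : χ.symm (φ (f z)).1 = X.s (f z) := by
    rw [hφ.eq _ h2, χ.left_inv (hφ.mapsTo _ h2)]
  obtain ⟨-, h7, h8⟩ := hNg _ h4
  rw [e3] at h7 h8
  have hPt : P z ∈ (dncChart hW.submanifold hadm).target := by
    refine ⟨?_, mem_univ _⟩
    change (χ' (X.s (f z)), T z • G (((φ (f z)).1, y z), T z)) ∈ ψ.target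
    rw [e2]
    exact h7
  obtain ⟨hb, ht⟩ := dncBase_symm hadm hPt
  have hb' : dncBase ((dncChart hW.submanifold hadm).symm (P z)) =
      ψ.symm (χ' (X.s (f z)), g (φ (f z))) := by
    rw [hb, ← e2]
  refine ⟨?_, ?_, ?_⟩
  · have h9 : ContMDiffAt 𝓘(ℝ, (E × ℝ) × 𝒳.fib) 𝓘(ℝ, E) ∞ (fun z => (φ (f z)).1) z :=
      ContMDiffAt.comp (g := Prod.fst) z contDiff_fst.contMDiff.contMDiffAt
        (ContMDiffAt.comp z (contMDiffAt_of_mem_maximalAtlas hφ.mem_maximalAtlas h2) h1.1)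
    have h10 : ContMDiffAt 𝓘(ℝ, (E × ℝ) × 𝒳.fib) 𝓘(ℝ, E) ∞ (fun z => χ' (X.s (f z))) z :=
      ContMDiffAt.comp z (contMDiffAt_of_mem_maximalAtlas hψ.mem_maximalAtlas' h3)
        ((hX.submersion_s.contMDiff _).comp z h1.1)
    have h11 : ContMDiffAt 𝓘(ℝ, (E × ℝ) × 𝒳.fib) 𝓘(ℝ, B.fib) ∞
        (fun z => G (((φ (f z)).1, y z), T z)) z :=
      ContMDiffAt.comp z (hGs _ hzΩ).contMDiffAt
        (contMDiffAt_prodMk_space (contMDiffAt_prodMk_space h9 h6.1) h1.2.1)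
    exact ContMDiffAt.comp (g := (dncChart hW.submanifold hadm).symm) z
      (contMDiffAt_symm_of_mem_maximalAtlas (dncChart_mem_maximalAtlas hadm) hPt)
      (contMDiffAt_prodMk_space (contMDiffAt_prodMk_space h10 h1.2.1) h11)
  · rw [dnc_s, hb', ht, h1.2.2.1]
    refine Prod.ext ?_ rfl
    have h12 := hψ.eq _ (ψ.map_target h7)
    rw [ψ.right_inv h7] at h12
    exact χ'.injOn (hψ.mapsTo _ (ψ.map_target h7)) h3 h12.symm
  · rw [dnc_t, hb', ht, h1.2.2.2, h8, φ.left_inv h2]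

theorem exists_eq_nor {A : Span E M} {V : Set A.carrier} {hV : IsSliceSubmanifold E A.fib V}
    {d : (A.dnc V hV).carrier} (hd : dncTime d = 0) : dncBase d ∈ V := by
  match d with
  | .ext _ _ hβ => exact absurd hd hβ
  | .nor _ hv _ => exact hv

/-- On the deformation the normal coordinate of a slice chart is divisible by the time, the quotient
being the fibre coordinate of the chart. -/
theorem IsIdentityBisection.eventually_dncChart {A : Span E M} {V : Set A.carrier}
    {hV : IsSliceSubmanifold E A.fib V} {φ : OpenPartialHomeomorph A.carrier (E × A.fib)}
    (hφ : IsSliceChart V φ) {d : (A.dnc V hV).carrier} (hd : dncBase d ∈ φ.source) :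
    ∃ y : (A.dnc V hV).carrier → A.fib, ∀ᶠ z in 𝓝 d,
      ContMDiffAt 𝓘(ℝ, (E × ℝ) × (A.dnc V hV).fib) 𝓘(ℝ, A.fib) ∞ y z ∧
        (φ (dncBase z)).2 = dncTime z • y z := by
  have hadm : DNC.IsAdmissible V φ univ := ⟨hφ.mem_maximalAtlas, isOpen_univ, fun _ => hφ⟩
  refine ⟨fun z => (dncChart hV hadm z).2, ?_⟩
  filter_upwards [(dncChart hV hadm).open_source.mem_nhds
    ((mem_dncChart_source hadm).2 ⟨hd, mem_univ _⟩)] with z hz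
  refine ⟨?_, congrArg Prod.snd (dncChart_apply_smul hadm hz).symm⟩
  have hs : ContMDiff 𝓘(ℝ, (E × ℝ) × (A.dnc V hV).fib) 𝓘(ℝ, A.fib) ∞
      (fun p : (E × ℝ) × (A.dnc V hV).fib => Prod.snd (α := E × ℝ) (β := A.fib) p) :=
    ContDiff.contMDiff (E := (E × ℝ) × A.fib) contDiff_snd
  have hc : ContMDiffAt 𝓘(ℝ, (E × ℝ) × (A.dnc V hV).fib) 𝓘(ℝ, (E × ℝ) × (A.dnc V hV).fib) ∞
      (dncChart hV hadm) z :=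
    contMDiffAt_of_mem_maximalAtlas (dncChart_mem_maximalAtlas hadm) hz
  have h5 := (hs (dncChart hV hadm z)).comp z hc
  exact h5

/-- A composition of two units over the same point is again a unit, and the product chart remains
adapted. -/
theorem isUnitChart_compChart {A : Span E M}
    {hA : Manifold.IsSubmersion 𝓘(ℝ, E × A.fib) 𝓘(ℝ, E) ∞ A.s}
    {hB : ContMDiff 𝓘(ℝ, E × B.fib) 𝓘(ℝ, E) ∞ B.t}
    {φ : OpenPartialHomeomorph A.carrier (E × A.fib)} {χ χ' : OpenPartialHomeomorph M E}
    {ψ : OpenPartialHomeomorph B.carrier (E × B.fib)} (hφ : IsAdaptedPair A.s φ χ)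
    (hψ : IsAdaptedPair B.s ψ χ') {z : (A.comp B hA hB).carrier}
    (hz : IsUnitChart A.t φ χ (compFst z)) (hz' : IsUnitChart B.t ψ χ' (compSnd z)) :
    IsUnitChart (B := (A.comp B hA hB).fib) (A.comp B hA hB).t (compChart hA hB hφ ψ z) χ' z := by
  set c := compChart hA hB hφ ψ z with hc
  have hzc : z ∈ c.source := ⟨hz.1, hz'.1⟩
  refine ⟨hzc, Prod.ext hz.2.1 hz'.2.1, ?_⟩
  have e0 : (c z).1 = (ψ (compSnd z)).1 := rfl
  have e1 : (((c z).1, 0) : E × (A.comp B hA hB).fib) = c z :=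
    Prod.ext rfl (Prod.ext hz.2.1 hz'.2.1).symm
  have h1 : ContinuousAt (fun a : E => ((a, 0) : E × (A.comp B hA hB).fib)) (c z).1 := by fun_prop
  have h2 : ∀ᶠ a in 𝓝 (c z).1, ((a, 0) : E × (A.comp B hA hB).fib) ∈ c.target :=
    h1.eventually (c.open_target.mem_nhds (e1.symm ▸ c.map_source hzc :
      (((c z).1, 0) : E × (A.comp B hA hB).fib) ∈ c.target))
  have e2 : χ'.symm (c z).1 = A.s (compFst z) := by
    have h3 := hz'.2.2.self_of_nhds
    have h4 : (((ψ (compSnd z)).1, 0) : E × B.fib) = ψ (compSnd z) := Prod.ext rfl hz'.2.1.symm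
    rw [h4, ψ.left_inv hz'.1] at h3
    rw [e0, ← h3, comp_eq]
  have hcz : (c z).1 ∈ χ'.target := by
    rw [e0, hψ.eq _ hz'.1]
    exact χ'.map_source (hψ.mapsTo _ hz'.1)
  have h3 : ContinuousAt χ'.symm (c z).1 := χ'.continuousAt_symm hcz
  have h4 : ∀ᶠ a in 𝓝 (c z).1, χ'.symm a ∈ χ.source := h3.eventually (χ.open_source.mem_nhds (by
    rw [e2]
    exact hφ.mapsTo _ hz.1))
  have h5 : ContinuousAt (fun a => χ (χ'.symm a)) (c z).1 :=
    ContinuousAt.comp (g := χ) (χ.continuousAt (by rw [e2]; exact hφ.mapsTo _ hz.1)) h3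
  have h6 : ∀ᶠ a in 𝓝 (c z).1, A.t (φ.symm (χ (χ'.symm a), 0)) = χ.symm (χ (χ'.symm a)) :=
    h5.eventually (p := fun a' => A.t (φ.symm (a', 0)) = χ.symm a') (by
      simp only
      rw [e2, ← hφ.eq _ hz.1]
      exact hz.2.2)
  filter_upwards [h2, h4, h6, hz'.2.2] with a h7 h8 h9 h10
  have h11 := (compChart_symm hφ h7).2.2.1
  have h12 : compCoord χ (B.t ∘ ψ.symm) ((a, 0) : E × (A.fib × B.fib)) = (χ (χ'.symm a), 0) :=
    Prod.ext (congrArg χ h10) rfl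
  refine (congrArg A.t (h11.trans (congrArg φ.symm h12))).trans ?_
  rw [h9, χ.left_inv h8]

variable [T2Space M] {ι : Type*} {𝒰 : ι → Span E M} {V : ∀ i, Set (𝒰 i).carrier}

/-- Inverses and compositions of deformations map to those of the `𝒰 i`, with the time as second
component. Nonzero times are covered by the atlas `𝒰`; at time `0` the image is a unit, and `hcover`
provides a point of some `V k` over the same point of `M`. -/
theorem isAtlas_dnc (hF : ∀ Z ∈ F, IsSmoothCompact Z) (h𝒰 : IsAtlas F 𝒰)
    (hV : ∀ i, IsIdentityBisection (𝒰 i) (V i)) (hcover : ⋃ i, (𝒰 i).s '' V i = univ) :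
    IsAtlas (adiabatic F) (fun i => (𝒰 i).dnc (V i) (hV i).submanifold) := by
  have hbis := fun i => (h𝒰.bisubmersion i).dnc hF (hV i)
  have hunit : ∀ x : M, ∃ i, ∃ w ∈ V i, x = (𝒰 i).s w := fun x => by
    obtain ⟨i, w, hw, rfl⟩ := mem_iUnion.1 (hcover.symm ▸ mem_univ x)
    exact ⟨i, w, hw, rfl⟩
  refine ⟨hbis, ?_, fun i => isAdapted_iff.2 fun d => ?_, fun i j => isAdapted_iff.2 fun z => ?_⟩
  · refine eq_univ_of_forall fun ⟨x, β⟩ => mem_iUnion.2 ?_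
    obtain ⟨i, w, hw, rfl⟩ := hunit x
    refine ⟨i, ?_⟩
    by_cases hβ : β = 0
    · subst hβ
      exact ⟨DNC.nor (G := E × (𝒰 i).fib) (V := V i) w hw 0, rfl⟩
    · exact ⟨DNC.ext (G := E × (𝒰 i).fib) (V := V i) w β hβ, rfl⟩
  · let 𝒳 : Span (E × ℝ) (M × ℝ) := ((𝒰 i).dnc (V i) (hV i).submanifold).inv
    set b : 𝒳.carrier → (𝒰 i).inv.carrier :=
      dncBase (A := 𝒰 i) (hV := (hV i).submanifold) with hb
    set T : 𝒳.carrier → ℝ := dncTime (A := 𝒰 i) (hV := (hV i).submanifold) with hT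
    have hf : ∀ᶠ z in 𝓝 d, ContMDiffAt 𝓘(ℝ, (E × ℝ) × 𝒳.fib) 𝓘(ℝ, E × (𝒰 i).inv.fib) ∞ b z ∧
        ContMDiffAt 𝓘(ℝ, (E × ℝ) × 𝒳.fib) 𝓘(ℝ, ℝ) ∞ T z ∧
        𝒳.s z = ((𝒰 i).inv.s (b z), T z) ∧ 𝒳.t z = ((𝒰 i).inv.t (b z), T z) :=
      Eventually.of_forall fun z => ⟨contMDiff_dncBase (A := 𝒰 i) (hV := (hV i).submanifold) z,
        contMDiff_dncTime (A := 𝒰 i) (hV := (hV i).submanifold) z, rfl, rfl⟩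
    by_cases hd : T d = 0
    · obtain ⟨φ, χ, h1, h2, h3⟩ := (hV i).inv.exists_chart (h𝒰.bisubmersion i).submersion_t
        (exists_eq_nor (A := 𝒰 i) hd)
      obtain ⟨y, hy⟩ := IsIdentityBisection.eventually_dncChart (A := 𝒰 i)
        (hV := (hV i).submanifold) (d := d) h2 h3.1
      obtain ⟨k, w, hw, hwk⟩ := hunit ((𝒰 i).inv.s (b d))
      exact ⟨k, AdaptedAt.dnc_of_isUnitChart hF (h𝒰.bisubmersion i).inv (h𝒰.bisubmersion k) (hV k)
        (f := b) (T := T) hf h1 h3 hy hw hwk⟩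
    · obtain ⟨k, hk⟩ := isAdapted_iff.1 (h𝒰.inv i) (b d)
      exact ⟨k, AdaptedAt.dnc_of_ne (hV k).submanifold (f := b) (T := T) hf hd hk⟩
  · let X : Span E M := (𝒰 i).comp (𝒰 j) (h𝒰.bisubmersion i).submersion_s
      (h𝒰.bisubmersion j).submersion_t.contMDiff
    let 𝒳 : Span (E × ℝ) (M × ℝ) := ((𝒰 i).dnc (V i) (hV i).submanifold).comp ((𝒰 j).dnc (V j) (hV j).submanifold)
      (hbis i).submersion_s (hbis j).submersion_t.contMDiff
    have hXb : IsBisubmersion F X := (h𝒰.bisubmersion i).comp hF (h𝒰.bisubmersion j)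
    have hst : ∀ z : 𝒳.carrier, (𝒰 i).s (dncBase (compFst z)) = (𝒰 j).t (dncBase (compSnd z)) :=
      fun z => congrArg Prod.fst (comp_eq z)
    have htt : ∀ z : 𝒳.carrier, dncTime (compFst z) = dncTime (compSnd z) :=
      fun z => congrArg Prod.snd (comp_eq z)
    -- The map induced on fibre products by the projections of the two deformations to `𝒰 i` and `𝒰
    -- j`.
    set f : 𝒳.carrier → X.carrier := compLift (fun z => dncBase (compFst z))
      (fun z => dncBase (compSnd z)) (compMk _ _ _ _ (hst z)) with hfd
    have hfz : ∀ z, f z = compMk _ _ (dncBase (compFst z)) (dncBase (compSnd z)) (hst z) :=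
      fun z => compLift_apply _ (hst z)
    have hf1 : ∀ z, compFst (f z) = dncBase (compFst z) := fun z => by rw [hfz]; rfl
    have hf2 : ∀ z, compSnd (f z) = dncBase (compSnd z) := fun z => by rw [hfz]; rfl
    set T : 𝒳.carrier → ℝ := fun z => dncTime (compFst z) with hT
    have hf : ∀ᶠ z in 𝓝 z, ContMDiffAt 𝓘(ℝ, (E × ℝ) × 𝒳.fib) 𝓘(ℝ, E × X.fib) ∞ f z ∧
        ContMDiffAt 𝓘(ℝ, (E × ℝ) × 𝒳.fib) 𝓘(ℝ, ℝ) ∞ T z ∧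
        𝒳.s z = (X.s (f z), T z) ∧ 𝒳.t z = (X.t (f z), T z) := by
      refine Eventually.of_forall fun z => ⟨?_, ?_, ?_, ?_⟩
      · exact contMDiffAt_compLift ((contMDiff_dncBase _).comp z (contMDiff_compFst z))
          ((contMDiff_dncBase _).comp z (contMDiff_compSnd z)) (Eventually.of_forall hst) _
      · exact (contMDiff_dncTime _).comp z (contMDiff_compFst z)
      · exact Prod.ext (congrArg (𝒰 j).s (hf2 z).symm) (htt z).symm
      · exact Prod.ext (congrArg (𝒰 i).t (hf1 z).symm) rfl
    -- At time `0` both components lie on the bisections, since the two times agree. The fibre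
    -- coordinate of the composition is the pair of the two normal coordinates, both divided by the
    -- common time.
    by_cases hd : T z = 0
    · obtain ⟨φ, χ, h1, h2, h3⟩ := (hV i).exists_chart (h𝒰.bisubmersion i).submersion_s
        (exists_eq_nor hd)
      obtain ⟨ψ, χ', h1', h2', h3'⟩ := (hV j).exists_chart (h𝒰.bisubmersion j).submersion_s
        (exists_eq_nor ((htt z).symm.trans hd))
      obtain ⟨y, hy⟩ := IsIdentityBisection.eventually_dncChart
        (hV := (hV i).submanifold) (d := compFst z) h2 h3.1
      obtain ⟨y', hy'⟩ := IsIdentityBisection.eventually_dncChart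
        (hV := (hV j).submanifold) (d := compSnd z) h2' h3'.1
      obtain ⟨k, w, hw, hwk⟩ := hunit (X.s (f z))
      rw [← hf1] at h3
      rw [← hf2] at h3'
      refine ⟨k, AdaptedAt.dnc_of_isUnitChart hF hXb (h𝒰.bisubmersion k) (hV k) (f := f) (T := T) hf
        (isAdaptedPair_compChart (z₀ := f z) h1 h1') (isUnitChart_compChart h1 h1' h3 h3')
        (y := fun z => (y (compFst z), y' (compSnd z))) ?_ hw hwk⟩
      filter_upwards [contMDiff_compFst.continuous.continuousAt.eventually hy,
        contMDiff_compSnd.continuous.continuousAt.eventually hy'] with x hx hx'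
      refine ⟨contMDiffAt_prodMk_space (hx.1.comp x (contMDiff_compFst x))
        (hx'.1.comp x (contMDiff_compSnd x)), ?_⟩
      refine Prod.ext ?_ ?_
      · refine (congrArg (fun u => (φ u).2) (hf1 x)).trans hx.2
      · refine (congrArg (fun u => (ψ u).2) (hf2 x)).trans (hx'.2.trans ?_)
        exact congrArg (fun r : ℝ => r • y' (compSnd x)) (htt x).symm
    · obtain ⟨k, hk⟩ := isAdapted_iff.1 (h𝒰.comp i j) (f z)
      exact ⟨k, AdaptedAt.dnc_of_ne (hV k).submanifold (f := f) (T := T) hf hd hk⟩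

end DeformationAtlas

/-! ### Units in atlases, and propagation of adaptedness -/

section AtlasPoints

variable {E : Type} [NormedAddCommGroup E] [NormedSpace ℝ E] [FiniteDimensional ℝ E] {M : Type u}
  [TopologicalSpace M] [ChartedSpace E M] [IsManifold 𝓘(ℝ, E) ∞ M]
  {F : Set (VField E M)} {A B : Span E M} {κ : Type*} {𝒲 : κ → Span E M}

theorem exists_local_section {B : Type} [NormedAddCommGroup B] [NormedSpace ℝ B]
    [FiniteDimensional ℝ B] {U : Type u} [TopologicalSpace U] [ChartedSpace (E × B) U]
    [IsManifold 𝓘(ℝ, E × B) ∞ U] {s : U → M} (hs : Manifold.IsSubmersion 𝓘(ℝ, E × B) 𝓘(ℝ, E) ∞ s)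
    (u : U) : ∃ e : M → U, e (s u) = u ∧ ∀ᶠ x in 𝓝 (s u),
      ContMDiffAt 𝓘(ℝ, E) 𝓘(ℝ, E × B) ∞ e x ∧ s (e x) = x := by
  obtain ⟨⟨φ, χ⟩, hφ, hu⟩ := exists_isAdaptedPair hs u
  simp only at hφ hu
  have h0 : ((χ (s u), (φ u).2) : E × B) = φ u := by rw [← hφ.eq u hu]
  have hχ := hφ.mapsTo u hu
  refine ⟨fun x => φ.symm (χ x, (φ u).2), ?_, ?_⟩
  · simp only [h0]
    exact φ.left_inv hu
  have h1 : ContinuousAt (fun x => ((χ x, (φ u).2) : E × B)) (s u) :=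
    (χ.continuousAt hχ).prodMk continuousAt_const
  filter_upwards [χ.open_source.mem_nhds hχ, h1.eventually (φ.open_target.mem_nhds (by
    simp only [h0]
    exact φ.map_source hu))] with x hx hx'
  refine ⟨ContMDiffAt.comp (g := φ.symm) x (contMDiffAt_symm_of_mem_maximalAtlas
    hφ.mem_maximalAtlas hx') (contMDiffAt_prodMk_space
      (contMDiffAt_of_mem_maximalAtlas hφ.mem_maximalAtlas' hx) contMDiffAt_const), ?_⟩
  have h2 := hφ.eq _ (φ.map_target hx')
  rw [φ.right_inv hx'] at h2
  exact (χ.injOn hx (hφ.mapsTo _ (φ.map_target hx')) h2).symm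

/-- For a local section `ε` of `s` through `u`, the products `ε(x)⁻¹ ε(x)` have source and target
`x`. The atlas axioms for inverses and compositions transfer this family of units to a member of the
atlas. -/
theorem IsAtlas.exists_isUnitPoint (h𝒲 : IsAtlas F 𝒲) (x : M) :
    ∃ (k : κ) (w : (𝒲 k).carrier), IsUnitPoint (𝒲 k) w ∧ (𝒲 k).s w = x := by
  obtain ⟨k, u, rfl⟩ := mem_iUnion.1 (h𝒲.cover.symm ▸ mem_univ x)
  obtain ⟨ε, hεu, hε⟩ := exists_local_section (h𝒲.bisubmersion k).submersion_s u
  obtain ⟨k₁, i, hi⟩ := isAdapted_iff.1 (h𝒲.inv k) u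
  set C := (𝒲 k₁).comp (𝒲 k) (h𝒲.bisubmersion k₁).submersion_s
    (h𝒲.bisubmersion k).submersion_t.contMDiff with hC
  set z : C.carrier := compMk _ _ (i u) u hi.self_of_nhds.2.1 with hz
  obtain ⟨k₂, g, hg⟩ := isAdapted_iff.1 (h𝒲.comp k₁ k) z
  set l : M → C.carrier := compLift (i ∘ ε) ε z with hl
  have hi' : ∀ᶠ x in 𝓝 ((𝒲 k).s u), ContMDiffAt 𝓘(ℝ, E × (𝒲 k).inv.fib) 𝓘(ℝ, E × (𝒲 k₁).fib) ∞
      i (ε x) ∧ (𝒲 k₁).s (i (ε x)) = (𝒲 k).t (ε x) ∧ (𝒲 k₁).t (i (ε x)) = (𝒲 k).s (ε x) :=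
    hε.self_of_nhds.1.continuousAt.eventually (by rw [hεu]; exact hi)
  have hls : ∀ᶠ x in 𝓝 ((𝒲 k).s u), ContMDiffAt 𝓘(ℝ, E) 𝓘(ℝ, E × C.fib) ∞ l x ∧
      C.s (l x) = x ∧ C.t (l x) = x := by
    filter_upwards [hε, hi', hi'.eventually_nhds] with x h1 h2 h3
    have h4 : l x = compMk _ _ (i (ε x)) (ε x) h2.2.1 := compLift_apply _ h2.2.1
    refine ⟨contMDiffAt_compLift (h2.1.comp x h1.1) h1.1 (h3.mono fun y hy => hy.2.1) _, ?_, ?_⟩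
    · rw [h4]
      exact h1.2
    · rw [h4]
      exact h2.2.2.trans h1.2
  have hlz : l ((𝒲 k).s u) = z := by
    refine (compLift_apply _ hi'.self_of_nhds.2.1).trans (comp_ext ?_ ?_)
    · exact congrArg i hεu
    · exact hεu
  have hgl : ∀ᶠ x in 𝓝 ((𝒲 k).s u), ContMDiffAt 𝓘(ℝ, E × C.fib) 𝓘(ℝ, E × (𝒲 k₂).fib) ∞ g (l x) ∧
      (𝒲 k₂).s (g (l x)) = C.s (l x) ∧ (𝒲 k₂).t (g (l x)) = C.t (l x) :=
    hls.self_of_nhds.1.continuousAt.eventually (by rw [hlz]; exact hg)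
  have hsx : (𝒲 k₂).s (g (l ((𝒲 k).s u))) = (𝒲 k).s u :=
    hgl.self_of_nhds.2.1.trans hls.self_of_nhds.2.1
  refine ⟨k₂, g (l ((𝒲 k).s u)), isUnitPoint_of_section (h𝒲.bisubmersion k₂).submersion_s
    (e := g ∘ l) ?_ ?_, hsx⟩
  · rw [hsx]
    filter_upwards [hls, hgl] with x h1 h2
    exact ⟨h2.1.comp x h1.1, h2.2.1.trans h1.2.1, h2.2.2.trans h1.2.2⟩
  · rw [hsx]
    rfl

/-- The atlas contains a unit over the same point, and near units morphisms always exist. -/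
theorem IsUnitPoint.exists_adaptedAt (hF : ∀ Z ∈ F, IsSmoothCompact Z) (h𝒲 : IsAtlas F 𝒲)
    (hA : IsBisubmersion F A) {v : A.carrier} (hv : IsUnitPoint A v) :
    ∃ k, AdaptedAt A (𝒲 k) v := by
  obtain ⟨k, w, hw, hwv⟩ := h𝒲.exists_isUnitPoint (A.s v)
  exact ⟨k, hv.adaptedAt hF hA (h𝒲.bisubmersion k) hw hwv.symm⟩

/-- If the points of `C` near `c` are products of points of `A` and `B` that are adapted to the
atlas, the product is formed within the atlas, which is closed under composition up to adaptedness.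
-/
theorem AdaptedAt.comp {C : Span E M} (h𝒲 : IsAtlas F 𝒲) {c : C.carrier}
    {a : C.carrier → A.carrier} {b : C.carrier → B.carrier}
    (hab : ∀ᶠ x in 𝓝 c, ContMDiffAt 𝓘(ℝ, E × C.fib) 𝓘(ℝ, E × A.fib) ∞ a x ∧
      ContMDiffAt 𝓘(ℝ, E × C.fib) 𝓘(ℝ, E × B.fib) ∞ b x ∧ A.s (a x) = B.t (b x) ∧
      B.s (b x) = C.s x ∧ A.t (a x) = C.t x)
    (hA : ∃ k, AdaptedAt A (𝒲 k) (a c)) (hB : ∃ k, AdaptedAt B (𝒲 k) (b c)) :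
    ∃ k, AdaptedAt C (𝒲 k) c := by
  obtain ⟨k, f, hf⟩ := hA
  obtain ⟨k', g, hg⟩ := hB
  have hf' := hab.self_of_nhds.1.continuousAt.eventually hf
  have hg' := hab.self_of_nhds.2.1.continuousAt.eventually hg
  have key : ∀ᶠ x in 𝓝 c, (𝒲 k).s (f (a x)) = (𝒲 k').t (g (b x)) := by
    filter_upwards [hab, hf', hg'] with x h1 h2 h3
    rw [h2.2.1, h1.2.2.1, h3.2.2]
  set z := compMk (h𝒲.bisubmersion k).submersion_s (h𝒲.bisubmersion k').submersion_t.contMDiff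
    (f (a c)) (g (b c)) key.self_of_nhds with hz
  obtain ⟨k₂, hk₂⟩ := isAdapted_iff.1 (h𝒲.comp k k') (compLift (f ∘ a) (g ∘ b) z c)
  refine ⟨k₂, AdaptedAt.of_map (f := compLift (f ∘ a) (g ∘ b) z) ?_ hk₂⟩
  filter_upwards [hab, hf', hg', key, key.eventually_nhds] with x h1 h2 h3 h4 h5
  have h6 : compLift (f ∘ a) (g ∘ b) z x = compMk _ _ (f (a x)) (g (b x)) h4 := compLift_apply _ h4
  refine ⟨contMDiffAt_compLift (h2.1.comp x h1.1) (h3.1.comp x h1.2.1) h5 z, ?_, ?_⟩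
  · rw [h6]
    exact h3.2.1.trans h1.2.2.2.1
  · rw [h6]
    exact h2.2.2.trans h1.2.2.2.2

/-- Adaptedness to an atlas propagates along the fibres of `s`. -/
theorem IsBisubmersion.exists_nhds_adaptedAt (hF : ∀ Z ∈ F, IsSmoothCompact Z) (h𝒲 : IsAtlas F 𝒲)
    (hA : IsBisubmersion F A) (d : A.carrier) : ∃ O ∈ 𝓝 d, ∀ d' ∈ O, A.s d' = A.s d →
      (∃ k, AdaptedAt A (𝒲 k) d') → ∃ k, AdaptedAt A (𝒲 k) d := by
  set C := A.comp A.inv hA.submersion_s hA.submersion_s.contMDiff with hC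
  have hCb : IsBisubmersion F C := hA.comp hF hA.inv
  set z : C.carrier := compMk (A := A) (B := A.inv) hA.submersion_s hA.submersion_s.contMDiff
    d d rfl with hz
  obtain ⟨ε, hεd, hε⟩ := exists_local_section hA.submersion_t d
  -- `C` consists of the quotients `u u'⁻¹` with `s u = s u'`. The diagonal is made of units, with
  -- section `x ↦ (ε x, ε x)` for a local section `ε` of `t`.
  have hzu : IsUnitPoint C z := by
    refine isUnitPoint_of_section hCb.submersion_s (e := compLift (A := A) (B := A.inv) ε ε z) ?_ ?_
    · filter_upwards [hε] with x hx
      have h1 : compLift (A := A) (B := A.inv) ε ε z x = compMk (A := A) (B := A.inv) _ _ (ε x)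
        (ε x) rfl := compLift_apply (A := A) (B := A.inv) _ rfl
      refine ⟨contMDiffAt_compLift (A := A) (B := A.inv) hx.1 hx.1
        (Eventually.of_forall fun y => rfl) z, ?_, ?_⟩
      · rw [h1]
        exact hx.2
      · rw [h1]
        exact hx.2
    · refine (compLift_apply (A := A) (B := A.inv) _ rfl).trans
        (comp_ext (A := A) (B := A.inv) hεd hεd)
  obtain ⟨k, hk⟩ := hzu.exists_adaptedAt hF h𝒲 hCb
  -- Adaptedness at the unit `(d, d)` is open, and the topology of `C` is that of a subspace; so
  -- `(d, d')` is adapted for `d'` close to `d`.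
  obtain ⟨N, hN, hNk⟩ := (mem_nhds_induced (fun z : C.carrier =>
    ((compFst (A := A) (B := A.inv) z, compSnd (A := A) (B := A.inv) z) :
      A.carrier × A.carrier)) z _).1 hk.eventually
  obtain ⟨⟨φ, χ⟩, hφ, hd⟩ := exists_isAdaptedPair hA.submersion_s d
  simp only at hφ hd
  have hc : ContinuousAt (fun d' : A.carrier => ((d, d') : A.carrier × A.carrier)) d := by fun_prop
  refine ⟨_, inter_mem (hc hN) (φ.open_source.mem_nhds hd), ?_⟩
  rintro d' ⟨hd'N, hd'φ⟩ hdd' had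
  have hz' : AdaptedAt C (𝒲 k) (compMk (A := A) (B := A.inv) hA.submersion_s
    hA.submersion_s.contMDiff d d' hdd'.symm) := hNk (by exact hd'N)
  -- Every `u` near `d` is `(u w(u)⁻¹) w(u)`, where `w u` lies over `s u` with the fibre coordinate
  -- of `d'`. At `u = d` the first factor is near a unit and the second is `d'`.
  set w : A.carrier → A.carrier := fun u => φ.symm ((φ u).1, (φ d').2) with hw
  have e0 : (((φ d).1, (φ d').2) : E × A.fib) = φ d' := by
    refine Prod.ext ?_ rfl
    simp only
    rw [hφ.eq _ hd, hφ.eq _ hd'φ, hdd']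
  have hwd : w d = d' := by
    simp only [hw, e0]
    exact φ.left_inv hd'φ
  have h1 : ContinuousAt (fun u => (((φ u).1, (φ d').2) : E × A.fib)) d :=
    (continuousAt_fst.comp (φ.continuousAt hd)).prodMk continuousAt_const
  have hws : ∀ᶠ u in 𝓝 d, ContMDiffAt 𝓘(ℝ, E × A.fib) 𝓘(ℝ, E × A.fib) ∞ w u ∧
      A.s u = A.s (w u) := by
    filter_upwards [φ.open_source.mem_nhds hd, h1.eventually (φ.open_target.mem_nhds (by
      simp only [e0]
      exact φ.map_source hd'φ))] with u hu hu'
    refine ⟨ContMDiffAt.comp (g := φ.symm) u (contMDiffAt_symm_of_mem_maximalAtlas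
      hφ.mem_maximalAtlas hu') (contMDiffAt_prodMk_space (ContMDiffAt.comp (g := Prod.fst) u
        contDiff_fst.contMDiff.contMDiffAt (contMDiffAt_of_mem_maximalAtlas hφ.mem_maximalAtlas hu))
        contMDiffAt_const), ?_⟩
    have h2 := hφ.eq _ (φ.map_target hu')
    rw [φ.right_inv hu'] at h2
    refine χ.injOn (hφ.mapsTo _ hu) (hφ.mapsTo _ (φ.map_target hu')) ?_
    rw [← hφ.eq _ hu]
    exact h2
  set l : A.carrier → C.carrier := compLift (A := A) (B := A.inv) id w z with hl
  have hlu : ∀ u (hu : A.s u = A.s (w u)), l u = compMk (A := A) (B := A.inv) hA.submersion_s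
    hA.submersion_s.contMDiff u (w u) hu := fun u hu => compLift_apply (A := A) (B := A.inv) _ hu
  refine AdaptedAt.comp h𝒲 (a := l) (b := w) ?_ ?_ ?_
  · filter_upwards [hws, hws.eventually_nhds] with u hu hu'
    refine ⟨contMDiffAt_compLift (A := A) (B := A.inv) contMDiffAt_id hu.1
      (hu'.mono fun y hy => hy.2) z, hu.1, ?_, hu.2.symm, ?_⟩
    · rw [hlu u hu.2]
      rfl
    · rw [hlu u hu.2]
      rfl
  · refine ⟨k, ?_⟩
    have h3 : l d = compMk (A := A) (B := A.inv) hA.submersion_s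
        hA.submersion_s.contMDiff d d' hdd'.symm :=
      (hlu d hws.self_of_nhds.2).trans (comp_ext (A := A) (B := A.inv) rfl hwd)
    rw [h3]
    exact hz'
  · rw [hwd]
    exact had

end AtlasPoints

/-! ### Restriction of bi-submersions to open subsets -/

section Restriction

variable {E : Type} [NormedAddCommGroup E] [NormedSpace ℝ E] [FiniteDimensional ℝ E] {M : Type u}
  [TopologicalSpace M] [ChartedSpace E M] [IsManifold 𝓘(ℝ, E) ∞ M] {F : Set (VField E M)}

theorem IsBisubmersion.isFibreAdapted (hF : ∀ Z ∈ F, IsSmoothCompact Z) {A : Span E M}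
    (hA : IsBisubmersion F A) (u : A.carrier) : IsFibreAdapted A.fib F A.s A.t u := by
  obtain ⟨⟨φ, χ⟩, hφ, hu⟩ := exists_isAdaptedPair hA.submersion_s u
  exact ⟨φ, χ, hφ, hu, hA.vertIn hφ hu, hA.vertGen hF hφ hu⟩

theorem IsFibreAdapted.restrict {B : Type} [NormedAddCommGroup B] [NormedSpace ℝ B]
    {U : Type u} [TopologicalSpace U] [ChartedSpace (E × B) U] [IsManifold 𝓘(ℝ, E × B) ∞ U]
    {s t : U → M} {O : TopologicalSpace.Opens U} {u : O} (h : IsFibreAdapted B F s t u) :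
    IsFibreAdapted B F (s ∘ (Subtype.val : O → U)) (t ∘ Subtype.val) u := by
  obtain ⟨φ, χ, hφ, hu, h1, h2⟩ := h
  set ψ := φ.subtypeRestr (s := O) ⟨u⟩ with hψ
  have hsrc : ∀ x : O, x ∈ ψ.source ↔ (x : U) ∈ φ.source := fun x => by
    rw [hψ, OpenPartialHomeomorph.subtypeRestr_source]
    rfl
  have hsymm : ∀ p ∈ ψ.target, (ψ.symm p : U) = φ.symm p := fun p hp =>
    φ.subtypeRestr_symm_apply ⟨u⟩ hp
  have hu' : u ∈ ψ.source := (hsrc u).2 hu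
  have ht : (t ∘ Subtype.val) ∘ ψ.symm =ᶠ[𝓝 (ψ u)] t ∘ φ.symm := by
    filter_upwards [ψ.open_target.mem_nhds (ψ.map_source hu')] with p hp
    exact congrArg t (hsymm p hp)
  refine ⟨ψ, χ, ⟨?_, hφ.mem_maximalAtlas', fun x hx => hφ.mapsTo _ ((hsrc x).1 hx),
    fun x hx => hφ.eq _ ((hsrc x).1 hx)⟩, hu', h1.congr ht, h2.congr ht⟩
  refine OpenPartialHomeomorph.mem_maximalAtlas_of_contMDiffOn _ (fun x hx => ?_) fun p hp => ?_
  · exact (ContMDiffAt.comp (g := φ) x (contMDiffAt_of_mem_maximalAtlas hφ.mem_maximalAtlas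
      ((hsrc x).1 hx)) contMDiff_subtype_val.contMDiffAt).contMDiffWithinAt
  · refine ContMDiffAt.contMDiffWithinAt ((ContMDiffAt.subtypeVal_comp_iff O _ p).1 ?_)
    refine (contMDiffAt_symm_of_mem_maximalAtlas hφ.mem_maximalAtlas
      (OpenPartialHomeomorph.subtypeRestr_target_subset φ ⟨u⟩ hp)).congr_of_eventuallyEq ?_
    filter_upwards [ψ.open_target.mem_nhds hp] with q hq
    exact hsymm q hq

/-- The restriction of a span to an open subset. -/
def Span.restrict (A : Span E M) (O : TopologicalSpace.Opens A.carrier) : Span E M where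
  carrier := O
  fib := A.fib
  t := A.t ∘ Subtype.val
  s := A.s ∘ Subtype.val

theorem IsBisubmersion.restrict (hF : ∀ Z ∈ F, IsSmoothCompact Z) {A : Span E M}
    (hA : IsBisubmersion F A) (O : TopologicalSpace.Opens A.carrier) :
    IsBisubmersion F (A.restrict O) := by
  have h1 := hA.t2
  have h2 := hA.secondCountable
  exact isBisubmersion_of_isFibreAdapted (inferInstanceAs (T2Space O))
    (inferInstanceAs (SecondCountableTopology O))
    (fun u => (hA.isFibreAdapted hF u.1).restrict) (fun u => (hA.inv.isFibreAdapted hF u.1).restrict)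

end Restriction

/-! ### Minimality of the deformed path holonomy atlas -/

section Minimality

variable {E : Type} [NormedAddCommGroup E] [NormedSpace ℝ E] [FiniteDimensional ℝ E] {M : Type u}
  [TopologicalSpace M] [ChartedSpace E M] [IsManifold 𝓘(ℝ, E) ∞ M] {F : Set (VField E M)}
  {A B : Span E M} {V : Set A.carrier} {hV : IsSliceSubmanifold E A.fib V} {W : Set B.carrier}
  {hW : IsSliceSubmanifold E B.fib W} {C : Span (E × ℝ) (M × ℝ)} {β : ℝ}

/-- A local morphism `f` from `A` to `B` induces `f × id` away from time `0`, whatever the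
submanifolds `V` and `W` are. -/
theorem AdaptedAt.dncExt (hβ : β ≠ 0) {u : A.carrier} {f : A.carrier → B.carrier}
    (hf : ∀ᶠ x in 𝓝 u, ContMDiffAt 𝓘(ℝ, E × A.fib) 𝓘(ℝ, E × B.fib) ∞ f x ∧
      B.s (f x) = A.s x ∧ B.t (f x) = A.t x)
    (h : AdaptedAt (B.dnc W hW) C (dncExt hW (f u) β)) :
    AdaptedAt (A.dnc V hV) C (dncExt hV u β) := by
  have h0 : dncBase (SingFol.dncExt hV u β) = u := dncBase_dncExt u β
  refine AdaptedAt.of_map (f := fun d => SingFol.dncExt hW (f (dncBase d)) (dncTime d)) ?_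
    (by simpa only [h0, dncTime_dncExt hβ] using h)
  have h1 : ∀ᶠ d in 𝓝 (SingFol.dncExt hV u β), dncTime d ≠ 0 :=
    (contMDiff_dncTime.continuous.continuousAt).eventually_ne (by rwa [dncTime_dncExt hβ])
  have h2 : ∀ᶠ d in 𝓝 (SingFol.dncExt hV u β),
      ContMDiffAt 𝓘(ℝ, E × A.fib) 𝓘(ℝ, E × B.fib) ∞ f (dncBase d) ∧
        B.s (f (dncBase d)) = A.s (dncBase d) ∧ B.t (f (dncBase d)) = A.t (dncBase d) :=
    contMDiff_dncBase.continuous.continuousAt.eventually (by rwa [h0])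
  filter_upwards [h1, h2] with d h3 h4
  refine ⟨contMDiffAt_dncExt (h4.1.comp d (contMDiff_dncBase d)) (contMDiff_dncTime d) h3, ?_, ?_⟩
  · rw [dnc_s, dnc_s, dncBase_dncExt, dncTime_dncExt h3, h4.2.1]
  · rw [dnc_t, dnc_t, dncBase_dncExt, dncTime_dncExt h3, h4.2.2]

theorem IsUnitPoint.exists_section {v : A.carrier} (hv : IsUnitPoint A v) :
    ∃ e : M → A.carrier, e (A.s v) = v ∧ ∀ᶠ x in 𝓝 (A.s v),
      ContMDiffAt 𝓘(ℝ, E) 𝓘(ℝ, E × A.fib) ∞ e x ∧ A.s (e x) = x ∧ A.t (e x) = x := by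
  obtain ⟨φ, χ, hφ, hu, hv0, hvt⟩ := hv
  have h0 : ((χ (A.s v), 0) : E × A.fib) = φ v := by
    rw [← hφ.eq v hu]
    exact Prod.ext rfl hv0.symm
  have hχ := hφ.mapsTo v hu
  refine ⟨fun x => φ.symm (χ x, 0), ?_, ?_⟩
  · simp only [h0]
    exact φ.left_inv hu
  have h1 : ContinuousAt (fun x => ((χ x, 0) : E × A.fib)) (A.s v) :=
    (χ.continuousAt hχ).prodMk continuousAt_const
  rw [hφ.eq v hu] at hvt
  filter_upwards [χ.open_source.mem_nhds hχ, h1.eventually (φ.open_target.mem_nhds (by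
    simp only [h0]
    exact φ.map_source hu)), (χ.continuousAt hχ).eventually hvt] with x hx hx' hxt
  refine ⟨ContMDiffAt.comp (g := φ.symm) x (contMDiffAt_symm_of_mem_maximalAtlas
    hφ.mem_maximalAtlas hx') (contMDiffAt_prodMk_space
      (contMDiffAt_of_mem_maximalAtlas hφ.mem_maximalAtlas' hx) contMDiffAt_const), ?_, ?_⟩
  · have h2 := hφ.eq _ (φ.map_target hx')
    rw [φ.right_inv hx'] at h2
    exact (χ.injOn hx (hφ.mapsTo _ (φ.map_target hx')) h2).symm
  · rw [hxt, χ.left_inv hx]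

/-- If `e` is a local section by units, so is `(x, r) ↦ (e x, r)` for `r ≠ 0`. -/
theorem IsUnitPoint.dncExt (hβ : β ≠ 0) (hD : Manifold.IsSubmersion 𝓘(ℝ, (E × ℝ) × (A.dnc V hV).fib)
    𝓘(ℝ, E × ℝ) ∞ (A.dnc V hV).s) {v : A.carrier} (hv : IsUnitPoint A v) :
    IsUnitPoint (A.dnc V hV) (dncExt hV v β) := by
  obtain ⟨e, hev, he⟩ := hv.exists_section
  have h0 : (A.dnc V hV).s (SingFol.dncExt hV v β) = (A.s v, β) := by
    rw [dnc_s, dncBase_dncExt, dncTime_dncExt hβ]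
  refine isUnitPoint_of_section hD (e := fun p => SingFol.dncExt hV (e p.1) p.2) ?_ ?_
  · rw [h0]
    have h1 : ∀ᶠ p : M × ℝ in 𝓝 (A.s v, β), p.2 ≠ 0 := continuousAt_snd.eventually_ne hβ
    have h2 : ∀ᶠ p : M × ℝ in 𝓝 (A.s v, β), ContMDiffAt 𝓘(ℝ, E) 𝓘(ℝ, E × A.fib) ∞ e p.1 ∧
      A.s (e p.1) = p.1 ∧ A.t (e p.1) = p.1 :=
      (continuous_fst.tendsto (A.s v, β)).eventually he
    filter_upwards [h1, h2] with p h3 h4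
    refine ⟨contMDiffAt_dncExt (h4.1.comp p (contMDiff_fst_real p)) (contMDiff_snd_real p) h3,
      ?_, ?_⟩
    · rw [dnc_s, dncBase_dncExt, dncTime_dncExt h3, h4.2.1]
    · rw [dnc_t, dncBase_dncExt, dncTime_dncExt h3, h4.2.2]
  · rw [h0]
    simp only [hev]

variable {φ : OpenPartialHomeomorph A.carrier (E × A.fib)} {χ : OpenPartialHomeomorph M E}

/-- The zero section of the normal bundle consists of units. -/
theorem isUnitPoint_dnc_zero (hφ : IsAdaptedPair A.s φ χ) (hφV : DNC.IsAdmissible V φ univ)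
    {v : A.carrier} (hv : IsUnitChart A.t φ χ v)
    (hD : Manifold.IsSubmersion 𝓘(ℝ, (E × ℝ) × (A.dnc V hV).fib) 𝓘(ℝ, E × ℝ) ∞ (A.dnc V hV).s) :
    IsUnitPoint (A.dnc V hV) ((dncChart hV hφV).symm (((φ v).1, 0), 0)) := by
  obtain ⟨hu, hv0, hvt⟩ := hv
  have hχ := hφ.mapsTo v hu
  have e0 : ((χ (A.s v), 0) : E × A.fib) = φ v := by
    rw [← hφ.eq v hu]
    exact Prod.ext rfl hv0.symm
  have htgt : ∀ p : M × ℝ, ((χ p.1, 0) : E × A.fib) ∈ φ.target →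
      (((χ p.1, p.2), 0) : (E × ℝ) × A.fib) ∈ (dncChart hV hφV).target := fun p hp => by
    refine ⟨?_, mem_univ _⟩
    simp only [smul_zero]
    exact hp
  have e1 : (((φ v).1, (0 : ℝ)), (0 : A.fib)) = ((χ (A.s v), 0), 0) := by rw [hφ.eq v hu]
  have h0 : (A.dnc V hV).s ((dncChart hV hφV).symm (((φ v).1, 0), 0)) = (A.s v, 0) := by
    have h2 := dncBase_symm hφV (htgt (A.s v, 0) (by
      simp only [e0]
      exact φ.map_source hu))
    simp only [smul_zero, e0, φ.left_inv hu] at h2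
    have h3 : (dncChart hV hφV).symm (((φ v).1, 0), 0) =
        (dncChart hV hφV).symm ((χ (A.s v), 0), 0) := congrArg (dncChart hV hφV).symm e1
    rw [h3]
    exact Prod.ext (congrArg A.s h2.1) h2.2
  refine isUnitPoint_of_section hD
    (e := fun p : M × ℝ => (dncChart hV hφV).symm ((χ p.1, p.2), 0)) ?_ ?_
  · rw [h0]
    have h1 : ContinuousAt (fun x => ((χ x, 0) : E × A.fib)) (A.s v) :=
      (χ.continuousAt hχ).prodMk continuousAt_const
    rw [hφ.eq v hu] at hvt
    have h2 : ∀ᶠ x in 𝓝 (A.s v), x ∈ χ.source ∧ ((χ x, 0) : E × A.fib) ∈ φ.target ∧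
        A.t (φ.symm (χ x, 0)) = χ.symm (χ x) := by
      filter_upwards [χ.open_source.mem_nhds hχ, h1.eventually (φ.open_target.mem_nhds (by
        simp only [e0]
        exact φ.map_source hu)), (χ.continuousAt hχ).eventually hvt] with x hx hx' hxt
      exact ⟨hx, hx', hxt⟩
    have h3 : ∀ᶠ p : M × ℝ in 𝓝 (A.s v, 0), p.1 ∈ χ.source ∧ ((χ p.1, 0) : E × A.fib) ∈ φ.target ∧
        A.t (φ.symm (χ p.1, 0)) = χ.symm (χ p.1) :=
      (continuous_fst.tendsto (A.s v, (0 : ℝ))).eventually h2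
    filter_upwards [h3] with p ⟨h4, h5, h6⟩
    have h7 := dncBase_symm hφV (htgt p h5)
    simp only [smul_zero] at h7
    refine ⟨?_, ?_, ?_⟩
    · have h8 : ContMDiffAt 𝓘(ℝ, E × ℝ) 𝓘(ℝ, E) ∞ (fun p : M × ℝ => χ p.1) p :=
        ContMDiffAt.comp p (contMDiffAt_of_mem_maximalAtlas hφ.mem_maximalAtlas' h4)
          (contMDiff_fst_real p)
      exact ContMDiffAt.comp (g := (dncChart hV hφV).symm) p
        (contMDiffAt_symm_of_mem_maximalAtlas (dncChart_mem_maximalAtlas hφV) (htgt p h5))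
        (contMDiffAt_prodMk_space (contMDiffAt_prodMk_space h8 (contMDiff_snd_real p))
          contMDiffAt_const)
    · have h2 := hφ.eq _ (φ.map_target h5)
      rw [φ.right_inv h5] at h2
      exact Prod.ext ((congrArg A.s h7.1).trans
        (χ.injOn h4 (hφ.mapsTo _ (φ.map_target h5)) h2).symm) h7.2
    · exact Prod.ext ((congrArg A.t h7.1).trans (h6.trans (χ.left_inv h4))) h7.2
  · rw [h0]
    exact congrArg (dncChart hV hφV).symm e1.symm

theorem isIdentityBisection_empty (A : Span E M) : IsIdentityBisection A ∅ :=
  ⟨fun _ h => h.elim, fun _ h => h.elim, fun _ h => h.elim, fun _ h => h.elim⟩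

/-- The deformation along the empty set: the span `(U × ℝ*, t × id, s × id)`. -/
abbrev Span.punctured (A : Span E M) : Span (E × ℝ) (M × ℝ) :=
  A.dnc ∅ (isIdentityBisection_empty A).submanifold

variable {κ : Type*} {𝒲 : κ → Span (E × ℝ) (M × ℝ)}

/-- The bi-submersions `U` for which `U × {β}` is adapted to the family `𝒲`. -/
def adaptedSpans (F : Set (VField E M)) (𝒲 : κ → Span (E × ℝ) (M × ℝ)) (β : ℝ) :
    Set (Span E M) :=
  {A | IsBisubmersion F A ∧ ∀ u, ∃ k, AdaptedAt A.punctured (𝒲 k)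
    (dncExt (isIdentityBisection_empty A).submanifold u β)}

variable [T2Space M]

/-- The punctured span of the inverse is definitionally the inverse of the punctured span, and `𝒲`
is closed under inverses. -/
theorem inv_mem_adaptedSpans (h𝒲 : IsAtlas (adiabatic F) 𝒲) (hA : A ∈ adaptedSpans F 𝒲 β) :
    A.inv ∈ adaptedSpans F 𝒲 β := by
  refine ⟨hA.1.inv, fun u => ?_⟩
  obtain ⟨k, hk⟩ := hA.2 u
  obtain ⟨f, hf⟩ := hk.inv
  obtain ⟨k', hk'⟩ := isAdapted_iff.1 (h𝒲.inv k) (f (dncExt (isIdentityBisection_empty A).submanifold u β))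
  exact ⟨k', AdaptedAt.of_map (A := A.inv.punctured) (B := (𝒲 k).inv) hf hk'⟩

/-- A point `(z, r)` over a composition is the product of the points over its two components at the
same time `r`. -/
theorem comp_mem_adaptedSpans (hF : ∀ Z ∈ F, IsSmoothCompact Z) (h𝒲 : IsAtlas (adiabatic F) 𝒲)
    (hβ : β ≠ 0) (hA : A ∈ adaptedSpans F 𝒲 β) (hB : B ∈ adaptedSpans F 𝒲 β) :
    A.comp B hA.1.submersion_s hB.1.submersion_t.contMDiff ∈ adaptedSpans F 𝒲 β := by
  refine ⟨hA.1.comp hF hB.1, fun z => ?_⟩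
  let D := (A.comp B hA.1.submersion_s hB.1.submersion_t.contMDiff).punctured
  refine AdaptedAt.comp (A := A.punctured) (B := B.punctured) h𝒲
    (a := fun d : D.carrier => dncExt _ (compFst (dncBase d)) (dncTime d))
    (b := fun d : D.carrier => dncExt _ (compSnd (dncBase d)) (dncTime d)) ?_ ?_ ?_
  · have h1 : ∀ᶠ d : D.carrier in 𝓝 (dncExt _ z β), dncTime d ≠ 0 :=
      (contMDiff_dncTime.continuous.continuousAt).eventually_ne (by rwa [dncTime_dncExt hβ])
    filter_upwards [h1] with d h2
    refine ⟨contMDiffAt_dncExt ((contMDiff_compFst _).comp d (contMDiff_dncBase d))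
        (contMDiff_dncTime d) h2,
      contMDiffAt_dncExt ((contMDiff_compSnd _).comp d (contMDiff_dncBase d))
        (contMDiff_dncTime d) h2, ?_, ?_, ?_⟩
    · rw [dnc_s, dnc_t, dncBase_dncExt, dncTime_dncExt h2, dncBase_dncExt, dncTime_dncExt h2,
        comp_eq]
    · rw [dnc_s, dncBase_dncExt, dncTime_dncExt h2]
      rfl
    · rw [dnc_t, dncBase_dncExt, dncTime_dncExt h2]
      rfl
  · simp only [dncBase_dncExt, dncTime_dncExt hβ]
    exact hA.2 _
  · simp only [dncBase_dncExt, dncTime_dncExt hβ]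
    exact hB.2 _

/-- At the unit `v` the point `(v, β)` is a unit, hence adapted to `𝒲`; by openness this persists on
a neighbourhood of `v`, to which `A` is restricted. -/
theorem exists_mem_adaptedSpans (hF : ∀ Z ∈ F, IsSmoothCompact Z)
    (hF' : ∀ Z ∈ adiabatic F, IsSmoothCompact Z) (h𝒲 : IsAtlas (adiabatic F) 𝒲) (hβ : β ≠ 0)
    (hA : IsBisubmersion F A) {v : A.carrier} (hv : IsUnitPoint A v) :
    ∃ A' ∈ adaptedSpans F 𝒲 β, A.s v ∈ range A'.s := by
  have hb := hA.dnc hF (isIdentityBisection_empty A)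
  obtain ⟨k, hk⟩ := (hv.dncExt (hV := (isIdentityBisection_empty A).submanifold) hβ
    hb.submersion_s).exists_adaptedAt hF' h𝒲 hb
  have h1 : ContinuousAt (fun u => dncExt (isIdentityBisection_empty A).submanifold u β) v :=
    (contMDiffAt_dncExt (H := E × A.fib) contMDiffAt_id contMDiffAt_const hβ).continuousAt
  obtain ⟨O, hOk, hO, hvO⟩ := eventually_nhds_iff.1 (h1.eventually hk.eventually)
  refine ⟨A.restrict ⟨O, hO⟩, ⟨hA.restrict hF _, fun u => ⟨k, ?_⟩⟩, ⟨⟨v, hvO⟩, rfl⟩⟩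
  refine AdaptedAt.dncExt (B := A) hβ (f := Subtype.val) (Eventually.of_forall fun x => ?_)
    (hOk _ u.2)
  have h2 : ContMDiff 𝓘(ℝ, E × A.fib) 𝓘(ℝ, E × A.fib) ∞
      (Subtype.val : (⟨O, hO⟩ : TopologicalSpace.Opens A.carrier) → A.carrier) :=
    contMDiff_subtype_val
  exact ⟨h2 x, rfl, rfl⟩

/-- The family is closed under inversion and composition, so adaptedness is realised by identity
maps. The deformation along the empty set is what makes the condition meaningful for bi-submersions
without a chosen bisection. -/
theorem isAtlas_adaptedSpans (hF : ∀ Z ∈ F, IsSmoothCompact Z)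
    (hF' : ∀ Z ∈ adiabatic F, IsSmoothCompact Z) (h𝒲 : IsAtlas (adiabatic F) 𝒲) (hβ : β ≠ 0)
    (hunit : ∀ x : M, ∃ (A : Span E M) (v : A.carrier), IsBisubmersion F A ∧ IsUnitPoint A v ∧
      A.s v = x) :
    IsAtlas F (fun A : adaptedSpans F 𝒲 β => (A : Span E M)) where
  bisubmersion A := A.2.1
  cover := by
    refine eq_univ_of_forall fun x => mem_iUnion.2 ?_
    obtain ⟨A, v, hA, hv, rfl⟩ := hunit x
    obtain ⟨A', hA', hx⟩ := exists_mem_adaptedSpans hF hF' h𝒲 hβ hA hv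
    exact ⟨⟨A', hA'⟩, hx⟩
  inv A := isAdapted_iff.2 fun u => ⟨⟨_, inv_mem_adaptedSpans h𝒲 A.2⟩, AdaptedAt.refl _ u⟩
  comp A B := isAdapted_iff.2 fun u =>
    ⟨⟨_, comp_mem_adaptedSpans hF h𝒲 hβ A.2 B.2⟩, AdaptedAt.refl _ u⟩

/-- At time `0` adaptedness is propagated from the zero section along a ray in the normal fibre. At
time `β ≠ 0` the minimality of `𝒰` is applied to the atlas `adaptedSpans F 𝒲 β`. -/
theorem isPathHolonomyAtlas_dnc (hF : IsFoliation F) (hF' : IsFoliation (adiabatic F))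
    {ι : Type*} {𝒰 : ι → Span E M} {V : ∀ i, Set (𝒰 i).carrier}
    (hV : ∀ i, IsIdentityBisection (𝒰 i) (V i)) (hcover : ⋃ i, (𝒰 i).s '' V i = univ)
    (h𝒰 : IsPathHolonomyAtlas F 𝒰) :
    IsPathHolonomyAtlas (adiabatic F) (fun i => (𝒰 i).dnc (V i) (hV i).submanifold) := by
  refine ⟨isAtlas_dnc hF.smooth h𝒰.1 hV hcover, fun 𝒲 h𝒲 i => isAdapted_iff.2 fun d => ?_⟩
  have hb := (h𝒰.1.bisubmersion i).dnc hF.smooth (hV i)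
  by_cases hd : dncTime d = 0
  · have hdV := exists_eq_nor hd
    obtain ⟨φ, χ, h1, h2, h3⟩ := (hV i).exists_chart (h𝒰.1.bisubmersion i).submersion_s hdV
    set v := dncBase d with hv
    have hadm : DNC.IsAdmissible (V i) φ univ := ⟨h1.mem_maximalAtlas, isOpen_univ, fun _ => h2⟩
    set c := dncChart (hV i).submanifold hadm with hc
    have hdc : d ∈ c.source := ⟨h3.1, mem_univ _⟩
    let b : (𝒰 i).fib := (c d).2
    -- The ray through `d` in its normal fibre: it stays over one point of `M × ℝ`, starts at the
    -- zero section and reaches `d` at `r = 1`.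
    set γ : ℝ → ((𝒰 i).dnc (V i) (hV i).submanifold).carrier := fun r =>
      c.symm (((φ v).1, 0), r • b) with hγ
    have htgt : ∀ r : ℝ, (((φ v).1, (0 : ℝ)), r • b) ∈ c.target := fun r => by
      refine ⟨?_, mem_univ _⟩
      have h4 : (((φ v).1, 0) : E × (𝒰 i).fib) = φ v := Prod.ext rfl h3.2.1.symm
      have h5 : (((φ v).1, (0 : ℝ) • r • b) : E × (𝒰 i).fib) = φ v :=
        (congrArg (Prod.mk (φ v).1) (zero_smul ℝ (r • b))).trans h4
      exact h5.symm ▸ φ.map_source h3.1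
    have hγc : Continuous γ := by
      refine continuous_iff_continuousAt.2 fun r => ?_
      exact ContinuousAt.comp (g := c.symm) (c.continuousAt_symm (htgt r)) (by fun_prop)
    have hγs : ∀ r r', ((𝒰 i).dnc (V i) (hV i).submanifold).s (γ r) =
        ((𝒰 i).dnc (V i) (hV i).submanifold).s (γ r') := fun r r' => by
      have h4 := dncBase_symm hadm (htgt r)
      have h5 := dncBase_symm hadm (htgt r')
      simp only [zero_smul] at h4 h5
      rw [dnc_s, dnc_s]
      exact Prod.ext (congrArg (𝒰 i).s (h4.1.trans h5.1.symm)) (h4.2.trans h5.2.symm)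
    have hγ1 : γ 1 = d := by
      have h4 : (((φ v).1, (0 : ℝ)) : E × ℝ) = ((φ v).1, dncTime d) :=
        congrArg (Prod.mk (φ v).1) hd.symm
      exact Eq.trans (congrArg c.symm (Prod.ext (h4.trans (dncChart_apply_fst hadm d).symm)
        (one_smul ℝ b))) (c.left_inv hdc)
    set R : Set ℝ := {r | ∃ A : 𝒲, AdaptedAt ((𝒰 i).dnc (V i) (hV i).submanifold) A (γ r)} with hR
    have hRo : IsOpen R := isOpen_iff_mem_nhds.2 fun r ⟨A, hA⟩ => by
      filter_upwards [hγc.continuousAt.eventually hA.eventually] with r' hr'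
      exact ⟨A, hr'⟩
    -- A limit point is adapted because nearby adapted points of the same `s`-fibre pass their
    -- adaptedness on to it.
    have hRc : IsClosed R := isClosed_of_closure_subset fun r hr => by
      obtain ⟨O, hO, hO'⟩ := hb.exists_nhds_adaptedAt hF'.smooth h𝒲 (γ r)
      obtain ⟨r', hr', hr'R⟩ := mem_closure_iff_nhds.1 hr _ (hγc.continuousAt hO)
      exact hO' _ hr' (hγs r' r) hr'R
    have hR0 : (0 : ℝ) ∈ R := by
      have h4 : γ 0 = c.symm (((φ v).1, 0), 0) :=
        congrArg (fun b' : (𝒰 i).fib => c.symm (((φ v).1, 0), b')) (zero_smul ℝ b)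
      have h5 : IsUnitPoint ((𝒰 i).dnc (V i) (hV i).submanifold) (γ 0) := by
        rw [h4]
        exact isUnitPoint_dnc_zero h1 hadm h3 hb.submersion_s
      exact h5.exists_adaptedAt hF'.smooth h𝒲 hb
    have hR1 : (1 : ℝ) ∈ R := by
      rw [(show IsClopen R from ⟨hRc, hRo⟩).eq_univ ⟨0, hR0⟩]
      exact mem_univ _
    rw [← hγ1]
    exact hR1
  -- The bisections supply, over every point of `M`, the unit that the atlas at time `dncTime d`
  -- requires.
  · have hat := isAtlas_adaptedSpans hF.smooth hF'.smooth h𝒲 hd fun x => by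
      obtain ⟨j, w, hw, rfl⟩ := mem_iUnion.1 (hcover.symm ▸ mem_univ x)
      obtain ⟨φ, χ, h1, -, h3⟩ := (hV j).exists_chart (h𝒰.1.bisubmersion j).submersion_s hw
      exact ⟨𝒰 j, w, h𝒰.1.bisubmersion j, ⟨φ, χ, h1, h3⟩, rfl⟩
    obtain ⟨A, f, hf⟩ := isAdapted_iff.1 (h𝒰.2 _ hat i) (dncBase d)
    obtain ⟨k, hk⟩ := A.2.2 (f (dncBase d))
    rw [eq_dncExt hd]
    exact ⟨k, AdaptedAt.dncExt hd hf hk⟩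

end Minimality

end

end SingFol

theorem mainTheorem5 {E : Type} [NormedAddCommGroup E] [NormedSpace ℝ E] [FiniteDimensional ℝ E]
    {M : Type u} [TopologicalSpace M] [ChartedSpace E M] [IsManifold 𝓘(ℝ, E) ∞ M]
    [T2Space M] [SecondCountableTopology M]
    (F : Set (VField E M)) (hF : IsFoliation F)
    {ι : Type*} (𝒰 : ι → Span E M) (h𝒰 : IsAtlas F 𝒰)
    (V : ∀ i, Set (𝒰 i).carrier) (hV : ∀ i, IsIdentityBisection (𝒰 i) (V i))
    (hcover : ⋃ i, (𝒰 i).s '' V i = univ) :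
    IsFoliation (adiabatic F) ∧
      IsAtlas (adiabatic F) (fun i => (𝒰 i).dnc (V i) (hV i).submanifold) ∧
      (IsPathHolonomyAtlas F 𝒰 →
        IsPathHolonomyAtlas (adiabatic F) (fun i => (𝒰 i).dnc (V i) (hV i).submanifold)) := by
  exact ⟨isFoliation_adiabatic hF, isAtlas_dnc hF.smooth h𝒰 hV hcover,
    isPathHolonomyAtlas_dnc hF (isFoliation_adiabatic hF) hV hcover⟩
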